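/- **Definitions.** A *real rational curve* is given by real polynomials $X,Y,Z$ in $\tau$ without common complex zero such that $\tau\mapsto[X:Y:Z]$ is birational from $\mathbb P^1(\mathbb C)$ onto its image (the complexified curve); $d=\max(\deg X,\deg Y,\deg Z)$ is its degree, it is *nonlinear* if $d\neq1$, and $X,Y,Z$ are regarded as binary forms of degree $d$ on $\mathbb P^1$. A *rational arc* is a simple arc in $\mathbb R^2$ which is the image of a compact interval $[a,b]$ (with endpoints the images of $a,b$, which may coincide), or a simple closed curve which is the image of all of $\mathbb P^1(\mathbb R)$ (without endpoints). A *regular rational plane polypol* $P\subset\mathbb R^2$ is a bounded path-connected semialgebraic set with $P\subseteq\overline{\operatorname{int}P}$, whose boundary is a finite union of rational arcs $\gamma_j$ such that distinct arcs meet only at common endpoints; the endpoints of the arcs are the *vertices* of $P$. The line $1-ux-vy=0$, $(u,v)\in\mathbb C^2$, is *tangent* to a complexified rational curve if the form $Z-uX-vY$ has a multiple zero on $\mathbb P^1(\mathbb C)$ (so asymptotes, and lines through images of critical points of the parametrization, such as cusps, count as tangent). Put $$F_P(u,v)=2\int_P\frac{dx\,dy}{(1-ux-vy)^3},\qquad U_P=\{(u,v)\in\mathbb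 C^2:\ 1-ux-vy\ne0\text{ for all }(x,y)\in\overline P\}.$$ A germ of an analytic function in two variables is *holonomic* if it generates a holonomic module (Bernstein dimension at most $2$) over the Weyl algebra $\mathbb C\langle u,v,\partial_u,\partial_v\rangle$. **Theorem.** Let $P$ be a regular rational plane polypol, and let $S_P\subset\mathbb C^2$ be the set of all $(u,v)$ for which the line $1-ux-vy=0$ passes through a vertex of $P$ or is tangent to a complexified nonlinear boundary component of $P$. 1. $F_P$ is analytic on $U_P$. The set $S_P$ is the zero set of a nonzero polynomial in $\mathbb C[u,v]$, and for every continuous path in $\mathbb C^2\setminus S_P$ starting at a point of $U_P$ the germ of $F_P$ at that point has an analytic continuation along the path, all of whose germs are holonomic. Thus $F_P$ continues to a holonomic multivalued function on the complement of the algebraic curve $S_P$, so singularities occur only on $S_P$. 2. $F_P$ is a period attached to the moving line along the oriented boundary: there are $\sigma_j\in\{-1,0,1\}$ such that for all $(u,v)\in U_P$ $$u\,F_P=\sum_j\sigma_j\int_{\gamma_j}\frac{dy}{(1-ux-vy)^2},\qquad v\,F_P=-\sum_j\sigma_j\int_{\gamma_j}\frac{dx}{(1-ux-vy)^2}.$$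 3. If $P$ is a polygon (all boundary arcs are straight segments), then $S_P$ consists of the vertex lines only. If moreover $P$ is convex with the origin in its interior, then $F_P\,du\wedge dv$ is (on $U_P$, as a rational form) the canonical form of the polar polygon $P^\circ=\{w\in\mathbb R^2: 1-\langle v,w\rangle\ge0\text{ for all vertices }v\text{ of }P\}$, oriented counterclockwise: the unique nonzero rational two-form on $\mathbb{CP}^2$ with at most simple poles along the edge lines of $P^\circ$, whose residue along each edge $[A,B]$, in the affine coordinate $t$ with $t=0$ at $A$ and $t=1$ at $B$ ($A,B$ in counterclockwise order), is the canonical form $\frac{dt}{t}-\frac{dt}{t-1}$ of the edge (residue of $\omega'\wedge\frac{d\ell}{\ell}$ along $\ell=0$ being $\omega'|_{\ell=0}$, where $\ell\ge0$ on $P^\circ$), and with no other poles. 4. For curved boundaries $F_P\,du\wedge dv$ is in general not a logarithmic canonical form. The closed unit disk $D$ is a regular rational polypol without vertices, $S_D=\{q=0\}$ with $q=1-u^2-v^2$, and on $U_D$ one has $q\notin(-\infty,0]$ and $F_D=2\pi q^{-3/2}$ (principal branch). $F_D$ is not a rational function. Moreover, no finite branched cover makes $F_D\,du\wedge dv$ logarithmic: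 let $U\subset\mathbb C^2$ be open, let $\varphi:U\to\mathbb C^2$ be holomorphic with finite fibres (a coordinate patch of a finite branched cover), and let $r:U\to\mathbb C$ be holomorphic with $\{r=0\}=\{q\circ\varphi=0\}\neq\emptyset$ and $dr\ne0$ on $\{r=0\}$. Then there is no holomorphic $G$ on $U\setminus\{r=0\}$ with $G^2\,(q\circ\varphi)^3=4\pi^2$ (a single-valued branch of $F_D\circ\varphi$) for which $r\,G\,\det(D\varphi)$ extends holomorphically to $U$, that is, for which the pulled-back form has at most a simple pole along $\{r=0\}$. -/

import Mathlib

open Polynomial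

noncomputable section

namespace Polypol

/-! ### Rational curves and arcs -/

/-- A real rational plane curve, given by a birational parametrization
`τ ↦ [X(τ) : Y(τ) : Z(τ)]` of its complexification by the projective line.
The parameter `τ = ∞` is included: with `d` the maximal degree of the three polynomials, they are
regarded as binary forms of degree `d`, so the point `∞` goes to the triple of `d`-th
coefficients. -/
structure RationalCurve where
  X : ℝ[X]
  Y : ℝ[X]
  Z : ℝ[X]
  /-- The three polynomials have no common complex zero. -/
  noCommonZero : ∀ τ : ℂ, ¬(aeval τ X = 0 ∧ aeval τ Y = 0 ∧ aeval τ Z = 0)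
  /-- All but finitely many points of the complexified curve have one parameter only. -/
  birational : {τ : ℂ | ∃ σ : ℂ, σ ≠ τ ∧
    aeval τ X * aeval σ Y = aeval σ X * aeval τ Y ∧
    aeval τ X * aeval σ Z = aeval σ X * aeval τ Z ∧
    aeval τ Y * aeval σ Z = aeval σ Y * aeval τ Z}.Finite

namespace RationalCurve

variable (C : RationalCurve)

/-- The degree of the parametrization; since it is birational and has no base points, this is the
degree of the curve. -/
def degree : ℕ := max C.X.natDegree (max C.Y.natDegree C.Z.natDegree)

/-- The curve is a straight line. -/
def IsLinear : Prop := C.degree = 1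

/-- The affine point with finite real parameter `τ` (meaningful if `Z(τ) ≠ 0`). -/
def point (τ : ℝ) : ℝ × ℝ := (C.X.eval τ / C.Z.eval τ, C.Y.eval τ / C.Z.eval τ)

/-- The affine point with parameter `∞` (meaningful if the `d`-th coefficient of `Z` is not 0). -/
def pointAtInfinity : ℝ × ℝ :=
  (C.X.coeff C.degree / C.Z.coeff C.degree, C.Y.coeff C.degree / C.Z.coeff C.degree)

/-- The linear form `Z - uX - vY` of the moving line `1 - ux - vy = 0`, restricted to the
complexified curve. -/
def lineForm (p : ℂ × ℂ) : ℂ[X] :=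
  C.Z.map (algebraMap ℝ ℂ) - Polynomial.C p.1 * C.X.map (algebraMap ℝ ℂ)
    - Polynomial.C p.2 * C.Y.map (algebraMap ℝ ℂ)

/-- The moving line `1 - ux - vy = 0` is tangent to the complexified projective curve: its
restriction to the parameter line has a multiple zero, at a finite parameter or at `∞`.
(Lines through the image of a critical point of the parametrization, e.g. through a cusp,
count as tangent.) -/
def IsTangent (p : ℂ × ℂ) : Prop :=
  (∃ τ : ℂ, (C.lineForm p).eval τ = 0 ∧ (C.lineForm p).derivative.eval τ = 0) ∨
    ((C.lineForm p).coeff C.degree = 0 ∧ (C.lineForm p).coeff (C.degree - 1) = 0)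

end RationalCurve

/-- A simple real rational arc in the affine plane: either the image of a compact parameter interval
`[a, b]` (`ends = some (a, b)`; the two endpoints may coincide), or, if `ends = none`, the simple
closed curve which is the image of the whole real projective parameter line, and which has no
endpoints. -/
structure RationalArc extends RationalCurve where
  ends : Option (ℝ × ℝ)
  ends_lt : ∀ e ∈ ends, e.1 < e.2
  /-- The arc lies in the affine plane. -/
  affine : match ends with
    | some e => ∀ τ ∈ Set.Icc e.1 e.2, Z.eval τ ≠ 0
    | none => (∀ τ : ℝ, Z.eval τ ≠ 0) ∧ Z.coeff toRationalCurve.degree ≠ 0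
  /-- The arc has no self-intersections, except that its endpoints may coincide. -/
  simple : match ends with
    | some e => Set.InjOn toRationalCurve.point (Set.Ico e.1 e.2) ∧
        Set.InjOn toRationalCurve.point (Set.Ioc e.1 e.2)
    | none => Function.Injective toRationalCurve.point ∧
        ∀ τ : ℝ, toRationalCurve.point τ ≠ toRationalCurve.pointAtInfinity

namespace RationalArc

variable (γ : RationalArc)

/-- The real parameter interval (without the parameter `∞`). -/
def interval : Set ℝ :=
  match γ.ends with
  | some e => Set.Icc e.1 e.2
  | none => Set.univ

/-- The set of points of the arc. -/
def support : Set (ℝ × ℝ) :=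
  match γ.ends with
  | some e => γ.point '' Set.Icc e.1 e.2
  | none => Set.range γ.point ∪ {γ.pointAtInfinity}

/-- The endpoints of the arc. -/
def endpoints : Set (ℝ × ℝ) :=
  match γ.ends with
  | some e => {γ.point e.1, γ.point e.2}
  | none => ∅

/-- The integral of `dx / (1 - ux - vy)²` along the arc, in the direction of increasing parameter:
`dx = (X'Z - XZ') / Z² dτ` and `1 - ux - vy = lineForm / Z`. -/
def periodX (p : ℂ × ℂ) : ℂ :=
  ∫ τ in γ.interval,
    (((γ.X.derivative * γ.Z - γ.X * γ.Z.derivative).eval τ : ℝ) : ℂ) /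
      ((γ.lineForm p).eval (τ : ℂ)) ^ 2

/-- The integral of `dy / (1 - ux - vy)²` along the arc, in the direction of increasing
parameter. -/
def periodY (p : ℂ × ℂ) : ℂ :=
  ∫ τ in γ.interval,
    (((γ.Y.derivative * γ.Z - γ.Y * γ.Z.derivative).eval τ : ℝ) : ℂ) /
      ((γ.lineForm p).eval (τ : ℂ)) ^ 2

end RationalArc

/-! ### Polypols -/

/-- A semialgebraic subset of the real plane: a finite union of sets given by finitely many
polynomial equations and strict polynomial inequalities. -/
def IsSemialgebraic (S : Set (ℝ × ℝ)) : Prop :=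
  ∃ F : Finset (Finset (MvPolynomial (Fin 2) ℝ) × Finset (MvPolynomial (Fin 2) ℝ)),
    S = {z | ∃ c ∈ F, (∀ f ∈ c.1, MvPolynomial.eval ![z.1, z.2] f = 0) ∧
      ∀ g ∈ c.2, 0 < MvPolynomial.eval ![z.1, z.2] g}

/-- A regular rational plane polypol: a bounded path-connected semialgebraic plane domain whose
boundary is a finite union of real rational arcs which meet only at common endpoints. No convention
is made on which boundary points belong to the domain. -/
structure RationalPolypol where
  carrier : Set (ℝ × ℝ)
  semialgebraic : IsSemialgebraic carrier
  bounded : Bornology.IsBounded carrier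
  pathConnected : IsPathConnected carrier
  /-- The set is a plane domain: it is full-dimensional at each of its points. -/
  domain : carrier ⊆ closure (interior carrier)
  numArcs : ℕ
  arc : Fin numArcs → RationalArc
  boundary : frontier carrier = ⋃ j, (arc j).support
  regular : ∀ i j, i ≠ j →
    (arc i).support ∩ (arc j).support ⊆ (arc i).endpoints ∩ (arc j).endpoints

namespace RationalPolypol

variable (P : RationalPolypol)

/-- The vertices: the endpoints of the boundary arcs. -/
def vertices : Set (ℝ × ℝ) := ⋃ j, (P.arc j).endpoints

/-- The points `(u, v)` of the complex dual plane for which the line `1 - ux - vy = 0` passes through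
a vertex of `P`. -/
def vertexLines : Set (ℂ × ℂ) :=
  {p | ∃ w ∈ P.vertices, 1 - p.1 * (w.1 : ℂ) - p.2 * (w.2 : ℂ) = 0}

/-- The points `(u, v)` for which the line passes through a vertex or is tangent to a complexified
nonlinear boundary component. -/
def singularLocus : Set (ℂ × ℂ) :=
  P.vertexLines ∪ {p | ∃ j, ¬(P.arc j).IsLinear ∧ (P.arc j).IsTangent p}

/-- All boundary arcs are straight segments. -/
def IsPolygon : Prop := ∀ j, (P.arc j).IsLinear

end RationalPolypol

/-! ### The transform and its analytic continuation -/

/-- The normalized moment generating function `2 ∫_S dx dy / (1 - ux - vy)³`. -/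
def fantappie (S : Set (ℝ × ℝ)) (p : ℂ × ℂ) : ℂ :=
  2 * ∫ z in S, 1 / (1 - p.1 * (z.1 : ℂ) - p.2 * (z.2 : ℂ)) ^ 3

/-- The points `(u, v)` for which the integrand has no singularity on the closure of `S`. -/
def fantappieDomain (S : Set (ℝ × ℝ)) : Set (ℂ × ℂ) :=
  {p | ∀ z ∈ closure S, 1 - p.1 * (z.1 : ℂ) - p.2 * (z.2 : ℂ) ≠ 0}

open Topology in
/-- The family of germs `g t` at `γ t` is an analytic continuation along the path `γ` of the germ of
`f` at `γ 0`. -/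
def IsContinuationAlong (f : ℂ × ℂ → ℂ) (γ : C(unitInterval, ℂ × ℂ))
    (g : unitInterval → ℂ × ℂ → ℂ) : Prop :=
  g 0 =ᶠ[𝓝 (γ 0)] f ∧ (∀ t, AnalyticAt ℂ (g t) (γ t)) ∧
    ∀ t, ∀ᶠ s in 𝓝 t, g s =ᶠ[𝓝 (γ s)] g t

/-- The partial derivative `∂/∂u`. -/
def partialU (f : ℂ × ℂ → ℂ) (p : ℂ × ℂ) : ℂ := fderiv ℂ f p (1, 0)

/-- The partial derivative `∂/∂v`. -/
def partialV (f : ℂ × ℂ → ℂ) (p : ℂ × ℂ) : ℂ := fderiv ℂ f p (0, 1)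

open Topology in
/-- The `k`-th step of the Bernstein filtration of the module generated by the germ of `f` at `p` over
the Weyl algebra `ℂ⟨u, v, ∂u, ∂v⟩`: the span of the germs `u^a v^b ∂u^c ∂v^d f` with
`a + b + c + d ≤ k`. -/
def bernsteinStep (f : ℂ × ℂ → ℂ) (p : ℂ × ℂ) (k : ℕ) :
    Submodule ℂ (Filter.Germ (𝓝 p) ℂ) :=
  Submodule.span ℂ {φ | ∃ a b c d : ℕ, a + b + c + d ≤ k ∧
    φ = ((fun z : ℂ × ℂ => z.1 ^ a * z.2 ^ b * (partialU^[c] (partialV^[d] f)) z :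
      ℂ × ℂ → ℂ) : Filter.Germ (𝓝 p) ℂ)}

/-- The germ of `f` at `p` is a holonomic function: it is analytic and it generates a holonomic
module over the Weyl algebra in two variables, that is, a module of Bernstein dimension at
most two. -/
def IsHolonomicAt (f : ℂ × ℂ → ℂ) (p : ℂ × ℂ) : Prop :=
  AnalyticAt ℂ f p ∧
    ∃ c : ℕ, ∀ k : ℕ, Module.finrank ℂ (bernsteinStep f p k) ≤ c * (k + 1) ^ 2

/-! ### Canonical forms of convex polygons -/

/-- The function field `ℂ(u, v)`; `f` stands for the rational two-form `f du ∧ dv` on the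
projective plane. -/
abbrev RationalFunction : Type := FractionRing (MvPolynomial (Fin 2) ℂ)

/-- The quotient `a / b` of polynomials as a rational function. -/
def quot (a b : MvPolynomial (Fin 2) ℂ) : RationalFunction :=
  algebraMap _ RationalFunction a / algebraMap _ RationalFunction b

/-- `g dt` is the canonical form of the interval `[0, 1]` oriented from `0` to `1`: a rational
one-form on the projective line with simple poles at `0` and `1` with residues `1` and `-1`, and no
other poles, also not at infinity. -/
def IsIntervalCanonicalForm (g : RatFunc ℂ) : Prop :=
  (∀ c : ℂ, c ≠ 0 → c ≠ 1 → ∃ a b : ℂ[X], b.eval c ≠ 0 ∧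
    g = algebraMap _ (RatFunc ℂ) a / algebraMap _ (RatFunc ℂ) b) ∧
  (∃ a b : ℂ[X], b.eval 0 ≠ 0 ∧ a.eval 0 / b.eval 0 = 1 ∧
    algebraMap _ (RatFunc ℂ) (X : ℂ[X]) * g =
      algebraMap _ (RatFunc ℂ) a / algebraMap _ (RatFunc ℂ) b) ∧
  (∃ a b : ℂ[X], b.eval 1 ≠ 0 ∧ a.eval 1 / b.eval 1 = -1 ∧
    algebraMap _ (RatFunc ℂ) (X - 1 : ℂ[X]) * g =
      algebraMap _ (RatFunc ℂ) a / algebraMap _ (RatFunc ℂ) b) ∧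
  g.intDegree ≤ -2

/-- `[A, B]` is an edge of the convex set `Q`, cut out by the supporting line `c + ⟨n, z⟩ = 0` with
`c + ⟨n, z⟩ ≥ 0` on `Q`, and traversed counterclockwise from `A` to `B` (with `Q` on the left). -/
def IsOrientedEdge (Q : Set (ℝ × ℝ)) (c : ℝ) (n A B : ℝ × ℝ) : Prop :=
  (∀ z ∈ Q, 0 ≤ c + n.1 * z.1 + n.2 * z.2) ∧
  {z ∈ Q | c + n.1 * z.1 + n.2 * z.2 = 0} = segment ℝ A B ∧
  0 < (B.1 - A.1) * n.2 - (B.2 - A.2) * n.1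

/-- The polynomial `c + n₁ u + n₂ v`. -/
def edgePoly (c : ℝ) (n : ℝ × ℝ) : MvPolynomial (Fin 2) ℂ :=
  MvPolynomial.C (c : ℂ) + MvPolynomial.C (n.1 : ℂ) * MvPolynomial.X 0
    + MvPolynomial.C (n.2 : ℂ) * MvPolynomial.X 1

/-- The restriction of a polynomial to the line through `A` and `B` with the coordinate `t` in
`A + t (B - A)`. -/
def restrictToLine (A B : ℝ × ℝ) (a : MvPolynomial (Fin 2) ℂ) : ℂ[X] :=
  MvPolynomial.aeval ![C (A.1 : ℂ) + C ((B.1 - A.1 : ℝ) : ℂ) * X,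
    C (A.2 : ℂ) + C ((B.2 - A.2 : ℝ) : ℂ) * X] a

/-- The two-form `f du ∧ dv` has at most a simple pole along the line `ℓ = c + ⟨n, z⟩ = 0`, and its
residue there is `g dt`. In the coordinates `z = A + t (B - A) + ℓ n / |n|²` one has
`du ∧ dv = κ dt ∧ dℓ` with `κ = det (B - A, n) / |n|²`; hence `f du ∧ dv = ω' ∧ dℓ / ℓ` with
`ω' = κ ℓ f dt`, and `g` is the restriction of `κ ℓ f` to the line. -/
def HasEdgeResidue (f : RationalFunction) (c : ℝ) (n A B : ℝ × ℝ) (g : RatFunc ℂ) : Prop :=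
  ∃ a b : MvPolynomial (Fin 2) ℂ, ¬edgePoly c n ∣ b ∧
    algebraMap _ RationalFunction (edgePoly c n) * f = quot a b ∧
    g = RatFunc.C (((((B.1 - A.1) * n.2 - (B.2 - A.2) * n.1) / (n.1 ^ 2 + n.2 ^ 2) : ℝ) : ℂ)) *
      (algebraMap _ (RatFunc ℂ) (restrictToLine A B a) /
        algebraMap _ (RatFunc ℂ) (restrictToLine A B b))

/-- `f du ∧ dv` is a canonical form of the positive geometry `(ℂP², Q)`, for a convex polygon `Q`
oriented counterclockwise: a nonzero rational two-form on the projective plane whose residue along each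
edge is the canonical form of the edge, and which has no other poles, also not along the line at
infinity, where `du ∧ dv` has a pole of order three. -/
structure IsCanonicalForm (Q : Set (ℝ × ℝ)) (f : RationalFunction) : Prop where
  ne_zero : f ≠ 0
  residue : ∀ c n A B, IsOrientedEdge Q c n A B →
    ∃ g : RatFunc ℂ, HasEdgeResidue f c n A B g ∧ IsIntervalCanonicalForm g
  regular : ∀ q : MvPolynomial (Fin 2) ℂ, Irreducible q →
    (∀ c n A B, IsOrientedEdge Q c n A B → ¬Associated q (edgePoly c n)) →
    ∃ a b : MvPolynomial (Fin 2) ℂ, ¬q ∣ b ∧ f = quot a b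
  regular_infinity : ∃ a b : MvPolynomial (Fin 2) ℂ, b ≠ 0 ∧ f = quot a b ∧
    a.totalDegree + 3 ≤ b.totalDegree

/-- The polar `{w | 1 - ⟨v, w⟩ ≥ 0 for all v ∈ V}`. -/
def polar (V : Set (ℝ × ℝ)) : Set (ℝ × ℝ) :=
  {w | ∀ v ∈ V, 0 ≤ 1 - (v.1 * w.1 + v.2 * w.2)}

/-! ### The disk -/

/-- The closed unit disk. -/
def unitDisk : Set (ℝ × ℝ) := {z | z.1 ^ 2 + z.2 ^ 2 ≤ 1}

/-- The equation `q(u, v) = 1 - u² - v²` of the dual conic of the unit circle. -/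
def dualConic (p : ℂ × ℂ) : ℂ := 1 - p.1 ^ 2 - p.2 ^ 2

/-- The open set `U` and the map `φ : U → ℂ²` with finite fibres are a coordinate patch of a finite
branched cover of the dual plane, and `r = 0` is a reduced equation of the preimage of the dual
conic, which is non-empty and smooth in this patch. -/
structure IsBranchedCoverPatch (U : Set (ℂ × ℂ)) (φ : ℂ × ℂ → ℂ × ℂ) (r : ℂ × ℂ → ℂ) : Prop where
  isOpen : IsOpen U
  analytic : AnalyticOnNhd ℂ φ U
  finite_fibres : ∀ y, {x ∈ U | φ x = y}.Finite
  analytic_eq : AnalyticOnNhd ℂ r U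
  nonempty : ∃ x ∈ U, r x = 0
  zero_iff : ∀ x ∈ U, r x = 0 ↔ dualConic (φ x) = 0
  smooth : ∀ x ∈ U, r x = 0 → fderiv ℂ r x ≠ 0

/-- The pull-back under `φ` of the form `2π q^(-3/2) du ∧ dv` is single-valued with at most a
logarithmic (simple) pole along `r = 0`: there is a single-valued analytic branch `G` of
`2π (q ∘ φ)^(-3/2)` outside `r = 0`, and `r G det(Dφ)` extends analytically across `r = 0`. -/
def PullbackIsLogarithmic (U : Set (ℂ × ℂ)) (φ : ℂ × ℂ → ℂ × ℂ) (r : ℂ × ℂ → ℂ) : Prop :=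
  ∃ G H : ℂ × ℂ → ℂ, AnalyticOnNhd ℂ G {x ∈ U | r x ≠ 0} ∧
    (∀ x ∈ U, r x ≠ 0 → G x ^ 2 * dualConic (φ x) ^ 3 = (2 * (Real.pi : ℂ)) ^ 2) ∧
    AnalyticOnNhd ℂ H U ∧
    ∀ x ∈ U, r x ≠ 0 → H x = r x * (G x * (fderiv ℂ φ x).det)

end Polypol

end

/-! Write ℓ = 1 - ux - vy, and L = Z - uX - vY for its restriction to a boundary curve of degree d.
Three facts carry the theorem: Green's formula turns the area integral into boundary periods,
Hermite reduction puts these periods into a Pfaffian system singular only on the curve S_P, and for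
polygons and the disk the periods are elementary.

Since ∂_x(x/ℓ²) + ∂_y(y/ℓ²) = 2/ℓ³, ∂_x(1/ℓ²) = 2u/ℓ³ and ∂_y(1/ℓ²) = 2v/ℓ³, Green's formula
expresses F, uF and vF by integrals of X dY - Y dX, dY and dX (in homogeneous form) over L². The
boundary may have cusps, corners, and arcs with the domain on both sides, so the formula
(`GreenData.green`) is proved from `local_green` at regular points, glued by a partition of unity;
finitely many bad points do not matter, because a bump of radius 1/k has gradient of order k on an
area of order 1/k². Applying the formula to exact forms shows that the multiplicity of an arc does
not jump at a critical parameter, so every arc has one sign σ.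

The discriminant of L is the resultant of the two partial derivatives of the binary form. Times this
discriminant, every numerator of degree at most 2d - 2 lies in the ideal of the partials
(`exists_reduction`), and integration by parts reduces ∫ R/L² to endpoint terms and the integrals ∫
τᵏ/L with k ≤ d - 2. These integrals and the constant 1 therefore satisfy a linear Pfaffian system
whose denominator is the discriminant times the forms of the endpoint lines (`exists_pfaffSystem`);
its zeros lie in S_P. Solutions are reproduced by a Volterra equation along segments, on a ball
whose radius depends on the centre only (`exists_extension`), which gives continuation along paths.
In such a system k derivatives cost k powers of the denominator and a numerator degree linear in k,
so the Bernstein filtration grows quadratically: the germs are holonomic.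

For a polygon the edge [A, B] contributes det(A, B)/(ℓ_A ℓ_B). Convexity makes all these
determinants positive after orientation. Comparing the formulas for F, uF and vF gives the identity
∑ B/ℓ_B = ∑ A/ℓ_A, and linear independence of the 1/ℓ_V then shows that every vertex is the start of
as many edges as it is the end. So the edges form a cycle (`ConvexCycle`), from which residues,
cancellation of other poles and the order at infinity are computed. Uniqueness holds because the
difference of two canonical forms is a polynomial of negative degree.

For the disk the period is an elementary integral with an arctangent, giving 2π q^(-3/2) at small
real points and then everywhere by the identity theorem. Irrationality is a parity of root
multiplicities in B² = A² N³. The logarithmic statement is excluded by comparing orders of vanishing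
on a curve transverse to r = 0 on which one coordinate of φ is constant. -/

open Polynomial

namespace Polypol

open MeasureTheory Filter Topology Set
open scoped BoundedContinuousFunction

/-! ### Integrals depending on the moving line -/

section Parametric

variable {T : Type*} [TopologicalSpace T]

/-- The moving linear form as a bounded continuous function. -/
noncomputable def movingForm (x y z : T →ᵇ ℂ) (p : ℂ × ℂ) : T →ᵇ ℂ := z - p.1 • x - p.2 • y

/-- The uniform lower bound bounds the pointwise reciprocal, so inversion takes place in the Banach
algebra of bounded continuous functions. Analyticity and differentiation under the integral sign
then follow from analyticity of inversion in that algebra. -/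
theorem isUnit_movingForm (x y z : T →ᵇ ℂ) (p : ℂ × ℂ) {ε : ℝ} (hε : 0 < ε)
    (h : ∀ t, ε ≤ ‖z t - p.1 * x t - p.2 * y t‖) : IsUnit (movingForm x y z p) := by
  have hne : ∀ t, movingForm x y z p t ≠ 0 := fun t => by
    have := h t
    intro h0
    simp only [movingForm, BoundedContinuousFunction.coe_sub, BoundedContinuousFunction.coe_smul,
      Pi.sub_apply, smul_eq_mul] at h0
    rw [h0, norm_zero] at this
    linarith
  refine IsUnit.of_mul_eq_one (BoundedContinuousFunction.ofNormedAddCommGroup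
    (fun t => (movingForm x y z p t)⁻¹)
    ((movingForm x y z p).continuous.inv₀ hne) ε⁻¹ (fun t => ?_)) ?_
  · rw [norm_inv]
    exact inv_anti₀ hε (h t)
  · ext t
    simp [hne t]

theorem inverse_apply {f : T →ᵇ ℂ} (hf : IsUnit f) (t : T) : (Ring.inverse f) t = (f t)⁻¹ := by
  have h := Ring.mul_inverse_cancel f hf
  have h2 : f t * (Ring.inverse f) t = 1 := by
    rw [← BoundedContinuousFunction.mul_apply, h]; rfl
  exact eq_inv_of_mul_eq_one_right h2

theorem hasFDerivAt_movingForm (x y z : T →ᵇ ℂ) (p : ℂ × ℂ) :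
    HasFDerivAt (movingForm x y z)
      (-((ContinuousLinearMap.fst ℂ ℂ ℂ).smulRight x)
        - ((ContinuousLinearMap.snd ℂ ℂ ℂ).smulRight y)) p := by
  have h1 : HasFDerivAt (fun p : ℂ × ℂ => p.1 • x) ((ContinuousLinearMap.fst ℂ ℂ ℂ).smulRight x) p :=
    ((ContinuousLinearMap.fst ℂ ℂ ℂ).smulRight x).hasFDerivAt
  have h2 : HasFDerivAt (fun p : ℂ × ℂ => p.2 • y) ((ContinuousLinearMap.snd ℂ ℂ ℂ).smulRight y) p :=
    ((ContinuousLinearMap.snd ℂ ℂ ℂ).smulRight y).hasFDerivAt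
  have := ((hasFDerivAt_const z p).sub h1).sub h2
  rw [zero_sub] at this
  exact this

theorem analyticAt_movingForm (x y z : T →ᵇ ℂ) (p : ℂ × ℂ) :
    AnalyticAt ℂ (movingForm x y z) p := by
  have h1 : AnalyticAt ℂ (fun p : ℂ × ℂ => p.1 • x) p :=
    ((ContinuousLinearMap.fst ℂ ℂ ℂ).smulRight x).analyticAt p
  have h2 : AnalyticAt ℂ (fun p : ℂ × ℂ => p.2 • y) p :=
    ((ContinuousLinearMap.snd ℂ ℂ ℂ).smulRight y).analyticAt p
  exact (analyticAt_const.sub h1).sub h2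

variable [MeasurableSpace T]

variable {μ : Measure T} {S : Set T} {ρ x y z w : T → ℂ}

/-- The data of a parametric integral over a set `S`. -/
structure ParametricData (μ : Measure T) (S : Set T) (ρ x y z w : T → ℂ) : Prop where
  measurableSet : MeasurableSet S
  weight : IntegrableOn ρ S μ
  contX : ContinuousOn x S
  contY : ContinuousOn y S
  contZ : ContinuousOn z S
  contW : ContinuousOn w S
  bdd : ∃ C, ∀ t ∈ S, ‖x t‖ ≤ C ∧ ‖y t‖ ≤ C ∧ ‖z t‖ ≤ C ∧ ‖w t‖ ≤ C

theorem ParametricData.exists_bcf (hS : ParametricData μ S ρ x y z w) :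
    ∃ x' y' z' w' : S →ᵇ ℂ, (∀ t : S, x' t = x t) ∧ (∀ t : S, y' t = y t) ∧ (∀ t : S, z' t = z t) ∧
      ∀ t : S, w' t = w t := by
  obtain ⟨C, hC⟩ := hS.bdd
  exact ⟨BoundedContinuousFunction.ofNormedAddCommGroup (S.domRestrict x)
      (continuousOn_iff_continuous_domRestrict.1 hS.contX) C (fun t => (hC t t.2).1),
    BoundedContinuousFunction.ofNormedAddCommGroup (S.domRestrict y)
      (continuousOn_iff_continuous_domRestrict.1 hS.contY) C (fun t => (hC t t.2).2.1),
    BoundedContinuousFunction.ofNormedAddCommGroup (S.domRestrict z)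
      (continuousOn_iff_continuous_domRestrict.1 hS.contZ) C (fun t => (hC t t.2).2.2.1),
    BoundedContinuousFunction.ofNormedAddCommGroup (S.domRestrict w)
      (continuousOn_iff_continuous_domRestrict.1 hS.contW) C (fun t => (hC t t.2).2.2.2),
    fun t => rfl, fun t => rfl, fun t => rfl, fun t => rfl⟩

theorem ParametricData.integrable_comap (hS : ParametricData μ S ρ x y z w) :
    Integrable (fun t : S => ρ t) (Measure.comap Subtype.val μ) := by
  have h := hS.weight
  rw [IntegrableOn, ← map_comap_subtype_coe hS.measurableSet,
    (MeasurableEmbedding.subtype_coe hS.measurableSet).integrable_map_iff] at h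
  exact h

variable [OpensMeasurableSpace T]

/-- Integration of bounded continuous functions against an integrable weight. -/
noncomputable def weightedIntegral (μ : Measure T) (ρ : T → ℂ) (hρ : Integrable ρ μ) :
    (T →ᵇ ℂ) →L[ℂ] ℂ :=
  LinearMap.mkContinuous
    { toFun := fun f => ∫ t, ρ t * f t ∂μ
      map_add' := fun f g => by
        have h : ∀ f : T →ᵇ ℂ, Integrable (fun t => ρ t * f t) μ := fun f =>
          hρ.mul_bdd (c := ‖f‖) f.continuous.measurable.aestronglyMeasurable
            (Eventually.of_forall fun t => f.norm_coe_le_norm t)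
        simp only [BoundedContinuousFunction.coe_add, Pi.add_apply, mul_add]
        exact integral_add (h f) (h g)
      map_smul' := fun c f => by
        simp only [BoundedContinuousFunction.coe_smul, smul_eq_mul, RingHom.id_apply]
        rw [← integral_const_mul]
        congr 1; ext t; ring }
    (∫ t, ‖ρ t‖ ∂μ) (fun f => by
      simp only [LinearMap.coe_mk, AddHom.coe_mk]
      rw [← integral_mul_const]
      refine norm_integral_le_of_norm_le (hρ.norm.mul_const _) (Eventually.of_forall fun t => ?_)
      rw [norm_mul]
      exact mul_le_mul_of_nonneg_left (f.norm_coe_le_norm t) (norm_nonneg _))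

theorem weightedIntegral_apply (μ : Measure T) (ρ : T → ℂ) (hρ : Integrable ρ μ) (f : T →ᵇ ℂ) :
    weightedIntegral μ ρ hρ f = ∫ t, ρ t * f t ∂μ := rfl

/-- Units are open, so near `p` the integrand is an honest element of the Banach algebra and the
integral is a continuous linear functional of it. Outside this neighbourhood `Ring.inverse` may be
the default value 0, hence only eventual equality. -/
theorem eventuallyEq_weightedIntegral (μ : Measure T) (ρ : T → ℂ) (hρ : Integrable ρ μ)
    (x y z w : T →ᵇ ℂ) (n : ℕ) (p : ℂ × ℂ) {ε : ℝ} (hε : 0 < ε)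
    (h : ∀ t, ε ≤ ‖z t - p.1 * x t - p.2 * y t‖) :
    (fun p : ℂ × ℂ => ∫ t, ρ t * (w t / (z t - p.1 * x t - p.2 * y t) ^ n) ∂μ) =ᶠ[𝓝 p]
      fun p => weightedIntegral μ ρ hρ (w * (Ring.inverse (movingForm x y z p)) ^ n) := by
  have hu := isUnit_movingForm x y z p hε h
  have hev : ∀ᶠ q in 𝓝 p, IsUnit (movingForm x y z q) :=
    (analyticAt_movingForm x y z p).continuousAt.eventually (Units.isOpen.mem_nhds hu)
  filter_upwards [hev] with q hq
  rw [weightedIntegral_apply]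
  congr 1
  ext t
  rw [BoundedContinuousFunction.mul_apply, BoundedContinuousFunction.coe_pow, Pi.pow_apply,
    inverse_apply hq]
  simp only [movingForm, BoundedContinuousFunction.coe_sub, BoundedContinuousFunction.coe_smul,
      Pi.sub_apply, smul_eq_mul, inv_pow, div_eq_mul_inv]

theorem analyticAt_integral_bcf (μ : Measure T) (ρ : T → ℂ) (hρ : Integrable ρ μ)
    (x y z w : T →ᵇ ℂ) (n : ℕ) (p : ℂ × ℂ) {ε : ℝ} (hε : 0 < ε)
    (h : ∀ t, ε ≤ ‖z t - p.1 * x t - p.2 * y t‖) :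
    AnalyticAt ℂ (fun p : ℂ × ℂ => ∫ t, ρ t * (w t / (z t - p.1 * x t - p.2 * y t) ^ n) ∂μ) p := by
  refine AnalyticAt.congr ?_ (eventuallyEq_weightedIntegral μ ρ hρ x y z w n p hε h).symm
  obtain ⟨U, hU⟩ := isUnit_movingForm x y z p hε h
  have h1 : AnalyticAt ℂ (fun p => Ring.inverse (movingForm x y z p)) p := by
    refine AnalyticAt.fun_comp (g := Ring.inverse) ?_ (analyticAt_movingForm x y z p)
    rw [← hU]; exact analyticAt_inverse U
  exact (ContinuousLinearMap.analyticAt _ _).fun_comp (analyticAt_const.mul (h1.pow n))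

theorem hasFDerivAt_integral_bcf (μ : Measure T) (ρ : T → ℂ) (hρ : Integrable ρ μ)
    (x y z w : T →ᵇ ℂ) (n : ℕ) (p : ℂ × ℂ) {ε : ℝ} (hε : 0 < ε)
    (h : ∀ t, ε ≤ ‖z t - p.1 * x t - p.2 * y t‖) :
    partialU (fun p : ℂ × ℂ => ∫ t, ρ t * (w t / (z t - p.1 * x t - p.2 * y t) ^ n) ∂μ) p =
      n * ∫ t, ρ t * (w t * x t / (z t - p.1 * x t - p.2 * y t) ^ (n + 1)) ∂μ ∧
    partialV (fun p : ℂ × ℂ => ∫ t, ρ t * (w t / (z t - p.1 * x t - p.2 * y t) ^ n) ∂μ) p =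
      n * ∫ t, ρ t * (w t * y t / (z t - p.1 * x t - p.2 * y t) ^ (n + 1)) ∂μ := by
  have hu := isUnit_movingForm x y z p hε h
  obtain ⟨U, hU⟩ := hu
  have hinv : (↑U⁻¹ : T →ᵇ ℂ) = Ring.inverse (movingForm x y z p) := by
    rw [← hU, Ring.inverse_unit]
  have h1 : HasFDerivAt (fun p => Ring.inverse (movingForm x y z p))
      ((-ContinuousLinearMap.mulLeftRight ℂ (T →ᵇ ℂ) ↑U⁻¹ ↑U⁻¹).comp
      (-((ContinuousLinearMap.fst ℂ ℂ ℂ).smulRight x)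
        - ((ContinuousLinearMap.snd ℂ ℂ ℂ).smulRight y))) p := by
    refine HasFDerivAt.comp p (g := Ring.inverse) ?_ (hasFDerivAt_movingForm x y z p)
    rw [← hU]; exact hasFDerivAt_ringInverse U
  have h2 := (weightedIntegral μ ρ hρ).hasFDerivAt.comp p ((h1.pow n).const_mul w)
  have h3 := h2.congr_of_eventuallyEq (eventuallyEq_weightedIntegral μ ρ hρ x y z w n p hε h)
  have hne : ∀ t, movingForm x y z p t = z t - p.1 * x t - p.2 * y t := fun t => by
    simp [movingForm]
  have hval : ∀ t, (↑U⁻¹ : T →ᵇ ℂ) t = (z t - p.1 * x t - p.2 * y t)⁻¹ := fun t => by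
    rw [hinv, inverse_apply (isUnit_movingForm x y z p hε h), hne]
  have hval' : ∀ t, (Ring.inverse (movingForm x y z p)) t = (z t - p.1 * x t - p.2 * y t)⁻¹ :=
    fun t => by rw [inverse_apply (isUnit_movingForm x y z p hε h), hne]
  have hnz : ∀ t, z t - p.1 * x t - p.2 * y t ≠ 0 := fun t h0 => by
    have := h t; rw [h0, norm_zero] at this; linarith
  -- The power rule produces the exponent `m - 1` in ℕ; for `m = 0` its truncation is harmless
  -- because the factor `m` vanishes.
  have key : ∀ (a : ℂ) (m : ℕ), a ≠ 0 → (a⁻¹) ^ (m - 1) * (a⁻¹ * a⁻¹) * m = m * (a ^ (m + 1))⁻¹ := by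
    intro a m ha
    cases m with
    | zero => simp
    | succ m => rw [Nat.add_sub_cancel, ← inv_pow]; ring
  constructor
  · rw [partialU, h3.fderiv]
    simp only [ContinuousLinearMap.comp_apply, weightedIntegral_apply]
    rw [← integral_const_mul]
    congr 1; ext t
    simp [hval, hval']
    have := key _ n (hnz t)
    linear_combination (ρ t * w t * x t) * this
  · rw [partialV, h3.fderiv]
    simp only [ContinuousLinearMap.comp_apply, weightedIntegral_apply]
    rw [← integral_const_mul]
    congr 1; ext t
    simp [hval, hval']
    have := key _ n (hnz t)
    linear_combination (ρ t * w t * y t) * this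

/-- The functions are bounded and continuous on `S` only, so the integral is moved to the subtype,
where they become elements of the Banach algebra. -/
theorem ParametricData.analyticAt (hS : ParametricData μ S ρ x y z w) (n : ℕ) (p : ℂ × ℂ)
    (h : ∃ ε > 0, ∀ t ∈ S, ε ≤ ‖z t - p.1 * x t - p.2 * y t‖) :
    AnalyticAt ℂ (fun p : ℂ × ℂ =>
      ∫ t in S, ρ t * (w t / (z t - p.1 * x t - p.2 * y t) ^ n) ∂μ) p := by
  obtain ⟨x', y', z', w', hx, hy, hz, hw⟩ := hS.exists_bcf
  obtain ⟨ε, hε, h⟩ := h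
  have := analyticAt_integral_bcf _ _ hS.integrable_comap x' y' z' w' n p hε
    (fun t => by rw [hx, hy, hz]; exact h t t.2)
  simp only [hx, hy, hz, hw] at this
  convert this using 2 with q
  exact (integral_subtype_comap hS.measurableSet _).symm

theorem ParametricData.partials (hS : ParametricData μ S ρ x y z w) (n : ℕ) (p : ℂ × ℂ)
    (h : ∃ ε > 0, ∀ t ∈ S, ε ≤ ‖z t - p.1 * x t - p.2 * y t‖) :
    partialU (fun p : ℂ × ℂ =>
      ∫ t in S, ρ t * (w t / (z t - p.1 * x t - p.2 * y t) ^ n) ∂μ) p =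
      n * ∫ t in S, ρ t * (w t * x t / (z t - p.1 * x t - p.2 * y t) ^ (n + 1)) ∂μ ∧
    partialV (fun p : ℂ × ℂ =>
      ∫ t in S, ρ t * (w t / (z t - p.1 * x t - p.2 * y t) ^ n) ∂μ) p =
      n * ∫ t in S, ρ t * (w t * y t / (z t - p.1 * x t - p.2 * y t) ^ (n + 1)) ∂μ := by
  obtain ⟨x', y', z', w', hx, hy, hz, hw⟩ := hS.exists_bcf
  obtain ⟨ε, hε, h⟩ := h
  have := hasFDerivAt_integral_bcf _ _ hS.integrable_comap x' y' z' w' n p hε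
    (fun t => by rw [hx, hy, hz]; exact h t t.2)
  simp only [hx, hy, hz, hw] at this
  simp only [← integral_subtype_comap hS.measurableSet]
  exact this

end Parametric

/-! ### Polynomials and analytic functions in two variables -/

/-- Evaluation of a polynomial in two variables at a point of the plane. -/
noncomputable abbrev evalPair (p : ℂ × ℂ) : MvPolynomial (Fin 2) ℂ →+* ℂ :=
  MvPolynomial.eval ![p.1, p.2]

theorem analyticAt_evalPair (h : MvPolynomial (Fin 2) ℂ) (p : ℂ × ℂ) :
    AnalyticAt ℂ (fun p => evalPair p h) p := by
  have := AnalyticAt.aeval_mvPolynomial (𝕜 := ℂ) (f := fun p : ℂ × ℂ => ![p.1, p.2]) (z := p)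
    (fun i => by
      fin_cases i
      · exact analyticAt_fst
      · exact analyticAt_snd) h
  exact this

theorem continuous_evalPair (h : MvPolynomial (Fin 2) ℂ) : Continuous (fun p => evalPair p h) :=
  continuous_iff_continuousAt.2 fun p => (analyticAt_evalPair h p).continuousAt

/-- A ball for the maximum norm is a product of two infinite sets, and such products are Zariski
dense. -/
theorem eq_zero_of_evalPair_eventually {h : MvPolynomial (Fin 2) ℂ} {p : ℂ × ℂ}
    (hp : ∀ᶠ q in 𝓝 p, evalPair q h = 0) : h = 0 := by
  obtain ⟨ε, hε, hb⟩ := Metric.eventually_nhds_iff_ball.1 hp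
  refine MvPolynomial.funext_set (s := ![Metric.ball p.1 ε, Metric.ball p.2 ε]) ?_ ?_
  · intro i
    fin_cases i <;> exact infinite_of_mem_nhds _ (Metric.ball_mem_nhds _ hε)
  · intro x hx
    have h0 := hx 0 (mem_univ _)
    have h1 := hx 1 (mem_univ _)
    have hxx : x = ![x 0, x 1] := by ext i; fin_cases i <;> rfl
    rw [map_zero, hxx]
    refine hb (x 0, x 1) ?_
    rw [← ball_prod_same]
    exact ⟨h0, h1⟩

theorem exists_evalPair_ne_zero {h : MvPolynomial (Fin 2) ℂ} (hh : h ≠ 0) {U : Set (ℂ × ℂ)}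
    (hU : IsOpen U) (hne : U.Nonempty) : ∃ p ∈ U, evalPair p h ≠ 0 := by
  by_contra! hc
  obtain ⟨p, hp⟩ := hne
  exact hh (eq_zero_of_evalPair_eventually (p := p) (by filter_upwards [hU.mem_nhds hp] with q hq using hc q hq))

theorem eq_of_evalPair_eq_on {h g : MvPolynomial (Fin 2) ℂ} {U : Set (ℂ × ℂ)} (hU : IsOpen U)
    (hne : U.Nonempty) (he : ∀ p ∈ U, evalPair p h = evalPair p g) : h = g := by
  by_contra hc
  obtain ⟨p, hp, hpp⟩ := exists_evalPair_ne_zero (sub_ne_zero.2 hc) hU hne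
  exact hpp (by rw [map_sub, he p hp, sub_self])

/-- An analytic function on a ball about a real point which vanishes at the real points of the
ball vanishes. -/
theorem eqOn_zero_of_real {f : ℂ × ℂ → ℂ} {ε : ℝ}
    (hf : AnalyticOnNhd ℂ f (Metric.ball 0 ε))
    (h : ∀ a b : ℝ, ((a : ℂ), (b : ℂ)) ∈ Metric.ball (0 : ℂ × ℂ) ε → f (a, b) = 0) :
    ∀ p ∈ Metric.ball (0 : ℂ × ℂ) ε, f p = 0 := by
  have hball : ∀ p : ℂ × ℂ, p ∈ Metric.ball (0 : ℂ × ℂ) ε ↔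
      p.1 ∈ Metric.ball (0 : ℂ) ε ∧ p.2 ∈ Metric.ball (0 : ℂ) ε := fun p => by
    rw [show (0 : ℂ × ℂ) = (0, 0) from rfl, ← ball_prod_same]; rfl
  -- The one-variable identity theorem, to be used in the first variable for real values of the
  -- second, and then in the second variable.
  have line : ∀ g : ℂ → ℂ, AnalyticOnNhd ℂ g (Metric.ball 0 ε) →
      (∀ a : ℝ, (a : ℂ) ∈ Metric.ball (0 : ℂ) ε → g a = 0) → ∀ z ∈ Metric.ball (0 : ℂ) ε, g z = 0 := by
    intro g hg h0 z hz
    have hε : 0 < ε := Metric.pos_of_mem_ball hz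
    refine hg.eqOn_zero_of_preconnected_of_frequently_eq_zero
      (convex_ball _ _).isPreconnected (Metric.mem_ball_self hε) ?_ hz
    -- Nonzero real zeros accumulating at the centre; the summand 2 keeps all of them strictly
    -- inside the ball.
    have ht : Tendsto (fun n : ℕ => (((ε / (n + 2) : ℝ)) : ℂ)) atTop (𝓝[≠] 0) := by
      refine tendsto_nhdsWithin_iff.2 ⟨?_, Eventually.of_forall fun n => ?_⟩
      · have h1 : Tendsto (fun n : ℕ => ε / ((n : ℝ) + 2)) atTop (𝓝 0) :=
          tendsto_const_nhds.div_atTop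
            (tendsto_atTop_add_const_right _ _ tendsto_natCast_atTop_atTop)
        have := (Complex.continuous_ofReal.tendsto 0).comp h1
        rwa [Complex.ofReal_zero] at this
      · have : ε / ((n : ℝ) + 2) ≠ 0 := by positivity
        simpa only [mem_compl_iff, mem_singleton_iff, Complex.ofReal_eq_zero] using this
    refine ht.frequently (Frequently.of_forall fun n => ?_)
    refine h0 _ ?_
    rw [mem_ball_zero_iff, Complex.norm_real, Real.norm_of_nonneg (by positivity)]
    exact div_lt_self hε (by have : (0 : ℝ) ≤ n := n.cast_nonneg; linarith)
  have hstep : ∀ b : ℝ, (b : ℂ) ∈ Metric.ball (0 : ℂ) ε → ∀ z ∈ Metric.ball (0 : ℂ) ε, f (z, b) = 0 := by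
    intro b hb
    refine line (fun z => f (z, b)) (fun z hz => ?_) (fun a ha => h a b ((hball _).2 ⟨ha, hb⟩))
    exact (hf (z, b) ((hball _).2 ⟨hz, hb⟩)).fun_comp (f := fun z : ℂ => (z, (b : ℂ))) (analyticAt_id.prod analyticAt_const)
  rintro ⟨p1, p2⟩ hp
  have hp' := (hball _).1 hp
  refine line (fun z => f (p1, z)) (fun z hz => ?_) (fun a ha => hstep a ha _ hp'.1) p2 hp'.2
  exact (hf (p1, z) ((hball _).2 ⟨hp'.1, hz⟩)).fun_comp (f := fun z : ℂ => (p1, z)) (analyticAt_const.prod analyticAt_id)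

/-! ### The transform of a bounded set -/

theorem IsSemialgebraic.measurableSet {S : Set (ℝ × ℝ)} (hS : IsSemialgebraic S) :
    MeasurableSet S := by
  obtain ⟨F, rfl⟩ := hS
  have hc : ∀ f : MvPolynomial (Fin 2) ℝ, Continuous fun z : ℝ × ℝ => MvPolynomial.eval ![z.1, z.2] f := by
    intro f
    refine (MvPolynomial.continuous_eval f).comp (continuous_pi fun i => ?_)
    fin_cases i
    · exact continuous_fst
    · exact continuous_snd
  have : {z : ℝ × ℝ | ∃ c ∈ F, (∀ f ∈ c.1, MvPolynomial.eval ![z.1, z.2] f = 0) ∧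
      ∀ g ∈ c.2, 0 < MvPolynomial.eval ![z.1, z.2] g} =
      ⋃ c ∈ F, ((⋂ f ∈ c.1, {z : ℝ × ℝ | MvPolynomial.eval ![z.1, z.2] f = 0}) ∩
        ⋂ g ∈ c.2, {z : ℝ × ℝ | 0 < MvPolynomial.eval ![z.1, z.2] g}) := by
    ext z; simp only [mem_ofPred_eq, mem_iUnion, mem_inter_iff, mem_iInter, exists_prop]
  rw [this]
  refine F.measurableSet_biUnion fun c _ => MeasurableSet.inter ?_ ?_
  · exact c.1.measurableSet_biInter fun f _ => (isClosed_eq (hc f) continuous_const).measurableSet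
  · exact c.2.measurableSet_biInter fun f _ => (isOpen_lt continuous_const (hc f)).measurableSet

theorem exists_pos_le_norm {S : Set (ℝ × ℝ)} (hb : Bornology.IsBounded S) {p : ℂ × ℂ}
    (hp : p ∈ fantappieDomain S) :
    ∃ ε > 0, ∀ z ∈ closure S, ε ≤ ‖1 - p.1 * (z.1 : ℂ) - p.2 * (z.2 : ℂ)‖ := by
  rcases (closure S).eq_empty_or_nonempty with h | h
  · exact ⟨1, one_pos, by simp [h]⟩
  have hK : IsCompact (closure S) := hb.isCompact_closure
  have hc : Continuous fun z : ℝ × ℝ => ‖1 - p.1 * (z.1 : ℂ) - p.2 * (z.2 : ℂ)‖ := by fun_prop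
  obtain ⟨z, hz, hm⟩ := hK.exists_isMinOn h hc.continuousOn
  exact ⟨_, norm_pos_iff.2 (hp z hz), fun w hw => hm hw⟩

theorem isOpen_fantappieDomain {S : Set (ℝ × ℝ)} (hb : Bornology.IsBounded S) :
    IsOpen (fantappieDomain S) := by
  rw [isOpen_iff_mem_nhds]
  intro p hp
  have hK : IsCompact (closure S) := hb.isCompact_closure
  have hcont : Continuous fun q : (ℂ × ℂ) × (ℝ × ℝ) =>
    1 - q.1.1 * (q.2.1 : ℂ) - q.1.2 * (q.2.2 : ℂ) := by fun_prop
  have := hK.eventually_forall_of_forall_eventually (x₀ := p)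
    (P := fun (p : ℂ × ℂ) (z : ℝ × ℝ) => 1 - p.1 * (z.1 : ℂ) - p.2 * (z.2 : ℂ) ≠ 0)
    (fun z hz => hcont.continuousAt.eventually_ne (x := (p, z)) (hp z hz))
  exact this

theorem zero_mem_fantappieDomain (S : Set (ℝ × ℝ)) : (0 : ℂ × ℂ) ∈ fantappieDomain S := by
  intro z _; simp

theorem analyticOnNhd_fantappie {S : Set (ℝ × ℝ)} (hS : MeasurableSet S)
    (hb : Bornology.IsBounded S) :
    AnalyticOnNhd ℂ (fantappie S) (fantappieDomain S) := by
  intro p hp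
  obtain ⟨C, hC⟩ := hb.exists_norm_le
  have hd : ParametricData (volume : Measure (ℝ × ℝ)) S (fun _ => 1) (fun z => (z.1 : ℂ))
      (fun z => (z.2 : ℂ)) (fun _ => 1) (fun _ => 1) :=
    { measurableSet := hS
      weight := integrableOn_const hb.measure_lt_top.ne
      contX := by fun_prop
      contY := by fun_prop
      contZ := by fun_prop
      contW := by fun_prop
      bdd := ⟨max C 1, fun z hz => by
        have := hC z hz
        refine ⟨?_, ?_, by simp, by simp⟩
        · rw [Complex.norm_real]; exact ((norm_fst_le z).trans this).trans (le_max_left _ _)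
        · rw [Complex.norm_real]; exact ((norm_snd_le z).trans this).trans (le_max_left _ _)⟩ }
  obtain ⟨ε, hε, h⟩ := exists_pos_le_norm hb hp
  have := hd.analyticAt 3 p ⟨ε, hε, fun z hz => h z (subset_closure hz)⟩
  simp only [one_mul] at this
  exact analyticAt_const.mul this

end Polypol

namespace Polypol

open MeasureTheory Filter Topology Set

/-! ### The Green formula near a regular boundary point -/

/-- The determinant of two vectors of the plane. -/
def cross (a b : ℝ × ℝ) : ℝ := a.1 * b.2 - a.2 * b.1

/-- The partial derivative in the direction of the first coordinate. -/
noncomputable def dX (f : ℝ × ℝ → ℂ) (z : ℝ × ℝ) : ℂ := fderiv ℝ f z (1, 0)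

/-- The partial derivative in the direction of the second coordinate. -/
noncomputable def dY (f : ℝ × ℝ → ℂ) (z : ℝ × ℝ) : ℂ := fderiv ℝ f z (0, 1)

theorem det_prod {𝕜 : Type*} [NontriviallyNormedField 𝕜] (A : 𝕜 × 𝕜 →L[𝕜] 𝕜 × 𝕜) :
    A.det = (A (1, 0)).1 * (A (0, 1)).2 - (A (1, 0)).2 * (A (0, 1)).1 := by
  rw [ContinuousLinearMap.det, ← LinearMap.det_toMatrix (Module.Basis.finTwoProd 𝕜),
    Matrix.det_fin_two]
  simp [LinearMap.toMatrix_apply]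
  ring

theorem fderiv_apply_prod (f : ℝ × ℝ → ℂ) (z v : ℝ × ℝ) :
    fderiv ℝ f z v = v.1 * dX f z + v.2 * dY f z := by
  have : v = v.1 • ((1 : ℝ), (0 : ℝ)) + v.2 • ((0 : ℝ), (1 : ℝ)) := by ext <;> simp
  conv_lhs => rw [this, map_add, map_smul, map_smul]
  simp [dX, dY]

/-- The complement of the frontier is the disjoint union of the open sets `interior s` and `(closure
s)ᶜ`. -/
theorem subset_or_disjoint_of_isPreconnected {s t : Set (ℝ × ℝ)} (ht : IsPreconnected t)
    (h : ∀ z ∈ t, z ∉ frontier s) : t ⊆ s ∨ ∀ z ∈ t, z ∉ s := by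
  have := ht.subset_or_subset (u := interior s) (v := (closure s)ᶜ) isOpen_interior
    isClosed_closure.isOpen_compl
    (disjoint_left.2 fun z h1 h2 => h2 (subset_closure (interior_subset h1)))
    (fun z hz => by
      by_cases hc : z ∈ closure s
      · left; by_contra hi; exact h z hz ⟨hc, hi⟩
      · right; exact hc)
  exact this.imp (fun h => h.trans interior_subset) (fun h z hz hs => h hz (subset_closure hs))

/-- The Stokes formula on a box, for a function vanishing on two opposite sides. -/
theorem box_stokes {a b s₁ s₂ : ℝ} (hab : a ≤ b) (hs : s₁ ≤ s₂) {g g₁ g₂ : ℝ × ℝ → ℂ} {c : ℝ → ℝ} (k : ℝ)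
    (h₁ : ∀ q ∈ Icc a b ×ˢ Icc s₁ s₂, HasDerivAt (fun t => g (t, q.2)) (g₁ q) q.1)
    (h₂ : ∀ q ∈ Icc a b ×ˢ Icc s₁ s₂, HasDerivAt (fun t => g (q.1, t)) (g₂ q) q.2)
    (hg₁ : ContinuousOn g₁ (Icc a b ×ˢ Icc s₁ s₂)) (hg₂ : ContinuousOn g₂ (Icc a b ×ˢ Icc s₁ s₂))
    (hc : ContinuousOn c (Icc a b))
    (ha : ∀ s ∈ Icc s₁ s₂, g (a, s) = 0) (hb : ∀ s ∈ Icc s₁ s₂, g (b, s) = 0) :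
    ∫ q in Ioo a b ×ˢ Ioo s₁ s₂, (k * g₁ q + c q.1 * g₂ q) =
      ∫ t in Ioo a b, c t * (g (t, s₂) - g (t, s₁)) := by
  have hsub : Ioo a b ×ˢ Ioo s₁ s₂ ⊆ Icc a b ×ˢ Icc s₁ s₂ :=
    prod_mono Ioo_subset_Icc_self Ioo_subset_Icc_self
  have hK : IsCompact (Icc a b ×ˢ Icc s₁ s₂) := isCompact_Icc.prod isCompact_Icc
  have hc' : ContinuousOn (fun q : ℝ × ℝ => (c q.1 : ℂ)) (Icc a b ×ˢ Icc s₁ s₂) :=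
    Complex.continuous_ofReal.comp_continuousOn
      (hc.comp continuousOn_fst fun q hq => hq.1)
  have i1 : IntegrableOn (fun q => (k : ℂ) * g₁ q) (Ioo a b ×ˢ Ioo s₁ s₂) :=
    ((continuousOn_const.mul hg₁).integrableOn_compact hK).mono_set hsub
  have i2 : IntegrableOn (fun q => (c q.1 : ℂ) * g₂ q) (Ioo a b ×ˢ Ioo s₁ s₂) :=
    ((hc'.mul hg₂).integrableOn_compact hK).mono_set hsub
  rw [integral_add i1 i2]
  -- Integrating first in the first variable gives the difference of the values on the two sides
  -- where `g` vanishes; this is why the coefficient `k` has to be constant while `c` may depend on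
  -- the first variable.
  have e1 : ∫ q in Ioo a b ×ˢ Ioo s₁ s₂, (k : ℂ) * g₁ q = 0 := by
    rw [show (volume : Measure (ℝ × ℝ)) = volume.prod volume from rfl, ← setIntegral_prod_swap,
      setIntegral_prod]
    · refine setIntegral_eq_zero_of_forall_eq_zero fun s hs' => ?_
      have hs'' := Ioo_subset_Icc_self hs'
      simp only [Prod.swap_prod_mk]
      rw [integral_const_mul, ← integral_Ioc_eq_integral_Ioo, ← intervalIntegral.integral_of_le hab,
        intervalIntegral.integral_eq_sub_of_hasDerivAt (f := fun t => g (t, s))]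
      · rw [ha s hs'', hb s hs'']; simp
      · intro t ht
        rw [uIcc_of_le hab] at ht
        exact h₁ (t, s) ⟨ht, hs''⟩
      · refine ContinuousOn.intervalIntegrable ?_
        rw [uIcc_of_le hab]
        exact hg₁.comp (f := fun t => (t, s)) (by fun_prop) fun t ht => ⟨ht, hs''⟩
    · rw [IntegrableOn, ← Measure.prod_restrict]
      exact (integrable_swap_iff (f := fun q : ℝ × ℝ => (k : ℂ) * g₁ q)).2
        (by rw [Measure.prod_restrict]; exact i1)
  have e2 : ∫ q in Ioo a b ×ˢ Ioo s₁ s₂, (c q.1 : ℂ) * g₂ q =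
      ∫ t in Ioo a b, c t * (g (t, s₂) - g (t, s₁)) := by
    rw [show (volume : Measure (ℝ × ℝ)) = volume.prod volume from rfl, setIntegral_prod _ i2]
    refine setIntegral_congr_fun measurableSet_Ioo fun t ht => ?_
    have ht' := Ioo_subset_Icc_self ht
    simp only
    rw [integral_const_mul, ← integral_Ioc_eq_integral_Ioo, ← intervalIntegral.integral_of_le hs,
        intervalIntegral.integral_eq_sub_of_hasDerivAt (f := fun s => g (t, s))]
    · intro s hs'
      rw [uIcc_of_le hs] at hs'
      exact h₂ (t, s) ⟨ht', hs'⟩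
    · refine ContinuousOn.intervalIntegrable ?_
      rw [uIcc_of_le hs]
      exact hg₂.comp (f := fun s => (t, s)) (by fun_prop) fun s hs' => ⟨ht', hs'⟩
  rw [e1, e2, zero_add]

/-- Integrals over the part of a symmetric box on which a predicate holds that is constant on the two
halves of the box. -/
theorem integral_box_split {a b r : ℝ} {A : Set (ℝ × ℝ)} (hA : A ⊆ Ioo a b ×ˢ Ioo (-r) r)
    {α β : ℤ}
    (hα : (α = 1 ∧ Ioo a b ×ˢ Ioo 0 r ⊆ A) ∨ (α = 0 ∧ ∀ q ∈ Ioo a b ×ˢ Ioo 0 r, q ∉ A))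
    (hβ : (β = 1 ∧ Ioo a b ×ˢ Ioo (-r) 0 ⊆ A) ∨ (β = 0 ∧ ∀ q ∈ Ioo a b ×ˢ Ioo (-r) 0, q ∉ A))
    {h : ℝ × ℝ → ℂ} (hi : IntegrableOn h (Ioo a b ×ˢ Ioo (-r) r)) :
    ∫ q in A, h q = α * (∫ q in Ioo a b ×ˢ Ioo 0 r, h q) + β * ∫ q in Ioo a b ×ˢ Ioo (-r) 0, h q := by
  -- The middle line is a null set, so it does not matter which boundary points belong to the
  -- domain.
  have h0 : ∀ᵐ q : ℝ × ℝ, q.2 ≠ 0 := by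
    rw [ae_iff]
    have : {q : ℝ × ℝ | ¬q.2 ≠ 0} = univ ×ˢ {0} := by ext q; simp
    rw [this, Measure.volume_eq_prod, Measure.prod_prod]
    simp
  have key : ∀ B : Set (ℝ × ℝ), (∀ q : ℝ × ℝ, q.2 ≠ 0 → (q ∈ A ↔ q ∈ B)) →
      ∫ q in A, h q = ∫ q in B, h q := by
    intro B hB
    refine setIntegral_congr_set ?_
    filter_upwards [h0] with q hq
    exact propext (hB q hq)
  have hcase : ∀ q ∈ A, q.2 ≠ 0 → q ∈ Ioo a b ×ˢ Ioo 0 r ∨ q ∈ Ioo a b ×ˢ Ioo (-r) 0 := by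
    intro q hq hq0
    obtain ⟨h1, h2, h3⟩ := hA hq
    rcases lt_or_gt_of_ne hq0 with h | h
    · exact Or.inr ⟨h1, h2, h⟩
    · exact Or.inl ⟨h1, h, h3⟩
  rcases hα with ⟨rfl, hα⟩ | ⟨rfl, hα⟩ <;> rcases hβ with ⟨rfl, hβ⟩ | ⟨rfl, hβ⟩
  · rw [key (Ioo a b ×ˢ Ioo 0 r ∪ Ioo a b ×ˢ Ioo (-r) 0)
      (fun q hq => ⟨fun h => hcase q h hq, fun h => h.elim (fun h => hα h) (fun h => hβ h)⟩),
      setIntegral_union]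
    · simp
    · refine disjoint_left.2 fun q h1 h2 => ?_
      exact absurd h1.2.1 (not_lt.2 h2.2.2.le)
    · exact measurableSet_Ioo.prod measurableSet_Ioo
    · refine hi.mono_set (prod_mono subset_rfl fun s hs => ?_)
      exact ⟨by linarith [hs.1, hs.2], hs.2⟩
    · refine hi.mono_set (prod_mono subset_rfl fun s hs => ?_)
      exact ⟨hs.1, by linarith [hs.1, hs.2]⟩
  · rw [key (Ioo a b ×ˢ Ioo 0 r) (fun q hq => ⟨fun h => (hcase q h hq).resolve_right
      (fun h' => hβ q h' h), fun h => hα h⟩)]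
    simp
  · rw [key (Ioo a b ×ˢ Ioo (-r) 0) (fun q hq => ⟨fun h => (hcase q h hq).resolve_left
      (fun h' => hα q h' h), fun h => hβ h⟩)]
    simp
  · rw [key ∅ (fun q hq => ⟨fun h => (hcase q h hq).elim (fun h' => hα q h' h)
      (fun h' => hβ q h' h), fun h => h.elim⟩)]
    simp

/-- The Green formula for functions supported near a regular boundary point. -/
theorem local_green {P : Set (ℝ × ℝ)} (hP : MeasurableSet P) {γ γ' : ℝ → ℝ × ℝ} {I : Set ℝ}
    (hI : IsOpen I) (hγ : ∀ τ ∈ I, HasDerivAt γ (γ' τ) τ) (hγ' : ContinuousOn γ' I)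
    {τ₀ : ℝ} (hτ₀ : τ₀ ∈ I) {e : ℝ × ℝ} (he : 0 < cross (γ' τ₀) e)
    (hfr : ∀ N ∈ 𝓝 τ₀, ∀ᶠ z in 𝓝 (γ τ₀), z ∈ frontier P → ∃ τ ∈ N, γ τ = z)
    {W : Set (ℝ × ℝ)} (hW : W ∈ 𝓝 (γ τ₀)) {N : Set ℝ} (hN : N ∈ 𝓝 τ₀) :
    ∃ V, IsOpen V ∧ γ τ₀ ∈ V ∧ V ⊆ W ∧ ∃ r > 0, Icc (τ₀ - r) (τ₀ + r) ⊆ N ∩ I ∧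
      (∀ τ ∈ Ioo (τ₀ - r) (τ₀ + r), γ τ ∈ V) ∧
      ∃ m : ℤ, (m = -1 ∨ m = 0 ∨ m = 1) ∧
      (∀ᶠ s : ℝ in 𝓝[>] 0, (γ τ₀ + s • e ∈ P → γ τ₀ - s • e ∉ P → m = 1) ∧
        (γ τ₀ + s • e ∉ P → γ τ₀ - s • e ∈ P → m = -1)) ∧
      ∀ f : ℝ × ℝ → ℂ, ContDiff ℝ 1 f → tsupport f ⊆ V →
        ∫ z in P, dX f z = m * ∫ τ in Ioo (τ₀ - r) (τ₀ + r), (γ' τ).2 * f (γ τ) ∧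
        ∫ z in P, dY f z = -(m * ∫ τ in Ioo (τ₀ - r) (τ₀ + r), (γ' τ).1 * f (γ τ)) := by
  -- Translating the arc in the transversal direction `e` gives coordinates in which the arc is the
  -- line where the second coordinate vanishes; the Jacobian is `cross (γ' q.1) e`.
  set Ψ : ℝ × ℝ → ℝ × ℝ := fun q => γ q.1 + q.2 • e with hΨ
  set Ψ' : ℝ × ℝ → ℝ × ℝ →L[ℝ] ℝ × ℝ := fun q =>
    (ContinuousLinearMap.fst ℝ ℝ ℝ).smulRight (γ' q.1) +
      (ContinuousLinearMap.snd ℝ ℝ ℝ).smulRight e with hΨ'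
  have hIn : I ∈ 𝓝 τ₀ := hI.mem_nhds hτ₀
  have hdet : ∀ q, (Ψ' q).det = cross (γ' q.1) e := fun q => by
    rw [det_prod]; simp [hΨ', cross]
  have hder : ∀ q : ℝ × ℝ, q.1 ∈ I → HasFDerivAt Ψ (Ψ' q) q := by
    intro q hq
    have h1 : HasFDerivAt (fun q : ℝ × ℝ => γ q.1)
        ((ContinuousLinearMap.fst ℝ ℝ ℝ).smulRight (γ' q.1)) q := by
      have := (hγ q.1 hq).hasFDerivAt.comp q (ContinuousLinearMap.fst ℝ ℝ ℝ).hasFDerivAt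
      exact this.congr_fderiv (by ext <;> simp)
    exact h1.add ((ContinuousLinearMap.snd ℝ ℝ ℝ).smulRight e).hasFDerivAt
  have hstrict : HasStrictFDerivAt Ψ (Ψ' (τ₀, 0)) (τ₀, 0) := by
    have h0 : HasStrictDerivAt γ (γ' τ₀) τ₀ :=
      hasStrictDerivAt_of_hasDerivAt_of_continuousAt
        (by filter_upwards [hIn] with τ hτ using hγ τ hτ) (hγ'.continuousAt hIn)
    have h1 : HasStrictFDerivAt (fun q : ℝ × ℝ => γ q.1)
        ((ContinuousLinearMap.fst ℝ ℝ ℝ).smulRight (γ' τ₀)) (τ₀, 0) := by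
      have := HasStrictFDerivAt.comp (τ₀, (0 : ℝ)) (g := γ) (f := fun q : ℝ × ℝ => q.1)
        h0.hasStrictFDerivAt (ContinuousLinearMap.fst ℝ ℝ ℝ).hasStrictFDerivAt
      exact this.congr_fderiv (by ext <;> simp)
    exact h1.add ((ContinuousLinearMap.snd ℝ ℝ ℝ).smulRight e).hasStrictFDerivAt
  have hne : (Ψ' (τ₀, 0)).det ≠ 0 := by rw [hdet]; exact he.ne'
  set L := (Ψ' (τ₀, 0)).toContinuousLinearEquivOfDetNeZero hne with hL
  have hstrict' : HasStrictFDerivAt Ψ (L : ℝ × ℝ →L[ℝ] ℝ × ℝ) (τ₀, 0) := by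
    rw [hL, ContinuousLinearMap.coe_toContinuousLinearEquivOfDetNeZero]; exact hstrict
  set Φ := hstrict'.toOpenPartialHomeomorph Ψ with hΦ
  have hΦc : (Φ : ℝ × ℝ → ℝ × ℝ) = Ψ := hstrict'.toOpenPartialHomeomorph_coe
  have hsrc : Φ.source ∈ 𝓝 (τ₀, (0 : ℝ)) :=
    Φ.open_source.mem_nhds hstrict'.mem_toOpenPartialHomeomorph_source
  have hinj : InjOn Ψ Φ.source := hΦc ▸ Φ.injOn
  have hΨ0 : ∀ τ, Ψ (τ, 0) = γ τ := fun τ => by simp [hΨ]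
  have hcont0 : ContinuousAt Ψ (τ₀, 0) := (hder (τ₀, 0) hτ₀).continuousAt
  have hN' : {τ : ℝ | (τ, (0 : ℝ)) ∈ Φ.source} ∈ 𝓝 τ₀ :=
    (Continuous.prodMk continuous_id continuous_const).continuousAt.preimage_mem_nhds hsrc
  have hev : ∀ᶠ q : ℝ × ℝ in 𝓝 (τ₀, 0), q ∈ Φ.source ∧ q.1 ∈ N ∩ I ∧ 0 < cross (γ' q.1) e ∧ Ψ q ∈ W ∧
      (Ψ q ∈ frontier P → ∃ τ ∈ {τ : ℝ | (τ, (0 : ℝ)) ∈ Φ.source}, γ τ = Ψ q) := by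
    refine Filter.Eventually.and hsrc (Filter.Eventually.and ?_ (Filter.Eventually.and ?_
      (Filter.Eventually.and ?_ ?_)))
    · exact continuous_fst.continuousAt.eventually (inter_mem hN hIn)
    · have hc : ContinuousAt (fun q : ℝ × ℝ => cross (γ' q.1) e) (τ₀, 0) := by
        have h1 : ContinuousAt (fun q : ℝ × ℝ => γ' q.1) (τ₀, 0) :=
          ContinuousAt.comp (f := fun q : ℝ × ℝ => q.1) (hγ'.continuousAt hIn)
            continuous_fst.continuousAt
        exact (h1.fst.mul continuousAt_const).sub (h1.snd.mul continuousAt_const)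
      exact hc.eventually (lt_mem_nhds he)
    · have : W ∈ 𝓝 (Ψ (τ₀, 0)) := by rwa [hΨ0]
      exact hcont0.eventually this
    · have h1 := hfr _ hN'
      rw [← hΨ0] at h1
      exact hcont0.eventually h1
  obtain ⟨r, hr, hbox⟩ := Metric.nhds_basis_closedBall.eventually_iff.1 hev
  rw [← closedBall_prod_same, Real.closedBall_eq_Icc, Real.closedBall_eq_Icc, zero_sub, zero_add] at hbox
  set R := Ioo (τ₀ - r) (τ₀ + r) ×ˢ Ioo (-r) r with hR
  have hRsub : R ⊆ Icc (τ₀ - r) (τ₀ + r) ×ˢ Icc (-r) r :=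
    prod_mono Ioo_subset_Icc_self Ioo_subset_Icc_self
  have hRsrc : R ⊆ Φ.source := fun q hq => (hbox (hRsub hq)).1
  have hRo : IsOpen R := isOpen_Ioo.prod isOpen_Ioo
  have hΨc : ContinuousOn Ψ (Icc (τ₀ - r) (τ₀ + r) ×ˢ Icc (-r) r) := fun q hq =>
    (hder q (hbox hq).2.1.2).continuousAt.continuousWithinAt
  -- A frontier point in the image of the box lies on the arc, at a parameter within the domain of
  -- injectivity of `Ψ`; injectivity then places it on the middle line.
  have hfron : ∀ q ∈ Icc (τ₀ - r) (τ₀ + r) ×ˢ Icc (-r) r, q.2 ≠ 0 → Ψ q ∉ frontier P := by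
    intro q hq hq2 hf
    obtain ⟨h1, -, -, -, h5⟩ := hbox hq
    obtain ⟨τ, hτ, hτ2⟩ := h5 hf
    rw [← hΨ0] at hτ2
    have := hinj hτ h1 hτ2
    rw [← this] at hq2
    exact hq2 rfl
  -- Each open half of the box is connected and avoids the frontier, so it is entirely inside or
  -- outside the domain. The indicators `α` of the left half and `β` of the right half give the
  -- multiplicity `α - β`, which is 0 if the domain lies on both sides of the arc or on neither.
  have hside : ∀ s₁ s₂ : ℝ, Ioo s₁ s₂ ⊆ Ioo (-r) r → (0 : ℝ) ∉ Ioo s₁ s₂ →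
      ∃ α : ℤ, (α = 1 ∧ ∀ q ∈ Ioo (τ₀ - r) (τ₀ + r) ×ˢ Ioo s₁ s₂, Ψ q ∈ P) ∨
        (α = 0 ∧ ∀ q ∈ Ioo (τ₀ - r) (τ₀ + r) ×ˢ Ioo s₁ s₂, Ψ q ∉ P) := by
    intro s₁ s₂ hs h0
    have hsub : Ioo (τ₀ - r) (τ₀ + r) ×ˢ Ioo s₁ s₂ ⊆ Icc (τ₀ - r) (τ₀ + r) ×ˢ Icc (-r) r :=
      prod_mono Ioo_subset_Icc_self (hs.trans Ioo_subset_Icc_self)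
    have hpre : IsPreconnected (Ψ '' (Ioo (τ₀ - r) (τ₀ + r) ×ˢ Ioo s₁ s₂)) :=
      (isPreconnected_Ioo.prod isPreconnected_Ioo).image _ (hΨc.mono hsub)
    rcases subset_or_disjoint_of_isPreconnected (s := P) hpre (by
      rintro _ ⟨q, hq, rfl⟩
      refine hfron q (hsub hq) ?_
      rintro h
      exact h0 (h ▸ hq.2)) with h | h
    · exact ⟨1, Or.inl ⟨rfl, fun q hq => h ⟨q, hq, rfl⟩⟩⟩
    · exact ⟨0, Or.inr ⟨rfl, fun q hq => h _ ⟨q, hq, rfl⟩⟩⟩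
  obtain ⟨α, hα⟩ := hside 0 r (fun s hs => ⟨by linarith [hs.1, hs.2], hs.2⟩) (by simp)
  obtain ⟨β, hβ⟩ := hside (-r) 0 (fun s hs => ⟨hs.1, by linarith [hs.1, hs.2]⟩) (by simp)
  have hVo : IsOpen (Ψ '' R) := by
    rw [← hΦc]; exact Φ.isOpen_image_of_subset_source hRo hRsrc
  have hτmem : ∀ s ∈ Ioo (-r) r, (τ₀, s) ∈ R := fun s hs => ⟨⟨by linarith, by linarith⟩, hs⟩
  refine ⟨Ψ '' R, hVo, ⟨(τ₀, 0), hτmem 0 ⟨by linarith, hr⟩, hΨ0 _⟩, ?_, r, hr, ?_, ?_, α - β, ?_, ?_, ?_⟩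
  · rintro _ ⟨q, hq, rfl⟩
    exact (hbox (hRsub hq)).2.2.2.1
  · intro τ hτ
    exact (hbox (x := (τ, 0)) ⟨hτ, by constructor <;> simp [hr.le]⟩).2.1
  · intro τ hτ
    exact ⟨(τ, 0), ⟨hτ, by simp [hr]⟩, hΨ0 _⟩
  · rcases hα with ⟨rfl, -⟩ | ⟨rfl, -⟩ <;> rcases hβ with ⟨rfl, -⟩ | ⟨rfl, -⟩ <;> simp
  · filter_upwards [Ioo_mem_nhdsGT hr] with s hs
    have m1 : ((τ₀, s) : ℝ × ℝ) ∈ Ioo (τ₀ - r) (τ₀ + r) ×ˢ Ioo 0 r := ⟨⟨by linarith, by linarith⟩, hs⟩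
    have m2 : ((τ₀, -s) : ℝ × ℝ) ∈ Ioo (τ₀ - r) (τ₀ + r) ×ˢ Ioo (-r) 0 :=
      ⟨⟨by linarith, by linarith⟩, by linarith [hs.2], by linarith [hs.1]⟩
    have e2 : Ψ (τ₀, -s) = γ τ₀ - s • e := by simp [hΨ, sub_eq_add_neg]
    constructor <;> intro h1 h2
    · rcases hα with ⟨rfl, hα⟩ | ⟨rfl, hα⟩
      · rcases hβ with ⟨rfl, hβ⟩ | ⟨rfl, hβ⟩
        · exact absurd (e2 ▸ hβ _ m2) h2
        · rfl
      · exact absurd h1 (hα _ m1)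
    · rcases hα with ⟨rfl, hα⟩ | ⟨rfl, hα⟩
      · exact absurd (hα _ m1) h1
      · rcases hβ with ⟨rfl, hβ⟩ | ⟨rfl, hβ⟩
        · rfl
        · exact absurd h2 (e2 ▸ hβ _ m2)
  intro f hf hsupp
  set A := R ∩ Ψ ⁻¹' P with hA
  have hAm : MeasurableSet A := by
    have h1 : Continuous (R.domRestrict Ψ) :=
      continuousOn_iff_continuous_domRestrict.1 (hΨc.mono hRsub)
    have := hRo.measurableSet.subtype_image (h1.measurable hP)
    convert! this using 1
    ext q
    simp [hA, and_comm]
  have himg : Ψ '' A = P ∩ Ψ '' R := by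
    ext z; constructor
    · rintro ⟨q, ⟨h1, h2⟩, rfl⟩; exact ⟨h2, q, h1, rfl⟩
    · rintro ⟨h1, q, hq, rfl⟩; exact ⟨q, ⟨hq, h1⟩, rfl⟩
  have hfd : Differentiable ℝ f := hf.differentiable one_ne_zero
  have hf' : Continuous (fderiv ℝ f) := hf.continuous_fderiv one_ne_zero
  have hdXc : Continuous (dX f) := hf'.clm_apply continuous_const
  have hdYc : Continuous (dY f) := hf'.clm_apply continuous_const
  set g₁ : ℝ × ℝ → ℂ := fun q => fderiv ℝ f (Ψ q) (γ' q.1) with hg₁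
  set g₂ : ℝ × ℝ → ℂ := fun q => fderiv ℝ f (Ψ q) e with hg₂
  have hγc : ContinuousOn (fun q : ℝ × ℝ => γ' q.1) (Icc (τ₀ - r) (τ₀ + r) ×ˢ Icc (-r) r) :=
    hγ'.comp continuousOn_fst fun q hq => (hbox hq).2.1.2
  have hg₁c : ContinuousOn g₁ (Icc (τ₀ - r) (τ₀ + r) ×ˢ Icc (-r) r) :=
    (hf'.comp_continuousOn hΨc).clm_apply hγc
  have hg₂c : ContinuousOn g₂ (Icc (τ₀ - r) (τ₀ + r) ×ˢ Icc (-r) r) :=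
    (hf'.comp_continuousOn hΨc).clm_apply continuousOn_const
  have hzero : ∀ q ∈ Icc (τ₀ - r) (τ₀ + r) ×ˢ Icc (-r) r, q ∉ R → f (Ψ q) = 0 := by
    intro q hq hqR
    refine image_eq_zero_of_notMem_tsupport fun h => hqR ?_
    obtain ⟨q', hq', he⟩ := hsupp h
    rwa [← hinj (hRsrc hq') (hbox hq).1 he]
  have hd₁ : ∀ q ∈ Icc (τ₀ - r) (τ₀ + r) ×ˢ Icc (-r) r,
      HasDerivAt (fun t => f (Ψ (t, q.2))) (g₁ q) q.1 := by
    intro q hq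
    have h1 : HasDerivAt (fun t => Ψ (t, q.2)) (γ' q.1) q.1 :=
      (hγ q.1 (hbox hq).2.1.2).add_const (q.2 • e)
    exact (hfd (Ψ q)).hasFDerivAt.comp_hasDerivAt q.1 h1
  have hd₂ : ∀ q ∈ Icc (τ₀ - r) (τ₀ + r) ×ˢ Icc (-r) r,
      HasDerivAt (fun t => f (Ψ (q.1, t))) (g₂ q) q.2 := by
    intro q hq
    have h1 : HasDerivAt (fun t : ℝ => Ψ (q.1, t)) e q.2 := by
      have h2 := ((hasDerivAt_id q.2).smul_const e).const_add (γ q.1)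
      rw [one_smul] at h2
      exact h2
    exact (hfd (Ψ q)).hasFDerivAt.comp_hasDerivAt q.2 h1
  have hγI : Icc (τ₀ - r) (τ₀ + r) ⊆ I := fun τ hτ =>
    (hbox (x := (τ, 0)) ⟨hτ, by constructor <;> simp [hr.le]⟩).2.1.2
  -- By Cramer's rule, the Jacobian times either partial derivative of `f` is a combination of the
  -- derivatives `g₁`, `g₂` along the box coordinates, with the coefficient of `g₁` constant. This
  -- is the form which `box_stokes` accepts.
  have main : ∀ (D : ℝ × ℝ → ℂ) (k : ℝ) (c : ℝ → ℝ), ContinuousOn c (Icc (τ₀ - r) (τ₀ + r)) →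
      Continuous D → (∀ z, z ∉ Ψ '' R → D z = 0) →
      (∀ q, cross (γ' q.1) e * D (Ψ q) = k * g₁ q + c q.1 * g₂ q) →
      ∫ z in P, D z = -(((α - β : ℤ) : ℂ) * ∫ τ in Ioo (τ₀ - r) (τ₀ + r), c τ * f (γ τ)) := by
    intro D k c hc hD hD0 hDe
    have s1 : ∫ z in P, D z = ∫ z in P ∩ Ψ '' R, D z :=
      (setIntegral_eq_of_subset_of_forall_sdiff_eq_zero hP inter_subset_left
        (fun z hz => hD0 z fun h => hz.2 ⟨hz.1, h⟩))
    have s2 : ∫ z in P ∩ Ψ '' R, D z = ∫ q in A, (k * g₁ q + c q.1 * g₂ q) := by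
      rw [← himg, integral_image_eq_integral_abs_det_fderiv_smul volume hAm (f' := Ψ')
        (fun q hq => (hder q (hbox (hRsub hq.1)).2.1.2).hasFDerivWithinAt)
        (hinj.mono fun q hq => hRsrc hq.1)]
      refine setIntegral_congr_fun hAm fun q hq => ?_
      rw [hdet, abs_of_pos (hbox (hRsub hq.1)).2.2.1, ← hDe q, Complex.real_smul]
    have hK : IsCompact (Icc (τ₀ - r) (τ₀ + r) ×ˢ Icc (-r) r) := isCompact_Icc.prod isCompact_Icc
    have hcc : ContinuousOn (fun q : ℝ × ℝ => (c q.1 : ℂ)) (Icc (τ₀ - r) (τ₀ + r) ×ˢ Icc (-r) r) :=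
      Complex.continuous_ofReal.comp_continuousOn (hc.comp continuousOn_fst fun q hq => hq.1)
    have hint : IntegrableOn (fun q : ℝ × ℝ => k * g₁ q + c q.1 * g₂ q)
        (Ioo (τ₀ - r) (τ₀ + r) ×ˢ Ioo (-r) r) :=
      (((continuousOn_const.mul hg₁c).add (hcc.mul hg₂c)).integrableOn_compact hK).mono_set hRsub
    have s3 := integral_box_split (A := A) (a := τ₀ - r) (b := τ₀ + r) (r := r) inter_subset_left
      (α := α) (β := β)
      (hα.imp (fun h => ⟨h.1, fun q hq => ⟨⟨hq.1, by linarith [hq.2.1], hq.2.2⟩, h.2 q hq⟩⟩)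
        (fun h => ⟨h.1, fun q hq hqA => h.2 q hq hqA.2⟩))
      (hβ.imp (fun h => ⟨h.1, fun q hq => ⟨⟨hq.1, hq.2.1, by linarith [hq.2.2]⟩, h.2 q hq⟩⟩)
        (fun h => ⟨h.1, fun q hq hqA => h.2 q hq hqA.2⟩)) hint
    have hsubp : Icc (τ₀ - r) (τ₀ + r) ×ˢ Icc 0 r ⊆ Icc (τ₀ - r) (τ₀ + r) ×ˢ Icc (-r) r :=
      prod_mono subset_rfl (Icc_subset_Icc_left (by linarith))
    have hsubm : Icc (τ₀ - r) (τ₀ + r) ×ˢ Icc (-r) 0 ⊆ Icc (τ₀ - r) (τ₀ + r) ×ˢ Icc (-r) r :=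
      prod_mono subset_rfl (Icc_subset_Icc_right (by linarith))
    have hrr : τ₀ - r ≤ τ₀ + r := by linarith
    have za : ∀ s ∈ Icc (-r) r, f (Ψ (τ₀ - r, s)) = 0 := fun s hs =>
      hzero _ ⟨left_mem_Icc.2 hrr, hs⟩ (fun h => lt_irrefl _ h.1.1)
    have zb : ∀ s ∈ Icc (-r) r, f (Ψ (τ₀ + r, s)) = 0 := fun s hs =>
      hzero _ ⟨right_mem_Icc.2 hrr, hs⟩ (fun h => lt_irrefl _ h.1.2)
    have t1 := box_stokes (g := fun q => f (Ψ q)) hrr hr.le k (fun q hq => hd₁ q (hsubp hq))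
      (fun q hq => hd₂ q (hsubp hq)) (hg₁c.mono hsubp) (hg₂c.mono hsubp) hc
      (fun s hs => za s ⟨by linarith [hs.1], hs.2⟩) (fun s hs => zb s ⟨by linarith [hs.1], hs.2⟩)
    have t2 := box_stokes (g := fun q => f (Ψ q)) hrr (neg_nonpos.2 hr.le) k
      (fun q hq => hd₁ q (hsubm hq))
      (fun q hq => hd₂ q (hsubm hq)) (hg₁c.mono hsubm) (hg₂c.mono hsubm) hc
      (fun s hs => za s ⟨hs.1, by linarith [hs.2]⟩) (fun s hs => zb s ⟨hs.1, by linarith [hs.2]⟩)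
    rw [s1, s2, s3, t1, t2]
    -- `f` vanishes on the outer sides of the box, so the two halves contribute only along the arc,
    -- with opposite signs.
    have u1 : ∫ t in Ioo (τ₀ - r) (τ₀ + r), (c t : ℂ) * (f (Ψ (t, r)) - f (Ψ (t, 0))) =
        -∫ t in Ioo (τ₀ - r) (τ₀ + r), (c t : ℂ) * f (γ t) := by
      rw [← integral_neg]
      refine setIntegral_congr_fun measurableSet_Ioo fun t ht => ?_
      rw [hzero (t, r) ⟨Ioo_subset_Icc_self ht, by constructor <;> simp [hr.le]⟩
        (fun h => lt_irrefl _ h.2.2), hΨ0]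
      ring
    have u2 : ∫ t in Ioo (τ₀ - r) (τ₀ + r), (c t : ℂ) * (f (Ψ (t, 0)) - f (Ψ (t, -r))) =
        ∫ t in Ioo (τ₀ - r) (τ₀ + r), (c t : ℂ) * f (γ t) := by
      refine setIntegral_congr_fun measurableSet_Ioo fun t ht => ?_
      rw [hzero (t, -r) ⟨Ioo_subset_Icc_self ht, by constructor <;> simp [hr.le]⟩
        (fun h => lt_irrefl _ h.2.1), hΨ0]
      ring
    rw [u1, u2]
    push_cast
    ring
  have hfd0 : ∀ z, z ∉ Ψ '' R → fderiv ℝ f z = 0 := fun z hz =>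
    image_eq_zero_of_notMem_tsupport fun h => hz (hsupp (tsupport_fderiv_subset ℝ h))
  constructor
  · rw [main (dX f) e.2 (fun τ => -(γ' τ).2) ((continuous_snd.comp_continuousOn (hγ'.mono hγI)).neg)
      hdXc (fun z hz => by rw [dX, hfd0 z hz]; rfl) (fun q => by
        simp only [hg₁, hg₂, fderiv_apply_prod, cross]; push_cast; ring)]
    rw [← mul_neg, ← integral_neg]
    congr 2; ext τ; push_cast; ring
  · rw [main (dY f) (-e.1) (fun τ => (γ' τ).1) (continuous_fst.comp_continuousOn (hγ'.mono hγI))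
      hdYc (fun z hz => by rw [dY, hfd0 z hz]; rfl) (fun q => by
        simp only [hg₁, hg₂, fderiv_apply_prod, cross]; push_cast; ring)]

end Polypol

namespace Polypol

open MeasureTheory Filter Topology Set

/-! ### The Green formula for domains bounded by finitely many arcs -/

/-- A plane domain whose frontier is a finite union of closed sets `S j`, each of which is up to
finitely many points a simple arc `γ j`, parametrized by the open interval `I j`, with derivative
`γ' j`. -/
structure GreenData (P : Set (ℝ × ℝ)) {n : ℕ} (γ γ' : Fin n → ℝ → ℝ × ℝ) (I : Fin n → Set ℝ)
    (S : Fin n → Set (ℝ × ℝ)) (E : Set (ℝ × ℝ)) : Prop where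
  measurableSet : MeasurableSet P
  frontier_eq : frontier P = ⋃ j, S j
  isClosed : ∀ j, IsClosed (S j)
  isOpen : ∀ j, IsOpen (I j)
  isPreconnected : ∀ j, IsPreconnected (I j)
  hasDerivAt : ∀ j, ∀ τ ∈ I j, HasDerivAt (γ j) (γ' j τ) τ
  continuousOn : ∀ j, ContinuousOn (γ' j) (I j)
  integrableOn : ∀ j, IntegrableOn (γ' j) (I j)
  mapsTo : ∀ j, ∀ τ ∈ I j, γ j τ ∈ S j
  covers : ∀ j, S j ⊆ γ j '' I j ∪ E
  finite : E.Finite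
  injOn : ∀ j, InjOn (γ j) (I j)
  disjoint : ∀ i j, i ≠ j → ∀ τ ∈ I i, γ i τ ∉ S j
  proper : ∀ j, ∀ τ ∈ I j, ∀ N ∈ 𝓝 τ, ∀ᶠ z in 𝓝 (γ j τ), z ∈ S j → ∃ τ' ∈ N ∩ I j, γ j τ' = z
  crit : ∀ j, {τ ∈ I j | γ' j τ = 0}.Finite

/-- The boundary side of the Green formula, with multiplicities `m`. -/
noncomputable def boundaryIntegral {n : ℕ} (γ γ' : Fin n → ℝ → ℝ × ℝ) (I : Fin n → Set ℝ)
    (m : Fin n → ℝ → ℤ) (v : ℝ × ℝ) (f : ℝ × ℝ → ℂ) : ℂ :=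
  ∑ j, ∫ τ in I j, (m j τ : ℂ) * ((cross v (γ' j τ) : ℝ) : ℂ) * f (γ j τ)

/-- A continuously differentiable function with compact support. -/
structure IsTest (f : ℝ × ℝ → ℂ) : Prop where
  contDiff : ContDiff ℝ 1 f
  compact : HasCompactSupport f

theorem IsTest.continuous {f : ℝ × ℝ → ℂ} (hf : IsTest f) : Continuous f := hf.contDiff.continuous

theorem IsTest.differentiable {f : ℝ × ℝ → ℂ} (hf : IsTest f) : Differentiable ℝ f :=
  hf.contDiff.differentiable one_ne_zero

theorem IsTest.continuous_fderiv {f : ℝ × ℝ → ℂ} (hf : IsTest f) (v : ℝ × ℝ) :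
    Continuous fun z => fderiv ℝ f z v :=
  (hf.contDiff.continuous_fderiv one_ne_zero).clm_apply continuous_const

theorem IsTest.integrable_fderiv {f : ℝ × ℝ → ℂ} (hf : IsTest f) (v : ℝ × ℝ) :
    Integrable fun z => fderiv ℝ f z v :=
  (hf.continuous_fderiv v).integrable_of_hasCompactSupport (hf.compact.fderiv_apply ℝ v)

theorem IsTest.exists_bound {f : ℝ × ℝ → ℂ} (hf : IsTest f) : ∃ C, ∀ z, ‖f z‖ ≤ C :=
  hf.compact.exists_bound_of_continuous hf.continuous

theorem IsTest.mul_left {f g : ℝ × ℝ → ℂ} (hf : IsTest f) (hg : ContDiff ℝ 1 g) :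
    IsTest (fun z => g z * f z) :=
  ⟨hg.mul hf.contDiff, hf.compact.mul_left⟩

theorem contDiff_ofReal_comp {φ : ℝ × ℝ → ℝ} {k : ℕ∞} (h : ContDiff ℝ k φ) :
    ContDiff ℝ k (fun z => (φ z : ℂ)) := Complex.ofRealCLM.contDiff.comp h

/-- Two derivatives are provided because exact forms are treated by applying the Green formula to
first derivatives of `φ`. -/
theorem exists_test {z₀ : ℝ × ℝ} {W : Set (ℝ × ℝ)} (hW : W ∈ 𝓝 z₀) :
    ∃ φ : ℝ × ℝ → ℝ, ContDiff ℝ 2 φ ∧ HasCompactSupport φ ∧ IsTest (fun z => (φ z : ℂ)) ∧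
      tsupport φ ⊆ W ∧ tsupport (fun z => (φ z : ℂ)) ⊆ W ∧ (∀ z, 0 ≤ φ z) ∧ φ z₀ = 1 := by
  obtain ⟨φ, h1, h2, h3, h4, h5⟩ := exists_contDiff_tsupport_subset (n := 2) hW
  have hs : Function.support (fun z => (φ z : ℂ)) = Function.support φ := by
    ext z; simp
  have hts : tsupport (fun z => (φ z : ℂ)) = tsupport φ := by rw [tsupport, tsupport, hs]
  refine ⟨φ, h3, h2, ⟨contDiff_ofReal_comp (k := 1) (h3.of_le (by norm_num)), ?_⟩, h1,
    hts ▸ h1, fun z => (h4 ⟨z, rfl⟩).1, h5⟩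
  rw [HasCompactSupport, hts]; exact h2

/-- The integral of a directional derivative of a test function vanishes. -/
theorem IsTest.integral_fderiv {f : ℝ × ℝ → ℂ} (hf : IsTest f) (v : ℝ × ℝ) :
    ∫ z, fderiv ℝ f z v = 0 := by
  obtain ⟨R, hR, hsub⟩ : ∃ R > 0, tsupport f ⊆ Metric.ball 0 R := by
    obtain ⟨R, hR⟩ := hf.compact.isBounded.subset_ball 0
    exact ⟨max R 1, by positivity, hR.trans (Metric.ball_subset_ball (le_max_left _ _))⟩
  have hball : Metric.ball (0 : ℝ × ℝ) R = Ioo (-R) R ×ˢ Ioo (-R) R := by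
    rw [show (0 : ℝ × ℝ) = (0, 0) from rfl, ← ball_prod_same, Real.ball_eq_Ioo]; simp
  have hz : ∀ z ∉ Ioo (-R) R ×ˢ Ioo (-R) R, f z = 0 := fun z hz =>
    image_eq_zero_of_notMem_tsupport fun h => hz (hball ▸ hsub h)
  have h0 : ∀ z ∉ Ioo (-R) R ×ˢ Ioo (-R) R, fderiv ℝ f z v = 0 := fun z hz => by
    have : fderiv ℝ f z = 0 := image_eq_zero_of_notMem_tsupport fun h =>
      hz (hball ▸ hsub (tsupport_fderiv_subset ℝ h))
    rw [this]; rfl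
  rw [← setIntegral_eq_integral_of_forall_compl_eq_zero h0]
  have h1 : ∀ q ∈ Icc (-R) R ×ˢ Icc (-R) R,
      HasDerivAt (fun t => f (t, q.2)) (dX f q) q.1 := by
    intro q _
    have h1 : HasDerivAt (fun t : ℝ => (t, q.2)) ((1 : ℝ), (0 : ℝ)) q.1 :=
      (hasDerivAt_id q.1).prodMk (hasDerivAt_const _ _)
    exact (hf.differentiable q).hasFDerivAt.comp_hasDerivAt q.1 h1
  have h2 : ∀ q ∈ Icc (-R) R ×ˢ Icc (-R) R,
      HasDerivAt (fun t => f (q.1, t)) (dY f q) q.2 := by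
    intro q _
    have h1 : HasDerivAt (fun t : ℝ => (q.1, t)) ((0 : ℝ), (1 : ℝ)) q.2 :=
      (hasDerivAt_const _ _).prodMk (hasDerivAt_id q.2)
    exact (hf.differentiable q).hasFDerivAt.comp_hasDerivAt q.2 h1
  have := box_stokes (g := f) (c := fun _ => v.2) (by linarith : -R ≤ R) (by linarith : -R ≤ R) v.1
    h1 h2 (hf.continuous_fderiv (1, 0)).continuousOn (hf.continuous_fderiv (0, 1)).continuousOn
    continuousOn_const (fun s _ => hz _ fun h => lt_irrefl _ h.1.1)
    (fun s _ => hz _ fun h => lt_irrefl _ h.1.2)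
  simp only [fderiv_apply_prod]
  rw [this]
  refine setIntegral_eq_zero_of_forall_eq_zero fun t _ => ?_
  rw [hz (t, R) fun h => lt_irrefl _ h.2.2, hz (t, -R) fun h => lt_irrefl _ h.2.1]
  simp

namespace GreenData

variable {P : Set (ℝ × ℝ)} {n : ℕ} {γ γ' : Fin n → ℝ → ℝ × ℝ} {I : Fin n → Set ℝ}
  {S : Fin n → Set (ℝ × ℝ)} {E : Set (ℝ × ℝ)}

/-- Localization: the other boundary sets are closed and miss the point, and `proper` together with
injectivity excludes remote parameters of the same arc. Near an interior point of an arc one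
therefore sees one piece of one arc. -/
theorem eventually_nhds (hG : GreenData P γ γ' I S E) {j : Fin n} {τ₀ : ℝ} (hτ₀ : τ₀ ∈ I j)
    {N : Set ℝ} (hN : N ∈ 𝓝 τ₀) :
    ∀ᶠ z in 𝓝 (γ j τ₀), (z ∈ frontier P → ∃ τ ∈ N ∩ I j, γ j τ = z) ∧
      ∀ i, ∀ τ ∈ I i, γ i τ = z → i = j ∧ τ ∈ N := by
  have h1 : ∀ᶠ z in 𝓝 (γ j τ₀), ∀ i, i ≠ j → z ∉ S i := by
    rw [eventually_all]
    intro i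
    by_cases hij : i = j
    · simp [hij]
    · filter_upwards [(hG.isClosed i).isOpen_compl.mem_nhds
        (hG.disjoint j i (Ne.symm hij) τ₀ hτ₀)] with z hz _ using hz
  filter_upwards [h1, hG.proper j τ₀ hτ₀ N hN] with z hz1 hz2
  refine ⟨fun hz => ?_, fun i τ hτ hz => ?_⟩
  · rw [hG.frontier_eq, mem_iUnion] at hz
    obtain ⟨i, hi⟩ := hz
    by_cases hij : i = j
    · subst hij; exact hz2 hi
    · exact absurd hi (hz1 i hij)
  · have hi : i = j := by
      by_contra hij
      exact hz1 i hij (hz ▸ hG.mapsTo i τ hτ)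
    subst hi
    obtain ⟨t, ht, he⟩ := hz2 (hz ▸ hG.mapsTo i τ hτ)
    have := hG.injOn i hτ ht.2 (hz.trans he.symm)
    exact ⟨rfl, this ▸ ht.1⟩

/-- Near the point with parameter `τ`, the Green formula holds with the multiplicity `m`. -/
def LocalMult (P : Set (ℝ × ℝ)) (γ γ' : Fin n → ℝ → ℝ × ℝ) (I : Fin n → Set ℝ) (j : Fin n) (τ : ℝ)
    (m : ℤ) : Prop :=
  ∃ V, IsOpen V ∧ γ j τ ∈ V ∧ ∀ f, IsTest f → tsupport f ⊆ V → ∀ v : ℝ × ℝ,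
    ∫ z in P, fderiv ℝ f z v = m * ∫ τ in I j, ((cross v (γ' j τ) : ℝ) : ℂ) * f (γ j τ)

theorem integrableOn_cross (hG : GreenData P γ γ' I S E) (j : Fin n) (v : ℝ × ℝ) :
    IntegrableOn (fun τ => ((cross v (γ' j τ) : ℝ) : ℂ)) (I j) := by
  have h := hG.integrableOn j
  exact ((h.snd.const_mul v.1).sub (h.fst.const_mul v.2)).ofReal

theorem continuousOn_curve (hG : GreenData P γ γ' I S E) (j : Fin n) : ContinuousOn (γ j) (I j) :=
  fun τ hτ => (hG.hasDerivAt j τ hτ).continuousAt.continuousWithinAt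

theorem integrableOn_cross_mul (hG : GreenData P γ γ' I S E) (j : Fin n) (v : ℝ × ℝ)
    {f : ℝ × ℝ → ℂ} (hf : IsTest f) :
    IntegrableOn (fun τ => ((cross v (γ' j τ) : ℝ) : ℂ) * f (γ j τ)) (I j) := by
  obtain ⟨C, hC⟩ := hf.exists_bound
  exact (hG.integrableOn_cross j v).mul_bdd (c := C)
    ((hf.continuous.comp_continuousOn (hG.continuousOn_curve j)).aestronglyMeasurable
      (hG.isOpen j).measurableSet) (Eventually.of_forall fun τ => hC _)

/-- The multiplicity found at `τ₀` serves for all nearby parameters, since a smaller neighbourhood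
of a nearby point lies in the same box. The test on the two sides of the arc along `e` is kept
because it later determines the signs for the disk and for convex polygons. -/
theorem exists_localMult (hG : GreenData P γ γ' I S E) {j : Fin n} {τ₀ : ℝ} (hτ₀ : τ₀ ∈ I j)
    {e : ℝ × ℝ} (he : 0 < cross (γ' j τ₀) e) :
    ∃ m : ℤ, (m = -1 ∨ m = 0 ∨ m = 1) ∧ (∀ᶠ τ in 𝓝 τ₀, LocalMult P γ γ' I j τ m) ∧
      ∀ᶠ s : ℝ in 𝓝[>] 0, (γ j τ₀ + s • e ∈ P → γ j τ₀ - s • e ∉ P → m = 1) ∧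
        (γ j τ₀ + s • e ∉ P → γ j τ₀ - s • e ∈ P → m = -1) := by
  obtain ⟨V, hV, hmV, -, r, hr, hrI, hrV, m, hm, hside, hgreen⟩ := local_green hG.measurableSet
    (hG.isOpen j) (hG.hasDerivAt j) (hG.continuousOn j) hτ₀ he
    (fun N hN => by
      filter_upwards [hG.eventually_nhds hτ₀ hN] with z hz hzf
      obtain ⟨τ, h1, h2⟩ := hz.1 hzf
      exact ⟨τ, h1.1, h2⟩) univ_mem univ_mem
  refine ⟨m, hm, ?_, hside⟩
  have hN : Ioo (τ₀ - r) (τ₀ + r) ∈ 𝓝 τ₀ := Ioo_mem_nhds (by linarith) (by linarith)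
  obtain ⟨W, hW, hWo, hmW⟩ := eventually_nhds_iff.1 (hG.eventually_nhds hτ₀ hN)
  have hcont : ContinuousAt (γ j) τ₀ := (hG.hasDerivAt j τ₀ hτ₀).continuousAt
  filter_upwards [hcont.eventually ((hV.inter hWo).mem_nhds ⟨hmV, hmW⟩)] with τ hτ
  refine ⟨V ∩ W, hV.inter hWo, hτ, fun f hf hsupp v => ?_⟩
  obtain ⟨g1, g2⟩ := hgreen f hf.contDiff (hsupp.trans inter_subset_left)
  have hres : ∀ c : ℝ → ℂ, ∫ τ in I j, c τ * f (γ j τ) =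
      ∫ τ in Ioo (τ₀ - r) (τ₀ + r), c τ * f (γ j τ) := by
    intro c
    refine setIntegral_eq_of_subset_of_forall_sdiff_eq_zero (hG.isOpen j).measurableSet
      (fun τ hτ => (hrI (Ioo_subset_Icc_self hτ)).2) fun τ hτ => ?_
    have : f (γ j τ) = 0 := image_eq_zero_of_notMem_tsupport fun h =>
      hτ.2 ((hW _ (hsupp h).2).2 j τ hτ.1 rfl).2
    rw [this, mul_zero]
  have hfi : ∀ w : ℝ × ℝ, IntegrableOn (fun z => fderiv ℝ f z w) P := fun w =>
    (hf.integrable_fderiv w).integrableOn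
  have hsplit : ∫ z in P, fderiv ℝ f z v = v.1 * (∫ z in P, dX f z) + v.2 * (∫ z in P, dY f z) := by
    simp only [fderiv_apply_prod f _ v]
    rw [integral_add (f := fun z => (v.1 : ℂ) * dX f z) (g := fun z => (v.2 : ℂ) * dY f z)
      ((hfi (1, 0)).const_mul _) ((hfi (0, 1)).const_mul _), integral_const_mul,
      integral_const_mul]
  have i1 := hG.integrableOn_cross_mul j (1, 0) hf
  have i2 := hG.integrableOn_cross_mul j (0, 1) hf
  simp only [cross, one_mul, zero_mul, sub_zero, zero_sub] at i1 i2
  have hc : ∫ τ in I j, ((cross v (γ' j τ) : ℝ) : ℂ) * f (γ j τ) =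
      v.1 * (∫ τ in I j, ((γ' j τ).2 : ℂ) * f (γ j τ)) -
        v.2 * ∫ τ in I j, ((γ' j τ).1 : ℂ) * f (γ j τ) := by
    rw [← integral_const_mul, ← integral_const_mul, ← integral_sub (i1.const_mul _)]
    · congr 1; ext τ; simp only [cross]; push_cast; ring
    · have := (i2.const_mul (v.2 : ℂ)).neg
      refine this.congr (Eventually.of_forall fun τ => ?_)
      simp
  rw [hsplit, g1, g2, hc, hres, hres]
  ring

/-- With `v` the velocity turned by a right angle, `cross v (γ' j τ₀)` is the square of the speed. A
bump supported where this quantity is still positive has a positive boundary integral, which can be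
cancelled. -/
theorem localMult_unique (hG : GreenData P γ γ' I S E) {j : Fin n} {τ₀ : ℝ} (hτ₀ : τ₀ ∈ I j)
    (hreg : γ' j τ₀ ≠ 0) {m m' : ℤ} (h : LocalMult P γ γ' I j τ₀ m)
    (h' : LocalMult P γ γ' I j τ₀ m') : m = m' := by
  obtain ⟨V, hV, hmV, hg⟩ := h
  obtain ⟨V', hV', hmV', hg'⟩ := h'
  set v : ℝ × ℝ := ((γ' j τ₀).2, -(γ' j τ₀).1) with hv
  have hpos : 0 < cross v (γ' j τ₀) := by
    have : γ' j τ₀ ≠ 0 := hreg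
    have h2 : (γ' j τ₀).1 ≠ 0 ∨ (γ' j τ₀).2 ≠ 0 := by
      by_contra! hc
      exact this (Prod.ext hc.1 hc.2)
    simp only [cross, hv]
    rcases h2 with h | h <;> nlinarith [mul_self_pos.2 h, mul_self_nonneg (γ' j τ₀).1, mul_self_nonneg (γ' j τ₀).2]
  have hIn : I j ∈ 𝓝 τ₀ := (hG.isOpen j).mem_nhds hτ₀
  have hcc : ContinuousAt (fun τ => cross v (γ' j τ)) τ₀ := by
    have := (hG.continuousOn j).continuousAt hIn
    exact (continuousAt_const.mul this.snd).sub (continuousAt_const.mul this.fst)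
  have hN : {τ | 0 < cross v (γ' j τ)} ∈ 𝓝 τ₀ := hcc.eventually (lt_mem_nhds hpos)
  obtain ⟨φ, -, -, htest, -, hsupp, hφ0, hφ1⟩ := exists_test (z₀ := γ j τ₀)
    (inter_mem (inter_mem (hV.mem_nhds hmV) (hV'.mem_nhds hmV')) (hG.eventually_nhds hτ₀ hN))
  have e1 := hg _ htest (fun z hz => (hsupp hz).1.1) v
  have e2 := hg' _ htest (fun z hz => (hsupp hz).1.2) v
  rw [e1] at e2
  have hne : ∫ τ in I j, ((cross v (γ' j τ) : ℝ) : ℂ) * (φ (γ j τ) : ℂ) ≠ 0 := by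
    have : ∫ τ in I j, ((cross v (γ' j τ) : ℝ) : ℂ) * (φ (γ j τ) : ℂ) =
        ((∫ τ in I j, cross v (γ' j τ) * φ (γ j τ) : ℝ) : ℂ) := by
      rw [← integral_complex_ofReal]
      congr 1; ext τ; push_cast; rfl
    rw [this]
    refine Complex.ofReal_ne_zero.2 (ne_of_gt ?_)
    rw [setIntegral_pos_iff_support_of_nonneg_ae]
    · have hφc : Continuous φ := by
        have := htest.continuous
        have h2 := Complex.continuous_re.comp this
        exact h2
      have hcφ : ContinuousAt (fun τ => φ (γ j τ)) τ₀ :=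
        hφc.continuousAt.comp (hG.hasDerivAt j τ₀ hτ₀).continuousAt
      refine Measure.measure_pos_of_mem_nhds _ (x := τ₀) (inter_mem ?_ hIn)
      have : ∀ᶠ τ in 𝓝 τ₀, φ (γ j τ) ≠ 0 := hcφ.eventually_ne (by rw [hφ1]; exact one_ne_zero)
      filter_upwards [hN, this] with τ h1 h2
      exact mul_ne_zero h1.ne' h2
    · refine (ae_restrict_iff' (hG.isOpen j).measurableSet).2 (Eventually.of_forall fun τ hτ => ?_)
      by_cases hz : φ (γ j τ) = 0
      · simp [hz]
      · have hm : γ j τ ∈ tsupport (fun z => (φ z : ℂ)) :=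
          subset_tsupport _ (by simpa using hz)
        exact mul_nonneg (((hsupp hm).2.2 j τ hτ rfl).2).le (hφ0 _)
    · have := (hG.integrableOn_cross_mul j v htest).re
      refine this.congr (Eventually.of_forall fun τ => ?_)
      simp only [← Complex.ofReal_mul]
      rfl
  exact_mod_cast mul_right_cancel₀ hne e2

open Classical in
/-- The multiplicity with which the arc `j` bounds the domain near the parameter `τ`. -/
noncomputable def mult (P : Set (ℝ × ℝ)) (γ γ' : Fin n → ℝ → ℝ × ℝ) (I : Fin n → Set ℝ) (j : Fin n)
    (τ : ℝ) : ℤ :=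
  if h : ∃ m, LocalMult P γ γ' I j τ m then h.choose else 0

theorem mult_eq (hG : GreenData P γ γ' I S E) {j : Fin n} {τ : ℝ} (hτ : τ ∈ I j)
    (hreg : γ' j τ ≠ 0) {m : ℤ} (h : LocalMult P γ γ' I j τ m) : mult P γ γ' I j τ = m := by
  have hex : ∃ m, LocalMult P γ γ' I j τ m := ⟨m, h⟩
  rw [mult, dif_pos hex]
  exact hG.localMult_unique hτ hreg hex.choose_spec h

theorem exists_normal {a : ℝ × ℝ} (ha : a ≠ 0) : 0 < cross a (-a.2, a.1) := by
  have h2 : a.1 ≠ 0 ∨ a.2 ≠ 0 := by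
    by_contra! hc
    exact ha (Prod.ext hc.1 hc.2)
  simp only [cross]
  rcases h2 with h | h <;> nlinarith [mul_self_pos.2 h, mul_self_nonneg a.1, mul_self_nonneg a.2]

theorem eventually_regular (hG : GreenData P γ γ' I S E) {j : Fin n} {τ₀ : ℝ} (hτ₀ : τ₀ ∈ I j)
    (hreg : γ' j τ₀ ≠ 0) : ∀ᶠ τ in 𝓝 τ₀, τ ∈ I j ∧ γ' j τ ≠ 0 := by
  have hIn : I j ∈ 𝓝 τ₀ := (hG.isOpen j).mem_nhds hτ₀
  filter_upwards [hIn, ((hG.continuousOn j).continuousAt hIn).eventually_ne hreg] with τ h1 h2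
  exact ⟨h1, h2⟩

/-- One integer works for all nearby parameters, and uniqueness at regular parameters forces `mult`,
defined by choice at each parameter separately, to agree with it. -/
theorem mult_locally_constant (hG : GreenData P γ γ' I S E) {j : Fin n} {τ₀ : ℝ} (hτ₀ : τ₀ ∈ I j)
    (hreg : γ' j τ₀ ≠ 0) : ∃ m : ℤ, (m = -1 ∨ m = 0 ∨ m = 1) ∧
      ∀ᶠ τ in 𝓝 τ₀, LocalMult P γ γ' I j τ m ∧ mult P γ γ' I j τ = m := by
  obtain ⟨m, hm, hl, -⟩ := hG.exists_localMult hτ₀ (exists_normal hreg)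
  refine ⟨m, hm, ?_⟩
  filter_upwards [hl, hG.eventually_regular hτ₀ hreg] with τ h1 h2
  exact ⟨h1, hG.mult_eq h2.1 h2.2 h1⟩

theorem norm_mult_le (hG : GreenData P γ γ' I S E) {j : Fin n} {τ₀ : ℝ} (hτ₀ : τ₀ ∈ I j)
    (hreg : γ' j τ₀ ≠ 0) : ‖(mult P γ γ' I j τ₀ : ℂ)‖ ≤ 1 := by
  obtain ⟨m, hm, h⟩ := hG.mult_locally_constant hτ₀ hreg
  rw [h.self_of_nhds.2]
  rcases hm with rfl | rfl | rfl <;> simp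

/-- The regular parameters of an arc. -/
def regular (γ' : Fin n → ℝ → ℝ × ℝ) (I : Fin n → Set ℝ) (j : Fin n) : Set ℝ :=
  {τ ∈ I j | γ' j τ ≠ 0}

theorem isOpen_regular (hG : GreenData P γ γ' I S E) (j : Fin n) : IsOpen (regular γ' I j) :=
  isOpen_iff_mem_nhds.2 fun _ hτ => hG.eventually_regular hτ.1 hτ.2

theorem ae_regular (hG : GreenData P γ γ' I S E) (j : Fin n) :
    ∀ᵐ τ ∂volume.restrict (I j), τ ∈ regular γ' I j := by
  rw [ae_restrict_iff' (hG.isOpen j).measurableSet]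
  have : ∀ᵐ τ : ℝ, τ ∉ {τ ∈ I j | γ' j τ = 0} := by
    rw [ae_iff]; simpa using (hG.crit j).measure_zero volume
  filter_upwards [this] with τ h1 h2
  exact ⟨h2, fun h => h1 ⟨h2, h⟩⟩

theorem aestronglyMeasurable_mult (hG : GreenData P γ γ' I S E) (j : Fin n) :
    AEStronglyMeasurable (fun τ => (mult P γ γ' I j τ : ℂ)) (volume.restrict (I j)) := by
  have h1 : ContinuousOn (fun τ => (mult P γ γ' I j τ : ℂ)) (regular γ' I j) := by
    intro τ hτ
    obtain ⟨m, -, h⟩ := hG.mult_locally_constant hτ.1 hτ.2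
    refine ContinuousAt.continuousWithinAt ?_
    refine (continuousAt_const (y := (m : ℂ))).congr ?_
    filter_upwards [h] with s hs
    rw [hs.2]
  have h2 := h1.aestronglyMeasurable (μ := volume) (hG.isOpen_regular j).measurableSet
  have h3 : volume.restrict (I j) = volume.restrict (regular γ' I j) := by
    refine Measure.restrict_congr_set ?_
    have := hG.ae_regular j
    rw [ae_restrict_iff' (hG.isOpen j).measurableSet] at this
    filter_upwards [this] with τ hτ
    exact propext ⟨hτ, fun h => h.1⟩
  rw [h3]; exact h2

theorem integrableOn_mult (hG : GreenData P γ γ' I S E) (j : Fin n) (v : ℝ × ℝ)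
    {f : ℝ × ℝ → ℂ} (hf : IsTest f) :
    IntegrableOn (fun τ => (mult P γ γ' I j τ : ℂ) * ((cross v (γ' j τ) : ℝ) : ℂ) * f (γ j τ)) (I j) := by
  have := (hG.integrableOn_cross_mul j v hf).bdd_mul (c := 1) (hG.aestronglyMeasurable_mult j)
    (by filter_upwards [hG.ae_regular j] with τ hτ using hG.norm_mult_le hτ.1 hτ.2)
  refine this.congr (Eventually.of_forall fun τ => ?_)
  simp only [mul_assoc]

end GreenData

end Polypol

/-! ### Green's formula: from local pieces to the whole boundary. -/

namespace Polypol

open MeasureTheory Filter Topology Set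

namespace GreenData

variable {P : Set (ℝ × ℝ)} {n : ℕ} {γ γ' : Fin n → ℝ → ℝ × ℝ} {I : Fin n → Set ℝ}
  {S : Fin n → Set (ℝ × ℝ)} {E : Set (ℝ × ℝ)}

/-- The difference of the two sides of the Green formula. -/
noncomputable def defect (P : Set (ℝ × ℝ)) (γ γ' : Fin n → ℝ → ℝ × ℝ) (I : Fin n → Set ℝ)
    (v : ℝ × ℝ) (f : ℝ × ℝ → ℂ) : ℂ :=
  (∫ z in P, fderiv ℝ f z v) - boundaryIntegral γ γ' I (mult P γ γ' I) v f

theorem defect_add (hG : GreenData P γ γ' I S E) (v : ℝ × ℝ) {f g : ℝ × ℝ → ℂ} (hf : IsTest f)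
    (hg : IsTest g) : defect P γ γ' I v (fun z => f z + g z) = defect P γ γ' I v f + defect P γ γ' I v g := by
  have h1 : ∫ z in P, fderiv ℝ (fun z => f z + g z) z v =
      (∫ z in P, fderiv ℝ f z v) + ∫ z in P, fderiv ℝ g z v := by
    rw [← integral_add (hf.integrable_fderiv v).integrableOn (hg.integrable_fderiv v).integrableOn]
    congr 1; ext z
    rw [fderiv_fun_add (hf.differentiable z) (hg.differentiable z)]; rfl
  have h2 : boundaryIntegral γ γ' I (mult P γ γ' I) v (fun z => f z + g z) =
      boundaryIntegral γ γ' I (mult P γ γ' I) v f + boundaryIntegral γ γ' I (mult P γ γ' I) v g := by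
    rw [boundaryIntegral, boundaryIntegral, boundaryIntegral, ← Finset.sum_add_distrib]
    refine Finset.sum_congr rfl fun j _ => ?_
    rw [← integral_add (hG.integrableOn_mult j v hf) (hG.integrableOn_mult j v hg)]
    congr 1; ext τ; ring
  rw [defect, defect, defect, h1, h2]; ring

theorem _root_.Polypol.isTest_zero : IsTest fun _ => 0 :=
  ⟨contDiff_const, HasCompactSupport.zero⟩

theorem _root_.Polypol.isTest_sum {ι : Type*} (s : Finset ι) {f : ι → ℝ × ℝ → ℂ} (hf : ∀ i ∈ s, IsTest (f i)) :
    IsTest fun z => ∑ i ∈ s, f i z := by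
  classical
  induction s using Finset.induction_on with
  | empty => simpa using isTest_zero
  | insert a s ha ih =>
    simp only [Finset.sum_insert ha]
    have h1 := hf a (Finset.mem_insert_self _ _)
    have h2 := ih fun i hi => hf i (Finset.mem_insert_of_mem hi)
    exact ⟨h1.contDiff.add h2.contDiff, h1.compact.add h2.compact⟩

theorem defect_sum (hG : GreenData P γ γ' I S E) (v : ℝ × ℝ) {ι : Type*} (s : Finset ι)
    {f : ι → ℝ × ℝ → ℂ} (hf : ∀ i ∈ s, IsTest (f i)) :
    defect P γ γ' I v (fun z => ∑ i ∈ s, f i z) = ∑ i ∈ s, defect P γ γ' I v (f i) := by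
  classical
  induction s using Finset.induction_on with
  | empty => simp [defect, boundaryIntegral]
  | insert a s ha ih =>
    simp only [Finset.sum_insert ha]
    rw [hG.defect_add v (hf a (Finset.mem_insert_self _ _))
      (isTest_sum s fun i hi => hf i (Finset.mem_insert_of_mem hi)),
      ih fun i hi => hf i (Finset.mem_insert_of_mem hi)]

/-- The points at which the local form of the Green formula is not available. -/
def bad (γ γ' : Fin n → ℝ → ℝ × ℝ) (I : Fin n → Set ℝ) (E : Set (ℝ × ℝ)) : Set (ℝ × ℝ) :=
  E ∪ ⋃ j, γ j '' {τ ∈ I j | γ' j τ = 0}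

theorem finite_bad (hG : GreenData P γ γ' I S E) : (bad γ γ' I E).Finite :=
  hG.finite.union (finite_iUnion fun j => (hG.crit j).image _)

/-- Near a regular boundary point this is the local multiplicity, which is constant on the visible
piece of arc. Away from the frontier a ball lies inside or outside the domain, and the integral of a
derivative of a test function over the plane is zero. -/
theorem exists_defect_eq_zero (hG : GreenData P γ γ' I S E) {z : ℝ × ℝ} (hz : z ∉ bad γ γ' I E) :
    ∃ V, IsOpen V ∧ z ∈ V ∧ ∀ f, IsTest f → tsupport f ⊆ V → ∀ v, defect P γ γ' I v f = 0 := by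
  by_cases hfr : z ∈ frontier P
  · have hfr' := hfr
    rw [hG.frontier_eq, mem_iUnion] at hfr'
    obtain ⟨j, hj⟩ := hfr'
    obtain ⟨τ₀, hτ₀, rfl⟩ : z ∈ γ j '' I j :=
      (hG.covers j hj).resolve_right fun h => hz (Or.inl h)
    have hreg : γ' j τ₀ ≠ 0 := fun h =>
      hz (Or.inr (mem_iUnion.2 ⟨j, τ₀, ⟨hτ₀, h⟩, rfl⟩))
    obtain ⟨m, -, hm⟩ := hG.mult_locally_constant hτ₀ hreg
    obtain ⟨V, hV, hmV, hgr⟩ := hm.self_of_nhds.1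
    obtain ⟨W, hW, hWo, hmW⟩ := eventually_nhds_iff.1 (hG.eventually_nhds hτ₀ hm)
    refine ⟨V ∩ W, hV.inter hWo, ⟨hmV, hmW⟩, fun f hf hsupp v => ?_⟩
    rw [defect, hgr f hf (hsupp.trans inter_subset_left) v, boundaryIntegral,
      Finset.sum_eq_single j, ← integral_const_mul, sub_eq_zero]
    · refine setIntegral_congr_fun (hG.isOpen j).measurableSet fun τ hτ => ?_
      by_cases h0 : f (γ j τ) = 0
      · simp [h0]
      · have := ((hW _ (hsupp (subset_tsupport _ h0)).2).2 j τ hτ rfl).2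
        simp only [this.2, mul_assoc]
    · intro i _ hij
      refine setIntegral_eq_zero_of_forall_eq_zero fun τ hτ => ?_
      by_cases h0 : f (γ i τ) = 0
      · simp [h0]
      · exact absurd ((hW _ (hsupp (subset_tsupport _ h0)).2).2 i τ hτ rfl).1 hij
    · simp
  · have : (frontier P)ᶜ ∈ 𝓝 z := isClosed_frontier.isOpen_compl.mem_nhds hfr
    obtain ⟨ε, hε, hb⟩ := Metric.mem_nhds_iff.1 this
    refine ⟨Metric.ball z ε, Metric.isOpen_ball, Metric.mem_ball_self hε, fun f hf hsupp v => ?_⟩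
    have h0 : ∀ w, w ∉ Metric.ball z ε → fderiv ℝ f w v = 0 := fun w hw => by
      have : fderiv ℝ f w = 0 := image_eq_zero_of_notMem_tsupport fun h =>
        hw (hsupp (tsupport_fderiv_subset ℝ h))
      rw [this]; rfl
    have hbd : boundaryIntegral γ γ' I (mult P γ γ' I) v f = 0 := by
      refine Finset.sum_eq_zero fun j _ => setIntegral_eq_zero_of_forall_eq_zero fun τ hτ => ?_
      have : f (γ j τ) = 0 := image_eq_zero_of_notMem_tsupport fun h => hb (hsupp h) (by
        rw [hG.frontier_eq]; exact mem_iUnion.2 ⟨j, hG.mapsTo j τ hτ⟩)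
      rw [this, mul_zero]
    rw [defect, hbd, sub_zero]
    rcases subset_or_disjoint_of_isPreconnected (s := P) (convex_ball z ε).isPreconnected
      (fun w hw => hb hw) with h | h
    · rw [setIntegral_eq_integral_of_forall_compl_eq_zero fun w hw => h0 w fun hw' => hw (h hw')]
      exact hf.integral_fderiv v
    · exact setIntegral_eq_zero_of_forall_eq_zero fun w hw => h0 w fun hw' => h w hw' hw

-- The defect is additive, so a partition of unity on the compact support reduces to functions
-- supported in the neighbourhoods of the preceding lemma.
open scoped Manifold ContDiff in
theorem defect_eq_zero_of_local (hG : GreenData P γ γ' I S E) {f : ℝ × ℝ → ℂ} (hf : IsTest f)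
    (h : ∀ z ∈ tsupport f, z ∉ bad γ γ' I E) (v : ℝ × ℝ) : defect P γ γ' I v f = 0 := by
  choose! V hVo hVm hV using fun z (hz : z ∉ bad γ γ' I E) => hG.exists_defect_eq_zero hz
  obtain ⟨t, ht, hcov⟩ := hf.compact.elim_nhds_subcover V
    fun z hz => (hVo z (h z hz)).mem_nhds (hVm z (h z hz))
  obtain ⟨ρ, hρ⟩ := SmoothPartitionOfUnity.exists_isSubordinate 𝓘(ℝ, ℝ × ℝ) (s := tsupport f)
    (isClosed_tsupport f) (fun i : t => V i) (fun i => hVo i (h i (ht i i.2)))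
    (fun z hz => by
      obtain ⟨x, hx, hzx⟩ := mem_iUnion₂.1 (hcov hz)
      exact mem_iUnion.2 ⟨⟨x, hx⟩, hzx⟩)
  have hρd : ∀ i, ContDiff ℝ 1 fun z => ((ρ i z : ℝ) : ℂ) := fun i =>
    contDiff_ofReal_comp (k := 1) (((ρ i).contMDiff.contDiff).of_le (by exact_mod_cast le_top))
  have hsum : f = fun z => ∑ i : t, ((ρ i z : ℝ) : ℂ) * f z := by
    ext z
    by_cases hz : z ∈ tsupport f
    · have := ρ.sum_eq_one hz
      rw [finsum_eq_sum_of_fintype] at this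
      rw [← Finset.sum_mul, ← Complex.ofReal_sum, this]; simp
    · simp [image_eq_zero_of_notMem_tsupport hz]
  have ht' : ∀ i : t, IsTest fun z => ((ρ i z : ℝ) : ℂ) * f z := fun i => hf.mul_left (hρd i)
  rw [hsum, hG.defect_sum v Finset.univ fun i _ => ht' i]
  refine Finset.sum_eq_zero fun i _ => hV i (h i (ht i i.2)) _ (ht' i) ?_ v
  refine (tsupport_mul_subset_left (f := fun z => ((ρ i z : ℝ) : ℂ)) (g := f)).trans
    (Subset.trans (closure_mono ?_) (hρ i))
  intro z hz
  simpa using hz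

theorem _root_.Polypol.contDiff_scale (k : ℕ) (b : ℝ × ℝ) :
    ContDiff ℝ 1 fun z : ℝ × ℝ => ((k : ℝ) + 1) • (z - b) := by fun_prop

/-- The bump of radius of order 1/k has a derivative of order k but lives on an area of order 1/k²,
so the product tends to zero: points are negligible in the plane for the area side of the formula.
-/
theorem tendsto_area_bump (hP : MeasurableSet P) {f : ℝ × ℝ → ℂ} (hf : IsTest f)
    (b v : ℝ × ℝ) (ψ : ContDiffBump (0 : ℝ × ℝ)) :
    Tendsto (fun k : ℕ => ∫ z in P,
      fderiv ℝ (fun z => ((ψ (((k : ℝ) + 1) • (z - b)) : ℝ) : ℂ) * f z) z v) atTop (𝓝 0) := by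
  have hψc : ContDiff ℝ 1 fun z => ((ψ z : ℝ) : ℂ) := contDiff_ofReal_comp (k := 1) ψ.contDiff
  have hψs : HasCompactSupport fun z => ((ψ z : ℝ) : ℂ) :=
    ψ.hasCompactSupport.comp_left Complex.ofReal_zero
  have hψt : IsTest fun z => ((ψ z : ℝ) : ℂ) := ⟨hψc, hψs⟩
  obtain ⟨C₁, hC₁⟩ := hf.exists_bound
  obtain ⟨C₂, hC₂⟩ := (hf.compact.fderiv_apply ℝ v).exists_bound_of_continuous (hf.continuous_fderiv v)
  obtain ⟨C₃, hC₃⟩ := (hψs.fderiv_apply ℝ v).exists_bound_of_continuous (hψt.continuous_fderiv v)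
  have hC₁0 : 0 ≤ C₁ := (norm_nonneg _).trans (hC₁ 0)
  have hC₂0 : 0 ≤ C₂ := (norm_nonneg _).trans (hC₂ 0)
  have hC₃0 : 0 ≤ C₃ := (norm_nonneg _).trans (hC₃ 0)
  have hψ1 : ∀ z, ‖((ψ z : ℝ) : ℂ)‖ ≤ 1 := fun z => by
    rw [Complex.norm_real, Real.norm_of_nonneg ψ.nonneg]; exact ψ.le_one
  have hψ0 : ∀ z, ψ.rOut ≤ ‖z‖ → ψ z = 0 := fun z hz =>
    ψ.zero_of_le_dist (by rwa [dist_zero_right])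
  have hd : ∀ (k : ℕ) (z : ℝ × ℝ), fderiv ℝ (fun z => ((ψ (((k : ℝ) + 1) • (z - b)) : ℝ) : ℂ) * f z) z v =
      ((ψ (((k : ℝ) + 1) • (z - b)) : ℝ) : ℂ) * fderiv ℝ f z v +
        f z * (((k : ℝ) + 1) * fderiv ℝ (fun z => ((ψ z : ℝ) : ℂ)) (((k : ℝ) + 1) • (z - b)) v) := by
    intro k z
    have h1 : HasFDerivAt (fun z : ℝ × ℝ => ((k : ℝ) + 1) • (z - b))
        (((k : ℝ) + 1) • ContinuousLinearMap.id ℝ (ℝ × ℝ)) z :=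
      ((hasFDerivAt_id z).sub_const b).fun_const_smul _
    have h2 := (hψt.differentiable (((k : ℝ) + 1) • (z - b))).hasFDerivAt.comp z h1
    have h3 := h2.mul (hf.differentiable z).hasFDerivAt
    have h4 : fderiv ℝ (fun z => ((ψ (((k : ℝ) + 1) • (z - b)) : ℝ) : ℂ) * f z) z = _ := h3.fderiv
    rw [h4]
    simp
  have hb : ∀ k : ℕ, ‖∫ z in P, fderiv ℝ (fun z => ((ψ (((k : ℝ) + 1) • (z - b)) : ℝ) : ℂ) * f z) z v‖ ≤
      (C₂ + C₁ * C₃) * (2 * ψ.rOut) ^ 2 * (1 / ((k : ℝ) + 1)) := by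
    intro k
    have hk : (0 : ℝ) < (k : ℝ) + 1 := by positivity
    set B := Metric.closedBall b (ψ.rOut / ((k : ℝ) + 1)) with hB
    have hout : ∀ z, z ∉ B → fderiv ℝ (fun z => ((ψ (((k : ℝ) + 1) • (z - b)) : ℝ) : ℂ) * f z) z v = 0 := by
      intro z hz
      have : (fun z => ((ψ (((k : ℝ) + 1) • (z - b)) : ℝ) : ℂ) * f z) =ᶠ[𝓝 z] fun _ => 0 := by
        filter_upwards [Metric.isClosed_closedBall.isOpen_compl.mem_nhds hz] with w hw
        have : ψ.rOut ≤ ‖((k : ℝ) + 1) • (w - b)‖ := by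
          rw [norm_smul, Real.norm_of_nonneg hk.le, ← dist_eq_norm]
          have : ψ.rOut / ((k : ℝ) + 1) < dist w b := by simpa [hB] using hw
          rw [div_lt_iff₀ hk] at this
          linarith
        rw [hψ0 _ this]; simp
      rw [this.fderiv_eq]; simp
    have hvol : volume.real B = (2 * ψ.rOut) ^ 2 * (1 / ((k : ℝ) + 1)) ^ 2 := by
      rw [hB, show b = (b.1, b.2) from rfl, ← closedBall_prod_same, Measure.real,
        Measure.volume_eq_prod, Measure.prod_prod, Real.volume_closedBall, Real.volume_closedBall,
        ENNReal.toReal_mul, ENNReal.toReal_ofReal (by have := ψ.rOut_pos; positivity)]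
      field_simp
    have hBfin : volume (P ∩ B) < ⊤ :=
      (measure_mono inter_subset_right).trans_lt measure_closedBall_lt_top
    calc ‖∫ z in P, fderiv ℝ (fun z => ((ψ (((k : ℝ) + 1) • (z - b)) : ℝ) : ℂ) * f z) z v‖
        = ‖∫ z in P ∩ B, fderiv ℝ (fun z => ((ψ (((k : ℝ) + 1) • (z - b)) : ℝ) : ℂ) * f z) z v‖ := by
          rw [setIntegral_eq_of_subset_of_forall_sdiff_eq_zero hP inter_subset_left
            fun z hz => hout z fun h => hz.2 ⟨hz.1, h⟩]
      _ ≤ ((C₂ + C₁ * C₃) * ((k : ℝ) + 1)) * volume.real (P ∩ B) := by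
          refine norm_setIntegral_le_of_norm_le_const hBfin fun z _ => ?_
          rw [hd]
          refine (norm_add_le _ _).trans ?_
          rw [norm_mul, norm_mul, norm_mul]
          have e1 : ‖((k : ℝ) : ℂ) + 1‖ = (k : ℝ) + 1 := by
            rw [← Complex.ofReal_one, ← Complex.ofReal_add, Complex.norm_real,
              Real.norm_of_nonneg hk.le]
          have e1' : ‖(((k : ℝ) + 1 : ℂ))‖ = (k : ℝ) + 1 := e1
          rw [e1']
          have e2 := mul_le_mul (hψ1 (((k : ℝ) + 1) • (z - b))) (hC₂ z) (norm_nonneg _) zero_le_one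
          have e3 := mul_le_mul (hC₁ z) (hC₃ (((k : ℝ) + 1) • (z - b))) (norm_nonneg _) hC₁0
          have hk1 : (1 : ℝ) ≤ (k : ℝ) + 1 := by
            have : (0 : ℝ) ≤ k := k.cast_nonneg
            linarith
          nlinarith [mul_le_mul_of_nonneg_right e3 hk.le]
      _ ≤ ((C₂ + C₁ * C₃) * ((k : ℝ) + 1)) * volume.real B := by
          refine mul_le_mul_of_nonneg_left (measureReal_mono inter_subset_right
            measure_closedBall_lt_top.ne) (by positivity)
      _ = (C₂ + C₁ * C₃) * (2 * ψ.rOut) ^ 2 * (1 / ((k : ℝ) + 1)) := by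
          rw [hvol]; field_simp
  refine squeeze_zero_norm hb ?_
  have := (tendsto_one_div_add_atTop_nhds_zero_nat (𝕜 := ℝ)).const_mul ((C₂ + C₁ * C₃) * (2 * ψ.rOut) ^ 2)
  simpa using this

/-- Dominated convergence: by injectivity an arc passes through `b` for at most one parameter, and
at all others the shrinking bump is eventually zero. -/
theorem tendsto_boundaryIntegral_bump (hG : GreenData P γ γ' I S E) {f : ℝ × ℝ → ℂ} (hf : IsTest f)
    (b v : ℝ × ℝ) (ψ : ContDiffBump (0 : ℝ × ℝ)) :
    Tendsto (fun k : ℕ => boundaryIntegral γ γ' I (mult P γ γ' I) v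
      (fun z => ((ψ (((k : ℝ) + 1) • (z - b)) : ℝ) : ℂ) * f z)) atTop (𝓝 0) := by
  have hψc : ContDiff ℝ 1 fun z => ((ψ z : ℝ) : ℂ) := contDiff_ofReal_comp (k := 1) ψ.contDiff
  have hψ1 : ∀ z, ‖((ψ z : ℝ) : ℂ)‖ ≤ 1 := fun z => by
    rw [Complex.norm_real, Real.norm_of_nonneg ψ.nonneg]; exact ψ.le_one
  have hψ0 : ∀ z, ψ.rOut ≤ ‖z‖ → ψ z = 0 := fun z hz =>
    ψ.zero_of_le_dist (by rwa [dist_zero_right])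
  have : (0 : ℂ) = ∑ j : Fin n, ∫ τ in I j, (0 : ℂ) := by simp
  rw [this]
  refine tendsto_finsetSum _ fun j _ => ?_
  have hint := hG.integrableOn_mult j v hf
  refine tendsto_integral_of_dominated_convergence
    (fun τ => ‖(mult P γ γ' I j τ : ℂ) * ((cross v (γ' j τ) : ℝ) : ℂ) * f (γ j τ)‖) ?_ hint.norm ?_ ?_
  · intro k
    exact (hG.integrableOn_mult j v (hf.mul_left (hψc.comp (contDiff_scale k b)))).aestronglyMeasurable
  · intro k
    refine Eventually.of_forall fun τ => ?_
    rw [norm_mul, norm_mul, norm_mul, norm_mul, norm_mul]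
    refine mul_le_mul_of_nonneg_left ?_ (by positivity)
    calc _ ≤ 1 * ‖f (γ j τ)‖ := mul_le_mul_of_nonneg_right (hψ1 _) (norm_nonneg _)
      _ = _ := one_mul _
  · have hne : ∀ᵐ τ ∂volume.restrict (I j), γ j τ ≠ b := by
      rw [ae_restrict_iff' (hG.isOpen j).measurableSet]
      have hs : {τ ∈ I j | γ j τ = b}.Subsingleton := fun τ hτ τ' hτ' =>
        hG.injOn j hτ.1 hτ'.1 (hτ.2.trans hτ'.2.symm)
      have : ∀ᵐ τ : ℝ, τ ∉ {τ ∈ I j | γ j τ = b} := by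
        rw [ae_iff]; simpa using hs.measure_zero volume
      filter_upwards [this] with τ h1 h2 h3
      exact h1 ⟨h2, h3⟩
    filter_upwards [hne] with τ hτ
    refine tendsto_const_nhds.congr' ?_
    have hpos : 0 < ‖γ j τ - b‖ := norm_pos_iff.2 (sub_ne_zero.2 hτ)
    filter_upwards [eventually_ge_atTop ⌈ψ.rOut / ‖γ j τ - b‖⌉₊] with k hk
    have h1 : ψ.rOut / ‖γ j τ - b‖ ≤ k := (Nat.le_ceil _).trans (by exact_mod_cast hk)
    rw [div_le_iff₀ hpos] at h1
    rw [hψ0, Complex.ofReal_zero, zero_mul, mul_zero]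
    rw [norm_smul, Real.norm_of_nonneg (by positivity)]
    nlinarith

/-- Bump functions concentrated at a point do not contribute to the Green formula. -/
theorem tendsto_defect_bump (hG : GreenData P γ γ' I S E) {f : ℝ × ℝ → ℂ} (hf : IsTest f)
    (b v : ℝ × ℝ) (ψ : ContDiffBump (0 : ℝ × ℝ)) :
    Tendsto (fun k : ℕ => defect P γ γ' I v (fun z => ((ψ (((k : ℝ) + 1) • (z - b)) : ℝ) : ℂ) * f z))
      atTop (𝓝 0) := by
  have h := (tendsto_area_bump hG.measurableSet hf b v ψ).sub
    (hG.tendsto_boundaryIntegral_bump hf b v ψ)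
  rw [sub_zero] at h
  exact h

/-- Induction on the finite set of bad points. A test function is split by a bump at one bad point
`b`: the part away from `b` has no defect, and the defect of the other part tends to zero while the
sum stays the same. -/
theorem defect_eq_zero (hG : GreenData P γ γ' I S E) (v : ℝ × ℝ) {f : ℝ × ℝ → ℂ} (hf : IsTest f) :
    defect P γ γ' I v f = 0 := by
  have key : ∀ B : Set (ℝ × ℝ), B.Finite →
      (∀ f, IsTest f → (∀ z ∈ tsupport f, z ∉ B) → defect P γ γ' I v f = 0) →
      ∀ f, IsTest f → defect P γ γ' I v f = 0 := by
    intro B hB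
    induction B, hB using Set.Finite.induction_on with
    | empty => exact fun h f hf => h f hf fun z _ => notMem_empty z
    | @insert b B hb hBf ih =>
      intro h
      refine ih fun f hf hfB => ?_
      set ψ : ContDiffBump (0 : ℝ × ℝ) := ⟨1, 2, one_pos, one_lt_two⟩ with hψ
      refine tendsto_nhds_unique (tendsto_const_nhds (x := defect P γ γ' I v f) (f := atTop (α := ℕ))) ?_
      refine (hG.tendsto_defect_bump hf b v ψ).congr fun k => ?_
      have hscale := contDiff_scale k b
      have hc : ContDiff ℝ 1 fun z : ℝ × ℝ => ((ψ (((k : ℝ) + 1) • (z - b)) : ℝ) : ℂ) :=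
        (contDiff_ofReal_comp (k := 1) ψ.contDiff).comp hscale
      have hc1 : ContDiff ℝ 1 fun z : ℝ × ℝ => 1 - ((ψ (((k : ℝ) + 1) • (z - b)) : ℝ) : ℂ) :=
        contDiff_const.sub hc
      have hz : defect P γ γ' I v (fun z => (1 - ((ψ (((k : ℝ) + 1) • (z - b)) : ℝ) : ℂ)) * f z) = 0 := by
        refine h _ (hf.mul_left hc1) fun z hz => ?_
        rw [mem_insert_iff]
        rintro (rfl | hzB)
        · have : (fun w => (1 - ((ψ (((k : ℝ) + 1) • (w - z)) : ℝ) : ℂ)) * f w) =ᶠ[𝓝 z] 0 := by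
            have h1 : ψ =ᶠ[𝓝 (((k : ℝ) + 1) • (z - z))] 1 := by
              rw [sub_self, smul_zero]; exact ψ.eventuallyEq_one
            filter_upwards [hscale.continuous.continuousAt.eventually h1] with w hw
            simp [hw]
          exact (notMem_tsupport_iff_eventuallyEq.2 this) hz
        · exact hfB z (tsupport_mul_subset_right hz) hzB
      have := hG.defect_add v (hf.mul_left hc) (hf.mul_left hc1)
      rw [hz, add_zero] at this
      rw [← this]
      congr 1; ext z; ring
  exact key _ hG.finite_bad (fun f hf h => hG.defect_eq_zero_of_local hf h v) f hf

end GreenData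

end Polypol

/-! ### Constancy of the boundary multiplicity along each arc. -/

namespace Polypol

open MeasureTheory Filter Topology Set

namespace GreenData

variable {P : Set (ℝ × ℝ)} {n : ℕ} {γ γ' : Fin n → ℝ → ℝ × ℝ} {I : Fin n → Set ℝ}
  {S : Fin n → Set (ℝ × ℝ)} {E : Set (ℝ × ℝ)}

theorem continuousOn_mult (hG : GreenData P γ γ' I S E) (j : Fin n) :
    ContinuousOn (mult P γ γ' I j) (regular γ' I j) := by
  intro τ hτ
  obtain ⟨m, -, h⟩ := hG.mult_locally_constant hτ.1 hτ.2
  refine ContinuousAt.continuousWithinAt ((continuousAt_const (y := m)).congr ?_)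
  filter_upwards [h] with s hs
  exact hs.2.symm

/-- Exact forms integrate to zero over the boundary. -/
theorem sum_integral_exact (hG : GreenData P γ γ' I S E) {φ : ℝ × ℝ → ℝ} (hφ : ContDiff ℝ 2 φ)
    (hc : HasCompactSupport φ) :
    ∑ j, ∫ τ in I j, (mult P γ γ' I j τ : ℂ) *
      fderiv ℝ (fun z => (φ z : ℂ)) (γ j τ) (γ' j τ) = 0 := by
  set f : ℝ × ℝ → ℂ := fun z => (φ z : ℂ) with hf
  have hf2 : ContDiff ℝ 2 f := contDiff_ofReal_comp (k := 2) hφ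
  have hfc : HasCompactSupport f := hc.comp_left Complex.ofReal_zero
  have ht : ∀ w : ℝ × ℝ, IsTest fun z => fderiv ℝ f z w := fun w =>
    ⟨(hf2.fderiv_right (m := 1) (by norm_num)).clm_apply contDiff_const, hfc.fderiv_apply ℝ w⟩
  -- The formula is used for the y-derivative of `φ` in direction x and for the x-derivative in
  -- direction y. The two area integrals agree by symmetry of second derivatives, and the difference
  -- of the boundary sides is the integral of dφ.
  have e1 := hG.defect_eq_zero (1, 0) (ht (0, 1))
  have e2 := hG.defect_eq_zero (0, 1) (ht (1, 0))
  rw [defect, sub_eq_zero] at e1 e2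
  have hsymm : ∀ z, fderiv ℝ (fun z => fderiv ℝ f z (0, 1)) z (1, 0) =
      fderiv ℝ (fun z => fderiv ℝ f z (1, 0)) z (0, 1) := by
    intro z
    have hd : DifferentiableAt ℝ (fderiv ℝ f) z :=
      (hf2.fderiv_right (m := 1) (by norm_num)).differentiable one_ne_zero z
    have h := (hf2.contDiffAt (x := z)).isSymmSndFDerivAt (by simp)
    rw [fderiv_clm_apply hd (differentiableAt_const _), fderiv_clm_apply hd (differentiableAt_const _)]
    simpa using h (1, 0) (0, 1)
  simp only [hsymm] at e1
  rw [e1] at e2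
  have e3 := sub_eq_zero.2 e2
  rw [boundaryIntegral, boundaryIntegral, ← Finset.sum_sub_distrib] at e3
  rw [← e3]
  refine Finset.sum_congr rfl fun j _ => ?_
  rw [← integral_sub (hG.integrableOn_mult j _ (ht _)) (hG.integrableOn_mult j _ (ht _))]
  congr 1; ext τ
  rw [fderiv_apply_prod]
  simp only [cross, dX, dY]
  push_cast
  ring

/-- At a critical parameter, such as a cusp, the arc need not have a tubular neighbourhood. Let
`m₁`, `m₂` be the multiplicities before and after it. For a bump `φ` equal to 1 at the point and
zero at the ends of the piece, the integral of dφ over the oriented boundary is `m₁ - m₂`, and exact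
forms integrate to zero. -/
theorem exists_mult_punctured (hG : GreenData P γ γ' I S E) {j : Fin n} {τ₀ : ℝ} (hτ₀ : τ₀ ∈ I j) :
    ∃ m : ℤ, (m = -1 ∨ m = 0 ∨ m = 1) ∧ ∀ᶠ τ in 𝓝[≠] τ₀, τ ∈ I j ∧ mult P γ γ' I j τ = m := by
  have hIn : I j ∈ 𝓝 τ₀ := (hG.isOpen j).mem_nhds hτ₀
  by_cases hreg : γ' j τ₀ ≠ 0
  · obtain ⟨m, hm, h⟩ := hG.mult_locally_constant hτ₀ hreg
    refine ⟨m, hm, ?_⟩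
    filter_upwards [nhdsWithin_le_nhds hIn, nhdsWithin_le_nhds h] with τ h1 h2
    exact ⟨h1, h2.2⟩
  have hpunct : ∀ᶠ τ in 𝓝 τ₀, τ ∈ I j ∧ (τ ≠ τ₀ → γ' j τ ≠ 0) := by
    have hfin : ({τ ∈ I j | γ' j τ = 0} \ {τ₀}).Finite := (hG.crit j).subset sdiff_subset
    filter_upwards [hIn, hfin.isClosed.isOpen_compl.mem_nhds (fun h => h.2 rfl)] with τ h1 h2
    exact ⟨h1, fun hne h0 => h2 ⟨⟨h1, h0⟩, hne⟩⟩
  obtain ⟨δ, hδ, hb⟩ := Metric.nhds_basis_closedBall.eventually_iff.1 hpunct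
  rw [Real.closedBall_eq_Icc] at hb
  have hconst : ∀ a b : ℝ, Ioo a b ⊆ Icc (τ₀ - δ) (τ₀ + δ) → τ₀ ∉ Ioo a b → a < b →
      ∃ m : ℤ, (m = -1 ∨ m = 0 ∨ m = 1) ∧ ∀ τ ∈ Ioo a b, mult P γ γ' I j τ = m := by
    intro a b hsub h0 hab
    have hsr : Ioo a b ⊆ regular γ' I j := fun τ hτ =>
      ⟨(hb (hsub hτ)).1, (hb (hsub hτ)).2 fun h => h0 (h ▸ hτ)⟩
    have hmid : (a + b) / 2 ∈ Ioo a b := ⟨by linarith, by linarith⟩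
    obtain ⟨m, hm, hm'⟩ := hG.mult_locally_constant (hsr hmid).1 (hsr hmid).2
    refine ⟨m, hm, fun τ hτ => ?_⟩
    rw [← hm'.self_of_nhds.2]
    exact isPreconnected_Ioo.constant ((hG.continuousOn_mult j).mono hsr) hτ hmid
  obtain ⟨m₁, hm₁, h₁⟩ := hconst (τ₀ - δ) τ₀ (Ioo_subset_Icc_self.trans (Icc_subset_Icc_right (by linarith)))
    (by simp) (by linarith)
  obtain ⟨m₂, hm₂, h₂⟩ := hconst τ₀ (τ₀ + δ) (Ioo_subset_Icc_self.trans (Icc_subset_Icc_left (by linarith)))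
    (by simp) (by linarith)
  have hN : Ioo (τ₀ - δ) (τ₀ + δ) ∈ 𝓝 τ₀ := Ioo_mem_nhds (by linarith) (by linarith)
  obtain ⟨φ, hφ2, hφc, htest, hsupp, -, -, hφ1⟩ := exists_test (hG.eventually_nhds hτ₀ hN)
  have hex := hG.sum_integral_exact hφ2 hφc
  set f : ℝ × ℝ → ℂ := fun z => (φ z : ℂ) with hf
  have hfd : ∀ z, z ∉ tsupport φ → fderiv ℝ f z = 0 := by
    intro z hz
    refine image_eq_zero_of_notMem_tsupport fun h => hz ?_
    have := tsupport_fderiv_subset ℝ h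
    refine closure_mono ?_ this
    intro w hw
    simpa [hf] using hw
  have hzero : ∀ i, ∀ τ ∈ I i, ¬(i = j ∧ τ ∈ Ioo (τ₀ - δ) (τ₀ + δ)) → γ i τ ∉ tsupport φ := by
    intro i τ hτ hn h
    exact hn ((hsupp h).2 i τ hτ rfl)
  set h : ℝ → ℂ := fun τ => fderiv ℝ f (γ j τ) (γ' j τ) with hh
  have hder : ∀ τ ∈ I j, HasDerivAt (fun t => f (γ j t)) (h τ) τ := fun τ hτ =>
    (htest.differentiable (γ j τ)).hasFDerivAt.comp_hasDerivAt τ (hG.hasDerivAt j τ hτ)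
  have hcont : ContinuousOn h (I j) :=
    ((htest.contDiff.continuous_fderiv one_ne_zero).comp_continuousOn
      (hG.continuousOn_curve j)).clm_apply (hG.continuousOn j)
  have hIcc : Icc (τ₀ - δ) (τ₀ + δ) ⊆ I j := fun τ hτ => (hb hτ).1
  have hftc : ∀ a b, a ≤ b → Icc a b ⊆ Icc (τ₀ - δ) (τ₀ + δ) →
      IntegrableOn h (Ioo a b) ∧ ∫ τ in Ioo a b, h τ = f (γ j b) - f (γ j a) := by
    intro a b hab hsub
    have hc := hcont.mono (hsub.trans hIcc)
    refine ⟨(hc.integrableOn_compact isCompact_Icc).mono_set Ioo_subset_Icc_self, ?_⟩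
    rw [← integral_Ioc_eq_integral_Ioo, ← intervalIntegral.integral_of_le hab]
    refine intervalIntegral.integral_eq_sub_of_hasDerivAt (f := fun t => f (γ j t)) ?_ ?_
    · intro τ hτ; rw [uIcc_of_le hab] at hτ; exact hder τ (hIcc (hsub hτ))
    · exact ContinuousOn.intervalIntegrable (by rwa [uIcc_of_le hab])
  have hend : ∀ τ ∈ Icc (τ₀ - δ) (τ₀ + δ), τ ∉ Ioo (τ₀ - δ) (τ₀ + δ) → f (γ j τ) = 0 := by
    intro τ hτ hn
    have := image_eq_zero_of_notMem_tsupport (hzero j τ (hIcc hτ) fun h => hn h.2)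
    simp [hf, this]
  rw [Finset.sum_eq_single j] at hex
  · rw [setIntegral_eq_of_subset_of_forall_sdiff_eq_zero (hG.isOpen j).measurableSet
      (Ioo_subset_Icc_self.trans hIcc) (fun τ hτ => by
        rw [hfd _ (hzero j τ hτ.1 fun h => hτ.2 h.2)]; simp)] at hex
    have hsplit : ∫ τ in Ioo (τ₀ - δ) (τ₀ + δ), (mult P γ γ' I j τ : ℂ) * h τ =
        ∫ τ in Ioo (τ₀ - δ) τ₀ ∪ Ioo τ₀ (τ₀ + δ), (mult P γ γ' I j τ : ℂ) * h τ := by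
      refine setIntegral_congr_set ?_
      have : ∀ᵐ τ : ℝ, τ ≠ τ₀ := by rw [ae_iff]; simp
      filter_upwards [this] with τ hτ
      refine propext ⟨fun ht => ?_, fun ht => ?_⟩
      · rcases lt_or_gt_of_ne hτ with h | h
        · exact Or.inl ⟨ht.1, h⟩
        · exact Or.inr ⟨h, ht.2⟩
      · rcases ht with h | h
        · exact ⟨h.1, by linarith [h.2]⟩
        · exact ⟨by linarith [h.1], h.2⟩
    obtain ⟨i1, f1⟩ := hftc (τ₀ - δ) τ₀ (by linarith) (Icc_subset_Icc_right (by linarith))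
    obtain ⟨i2, f2⟩ := hftc τ₀ (τ₀ + δ) (by linarith) (Icc_subset_Icc_left (by linarith))
    have g1 : EqOn (fun τ => (mult P γ γ' I j τ : ℂ) * h τ) (fun τ => (m₁ : ℂ) * h τ) (Ioo (τ₀ - δ) τ₀) :=
      fun τ hτ => by simp only [h₁ τ hτ]
    have g2 : EqOn (fun τ => (mult P γ γ' I j τ : ℂ) * h τ) (fun τ => (m₂ : ℂ) * h τ) (Ioo τ₀ (τ₀ + δ)) :=
      fun τ hτ => by simp only [h₂ τ hτ]
    rw [show (∫ τ in Ioo (τ₀ - δ) (τ₀ + δ), (mult P γ γ' I j τ : ℂ) * fderiv ℝ f (γ j τ) (γ' j τ)) =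
      ∫ τ in Ioo (τ₀ - δ) (τ₀ + δ), (mult P γ γ' I j τ : ℂ) * h τ from rfl, hsplit,
      setIntegral_union _ measurableSet_Ioo ((integrableOn_congr_fun g1 measurableSet_Ioo).2 (i1.const_mul _))
        ((integrableOn_congr_fun g2 measurableSet_Ioo).2 (i2.const_mul _)),
      setIntegral_congr_fun measurableSet_Ioo g1, setIntegral_congr_fun measurableSet_Ioo g2,
      integral_const_mul, integral_const_mul, f1, f2, hend (τ₀ - δ) ⟨le_rfl, by linarith⟩ (by simp),
      hend (τ₀ + δ) ⟨by linarith, le_rfl⟩ (by simp)] at hex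
    · have hval : f (γ j τ₀) = 1 := by simp [hf, hφ1]
      rw [hval] at hex
      have hmm : m₁ = m₂ := by
        have : (m₁ : ℂ) = m₂ := by linear_combination hex
        exact_mod_cast this
      refine ⟨m₁, hm₁, ?_⟩
      filter_upwards [nhdsWithin_le_nhds hN, self_mem_nhdsWithin] with τ hτ hne
      refine ⟨hIcc (Ioo_subset_Icc_self hτ), ?_⟩
      rcases lt_or_gt_of_ne hne with h | h
      · exact h₁ τ ⟨hτ.1, h⟩
      · rw [hmm]; exact h₂ τ ⟨h, hτ.2⟩
    · exact disjoint_left.2 fun τ h1 h2 => lt_asymm h1.2 h2.1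
  · intro i _ hij
    refine setIntegral_eq_zero_of_forall_eq_zero fun τ hτ => ?_
    rw [hfd _ (hzero i τ hτ fun h => hij h.1)]; simp
  · simp

/-- The punctured limits of the multiplicity form a locally constant function on the whole parameter
interval, critical parameters included, and the interval is connected. -/
theorem exists_mult_eq (hG : GreenData P γ γ' I S E) (j : Fin n) :
    ∃ σ : ℤ, (σ = -1 ∨ σ = 0 ∨ σ = 1) ∧ ∀ τ ∈ regular γ' I j, mult P γ γ' I j τ = σ := by
  rcases (I j).eq_empty_or_nonempty with hemp | ⟨τ₁, hτ₁⟩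
  · exact ⟨0, by simp, fun τ hτ => by have := hτ.1; rw [hemp] at this; exact this.elim⟩
  choose! g hg1 hg2 using fun τ (hτ : τ ∈ I j) => hG.exists_mult_punctured hτ
  have hgc : ContinuousOn g (I j) := by
    intro τ hτ
    refine ContinuousAt.continuousWithinAt ((continuousAt_const (y := g τ)).congr ?_)
    have h1 := hg2 τ hτ
    rw [eventually_nhdsWithin_iff] at h1
    filter_upwards [h1.eventually_nhds] with s hs
    by_cases hst : s = τ
    · rw [hst]
    · have hs1 := hs.self_of_nhds hst
      have hne : ∀ᶠ s' in 𝓝[≠] s, s' ≠ τ := nhdsWithin_le_nhds (isOpen_ne.mem_nhds hst)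
      obtain ⟨s', a1, a2, a3⟩ := ((hg2 s hs1.1).and (hne.and (nhdsWithin_le_nhds hs))).exists
      rw [← a1.2, ← (a3 a2).2]
  refine ⟨g τ₁, hg1 τ₁ hτ₁, fun τ hτ => ?_⟩
  rw [(hG.isPreconnected j).constant hgc hτ₁ hτ.1]
  obtain ⟨m, -, hm⟩ := hG.mult_locally_constant hτ.1 hτ.2
  obtain ⟨s', a1, a2⟩ := ((hg2 τ hτ.1).and (nhdsWithin_le_nhds hm)).exists
  rw [hm.self_of_nhds.2, ← a2.2, a1.2]

/-- **Green formula** for a plane domain bounded by finitely many arcs. -/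
theorem green (hG : GreenData P γ γ' I S E) :
    ∃ σ : Fin n → ℤ, (∀ j, σ j = -1 ∨ σ j = 0 ∨ σ j = 1) ∧
      (∀ f, IsTest f → ∀ v : ℝ × ℝ, ∫ z in P, fderiv ℝ f z v =
        ∑ j, (σ j : ℂ) * ∫ τ in I j, ((cross v (γ' j τ) : ℝ) : ℂ) * f (γ j τ)) ∧
      ∀ j, ∀ τ ∈ I j, ∀ e : ℝ × ℝ, 0 < cross (γ' j τ) e →
        ∀ᶠ s : ℝ in 𝓝[>] 0, (γ j τ + s • e ∈ P → γ j τ - s • e ∉ P → σ j = 1) ∧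
          (γ j τ + s • e ∉ P → γ j τ - s • e ∈ P → σ j = -1) := by
  choose σ hσ hσ' using hG.exists_mult_eq
  refine ⟨σ, hσ, fun f hf v => ?_, fun j τ hτ e he => ?_⟩
  · have h := hG.defect_eq_zero v hf
    rw [defect, sub_eq_zero] at h
    rw [h, boundaryIntegral]
    refine Finset.sum_congr rfl fun j _ => ?_
    rw [← integral_const_mul]
    refine integral_congr_ae ?_
    filter_upwards [hG.ae_regular j] with τ hτ
    simp only [hσ' j τ hτ, mul_assoc]
  · obtain ⟨m, -, hl, hs⟩ := hG.exists_localMult hτ he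
    have hreg : γ' j τ ≠ 0 := by
      rintro h
      rw [h] at he
      simp [cross] at he
    have : σ j = m := by
      rw [← hσ' j τ ⟨hτ, hreg⟩]; exact hG.mult_eq hτ hreg hl.self_of_nhds
    rw [this]; exact hs

end GreenData

end Polypol

namespace Polypol

open MeasureTheory Filter Topology Set

/-! ### Polynomials near infinity -/

theorem eval_reflect_inv {K : Type*} [Field K] {Q : K[X]} {d : ℕ} (hQ : Q.natDegree ≤ d) {τ : K}
    (hτ : τ ≠ 0) : Q.eval τ = τ ^ d * (reflect d Q).eval τ⁻¹ := by
  let := invertibleOfNonzero hτ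
  have h := eval₂_reflect_mul_pow (RingHom.id K) τ d Q hQ
  rw [invOf_eq_inv] at h
  rw [← eval₂_id (p := Q), ← eval₂_id (p := reflect d Q), ← h, mul_comm]

/-- The weight `√(1 + τ²)`, comparable to the size of a linear binary form. -/
noncomputable def weight (τ : ℝ) : ℝ := √(1 + τ ^ 2)

theorem weight_sq (τ : ℝ) : weight τ ^ 2 = 1 + τ ^ 2 := Real.sq_sqrt (by positivity)

theorem one_le_weight (τ : ℝ) : 1 ≤ weight τ :=
  Real.one_le_sqrt.2 (by linarith [sq_nonneg τ])

theorem weight_pos (τ : ℝ) : 0 < weight τ := one_pos.trans_le (one_le_weight τ)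

theorem abs_le_weight (τ : ℝ) : |τ| ≤ weight τ := Real.abs_le_sqrt (by linarith)

theorem continuous_weight : Continuous weight := by unfold weight; fun_prop

theorem exists_norm_eval_le (Q : ℂ[X]) {d : ℕ} (hQ : Q.natDegree ≤ d) :
    ∃ C, ∀ τ : ℝ, ‖Q.eval (τ : ℂ)‖ ≤ C * weight τ ^ d := by
  refine ⟨∑ i ∈ Finset.range (d + 1), ‖Q.coeff i‖, fun τ => ?_⟩
  rw [eval_eq_sum_range' (Nat.lt_succ_of_le hQ), Finset.sum_mul]
  refine norm_sum_le_of_le _ fun i hi => ?_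
  rw [norm_mul, norm_pow, Complex.norm_real, Real.norm_eq_abs]
  refine mul_le_mul_of_nonneg_left ?_ (norm_nonneg _)
  exact (pow_le_pow_left₀ (abs_nonneg _) (abs_le_weight τ) i).trans
    (pow_le_pow_right₀ (one_le_weight τ) (by have := Finset.mem_range.1 hi; omega))

theorem tendsto_inv_cocompact : Tendsto (fun τ : ℝ => τ⁻¹) (cocompact ℝ) (𝓝 0) := by
  rw [← Metric.cobounded_eq_cocompact]; exact tendsto_inv₀_cobounded

theorem eventually_ne_zero_cocompact : ∀ᶠ τ : ℝ in cocompact ℝ, τ ≠ 0 := by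
  filter_upwards [(isCompact_singleton (x := (0 : ℝ))).compl_mem_cocompact] with τ hτ using hτ

/-- In the coordinate 1/τ the binary form is given by the reflected polynomial, whose value at 0 is
the `d`-th coefficient. -/
theorem tendsto_eval_div_pow (Q : ℂ[X]) {d : ℕ} (hQ : Q.natDegree ≤ d) :
    Tendsto (fun τ : ℝ => Q.eval (τ : ℂ) / (τ : ℂ) ^ d) (cocompact ℝ) (𝓝 (Q.coeff d)) := by
  have h0 : (reflect d Q).eval 0 = Q.coeff d := by
    rw [← coeff_zero_eq_eval_zero, coeff_reflect, revAt_le (Nat.zero_le d), Nat.sub_zero]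
  have h1 : Tendsto (fun τ : ℝ => (reflect d Q).eval (((τ⁻¹ : ℝ)) : ℂ)) (cocompact ℝ)
      (𝓝 ((reflect d Q).eval ((0 : ℝ) : ℂ))) :=
    (((reflect d Q).continuous.comp Complex.continuous_ofReal).tendsto 0).comp
      tendsto_inv_cocompact
  rw [Complex.ofReal_zero, h0] at h1
  refine h1.congr' ?_
  filter_upwards [eventually_ne_zero_cocompact] with τ hτ
  have hτ' : (τ : ℂ) ≠ 0 := by exact_mod_cast hτ
  rw [eval_reflect_inv hQ hτ', Complex.ofReal_inv, mul_div_cancel_left₀ _ (pow_ne_zero _ hτ')]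

/-- The quotient of `‖L‖` by `weight ^ d` extends continuously to the real projective line, with the
norm of the `d`-th coefficient as its value at infinity. It has no zero there, and the line is
compact. -/
theorem exists_le_norm_eval {L : ℂ[X]} {d : ℕ} (hL : L.natDegree ≤ d)
    (h0 : ∀ τ : ℝ, L.eval (τ : ℂ) ≠ 0) (hd : L.coeff d ≠ 0) :
    ∃ ε > 0, ∀ τ : ℝ, ε * weight τ ^ d ≤ ‖L.eval (τ : ℂ)‖ := by
  have h1 : Tendsto (fun τ : ℝ => |τ| / weight τ) (cocompact ℝ) (𝓝 1) := by
    have : Tendsto (fun τ : ℝ => (weight τ⁻¹)⁻¹) (cocompact ℝ) (𝓝 (weight 0)⁻¹) :=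
      ((continuous_weight.tendsto 0).comp tendsto_inv_cocompact).inv₀ (weight_pos 0).ne'
    rw [show weight 0 = 1 by simp [weight], inv_one] at this
    refine this.congr' ?_
    filter_upwards [eventually_ne_zero_cocompact] with τ hτ
    have ha : 0 < |τ| := abs_pos.2 hτ
    rw [inv_eq_one_div, div_eq_div_iff (weight_pos _).ne' (weight_pos _).ne', one_mul, weight,
      weight, ← Real.sqrt_sq_eq_abs, ← Real.sqrt_mul (sq_nonneg τ)]
    congr 1
    field_simp
    ring
  have h2 : Tendsto (fun τ : ℝ => ‖L.eval (τ : ℂ)‖ / weight τ ^ d) (cocompact ℝ)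
      (𝓝 ‖L.coeff d‖) := by
    have := (tendsto_eval_div_pow L hL).norm.mul (h1.pow d)
    rw [one_pow, mul_one] at this
    refine this.congr' ?_
    filter_upwards [eventually_ne_zero_cocompact] with τ hτ
    have ha : 0 < |τ| := abs_pos.2 hτ
    have := weight_pos τ
    rw [norm_div, norm_pow, Complex.norm_real, Real.norm_eq_abs, div_pow]
    field_simp
  have hcont : Continuous fun τ : ℝ => ‖L.eval (τ : ℂ)‖ / weight τ ^ d :=
    ((L.continuous.comp Complex.continuous_ofReal).norm).div (continuous_weight.pow d)
      fun τ => (pow_pos (weight_pos τ) d).ne'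
  have hK := h2.isCompact_insert_range_of_cocompact hcont
  obtain ⟨m, hm, hmin⟩ := hK.exists_isMinOn ⟨_, mem_insert _ _⟩ continuousOn_id
  refine ⟨m, ?_, fun τ => ?_⟩
  · rcases hm with rfl | ⟨τ, rfl⟩
    · exact norm_pos_iff.2 hd
    · exact div_pos (norm_pos_iff.2 (h0 τ)) (pow_pos (weight_pos τ) d)
  · rw [← le_div_iff₀ (pow_pos (weight_pos τ) d)]
    exact hmin (mem_insert_of_mem _ ⟨τ, rfl⟩)

theorem integrable_inv_weight_sq : Integrable fun τ : ℝ => (weight τ ^ 2)⁻¹ := by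
  simp only [weight_sq]; exact integrable_inv_one_add_sq

/-- The terms of degree `d` cancel. For a binary form with dehomogenization `Q` this is its partial
derivative in the second variable, by Euler's relation. -/
theorem natDegree_euler_le {K : Type*} [CommRing K] {Q : K[X]} {d : ℕ} (hQ : Q.natDegree ≤ d) :
    ((d : K[X]) * Q - X * derivative Q).natDegree ≤ d - 1 := by
  refine natDegree_le_iff_coeff_eq_zero.2 fun k hk => ?_
  rw [coeff_sub, ← C_eq_natCast, coeff_C_mul]
  rcases k with _ | k
  · rw [Nat.le_zero.1 (by omega : d ≤ 0)] at *; simp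
  · rw [coeff_X_mul, coeff_derivative]
    rcases lt_or_ge d (k + 1) with h | h
    · rw [coeff_eq_zero_of_natDegree_lt (hQ.trans_lt h)]; simp
    · have : d = k + 1 := by omega
      rw [this]; push_cast; ring

/-- The bound is one better than the naive count. Up to the factor `d`, the Wronskian is a
determinant of partial derivatives of binary forms, each of degree `d - 1`. This gives the decay of
order τ⁻² which makes the differential regular at the parameter ∞. -/
theorem natDegree_wronskian_le {K : Type*} [Field K] [CharZero K] {f g : K[X]} {d : ℕ}
    (hf : f.natDegree ≤ d) (hg : g.natDegree ≤ d) :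
    (derivative f * g - f * derivative g).natDegree ≤ 2 * d - 2 := by
  rcases Nat.eq_zero_or_pos d with rfl | hd
  · rw [natDegree_eq_zero.1 (Nat.le_zero.1 hf) |>.choose_spec.symm,
      natDegree_eq_zero.1 (Nat.le_zero.1 hg) |>.choose_spec.symm]
    simp
  have hd' : (d : K) ≠ 0 := by exact_mod_cast hd.ne'
  have h : C (d : K) * (derivative f * g - f * derivative g) =
      derivative f * ((d : K[X]) * g - X * derivative g) -
      derivative g * ((d : K[X]) * f - X * derivative f) := by
    rw [C_eq_natCast]; ring
  rw [← natDegree_C_mul hd', h]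
  have h1 : (derivative f).natDegree ≤ d - 1 := (natDegree_derivative_le f).trans (by omega)
  have h2 : (derivative g).natDegree ≤ d - 1 := (natDegree_derivative_le g).trans (by omega)
  refine natDegree_sub_le_of_le (natDegree_mul_le_of_le h1 (natDegree_euler_le hg) |>.trans ?_)
    (natDegree_mul_le_of_le h2 (natDegree_euler_le hf) |>.trans ?_) |>.trans (max_self _).le <;> omega

/-! ### Rational arcs -/

namespace RationalCurve

variable (C : RationalCurve)

theorem natDegree_X_le : C.X.natDegree ≤ C.degree := le_max_left _ _
theorem natDegree_Y_le : C.Y.natDegree ≤ C.degree := (le_max_left _ _).trans (le_max_right _ _)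
theorem natDegree_Z_le : C.Z.natDegree ≤ C.degree := (le_max_right _ _).trans (le_max_right _ _)

/-- The derivative of the parametrization. -/
noncomputable def velocity (τ : ℝ) : ℝ × ℝ :=
  ((derivative C.X * C.Z - C.X * derivative C.Z).eval τ / C.Z.eval τ ^ 2,
    (derivative C.Y * C.Z - C.Y * derivative C.Z).eval τ / C.Z.eval τ ^ 2)

theorem hasDerivAt_point {τ : ℝ} (h : C.Z.eval τ ≠ 0) :
    HasDerivAt C.point (C.velocity τ) τ := by
  have h1 := (C.X.hasDerivAt τ).div (C.Z.hasDerivAt τ) h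
  have h2 := (C.Y.hasDerivAt τ).div (C.Z.hasDerivAt τ) h
  refine (h1.prodMk h2).congr_deriv ?_
  simp [velocity]

theorem continuousAt_velocity {τ : ℝ} (h : C.Z.eval τ ≠ 0) : ContinuousAt C.velocity τ := by
  refine ContinuousAt.prodMk ?_ ?_ <;>
  exact (Polynomial.continuous _).continuousAt.div ((Polynomial.continuous _).continuousAt.pow 2)
    (pow_ne_zero 2 h)

theorem natDegree_lineForm_le (p : ℂ × ℂ) : (C.lineForm p).natDegree ≤ C.degree := by
  unfold lineForm
  have hm : ∀ Q : ℝ[X], Q.natDegree ≤ C.degree → (Q.map (algebraMap ℝ ℂ)).natDegree ≤ C.degree :=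
    fun Q h => natDegree_map_le.trans h
  exact (natDegree_sub_le_of_le (natDegree_sub_le_of_le (hm _ C.natDegree_Z_le)
    ((natDegree_C_mul_le _ _).trans (hm _ C.natDegree_X_le)))
    ((natDegree_C_mul_le _ _).trans (hm _ C.natDegree_Y_le))).trans (by simp)

theorem eval_map_ofReal (Q : ℝ[X]) (τ : ℝ) :
    (Q.map (algebraMap ℝ ℂ)).eval (τ : ℂ) = ((Q.eval τ : ℝ) : ℂ) := by
  rw [eval_map, eval₂_at_apply_ofReal]
where
  eval₂_at_apply_ofReal : eval₂ (algebraMap ℝ ℂ) (τ : ℂ) Q = ((Q.eval τ : ℝ) : ℂ) := by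
    have := eval₂_at_apply (p := Q) (algebraMap ℝ ℂ) τ
    exact this

theorem eval_lineForm (p : ℂ × ℂ) (τ : ℂ) : (C.lineForm p).eval τ =
    (C.Z.map (algebraMap ℝ ℂ)).eval τ - p.1 * (C.X.map (algebraMap ℝ ℂ)).eval τ
      - p.2 * (C.Y.map (algebraMap ℝ ℂ)).eval τ := by
  simp [lineForm]

theorem eval_lineForm_ofReal (p : ℂ × ℂ) {τ : ℝ} (h : C.Z.eval τ ≠ 0) :
    (C.lineForm p).eval (τ : ℂ) = ((C.Z.eval τ : ℝ) : ℂ) *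
      (1 - p.1 * ((C.point τ).1 : ℂ) - p.2 * ((C.point τ).2 : ℂ)) := by
  have : ((C.Z.eval τ : ℝ) : ℂ) ≠ 0 := by exact_mod_cast h
  rw [eval_lineForm, eval_map_ofReal, eval_map_ofReal, eval_map_ofReal]
  simp only [point, Complex.ofReal_div]
  field_simp

theorem coeff_lineForm (p : ℂ × ℂ) (k : ℕ) : (C.lineForm p).coeff k =
    (C.Z.coeff k : ℂ) - p.1 * (C.X.coeff k : ℂ) - p.2 * (C.Y.coeff k : ℂ) := by
  simp [lineForm]

theorem coeff_degree_lineForm (p : ℂ × ℂ) (h : C.Z.coeff C.degree ≠ 0) :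
    (C.lineForm p).coeff C.degree = (C.Z.coeff C.degree : ℂ) *
      (1 - p.1 * (C.pointAtInfinity.1 : ℂ) - p.2 * (C.pointAtInfinity.2 : ℂ)) := by
  have : (C.Z.coeff C.degree : ℂ) ≠ 0 := by exact_mod_cast h
  rw [coeff_lineForm]
  simp only [pointAtInfinity, Complex.ofReal_div]
  field_simp

theorem tendsto_point (h : C.Z.coeff C.degree ≠ 0) :
    Tendsto C.point (cocompact ℝ) (𝓝 C.pointAtInfinity) := by
  have key : ∀ Q : ℝ[X], Q.natDegree ≤ C.degree →
      Tendsto (fun τ : ℝ => Q.eval τ / C.Z.eval τ) (cocompact ℝ)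
        (𝓝 (Q.coeff C.degree / C.Z.coeff C.degree)) := by
    have aux : ∀ Q : ℝ[X], Q.natDegree ≤ C.degree →
        Tendsto (fun τ : ℝ => Q.eval τ / τ ^ C.degree) (cocompact ℝ) (𝓝 (Q.coeff C.degree)) := by
      intro Q hQ
      have := tendsto_eval_div_pow (Q.map (algebraMap ℝ ℂ)) (natDegree_map_le.trans hQ)
      have h2 := (Complex.continuous_re.tendsto _).comp this
      rw [coeff_map] at h2
      refine h2.congr fun τ => ?_
      simp only [Function.comp_apply, eval_map_ofReal]
      rw [← Complex.ofReal_pow, ← Complex.ofReal_div, Complex.ofReal_re]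
    intro Q hQ
    refine ((aux Q hQ).div (aux _ C.natDegree_Z_le) h).congr' ?_
    filter_upwards [eventually_ne_zero_cocompact] with τ hτ
    exact div_div_div_cancel_right₀ (pow_ne_zero _ hτ) _ _
  exact (key _ C.natDegree_X_le).prodMk_nhds (key _ C.natDegree_Y_le)

end RationalCurve

namespace RationalArc

variable (γ : RationalArc)

/-- The interior of the parameter interval. -/
def openInterval : Set ℝ :=
  match γ.ends with
  | some e => Ioo e.1 e.2
  | none => univ

/-- Both shapes of an arc are unpacked here once, so that later arguments need not reduce the
`match` in the definitions. -/
theorem cases_ends : (∃ a b, γ.ends = some (a, b) ∧ a < b ∧ γ.interval = Icc a b ∧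
      γ.openInterval = Ioo a b ∧ γ.support = γ.point '' Icc a b ∧
      γ.endpoints = {γ.point a, γ.point b} ∧ (∀ τ ∈ Icc a b, γ.Z.eval τ ≠ 0) ∧
      InjOn γ.point (Ico a b) ∧ InjOn γ.point (Ioc a b)) ∨
    (γ.ends = none ∧ γ.interval = univ ∧ γ.openInterval = univ ∧
      γ.support = range γ.point ∪ {γ.pointAtInfinity} ∧ γ.endpoints = ∅ ∧
      (∀ τ : ℝ, γ.Z.eval τ ≠ 0) ∧ γ.Z.coeff γ.degree ≠ 0 ∧ Function.Injective γ.point ∧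
      ∀ τ : ℝ, γ.point τ ≠ γ.pointAtInfinity) := by
  rcases γ with ⟨C, _ | ⟨a, b⟩, h3, h1, h2⟩
  · exact Or.inr ⟨rfl, rfl, rfl, rfl, rfl, h1.1, h1.2, h2.1, h2.2⟩
  · exact Or.inl ⟨a, b, rfl, h3 (a, b) rfl, rfl, rfl, rfl, rfl, h1, h2.1, h2.2⟩

theorem openInterval_subset : γ.openInterval ⊆ γ.interval := by
  rcases γ.cases_ends with ⟨a, b, -, -, h1, h2, -⟩ | ⟨-, h1, h2, -⟩ <;> rw [h1, h2]
  exact Ioo_subset_Icc_self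

theorem eval_Z_ne_zero {τ : ℝ} (hτ : τ ∈ γ.interval) : γ.Z.eval τ ≠ 0 := by
  rcases γ.cases_ends with ⟨a, b, -, -, h1, -, -, -, h, -⟩ | ⟨-, h1, -, -, -, h, -⟩
  · exact h τ (h1 ▸ hτ)
  · exact h τ

theorem point_mem_support {τ : ℝ} (hτ : τ ∈ γ.interval) : γ.point τ ∈ γ.support := by
  rcases γ.cases_ends with ⟨a, b, -, -, h1, -, h, -⟩ | ⟨-, h1, -, h, -⟩ <;> rw [h]
  · exact ⟨τ, h1 ▸ hτ, rfl⟩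
  · exact Or.inl ⟨τ, rfl⟩

theorem isOpen_openInterval : IsOpen γ.openInterval := by
  rcases γ.cases_ends with ⟨a, b, -, -, -, h, -⟩ | ⟨-, -, h, -⟩ <;> rw [h]
  exacts [isOpen_Ioo, isOpen_univ]

theorem isPreconnected_openInterval : IsPreconnected γ.openInterval := by
  rcases γ.cases_ends with ⟨a, b, -, -, -, h, -⟩ | ⟨-, -, h, -⟩ <;> rw [h]
  exacts [isPreconnected_Ioo, isPreconnected_univ]

theorem continuousOn_point : ContinuousOn γ.point γ.interval := fun _ hτ =>
  (γ.hasDerivAt_point (γ.eval_Z_ne_zero hτ)).continuousAt.continuousWithinAt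

theorem injOn_point : InjOn γ.point γ.openInterval := by
  rcases γ.cases_ends with ⟨a, b, -, -, -, h, -, -, -, hi, -⟩ | ⟨-, -, h, -, -, -, -, hi, -⟩ <;> rw [h]
  exacts [hi.mono Ioo_subset_Ico_self, hi.injOn]

theorem point_notMem_endpoints {τ : ℝ} (hτ : τ ∈ γ.openInterval) : γ.point τ ∉ γ.endpoints := by
  rcases γ.cases_ends with ⟨a, b, -, hab, -, h, -, he, -, h1, h2⟩ | ⟨-, -, -, -, h, -⟩
  · rw [he]
    rw [h] at hτ
    rintro (h0 | h0)
    · exact hτ.1.ne' (h1 (Ioo_subset_Ico_self hτ) (left_mem_Ico.2 hab) h0)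
    · exact hτ.2.ne (h2 (Ioo_subset_Ioc_self hτ) (right_mem_Ioc.2 hab) h0)
  · rw [h]; simp

/-- The part of the arc away from an interior parameter is closed. -/
theorem exists_isClosed_of_mem {τ : ℝ} (hτ : τ ∈ γ.openInterval) {N : Set ℝ} (hN : IsOpen N)
    (hτN : τ ∈ N) :
    ∃ F, IsClosed F ∧ γ.point τ ∉ F ∧ γ.support ⊆ γ.point '' N ∪ F := by
  rcases γ.cases_ends with ⟨a, b, -, hab, hI, h, hs, he, -, h1, h2⟩ | ⟨-, -, h, hs, -, hz, hzd, hi, hinf⟩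
  · refine ⟨γ.point '' (Icc a b \ N), ?_, ?_, ?_⟩
    · exact ((isCompact_Icc.diff hN).image_of_continuousOn
        ((hI ▸ γ.continuousOn_point).mono sdiff_subset)).isClosed
    · rintro ⟨s, ⟨hs1, hs2⟩, hs3⟩
      rw [h] at hτ
      rcases hs1.2.eq_or_lt with rfl | hlt
      · exact γ.point_notMem_endpoints (h ▸ hτ) (by rw [he, ← hs3]; simp)
      · exact hs2 ((h1 ⟨hs1.1, hlt⟩ (Ioo_subset_Ico_self hτ) hs3) ▸ hτN)
    · rw [hs, ← image_union]
      exact image_mono fun s hs => by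
        by_cases h : s ∈ N
        exacts [Or.inl h, Or.inr ⟨hs, h⟩]
  · have hc : Continuous γ.point :=
      continuous_iff_continuousAt.2 fun s => (γ.hasDerivAt_point (hz s)).continuousAt
    have hemb : IsClosedEmbedding (Subtype.val : ↥(Nᶜ) → ℝ) := hN.isClosed_compl.isClosedEmbedding_subtypeVal
    have hK := ((γ.tendsto_point hzd).comp hemb.tendsto_cocompact).isCompact_insert_range_of_cocompact
      (hc.comp continuous_subtype_val)
    refine ⟨_, hK.isClosed, ?_, ?_⟩
    · rintro (h0 | ⟨s, h0⟩)
      · exact hinf τ h0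
      · exact s.2 ((hi h0) ▸ hτN)
    · rw [hs]
      rintro z (⟨s, rfl⟩ | hz)
      · by_cases hsN : s ∈ N
        · exact Or.inl ⟨s, hsN, rfl⟩
        · exact Or.inr (Or.inr ⟨⟨s, hsN⟩, rfl⟩)
      · exact Or.inr (Or.inl hz)

theorem isClosed_support : IsClosed γ.support := by
  rcases γ.cases_ends with ⟨a, b, -, hab, hI, -, hs, -⟩ | ⟨-, -, -, hs, -, hz, hzd, -⟩
  · rw [hs]
    exact (isCompact_Icc.image_of_continuousOn (hI ▸ γ.continuousOn_point)).isClosed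
  · rw [hs, union_singleton]
    exact ((γ.tendsto_point hzd).isCompact_insert_range_of_cocompact
      (continuous_iff_continuousAt.2 fun s => (γ.hasDerivAt_point (hz s)).continuousAt)).isClosed

theorem proper {τ : ℝ} (hτ : τ ∈ γ.openInterval) {N : Set ℝ} (hN : N ∈ 𝓝 τ) :
    ∀ᶠ z in 𝓝 (γ.point τ), z ∈ γ.support → ∃ τ' ∈ N ∩ γ.openInterval, γ.point τ' = z := by
  obtain ⟨N', hN', hN'o, hτN⟩ := mem_nhds_iff.1 (inter_mem hN (γ.isOpen_openInterval.mem_nhds hτ))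
  obtain ⟨F, hF, hF1, hF2⟩ := γ.exists_isClosed_of_mem hτ hN'o hτN
  filter_upwards [hF.isOpen_compl.mem_nhds hF1] with z hz hzs
  rcases hF2 hzs with ⟨τ', h1, h2⟩ | h
  · exact ⟨τ', hN' h1, h2⟩
  · exact absurd h hz

/-- Critical parameters are common zeros of two Wronskians. If both vanished identically, the point
would be constant on the parameter interval, contradicting simplicity of the arc. -/
theorem crit_finite : {τ ∈ γ.openInterval | γ.velocity τ = 0}.Finite := by
  by_cases hc : derivative γ.X * γ.Z - γ.X * derivative γ.Z = 0 ∧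
      derivative γ.Y * γ.Z - γ.Y * derivative γ.Z = 0
  · exfalso
    have h0 : ∀ τ ∈ γ.openInterval, HasDerivAt γ.point 0 τ := fun τ hτ => by
      have := γ.hasDerivAt_point (γ.eval_Z_ne_zero (γ.openInterval_subset hτ))
      rwa [RationalCurve.velocity, hc.1, hc.2, eval_zero, zero_div] at this
    obtain ⟨s, hs, t, ht, hst⟩ : ∃ s ∈ γ.openInterval, ∃ t ∈ γ.openInterval, s ≠ t := by
      rcases γ.cases_ends with ⟨a, b, -, hab, -, h, -⟩ | ⟨-, -, h, -⟩ <;> rw [h]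
      · obtain ⟨c, hc⟩ := exists_between hab
        obtain ⟨c', hc'⟩ := exists_between hc.2
        exact ⟨c, hc, c', ⟨hc.1.trans hc'.1, hc'.2⟩, hc'.1.ne⟩
      · exact ⟨0, trivial, 1, trivial, zero_ne_one⟩
    exact hst (γ.injOn_point hs ht (γ.isOpen_openInterval.is_const_of_deriv_eq_zero
      γ.isPreconnected_openInterval
      (fun τ hτ => (h0 τ hτ).differentiableAt.differentiableWithinAt)
      (fun τ hτ => (h0 τ hτ).deriv) hs ht))
  · have key : ∀ τ ∈ γ.openInterval, γ.velocity τ = 0 →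
        (derivative γ.X * γ.Z - γ.X * derivative γ.Z).IsRoot τ ∧
        (derivative γ.Y * γ.Z - γ.Y * derivative γ.Z).IsRoot τ := by
      intro τ hτ h
      have hz := pow_ne_zero 2 (γ.eval_Z_ne_zero (γ.openInterval_subset hτ))
      rw [RationalCurve.velocity, Prod.mk_eq_zero] at h
      exact ⟨(div_eq_zero_iff.1 h.1).resolve_right hz, (div_eq_zero_iff.1 h.2).resolve_right hz⟩
    rw [not_and_or] at hc
    rcases hc with hc | hc
    · exact (finite_setOfPred_isRoot hc).subset fun τ hτ => (key τ hτ.1 hτ.2).1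
    · exact (finite_setOfPred_isRoot hc).subset fun τ hτ => (key τ hτ.1 hτ.2).2

end RationalArc

end Polypol

namespace Polypol

open MeasureTheory Filter Topology Set

/-! ### Integrals of rational functions along an arc -/

/-- A constant parametrization would identify every parameter with another one, against
birationality. -/
theorem RationalCurve.one_le_degree (C : RationalCurve) : 1 ≤ C.degree := by
  by_contra! h
  have h0 : C.degree = 0 := by omega
  have hc : ∀ Q : ℝ[X], Q.natDegree ≤ C.degree → ∀ τ σ : ℂ, aeval τ Q = aeval σ Q := by
    intro Q hQ τ σ
    rw [eq_C_of_natDegree_le_zero (p := Q) (h0 ▸ hQ), aeval_C, aeval_C]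
  have hX := hc _ C.natDegree_X_le
  have hY := hc _ C.natDegree_Y_le
  have hZ := hc _ C.natDegree_Z_le
  refine Set.infinite_univ (C.birational.subset fun τ _ => ⟨τ + 1, by simp, ?_⟩)
  rw [hX (τ + 1) τ, hY (τ + 1) τ, hZ (τ + 1) τ]
  exact ⟨rfl, rfl, rfl⟩

namespace RationalArc

variable (γ : RationalArc)

/-- The polynomial `L` has no zeros on the arc. -/
def Avoids (L : ℂ[X]) : Prop :=
  (∀ τ ∈ γ.interval, L.eval (τ : ℂ) ≠ 0) ∧ (γ.ends = none → L.coeff γ.degree ≠ 0)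

theorem measurableSet_interval : MeasurableSet γ.interval := by
  rcases γ.cases_ends with ⟨a, b, -, -, h, -⟩ | ⟨-, h, -⟩ <;> rw [h]
  exacts [measurableSet_Icc, MeasurableSet.univ]

variable {γ}

theorem Avoids.exists_le_norm {L : ℂ[X]} (h : γ.Avoids L) (hL : L.natDegree ≤ γ.degree) :
    ∃ ε > 0, ∀ τ ∈ γ.interval, ε * weight τ ^ γ.degree ≤ ‖L.eval (τ : ℂ)‖ := by
  rcases γ.cases_ends with ⟨a, b, -, hab, hI, -⟩ | ⟨hn, hI, -⟩
  · have hcont : Continuous fun τ : ℝ => ‖L.eval (τ : ℂ)‖ / weight τ ^ γ.degree :=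
      ((L.continuous.comp Complex.continuous_ofReal).norm).div (continuous_weight.pow _)
        fun τ => (pow_pos (weight_pos τ) _).ne'
    obtain ⟨m, hm, hmin⟩ := isCompact_Icc.exists_isMinOn (nonempty_Icc.2 hab.le) hcont.continuousOn
    refine ⟨_, div_pos (norm_pos_iff.2 (h.1 m (hI ▸ hm))) (pow_pos (weight_pos m) γ.degree),
      fun τ hτ => ?_⟩
    rw [← le_div_iff₀ (pow_pos (weight_pos τ) _)]
    exact hmin (hI ▸ hτ)
  · obtain ⟨ε, h1, h2⟩ := exists_le_norm_eval hL (fun τ => h.1 τ (hI ▸ mem_univ τ)) (h.2 hn)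
    exact ⟨ε, h1, fun τ _ => h2 τ⟩

/-- The degree condition says that the integrand decays at least like τ⁻². This also covers arcs
through the parameter ∞, with the same statement for both kinds of arc. -/
theorem Avoids.integrableOn {L : ℂ[X]} (h : γ.Avoids L) (hL : L.natDegree ≤ γ.degree) (R : ℂ[X])
    {n : ℕ} (hR : R.natDegree + 2 ≤ n * γ.degree) :
    IntegrableOn (fun τ : ℝ => R.eval (τ : ℂ) / L.eval (τ : ℂ) ^ n) γ.interval := by
  obtain ⟨ε, hε, hb⟩ := h.exists_le_norm hL
  obtain ⟨C, hC⟩ := exists_norm_eval_le R le_rfl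
  have hcont : ContinuousOn (fun τ : ℝ => R.eval (τ : ℂ) / L.eval (τ : ℂ) ^ n) γ.interval :=
    (R.continuous.comp Complex.continuous_ofReal).continuousOn.div
      ((L.continuous.comp Complex.continuous_ofReal).pow n).continuousOn
      fun τ hτ => pow_ne_zero n (h.1 τ hτ)
  refine Integrable.mono' (g := fun τ => |C| / ε ^ n * (weight τ ^ 2)⁻¹)
    (integrable_inv_weight_sq.const_mul _).integrableOn
    (hcont.aestronglyMeasurable γ.measurableSet_interval)
    ((ae_restrict_mem γ.measurableSet_interval).mono fun τ hτ => ?_)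
  have hw := weight_pos τ
  have h1 : (ε * weight τ ^ γ.degree) ^ n ≤ ‖L.eval (τ : ℂ)‖ ^ n :=
    pow_le_pow_left₀ (by positivity) (hb τ hτ) n
  have h2 : ‖R.eval (τ : ℂ)‖ ≤ |C| * weight τ ^ R.natDegree :=
    (hC τ).trans (mul_le_mul_of_nonneg_right (le_abs_self C) (by positivity))
  rw [norm_div, norm_pow]
  calc ‖R.eval (τ : ℂ)‖ / ‖L.eval (τ : ℂ)‖ ^ n
      ≤ |C| * weight τ ^ R.natDegree / (ε * weight τ ^ γ.degree) ^ n := by gcongr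
    _ = |C| / ε ^ n * (weight τ ^ R.natDegree / weight τ ^ (n * γ.degree)) := by
        rw [mul_pow, ← pow_mul, mul_comm γ.degree n]; field_simp
    _ ≤ |C| / ε ^ n * (weight τ ^ 2)⁻¹ := by
        refine mul_le_mul_of_nonneg_left ?_ (by positivity)
        rw [div_le_iff₀ (by positivity), inv_mul_eq_div, le_div_iff₀ (by positivity), ← pow_add]
        exact pow_le_pow_right₀ (one_le_weight τ) hR

variable (γ) in
/-- The integral of `R / Lⁿ` along the arc, where `L` is the form of the moving line. -/
noncomputable def lineIntegral (R : ℂ[X]) (n : ℕ) (p : ℂ × ℂ) : ℂ :=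
  ∫ τ in γ.interval, R.eval (τ : ℂ) / (γ.lineForm p).eval (τ : ℂ) ^ n

/-- Dividing forms by powers of the weight makes them bounded and leaves the finite measure dτ/(1 +
τ²), so arcs through ∞ need no separate treatment. The subtraction `n * γ.degree - 2` is not
truncated, by `hR`. -/
theorem parametricData {R : ℂ[X]} {n : ℕ} (hR : R.natDegree + 2 ≤ n * γ.degree) :
    ParametricData volume γ.interval (fun τ : ℝ => (((weight τ ^ 2)⁻¹ : ℝ) : ℂ))
      (fun τ => (γ.X.map (algebraMap ℝ ℂ)).eval (τ : ℂ) / (weight τ : ℂ) ^ γ.degree)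
      (fun τ => (γ.Y.map (algebraMap ℝ ℂ)).eval (τ : ℂ) / (weight τ : ℂ) ^ γ.degree)
      (fun τ => (γ.Z.map (algebraMap ℝ ℂ)).eval (τ : ℂ) / (weight τ : ℂ) ^ γ.degree)
      (fun τ => R.eval (τ : ℂ) / (weight τ : ℂ) ^ (n * γ.degree - 2)) := by
  have hc : ∀ (Q : ℂ[X]) (k : ℕ), Continuous fun τ : ℝ => Q.eval (τ : ℂ) / (weight τ : ℂ) ^ k := by
    intro Q k
    refine (Q.continuous.comp Complex.continuous_ofReal).div
      ((Complex.continuous_ofReal.comp continuous_weight).pow k) fun τ => pow_ne_zero k ?_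
    exact_mod_cast (weight_pos τ).ne'
  have hbd : ∀ (Q : ℂ[X]) (k : ℕ), Q.natDegree ≤ k →
      ∃ C, ∀ τ : ℝ, ‖Q.eval (τ : ℂ) / (weight τ : ℂ) ^ k‖ ≤ C := by
    intro Q k hQ
    obtain ⟨C, hC⟩ := exists_norm_eval_le Q hQ
    refine ⟨C, fun τ => ?_⟩
    rw [norm_div, norm_pow, Complex.norm_real, Real.norm_of_nonneg (weight_pos τ).le,
      div_le_iff₀ (pow_pos (weight_pos τ) k)]
    exact hC τ
  obtain ⟨C1, h1⟩ := hbd (γ.X.map (algebraMap ℝ ℂ)) γ.degree (natDegree_map_le.trans γ.natDegree_X_le)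
  obtain ⟨C2, h2⟩ := hbd (γ.Y.map (algebraMap ℝ ℂ)) γ.degree (natDegree_map_le.trans γ.natDegree_Y_le)
  obtain ⟨C3, h3⟩ := hbd (γ.Z.map (algebraMap ℝ ℂ)) γ.degree (natDegree_map_le.trans γ.natDegree_Z_le)
  obtain ⟨C4, h4⟩ := hbd R (n * γ.degree - 2) (by omega)
  refine ⟨γ.measurableSet_interval, integrable_inv_weight_sq.ofReal.integrableOn,
    (hc _ _).continuousOn, (hc _ _).continuousOn, (hc _ _).continuousOn, (hc _ _).continuousOn,
    max (max C1 C2) (max C3 C4), fun τ _ => ⟨?_, ?_, ?_, ?_⟩⟩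
  · exact (h1 τ).trans ((le_max_left _ _).trans (le_max_left _ _))
  · exact (h2 τ).trans ((le_max_right _ _).trans (le_max_left _ _))
  · exact (h3 τ).trans ((le_max_left _ _).trans (le_max_right _ _))
  · exact (h4 τ).trans ((le_max_right _ _).trans (le_max_right _ _))

theorem lineForm_div_weight (p : ℂ × ℂ) (τ : ℝ) :
    (γ.Z.map (algebraMap ℝ ℂ)).eval (τ : ℂ) / (weight τ : ℂ) ^ γ.degree
      - p.1 * ((γ.X.map (algebraMap ℝ ℂ)).eval (τ : ℂ) / (weight τ : ℂ) ^ γ.degree)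
      - p.2 * ((γ.Y.map (algebraMap ℝ ℂ)).eval (τ : ℂ) / (weight τ : ℂ) ^ γ.degree) =
    (γ.lineForm p).eval (τ : ℂ) / (weight τ : ℂ) ^ γ.degree := by
  rw [RationalCurve.eval_lineForm]; ring

theorem lineIntegral_eq_weighted {R : ℂ[X]} {n : ℕ} (hR : R.natDegree + 2 ≤ n * γ.degree)
    (p : ℂ × ℂ) : γ.lineIntegral R n p =
    ∫ τ in γ.interval, (((weight τ ^ 2)⁻¹ : ℝ) : ℂ) *
      (R.eval (τ : ℂ) / (weight τ : ℂ) ^ (n * γ.degree - 2) /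
      ((γ.Z.map (algebraMap ℝ ℂ)).eval (τ : ℂ) / (weight τ : ℂ) ^ γ.degree
      - p.1 * ((γ.X.map (algebraMap ℝ ℂ)).eval (τ : ℂ) / (weight τ : ℂ) ^ γ.degree)
      - p.2 * ((γ.Y.map (algebraMap ℝ ℂ)).eval (τ : ℂ) / (weight τ : ℂ) ^ γ.degree)) ^ n) := by
  refine integral_congr_ae (Eventually.of_forall fun τ => ?_)
  have hw : (weight τ : ℂ) ≠ 0 := by exact_mod_cast (weight_pos τ).ne'
  simp only
  rw [lineForm_div_weight, div_pow, ← pow_mul, mul_comm γ.degree n,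
    show n * γ.degree = (n * γ.degree - 2) + 2 by omega, Nat.add_sub_cancel, pow_add]
  push_cast
  field_simp

theorem exists_le_norm_weighted {p : ℂ × ℂ} (h : γ.Avoids (γ.lineForm p)) :
    ∃ ε > 0, ∀ τ ∈ γ.interval, ε ≤
      ‖(γ.Z.map (algebraMap ℝ ℂ)).eval (τ : ℂ) / (weight τ : ℂ) ^ γ.degree
      - p.1 * ((γ.X.map (algebraMap ℝ ℂ)).eval (τ : ℂ) / (weight τ : ℂ) ^ γ.degree)
      - p.2 * ((γ.Y.map (algebraMap ℝ ℂ)).eval (τ : ℂ) / (weight τ : ℂ) ^ γ.degree)‖ := by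
  obtain ⟨ε, hε, hb⟩ := h.exists_le_norm (γ.natDegree_lineForm_le p)
  refine ⟨ε, hε, fun τ hτ => ?_⟩
  rw [lineForm_div_weight, norm_div, norm_pow, Complex.norm_real,
    Real.norm_of_nonneg (weight_pos τ).le, le_div_iff₀ (pow_pos (weight_pos τ) _)]
  exact hb τ hτ

theorem analyticAt_lineIntegral {R : ℂ[X]} {n : ℕ} (hR : R.natDegree + 2 ≤ n * γ.degree)
    {p : ℂ × ℂ} (h : γ.Avoids (γ.lineForm p)) : AnalyticAt ℂ (γ.lineIntegral R n) p := by
  rw [show γ.lineIntegral R n = _ from funext fun p => lineIntegral_eq_weighted hR p]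
  exact (parametricData hR).analyticAt n p (exists_le_norm_weighted h)

theorem partials_lineIntegral {R : ℂ[X]} {n : ℕ} (hR : R.natDegree + 2 ≤ n * γ.degree)
    {p : ℂ × ℂ} (h : γ.Avoids (γ.lineForm p)) :
    partialU (γ.lineIntegral R n) p =
      n * γ.lineIntegral (R * γ.X.map (algebraMap ℝ ℂ)) (n + 1) p ∧
    partialV (γ.lineIntegral R n) p =
      n * γ.lineIntegral (R * γ.Y.map (algebraMap ℝ ℂ)) (n + 1) p := by
  have hX : (R * γ.X.map (algebraMap ℝ ℂ)).natDegree + 2 ≤ (n + 1) * γ.degree := by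
    have := natDegree_mul_le (p := R) (q := γ.X.map (algebraMap ℝ ℂ))
    have h2 : (γ.X.map (algebraMap ℝ ℂ)).natDegree ≤ γ.degree := natDegree_map_le.trans γ.natDegree_X_le
    rw [add_mul]; omega
  have hY : (R * γ.Y.map (algebraMap ℝ ℂ)).natDegree + 2 ≤ (n + 1) * γ.degree := by
    have := natDegree_mul_le (p := R) (q := γ.Y.map (algebraMap ℝ ℂ))
    have h2 : (γ.Y.map (algebraMap ℝ ℂ)).natDegree ≤ γ.degree := natDegree_map_le.trans γ.natDegree_Y_le
    rw [add_mul]; omega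
  have hp := (parametricData hR).partials n p (exists_le_norm_weighted h)
  have hn : (n + 1) * γ.degree - 2 = (n * γ.degree - 2) + γ.degree := by
    rw [add_mul]; omega
  rw [lineIntegral_eq_weighted hX, lineIntegral_eq_weighted hY,
    show γ.lineIntegral R n = _ from funext fun p => lineIntegral_eq_weighted hR p]
  refine ⟨hp.1.trans ?_, hp.2.trans ?_⟩ <;>
  · congr 2
    ext τ
    rw [hn, pow_add (weight τ : ℂ), eval_mul, div_mul_div_comm]

end RationalArc

end Polypol

namespace Polypol

open MeasureTheory Filter Topology Set

/-! ### The transform as a boundary integral -/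

/-- A differentiable function on a neighbourhood of a compact set agrees near the set with a test
function. -/
theorem exists_isTest_eq {K W : Set (ℝ × ℝ)} (hK : IsCompact K) (hW : IsOpen W) (hKW : K ⊆ W)
    {g : ℝ × ℝ → ℂ} (hg : ContDiffOn ℝ 1 g W) :
    ∃ f, IsTest f ∧ ∀ z ∈ K, f =ᶠ[𝓝 z] g := by
  obtain ⟨t, ht, hKt, htW⟩ := exists_compact_between hK hW hKW
  obtain ⟨φ, h1, h2, -⟩ := exists_contMDiffMap_one_nhds_of_subset_interior (n := 1)
    (modelWithCornersSelf ℝ (ℝ × ℝ)) hK.isClosed hKt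
  have hφ : ContDiff ℝ 1 φ := φ.contMDiff.contDiff
  have hsupp : Function.support (fun z => (φ z : ℂ) * g z) ⊆ t := by
    intro z hz
    by_contra hzt
    exact hz (by simp [h2 z hzt])
  refine ⟨fun z => (φ z : ℂ) * g z, ⟨?_, ?_⟩, fun z hz => ?_⟩
  · rw [contDiff_iff_contDiffAt]
    intro z
    by_cases hz : z ∈ W
    · exact ((contDiff_ofReal_comp (k := 1) hφ).contDiffAt).mul (hg.contDiffAt (hW.mem_nhds hz))
    · refine (contDiffAt_const (c := 0)).congr_of_eventuallyEq ?_
      filter_upwards [ht.isClosed.isOpen_compl.mem_nhds fun h => hz (htW h)] with w hw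
      simp [h2 w hw]
  · exact HasCompactSupport.of_support_subset_isCompact ht hsupp
  · have := Filter.eventually_of_mem (show {w | φ w = 1} ∈ 𝓝ˢ K from h1) (fun w hw => hw)
    filter_upwards [this.filter_mono (nhds_le_nhdsSet hz)] with w hw
    rw [show φ w = 1 from hw]; simp

theorem RationalArc.integrableOn_velocity (γ : RationalArc) :
    IntegrableOn γ.velocity γ.openInterval := by
  have hav : γ.Avoids (γ.Z.map (algebraMap ℝ ℂ)) := by
    refine ⟨fun τ hτ => ?_, fun h => ?_⟩
    · rw [RationalCurve.eval_map_ofReal]; exact_mod_cast γ.eval_Z_ne_zero hτ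
    · rw [coeff_map]
      rcases γ.cases_ends with ⟨a, b, h', -⟩ | ⟨-, -, -, -, -, -, h', -⟩
      · simp [h] at h'
      · simpa using h'
  have key : ∀ Q : ℝ[X], Q.natDegree ≤ γ.degree → IntegrableOn (fun τ =>
      (derivative Q * γ.Z - Q * derivative γ.Z).eval τ / γ.Z.eval τ ^ 2) γ.openInterval := by
    intro Q hQ
    have h := hav.integrableOn (natDegree_map_le.trans γ.natDegree_Z_le)
      ((derivative Q * γ.Z - Q * derivative γ.Z).map (algebraMap ℝ ℂ)) (n := 2) (by
        have h1 := natDegree_wronskian_le hQ γ.natDegree_Z_le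
        have h2 : ((derivative Q * γ.Z - Q * derivative γ.Z).map (algebraMap ℝ ℂ)).natDegree ≤ _ :=
          natDegree_map_le
        have := γ.one_le_degree
        omega)
    refine ((Integrable.re h).mono_measure (Measure.restrict_mono γ.openInterval_subset le_rfl)).congr
      (Eventually.of_forall fun τ => ?_)
    simp only [RationalCurve.eval_map_ofReal]
    rw [← Complex.ofReal_pow, ← Complex.ofReal_div]
    exact Complex.ofReal_re _
  exact (key _ γ.natDegree_X_le).prodMk (key _ γ.natDegree_Y_le)

namespace RationalPolypol

variable (P : RationalPolypol)

theorem endpoints_finite (γ : RationalArc) : γ.endpoints.Finite := by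
  rcases γ.cases_ends with ⟨a, b, -, -, -, -, -, h, -⟩ | ⟨-, -, -, -, h, -⟩ <;> rw [h]
  exacts [Set.toFinite _, Set.finite_empty]

/-- The exceptional set consists of the endpoints and, for closed arcs, of the image of the
parameter ∞. For arcs with ends, `pointAtInfinity` is a possibly meaningless extra point, which does
no harm because only finiteness and covering matter. -/
theorem greenData : GreenData P.carrier (fun j => (P.arc j).point) (fun j => (P.arc j).velocity)
    (fun j => (P.arc j).openInterval) (fun j => (P.arc j).support)
    (⋃ j, ((P.arc j).endpoints ∪ {(P.arc j).pointAtInfinity})) where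
  measurableSet := P.semialgebraic.measurableSet
  frontier_eq := P.boundary
  isClosed j := (P.arc j).isClosed_support
  isOpen j := (P.arc j).isOpen_openInterval
  isPreconnected j := (P.arc j).isPreconnected_openInterval
  hasDerivAt j τ hτ := (P.arc j).hasDerivAt_point
    ((P.arc j).eval_Z_ne_zero ((P.arc j).openInterval_subset hτ))
  continuousOn j τ hτ := ((P.arc j).continuousAt_velocity
    ((P.arc j).eval_Z_ne_zero ((P.arc j).openInterval_subset hτ))).continuousWithinAt
  integrableOn j := (P.arc j).integrableOn_velocity
  mapsTo j τ hτ := (P.arc j).point_mem_support ((P.arc j).openInterval_subset hτ)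
  covers j := by
    intro z hz
    rcases (P.arc j).cases_ends with ⟨a, b, -, -, -, h, hs, he, -⟩ | ⟨-, -, h, hs, -⟩
    · rw [hs] at hz
      obtain ⟨τ, hτ, rfl⟩ := hz
      rcases hτ.1.eq_or_lt with rfl | h1
      · exact Or.inr (mem_iUnion.2 ⟨j, Or.inl (by rw [he]; simp)⟩)
      rcases hτ.2.eq_or_lt with rfl | h2
      · exact Or.inr (mem_iUnion.2 ⟨j, Or.inl (by rw [he]; simp)⟩)
      exact Or.inl ⟨τ, by rw [h]; exact ⟨h1, h2⟩, rfl⟩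
    · rw [hs] at hz
      rcases hz with ⟨τ, rfl⟩ | hz
      · exact Or.inl ⟨τ, by rw [h]; trivial, rfl⟩
      · exact Or.inr (mem_iUnion.2 ⟨j, Or.inr hz⟩)
  finite := Set.finite_iUnion fun j => (endpoints_finite _).union (Set.finite_singleton _)
  injOn j := (P.arc j).injOn_point
  disjoint i j hij τ hτ h := (P.arc i).point_notMem_endpoints hτ
    (P.regular i j hij ⟨(P.arc i).point_mem_support ((P.arc i).openInterval_subset hτ), h⟩).1
  proper j τ hτ N hN := (P.arc j).proper hτ hN
  crit j := (P.arc j).crit_finite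

theorem support_subset_closure (j : Fin P.numArcs) : (P.arc j).support ⊆ closure P.carrier :=
  (Set.subset_iUnion _ j).trans (P.boundary ▸ frontier_subset_closure)

theorem avoids {p : ℂ × ℂ} (hp : p ∈ fantappieDomain P.carrier) (j : Fin P.numArcs) :
    (P.arc j).Avoids ((P.arc j).lineForm p) := by
  refine ⟨fun τ hτ => ?_, fun h => ?_⟩
  · have hz := (P.arc j).eval_Z_ne_zero hτ
    rw [RationalCurve.eval_lineForm_ofReal _ _ hz]
    exact mul_ne_zero (by exact_mod_cast hz)
      (hp _ (P.support_subset_closure j ((P.arc j).point_mem_support hτ)))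
  · rcases (P.arc j).cases_ends with ⟨a, b, h', -⟩ | ⟨-, -, -, hs, -, -, h', -⟩
    · simp [h] at h'
    · rw [RationalCurve.coeff_degree_lineForm _ _ h']
      exact mul_ne_zero (by exact_mod_cast h')
        (hp _ (P.support_subset_closure j (by rw [hs]; right; rfl)))

end RationalPolypol

theorem setIntegral_openInterval (γ : RationalArc) (f : ℝ → ℂ) :
    ∫ τ in γ.openInterval, f τ = ∫ τ in γ.interval, f τ := by
  rcases γ.cases_ends with ⟨a, b, -, -, h1, h2, -⟩ | ⟨-, h1, h2, -⟩ <;> rw [h1, h2]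
  exact (integral_Icc_eq_integral_Ioo).symm

theorem integrableOn_openInterval_iff (γ : RationalArc) (f : ℝ → ℂ) :
    IntegrableOn f γ.openInterval ↔ IntegrableOn f γ.interval := by
  rcases γ.cases_ends with ⟨a, b, -, -, h1, h2, -⟩ | ⟨-, h1, h2, -⟩ <;> rw [h1, h2]
  rw [integrableOn_Icc_iff_integrableOn_Ioo]

/-- The form `X dY - Y dX` on the parameter line. -/
noncomputable def RationalCurve.areaForm (C : RationalCurve) : ℂ[X] :=
  (derivative C.Y * C.X - C.Y * derivative C.X).map (algebraMap ℝ ℂ)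

theorem RationalCurve.natDegree_areaForm_le (C : RationalCurve) :
    C.areaForm.natDegree + 2 ≤ 2 * C.degree := by
  have h1 := natDegree_wronskian_le C.natDegree_Y_le C.natDegree_X_le
  have h2 : C.areaForm.natDegree ≤ _ := natDegree_map_le
  have := C.one_le_degree
  omega

/-- The affine numerator treats all needed primitives at once: 1/ℓ² for uF and vF, and x/ℓ², y/ℓ²
for F itself. -/
theorem hasFDerivAt_inv_pow {p : ℂ × ℂ} {z : ℝ × ℝ}
    (hz : 1 - p.1 * (z.1 : ℂ) - p.2 * (z.2 : ℂ) ≠ 0) (a b c : ℂ) (v : ℝ × ℝ) :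
    fderiv ℝ (fun z : ℝ × ℝ => (a + b * (z.1 : ℂ) + c * (z.2 : ℂ)) *
      ((1 - p.1 * (z.1 : ℂ) - p.2 * (z.2 : ℂ)) ^ 2)⁻¹) z v =
      (b * v.1 + c * v.2) * ((1 - p.1 * (z.1 : ℂ) - p.2 * (z.2 : ℂ)) ^ 2)⁻¹ +
      (a + b * (z.1 : ℂ) + c * (z.2 : ℂ)) *
        (2 * (p.1 * v.1 + p.2 * v.2) / (1 - p.1 * (z.1 : ℂ) - p.2 * (z.2 : ℂ)) ^ 3) := by
  have hx : HasFDerivAt (fun z : ℝ × ℝ => (z.1 : ℂ))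
      (Complex.ofRealCLM.comp (ContinuousLinearMap.fst ℝ ℝ ℝ)) z :=
    (Complex.ofRealCLM.comp (ContinuousLinearMap.fst ℝ ℝ ℝ)).hasFDerivAt
  have hy : HasFDerivAt (fun z : ℝ × ℝ => (z.2 : ℂ))
      (Complex.ofRealCLM.comp (ContinuousLinearMap.snd ℝ ℝ ℝ)) z :=
    (Complex.ofRealCLM.comp (ContinuousLinearMap.snd ℝ ℝ ℝ)).hasFDerivAt
  have hl : HasFDerivAt (fun z : ℝ × ℝ => 1 - p.1 * (z.1 : ℂ) - p.2 * (z.2 : ℂ)) _ z :=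
    ((hasFDerivAt_const (1 : ℂ) z).sub (hx.const_mul p.1)).sub (hy.const_mul p.2)
  have hn : HasFDerivAt (fun z : ℝ × ℝ => a + b * (z.1 : ℂ) + c * (z.2 : ℂ)) _ z :=
    ((hasFDerivAt_const a z).add (hx.const_mul b)).add (hy.const_mul c)
  have hi := ((hasDerivAt_inv (pow_ne_zero 2 hz)).comp_hasFDerivAt z (hl.pow 2))
  have := (hn.mul hi).fderiv
  rw [show (fun z : ℝ × ℝ => (a + b * (z.1 : ℂ) + c * (z.2 : ℂ)) *
      ((1 - p.1 * (z.1 : ℂ) - p.2 * (z.2 : ℂ)) ^ 2)⁻¹) = _ from rfl]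
  erw [this]
  simp
  field_simp
  ring

namespace RationalPolypol

variable (P : RationalPolypol)

/-- The boundary multiplicities of the Green formula, and the transform as a boundary integral. -/
theorem exists_orientation :
    ∃ σ : Fin P.numArcs → ℤ, (∀ j, σ j = -1 ∨ σ j = 0 ∨ σ j = 1) ∧
      (∀ p ∈ fantappieDomain P.carrier,
        p.1 * fantappie P.carrier p = ∑ j, (σ j : ℂ) * (P.arc j).periodY p ∧
        p.2 * fantappie P.carrier p = -∑ j, (σ j : ℂ) * (P.arc j).periodX p ∧
        fantappie P.carrier p =
          ∑ j, (σ j : ℂ) * (P.arc j).lineIntegral (P.arc j).areaForm 2 p) ∧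
      ∀ j, ∀ τ ∈ (P.arc j).openInterval, ∀ e : ℝ × ℝ, 0 < cross ((P.arc j).velocity τ) e →
        ∀ᶠ s : ℝ in 𝓝[>] 0,
          ((P.arc j).point τ + s • e ∈ P.carrier →
            (P.arc j).point τ - s • e ∉ P.carrier → σ j = 1) ∧
          ((P.arc j).point τ + s • e ∉ P.carrier →
            (P.arc j).point τ - s • e ∈ P.carrier → σ j = -1) := by
  obtain ⟨σ, h1, h2, h3⟩ := P.greenData.green
  refine ⟨σ, h1, fun p hp => ?_, h3⟩
  have hK : IsCompact (closure P.carrier) := P.bounded.isCompact_closure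
  have hlc : Continuous fun z : ℝ × ℝ => 1 - p.1 * (z.1 : ℂ) - p.2 * (z.2 : ℂ) := by fun_prop
  have hm := P.semialgebraic.measurableSet
  let A : ℂ → ℂ → ℂ → ℝ × ℝ → ℝ × ℝ → ℂ := fun a b c v z =>
      (b * v.1 + c * v.2) * ((1 - p.1 * (z.1 : ℂ) - p.2 * (z.2 : ℂ)) ^ 2)⁻¹ +
      (a + b * (z.1 : ℂ) + c * (z.2 : ℂ)) *
        (2 * (p.1 * v.1 + p.2 * v.2) / (1 - p.1 * (z.1 : ℂ) - p.2 * (z.2 : ℂ)) ^ 3)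
  let B : ℂ → ℂ → ℂ → ℝ × ℝ → Fin P.numArcs → ℝ → ℂ := fun a b c v j τ =>
      ((cross v ((P.arc j).velocity τ) : ℝ) : ℂ) *
        ((a + b * ((P.arc j).point τ).1 + c * ((P.arc j).point τ).2) *
        ((1 - p.1 * ((P.arc j).point τ).1 - p.2 * ((P.arc j).point τ).2) ^ 2)⁻¹)
  have key : ∀ a b c : ℂ, ∀ v : ℝ × ℝ, (∫ z in P.carrier, A a b c v z) =
      ∑ j, (σ j : ℂ) * (∫ τ in (P.arc j).interval, B a b c v j τ) ∧
      IntegrableOn (A a b c v) P.carrier ∧ ∀ j, IntegrableOn (B a b c v j) (P.arc j).interval := by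
    intro a b c v
    -- The primitive is singular on ℓ = 0, away from the closure of the domain; it is cut off to a
    -- test function which agrees with it near the closure.
    obtain ⟨f, hf, hfg⟩ := exists_isTest_eq hK (isOpen_ne_fun hlc continuous_const) hp
      (g := fun z : ℝ × ℝ => (a + b * (z.1 : ℂ) + c * (z.2 : ℂ)) *
      ((1 - p.1 * (z.1 : ℂ) - p.2 * (z.2 : ℂ)) ^ 2)⁻¹) (by
        have hx : ContDiff ℝ 1 fun z : ℝ × ℝ => (z.1 : ℂ) := contDiff_ofReal_comp (k := 1) contDiff_fst
        have hy : ContDiff ℝ 1 fun z : ℝ × ℝ => (z.2 : ℂ) := contDiff_ofReal_comp (k := 1) contDiff_snd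
        refine ContDiffOn.mul (by fun_prop) (ContDiffOn.inv (by fun_prop) ?_)
        intro z hz
        exact pow_ne_zero 2 hz)
    have h := h2 f hf v
    have hA : ∀ z ∈ P.carrier, fderiv ℝ f z v = A a b c v z := fun z hz => by
      have hz' := subset_closure hz
      rw [(hfg z hz').fderiv_eq, hasFDerivAt_inv_pow (hp z hz')]
    have hB : ∀ j, ∀ τ ∈ (P.arc j).interval,
        ((cross v ((P.arc j).velocity τ) : ℝ) : ℂ) * f ((P.arc j).point τ) = B a b c v j τ := by
      intro j τ hτ
      rw [(hfg _ (P.support_subset_closure j ((P.arc j).point_mem_support hτ))).self_of_nhds]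
    refine ⟨(setIntegral_congr_fun hm hA).symm.trans (h.trans (Finset.sum_congr rfl fun j _ => ?_)),
      (hf.integrable_fderiv v).integrableOn.congr_fun hA hm, fun j => ?_⟩
    · rw [setIntegral_openInterval]
      congr 1
      exact setIntegral_congr_fun (P.arc j).measurableSet_interval (hB j)
    · refine IntegrableOn.congr_fun ?_ (hB j) (P.arc j).measurableSet_interval
      rw [← integrableOn_openInterval_iff]
      exact P.greenData.integrableOn_cross_mul j v hf
  have hL : ∀ j, ∀ τ ∈ (P.arc j).interval, ((P.arc j).Z.eval τ : ℝ) ≠ 0 ∧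
      1 - p.1 * ((P.arc j).point τ).1 - p.2 * ((P.arc j).point τ).2 ≠ 0 := fun j τ hτ =>
    ⟨(P.arc j).eval_Z_ne_zero hτ,
      hp _ (P.support_subset_closure j ((P.arc j).point_mem_support hτ))⟩
  refine ⟨?_, ?_, ?_⟩
  · have h := (key 1 0 0 (1, 0)).1
    rw [fantappie, ← mul_assoc, ← integral_const_mul]
    refine Eq.trans (integral_congr_ae (Eventually.of_forall fun z => ?_))
      (h.trans (Finset.sum_congr rfl fun j _ => ?_))
    · simp [A]; ring
    · rw [RationalArc.periodY]
      congr 1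
      refine setIntegral_congr_fun (P.arc j).measurableSet_interval fun τ hτ => ?_
      obtain ⟨hz, hl⟩ := hL j τ hτ
      have hz' : (((P.arc j).Z.eval τ : ℝ) : ℂ) ≠ 0 := by exact_mod_cast hz
      rw [RationalCurve.eval_lineForm_ofReal _ _ hz]
      simp only [B, cross, RationalCurve.velocity, Complex.ofReal_sub, Complex.ofReal_mul,
        Complex.ofReal_div, Complex.ofReal_pow, Complex.ofReal_one, Complex.ofReal_zero]
      field_simp
      ring
  · have h := (key 1 0 0 (0, 1)).1
    rw [fantappie, ← mul_assoc, ← integral_const_mul, ← Finset.sum_neg_distrib]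
    refine Eq.trans (integral_congr_ae (Eventually.of_forall fun z => ?_))
      (h.trans (Finset.sum_congr rfl fun j _ => ?_))
    · simp [A]; ring
    · rw [RationalArc.periodX, ← mul_neg, ← integral_neg]
      congr 1
      refine setIntegral_congr_fun (P.arc j).measurableSet_interval fun τ hτ => ?_
      obtain ⟨hz, hl⟩ := hL j τ hτ
      have hz' : (((P.arc j).Z.eval τ : ℝ) : ℂ) ≠ 0 := by exact_mod_cast hz
      rw [RationalCurve.eval_lineForm_ofReal _ _ hz]
      simp only [B, cross, RationalCurve.velocity, Complex.ofReal_sub, Complex.ofReal_mul,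
        Complex.ofReal_div, Complex.ofReal_pow, Complex.ofReal_one, Complex.ofReal_zero]
      field_simp
      ring
  -- The divergence of (x, y)/ℓ² is 2/ℓ² + 2(ux + vy)/ℓ³ = 2/ℓ³. Unlike the formulas for uF and vF,
  -- this one needs no division by u or v.
  · obtain ⟨e1, a1, b1⟩ := key 0 1 0 (1, 0)
    obtain ⟨e2, a2, b2⟩ := key 0 0 1 (0, 1)
    have h : (∫ z in P.carrier, (A 0 1 0 (1, 0) z + A 0 0 1 (0, 1) z)) = ∑ j, (σ j : ℂ) *
        (∫ τ in (P.arc j).interval, (B 0 1 0 (1, 0) j τ + B 0 0 1 (0, 1) j τ)) := by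
      rw [integral_add a1 a2, e1, e2, ← Finset.sum_add_distrib]
      exact Finset.sum_congr rfl fun j _ => by rw [← mul_add, integral_add (b1 j) (b2 j)]
    rw [fantappie, ← integral_const_mul]
    refine Eq.trans (setIntegral_congr_fun hm fun z hz => ?_)
      (h.trans (Finset.sum_congr rfl fun j _ => ?_))
    · have := hp z (subset_closure hz)
      simp only [A]
      push_cast
      field_simp
      ring
    · rw [RationalArc.lineIntegral]
      congr 1
      refine setIntegral_congr_fun (P.arc j).measurableSet_interval fun τ hτ => ?_
      obtain ⟨hz, hl⟩ := hL j τ hτ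
      have hz' : (((P.arc j).Z.eval τ : ℝ) : ℂ) ≠ 0 := by exact_mod_cast hz
      rw [RationalCurve.eval_lineForm_ofReal _ _ hz, RationalCurve.areaForm,
        RationalCurve.eval_map_ofReal]
      simp only [B, cross, RationalCurve.velocity, RationalCurve.point, eval_sub, eval_mul,
        Complex.ofReal_sub, Complex.ofReal_mul,
        Complex.ofReal_div, Complex.ofReal_pow, Complex.ofReal_one, Complex.ofReal_zero] at hl ⊢
      field_simp
      ring

end RationalPolypol

end Polypol

namespace Polypol

open MeasureTheory Filter Topology Set

/-! ### The discriminant of the moving line -/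

/-- The form of degree `d` with dehomogenization `L` has a multiple zero on the projective line. -/
def HasMultipleZero (d : ℕ) (L : ℂ[X]) : Prop :=
  (∃ τ : ℂ, L.eval τ = 0 ∧ (derivative L).eval τ = 0) ∨ (L.coeff d = 0 ∧ L.coeff (d - 1) = 0)

/-- The discriminant of a form of degree `d`: the resultant of its two partial derivatives. -/
noncomputable def formDiscr {R : Type*} [CommRing R] (d : ℕ) (L : R[X]) : R :=
  resultant (derivative L) ((d : R[X]) * L - X * derivative L) (d - 1) (d - 1)

theorem map_formDiscr {R S : Type*} [CommRing R] [CommRing S] (φ : R →+* S) (d : ℕ) (L : R[X]) :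
    φ (formDiscr d L) = formDiscr d (L.map φ) := by
  rw [formDiscr, formDiscr, derivative_map, show (d : S[X]) * L.map φ - X * (derivative L).map φ =
    ((d : R[X]) * L - X * derivative L).map φ by simp, resultant_map_map]

theorem coeff_euler {R : Type*} [CommRing R] (d k : ℕ) (L : R[X]) :
    ((d : R[X]) * L - X * derivative L).coeff k = ((d : R) - k) * L.coeff k := by
  rw [coeff_sub, ← C_eq_natCast, coeff_C_mul]
  rcases k with _ | k
  · simp
  · rw [coeff_X_mul, coeff_derivative]; push_cast; ring

/-- A multiple zero of a binary form is a common zero of its partials. At a finite parameter this is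
detected by coprimality; at infinity it means that both partials drop below the formal degree `d -
1`. If one of them attains this degree, the resultant with formal degrees is the true resultant up
to a nonzero factor. -/
theorem formDiscr_eq_zero_iff {d : ℕ} (hd : 2 ≤ d) {L : ℂ[X]} (hL : L.natDegree ≤ d) :
    formDiscr d L = 0 ↔ HasMultipleZero d L := by
  have h1 : (derivative L).natDegree ≤ d - 1 := (natDegree_derivative_le L).trans (by omega)
  have h2 := natDegree_euler_le hL
  have hdC : (d : ℂ) ≠ 0 := by exact_mod_cast (by omega : d ≠ 0)
  have c1 : (derivative L).coeff (d - 1) = d * L.coeff d := by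
    rw [coeff_derivative, show d - 1 + 1 = d by omega, mul_comm]
    push_cast [show 1 ≤ d by omega]; ring
  have c2 : ((d : ℂ[X]) * L - X * derivative L).coeff (d - 1) = L.coeff (d - 1) := by
    rw [coeff_euler]; push_cast [show 1 ≤ d by omega]; ring
  constructor
  · intro h
    by_contra hm
    have hcop : IsCoprime (derivative L) ((d : ℂ[X]) * L - X * derivative L) := by
      rw [Polynomial.isCoprime_iff_aeval_ne_zero_of_isAlgClosed (k := ℂ) (K := ℂ)]
      intro τ
      by_contra! hc
      refine hm (Or.inl ⟨τ, ?_, by simpa using hc.1⟩)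
      have h3 := hc.2
      have h4 := hc.1
      simp only [coe_aeval_eq_eval] at h3 h4
      rw [eval_sub, eval_mul, eval_mul, h4, eval_natCast, mul_zero, sub_zero] at h3
      exact (mul_eq_zero.1 h3).resolve_left hdC
    have hne := resultant_ne_zero _ _ hcop
    have htop : (derivative L).coeff (d - 1) ≠ 0 ∨
        ((d : ℂ[X]) * L - X * derivative L).coeff (d - 1) ≠ 0 := by
      by_contra! hc
      refine hm (Or.inr ⟨?_, c2 ▸ hc.2⟩)
      exact (mul_eq_zero.1 (c1 ▸ hc.1)).resolve_left hdC
    rcases htop with ht | ht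
    · have hdeg : (derivative L).natDegree = d - 1 := le_antisymm h1 (le_natDegree_of_ne_zero ht)
      obtain ⟨k, hk⟩ := Nat.exists_eq_add_of_le h2
      rw [formDiscr, show resultant (derivative L) ((d : ℂ[X]) * L - X * derivative L) (d - 1) (d - 1)
        = resultant (derivative L) ((d : ℂ[X]) * L - X * derivative L) (derivative L).natDegree
          (((d : ℂ[X]) * L - X * derivative L).natDegree + k) by rw [hdeg, ← hk],
        resultant_add_right_deg _ _ _ _ _ le_rfl] at h
      exact mul_ne_zero (pow_ne_zero _ (hdeg ▸ ht)) hne h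
    · have hdeg : ((d : ℂ[X]) * L - X * derivative L).natDegree = d - 1 :=
        le_antisymm h2 (le_natDegree_of_ne_zero ht)
      obtain ⟨k, hk⟩ := Nat.exists_eq_add_of_le h1
      rw [formDiscr, show resultant (derivative L) ((d : ℂ[X]) * L - X * derivative L) (d - 1) (d - 1)
        = resultant (derivative L) ((d : ℂ[X]) * L - X * derivative L) ((derivative L).natDegree + k)
          ((d : ℂ[X]) * L - X * derivative L).natDegree by rw [hdeg, ← hk],
        resultant_add_left_deg _ _ _ _ _ le_rfl] at h
      exact mul_ne_zero (mul_ne_zero (pow_ne_zero _ (by norm_num))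
        (pow_ne_zero _ (hdeg ▸ ht))) hne h
  · rintro (⟨τ, a1, a2⟩ | ⟨a1, a2⟩)
    · obtain ⟨p, q, -, -, he⟩ := exists_mul_add_mul_eq_C_resultant _ _ h1 h2 (Or.inl (by omega))
      have := congrArg (eval τ) he
      rw [eval_C, eval_add, eval_mul, eval_mul, a2, eval_sub, eval_mul, eval_mul, a1, a2] at this
      rw [formDiscr, ← this]; simp
    · refine resultant_eq_zero_of_lt_lt _ _ _ _ (lt_of_le_of_ne h1 fun h => ?_)
        (lt_of_le_of_ne h2 fun h => ?_)
      · have h0 : derivative L = 0 := leadingCoeff_eq_zero.1 (by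
          rw [leadingCoeff, h, c1, a1, mul_zero])
        rw [h0, natDegree_zero] at h; omega
      · have h0 : (d : ℂ[X]) * L - X * derivative L = 0 := leadingCoeff_eq_zero.1 (by
          rw [leadingCoeff, h, c2, a2])
        rw [h0, natDegree_zero] at h; omega

/-- The adjugate of the Sylvester matrix inverts the map (a, b) ↦ fa + gb up to the resultant, so
the determinant times any polynomial of admissible degree lies in its image. No division is needed,
and the coefficient ring stays polynomial in u and v. -/
theorem exists_mul_add_mul_eq_resultant_mul {R : Type*} [CommRing R] {f g : R[X]} {m n : ℕ}
    (hf : f.natDegree ≤ m) (hg : g.natDegree ≤ n) {Q : R[X]}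
    (hQ : Q.degree < ((m + n : ℕ) : WithBot ℕ)) :
    ∃ a b : R[X], a.degree < (n : WithBot ℕ) ∧ b.degree < (m : WithBot ℕ) ∧
      f * a + g * b = C (f.resultant g m n) * Q := by
  let x := adjSylvester (m := m) (n := n) f g ⟨Q, mem_degreeLT.2 hQ⟩
  have h : ((sylvesterMap f g hf hg x)).1 = _ :=
    congrArg Subtype.val (LinearMap.congr_fun (sylveserMap_comp_adjSylvester f g hf hg) _)
  exact ⟨x.2, x.1, mem_degreeLT.1 x.2.2, mem_degreeLT.1 x.1.2,
    by simpa [smul_eq_C_mul] using h⟩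

/-- A general member of a pencil without base points has no multiple zero. -/
theorem finite_hasMultipleZero_pencil {M N : ℂ[X]} {d : ℕ} (hd : 1 ≤ d)
    (hMN : ∀ τ : ℂ, ¬(M.eval τ = 0 ∧ N.eval τ = 0)) (htop : ¬(M.coeff d = 0 ∧ N.coeff d = 0)) :
    {u : ℂ | HasMultipleZero d (M - C u * N)}.Finite := by
  have hcop : IsCoprime M N := by
    rw [Polynomial.isCoprime_iff_aeval_ne_zero_of_isAlgClosed (k := ℂ) (K := ℂ)]
    intro τ
    by_contra! hc
    exact hMN τ (by simpa using hc)
  -- If the Wronskian vanished, coprimality would force `M` and `N` to divide their own derivatives,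
  -- hence to be constant; the pencil would then have a base point at infinity.
  have hW : derivative M * N - M * derivative N ≠ 0 := by
    intro h0
    rw [sub_eq_zero] at h0
    have hconst : ∀ Q : ℂ[X], Q ∣ derivative Q → Q.coeff d = 0 := by
      intro Q hQ
      by_cases hn : Q.natDegree = 0
      · exact coeff_eq_zero_of_natDegree_lt (by omega)
      · have h1 : derivative Q = 0 := by
          by_contra hne
          have := natDegree_le_of_dvd hQ hne
          have := natDegree_derivative_lt hn
          omega
        exact absurd (derivative_eq_zero.1 h1) hn
    refine htop ⟨hconst M ?_, hconst N ?_⟩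
    · exact hcop.dvd_of_dvd_mul_right (h0 ▸ dvd_mul_right _ _)
    · exact hcop.symm.dvd_of_dvd_mul_left (h0 ▸ dvd_mul_left _ _)
  -- A finite double zero of `M - uN` is a zero of the Wronskian and determines `u` there as `M /
  -- N`; a double zero at infinity leaves only the ratio of the top coefficients.
  refine (((derivative M * N - M * derivative N).roots.toFinset.finite_toSet.image
    fun τ => M.eval τ / N.eval τ).union (Set.finite_singleton (M.coeff d / N.coeff d))).subset ?_
  rintro u (⟨τ, h1, h2⟩ | ⟨h1, -⟩)
  · left
    simp only [eval_sub, eval_mul, eval_C, derivative_sub, derivative_C_mul] at h1 h2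
    have hN : N.eval τ ≠ 0 := fun h => hMN τ ⟨by rw [h] at h1; simpa using h1, h⟩
    refine ⟨τ, ?_, ?_⟩
    · rw [Finset.mem_coe, Multiset.mem_toFinset, mem_roots hW, IsRoot.def, eval_sub, eval_mul, eval_mul]
      linear_combination N.eval τ * h2 - (derivative N).eval τ * h1
    · simp only
      rw [div_eq_iff hN]; linear_combination h1
  · right
    rw [coeff_sub, coeff_C_mul] at h1
    have hN : N.coeff d ≠ 0 := fun h => htop ⟨by rw [h] at h1; simpa using h1, h⟩
    rw [mem_singleton_iff, eq_div_iff hN]; linear_combination -h1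

namespace RationalCurve

variable (C : RationalCurve)

theorem isTangent_iff (p : ℂ × ℂ) : C.IsTangent p ↔ HasMultipleZero C.degree (C.lineForm p) :=
  Iff.rfl

/-- The moving lines form a net without base points. A value of `v` outside a finite set makes the
pencil spanned by Z - vY and X free of base points, including at ∞, and a general member of it is
not tangent. If X = 0, the pencil spanned by Z and Y is used instead. -/
theorem exists_not_isTangent : ∃ p, ¬C.IsTangent p := by
  have hd := C.one_le_degree
  have hz : ∀ τ : ℂ, ¬((C.X.map (algebraMap ℝ ℂ)).eval τ = 0 ∧
      (C.Y.map (algebraMap ℝ ℂ)).eval τ = 0 ∧ (C.Z.map (algebraMap ℝ ℂ)).eval τ = 0) := by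
    intro τ
    have := C.noCommonZero τ
    rwa [aeval_def, aeval_def, aeval_def, ← eval_map, ← eval_map, ← eval_map] at this
  have htop : ¬(C.X.coeff C.degree = 0 ∧ C.Y.coeff C.degree = 0 ∧ C.Z.coeff C.degree = 0) := by
    rintro ⟨h1, h2, h3⟩
    have hk : ∀ Q : ℝ[X], Q.natDegree ≤ C.degree → Q.coeff C.degree = 0 → Q.natDegree < C.degree := by
      intro Q hQ h
      refine lt_of_le_of_ne hQ fun he => ?_
      have : Q = 0 := leadingCoeff_eq_zero.1 (by rw [leadingCoeff, he, h])
      rw [this, natDegree_zero] at he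
      omega
    exact absurd (max_lt (hk _ C.natDegree_X_le h1) (max_lt (hk _ C.natDegree_Y_le h2)
      (hk _ C.natDegree_Z_le h3))) (lt_irrefl _)
  by_cases hX : C.X = 0
  · have hfin := finite_hasMultipleZero_pencil (M := C.Z.map (algebraMap ℝ ℂ))
      (N := C.Y.map (algebraMap ℝ ℂ)) hd (fun τ h => hz τ ⟨by simp [hX], h.2, h.1⟩) (fun h => htop
        ⟨by simp [hX], by simpa using h.2, by simpa using h.1⟩)
    obtain ⟨v, hv⟩ := hfin.exists_notMem
    refine ⟨(0, v), fun h => hv ?_⟩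
    rw [isTangent_iff, lineForm] at h
    simpa [hX] using h
  · have hX' : C.X.map (algebraMap ℝ ℂ) ≠ 0 := (Polynomial.map_ne_zero_iff (algebraMap ℝ ℂ).injective).2 hX
    obtain ⟨v, hv⟩ := (((C.X.map (algebraMap ℝ ℂ)).roots.toFinset.finite_toSet.image
      fun τ => (C.Z.map (algebraMap ℝ ℂ)).eval τ / (C.Y.map (algebraMap ℝ ℂ)).eval τ).union
      (Set.finite_singleton ((C.Z.map (algebraMap ℝ ℂ)).coeff C.degree /
        (C.Y.map (algebraMap ℝ ℂ)).coeff C.degree))).exists_notMem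
    rw [mem_union, not_or] at hv
    have hfin := finite_hasMultipleZero_pencil (d := C.degree)
      (M := C.Z.map (algebraMap ℝ ℂ) - Polynomial.C v * C.Y.map (algebraMap ℝ ℂ))
      (N := C.X.map (algebraMap ℝ ℂ)) hd (fun τ h => by
        have h1 := h.1
        rw [eval_sub, eval_mul, eval_C] at h1
        have hY : (C.Y.map (algebraMap ℝ ℂ)).eval τ ≠ 0 := fun h0 =>
          hz τ ⟨h.2, h0, by rw [h0] at h1; simpa using h1⟩
        refine hv.1 ⟨τ, ?_, ?_⟩
        · rw [Finset.mem_coe, Multiset.mem_toFinset, mem_roots hX']; exact h.2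
        · simp only
          rw [div_eq_iff hY]; linear_combination h1) (fun h => by
        have h1 := h.1
        rw [coeff_sub, coeff_C_mul] at h1
        have hY : (C.Y.map (algebraMap ℝ ℂ)).coeff C.degree ≠ 0 := fun h0 =>
          htop ⟨by simpa using h.2, by simpa using h0, by rw [h0] at h1; simpa using h1⟩
        refine hv.2 ?_
        rw [mem_singleton_iff, eq_div_iff hY]; linear_combination -h1)
    obtain ⟨u, hu⟩ := hfin.exists_notMem
    refine ⟨(u, v), fun h => hu ?_⟩
    rw [isTangent_iff, lineForm] at h
    rw [mem_ofPred_eq, sub_right_comm]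
    exact h

/-- The form of the moving line with indeterminate coordinates. -/
noncomputable def linePoly : (MvPolynomial (Fin 2) ℂ)[X] :=
  C.Z.map (MvPolynomial.C.comp (algebraMap ℝ ℂ))
    - Polynomial.C (MvPolynomial.X 0) * C.X.map (MvPolynomial.C.comp (algebraMap ℝ ℂ))
    - Polynomial.C (MvPolynomial.X 1) * C.Y.map (MvPolynomial.C.comp (algebraMap ℝ ℂ))

theorem map_linePoly (p : ℂ × ℂ) : C.linePoly.map (evalPair p) = C.lineForm p := by
  have h : ∀ p : ℂ × ℂ, (evalPair p).comp (MvPolynomial.C.comp (algebraMap ℝ ℂ)) = algebraMap ℝ ℂ :=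
    fun p => by ext x; simp
  simp only [linePoly, Polynomial.map_sub, Polynomial.map_mul, Polynomial.map_map, h, map_C,
    MvPolynomial.eval_X, lineForm]
  rfl

theorem natDegree_linePoly_le : C.linePoly.natDegree ≤ C.degree := by
  unfold linePoly
  have hm : ∀ Q : ℝ[X], Q.natDegree ≤ C.degree →
      (Q.map (MvPolynomial.C.comp (algebraMap ℝ ℂ) : ℝ →+* MvPolynomial (Fin 2) ℂ)).natDegree ≤
        C.degree := fun Q h => natDegree_map_le.trans h
  exact (natDegree_sub_le_of_le (natDegree_sub_le_of_le (hm _ C.natDegree_Z_le)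
    ((natDegree_C_mul_le _ _).trans (hm _ C.natDegree_X_le)))
    ((natDegree_C_mul_le _ _).trans (hm _ C.natDegree_Y_le))).trans (by simp)

/-- The equation of the dual curve, with the lines dual to critical values of the
parametrization. -/
noncomputable def dualPoly : MvPolynomial (Fin 2) ℂ := formDiscr C.degree C.linePoly

theorem evalPair_dualPoly (p : ℂ × ℂ) : evalPair p C.dualPoly = formDiscr C.degree (C.lineForm p) := by
  rw [dualPoly, map_formDiscr, map_linePoly]

theorem evalPair_dualPoly_eq_zero_iff (hd : 2 ≤ C.degree) (p : ℂ × ℂ) :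
    evalPair p C.dualPoly = 0 ↔ C.IsTangent p := by
  rw [evalPair_dualPoly, formDiscr_eq_zero_iff hd (C.natDegree_lineForm_le p), isTangent_iff]

theorem dualPoly_ne_zero (hd : 2 ≤ C.degree) : C.dualPoly ≠ 0 := by
  intro h
  obtain ⟨p, hp⟩ := C.exists_not_isTangent
  exact hp ((C.evalPair_dualPoly_eq_zero_iff hd p).1 (by rw [h, map_zero]))

theorem two_le_degree (h : ¬C.IsLinear) : 2 ≤ C.degree := by
  have := C.one_le_degree
  have : C.degree ≠ 1 := h
  omega

/-- Every form of degree `2 * d - 2` times the discriminant lies in the ideal of the partial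
derivatives of the moving form. -/
theorem exists_reduction (hd : 2 ≤ C.degree) {R : (MvPolynomial (Fin 2) ℂ)[X]}
    (hR : R.natDegree + 2 ≤ 2 * C.degree) :
    ∃ A B : (MvPolynomial (Fin 2) ℂ)[X], A.natDegree ≤ C.degree - 1 ∧ B.natDegree ≤ C.degree - 1 ∧
      Polynomial.C C.dualPoly * R = A * derivative C.linePoly +
        B * ((C.degree : (MvPolynomial (Fin 2) ℂ)[X]) * C.linePoly - Polynomial.X * derivative C.linePoly) := by
  set d := C.degree with hdd
  have h1 : (derivative C.linePoly).natDegree ≤ d - 1 :=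
    (natDegree_derivative_le _).trans (by have := C.natDegree_linePoly_le; omega)
  have h2 := natDegree_euler_le C.natDegree_linePoly_le
  have key : ∀ Q : (MvPolynomial (Fin 2) ℂ)[X], Q.degree < ((d - 1 + (d - 1) : ℕ) : WithBot ℕ) →
      ∃ A B : (MvPolynomial (Fin 2) ℂ)[X], A.natDegree ≤ d - 2 ∧ B.natDegree ≤ d - 2 ∧
      Polynomial.C C.dualPoly * Q = A * derivative C.linePoly +
        B * ((d : (MvPolynomial (Fin 2) ℂ)[X]) * C.linePoly - Polynomial.X * derivative C.linePoly) := by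
    intro Q hQ
    obtain ⟨a, b, ha, hb, hab⟩ := exists_mul_add_mul_eq_resultant_mul h1 h2 hQ
    have hdeg : ∀ q : (MvPolynomial (Fin 2) ℂ)[X], q.degree < ((d - 1 : ℕ) : WithBot ℕ) →
        q.natDegree ≤ d - 2 := by
      intro q hq
      by_cases h0 : q = 0
      · rw [h0]; simp
      · have := (natDegree_lt_iff_degree_lt h0).2 hq
        omega
    refine ⟨a, b, hdeg _ ha, hdeg _ hb, ?_⟩
    rw [dualPoly, formDiscr, ← hab, mul_comm a, mul_comm b]
  -- The Sylvester argument covers degrees up to 2d - 3, while `R` may have degree 2d - 2. So the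
  -- constant term and the quotient by the variable are treated separately, at the cost of one
  -- degree in the cofactors.
  obtain ⟨A₀, B₀, a1, a2, a3⟩ := key (Polynomial.C (R.coeff 0)) (by
    refine degree_C_le.trans_lt ?_
    exact_mod_cast (by omega : 0 < d - 1 + (d - 1)))
  obtain ⟨A₁, B₁, b1, b2, b3⟩ := key R.divX (by
    by_cases h0 : R.divX = 0
    · rw [h0, degree_zero]; exact WithBot.bot_lt_coe _
    · rw [← natDegree_lt_iff_degree_lt h0, natDegree_divX_eq_natDegree_tsub_one]; omega)
  refine ⟨A₀ + Polynomial.X * A₁, B₀ + Polynomial.X * B₁, ?_, ?_, ?_⟩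
  · exact (natDegree_add_le_of_degree_le (n := d - 1) (by omega)
      (natDegree_mul_le.trans (by rw [natDegree_X]; omega)))
  · exact (natDegree_add_le_of_degree_le (n := d - 1) (by omega)
      (natDegree_mul_le.trans (by rw [natDegree_X]; omega)))
  · conv_lhs => rw [← divX_mul_X_add R]
    linear_combination a3 + Polynomial.X * b3

end RationalCurve

namespace RationalPolypol

variable (P : RationalPolypol)

theorem vertices_finite : P.vertices.Finite := Set.finite_iUnion fun _ => endpoints_finite _

theorem evalPair_edgePoly (c : ℝ) (n : ℝ × ℝ) (p : ℂ × ℂ) :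
    evalPair p (edgePoly c n) = c + n.1 * p.1 + n.2 * p.2 := by
  simp [edgePoly]

theorem evalPair_vertexPoly (w : ℝ × ℝ) (p : ℂ × ℂ) :
    evalPair p (edgePoly 1 (-w)) = 1 - p.1 * w.1 - p.2 * w.2 := by
  rw [evalPair_edgePoly]; simp; ring

theorem vertexPoly_ne_zero (w : ℝ × ℝ) : edgePoly 1 (-w) ≠ 0 := by
  intro h
  have := evalPair_vertexPoly w 0
  rw [h] at this
  simp at this

open Classical in
/-- The singular locus is an algebraic curve. -/
theorem exists_singularLocus_eq : ∃ h : MvPolynomial (Fin 2) ℂ, h ≠ 0 ∧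
    P.singularLocus = {p | MvPolynomial.eval ![p.1, p.2] h = 0} := by
  refine ⟨(∏ w ∈ P.vertices_finite.toFinset, edgePoly 1 (-w)) *
    ∏ j ∈ Finset.univ.filter (fun j => ¬(P.arc j).IsLinear), (P.arc j).dualPoly, ?_, ?_⟩
  · refine mul_ne_zero (Finset.prod_ne_zero_iff.2 fun w _ => vertexPoly_ne_zero w)
      (Finset.prod_ne_zero_iff.2 fun j hj => ?_)
    exact (P.arc j).dualPoly_ne_zero ((P.arc j).two_le_degree (Finset.mem_filter.1 hj).2)
  · ext p
    change p ∈ P.singularLocus ↔ evalPair p _ = 0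
    rw [map_mul, mul_eq_zero, map_prod, map_prod, Finset.prod_eq_zero_iff, Finset.prod_eq_zero_iff]
    refine or_congr (exists_congr fun w => ?_) (exists_congr fun j => ?_)
    · rw [evalPair_vertexPoly, Set.Finite.mem_toFinset]
    · simp only [Finset.mem_filter, Finset.mem_univ, true_and]
      exact and_congr_right fun h =>
        ((P.arc j).evalPair_dualPoly_eq_zero_iff ((P.arc j).two_le_degree h) p).symm

end RationalPolypol

end Polypol

namespace Polypol

open MeasureTheory Filter Topology Set

/-! ### Reduction of the periods and their Pfaffian system -/

namespace RationalArc

variable {γ : RationalArc}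

theorem integral_quotient_derivative_of_some {a b : ℝ} (hab : a < b) (hI : γ.interval = Icc a b)
    {L N : ℂ[X]} (h : γ.Avoids L) :
    ∫ τ in γ.interval, (derivative N * L - N * derivative L).eval (τ : ℂ) / L.eval (τ : ℂ) ^ 2 =
      N.eval (b : ℂ) / L.eval (b : ℂ) - N.eval (a : ℂ) / L.eval (a : ℂ) := by
  rw [hI, integral_Icc_eq_integral_Ioc, ← intervalIntegral.integral_of_le hab.le]
  refine intervalIntegral.integral_eq_sub_of_hasDerivAt
    (f := fun τ : ℝ => N.eval (τ : ℂ) / L.eval (τ : ℂ)) (fun τ hτ => ?_) ?_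
  · rw [uIcc_of_le hab.le, ← hI] at hτ
    refine (((N.hasDerivAt (τ : ℂ)).div (L.hasDerivAt (τ : ℂ)) (h.1 τ hτ)).comp_ofReal).congr_deriv ?_
    simp
  · refine ContinuousOn.intervalIntegrable ?_
    rw [uIcc_of_le hab.le, ← hI]
    exact ((Polynomial.continuous _).comp Complex.continuous_ofReal).continuousOn.div
      ((L.continuous.comp Complex.continuous_ofReal).pow 2).continuousOn
      fun τ hτ => pow_ne_zero 2 (h.1 τ hτ)

/-- On the projective line the primitive N/L returns to the same value: its limits at both ends of
the real line are the ratio of the top coefficients. -/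
theorem integral_quotient_derivative_of_none (hn : γ.ends = none)
    {L N : ℂ[X]} (h : γ.Avoids L) (hL : L.natDegree ≤ γ.degree) (hN : N.natDegree ≤ γ.degree) :
    ∫ τ in γ.interval, (derivative N * L - N * derivative L).eval (τ : ℂ) / L.eval (τ : ℂ) ^ 2 = 0 := by
  rcases γ.cases_ends with ⟨a, b, h', -⟩ | ⟨-, hI, -⟩
  · simp [hn] at h'
  have hlim : Tendsto (fun τ : ℝ => N.eval (τ : ℂ) / L.eval (τ : ℂ)) (cocompact ℝ)
      (𝓝 (N.coeff γ.degree / L.coeff γ.degree)) := by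
    refine ((tendsto_eval_div_pow N hN).div (tendsto_eval_div_pow L hL) (h.2 hn)).congr' ?_
    filter_upwards [eventually_ne_zero_cocompact] with τ hτ
    exact div_div_div_cancel_right₀ (pow_ne_zero _ (by exact_mod_cast hτ)) _ _
  have hint := h.integrableOn hL (derivative N * L - N * derivative L) (n := 2) (by
    have := natDegree_wronskian_le hN hL
    have := γ.one_le_degree
    omega)
  rw [hI] at hint ⊢
  rw [Measure.restrict_univ]
  rw [integral_of_hasDerivAt_of_tendsto (f := fun τ : ℝ => N.eval (τ : ℂ) / L.eval (τ : ℂ))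
    (fun τ => ?_) (integrableOn_univ.1 hint) (hlim.mono_left atBot_le_cocompact)
    (hlim.mono_left atTop_le_cocompact), sub_self]
  refine (((N.hasDerivAt (τ : ℂ)).div (L.hasDerivAt (τ : ℂ)) (h.1 τ (hI ▸ mem_univ τ))).comp_ofReal).congr_deriv ?_
  simp

/-- A real line meets the line at infinity in a real point: a linear Z with nonzero leading
coefficient has a real root. -/
theorem ends_ne_none_of_isLinear (h : γ.IsLinear) : γ.ends ≠ none := fun hn => by
  have hd : γ.degree = 1 := h
  rcases γ.cases_ends with ⟨a, b, h', -⟩ | ⟨-, -, -, -, -, hz, hzd, -⟩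
  · simp [hn] at h'
  rw [hd] at hzd
  refine hz (-γ.Z.coeff 0 / γ.Z.coeff 1) ?_
  rw [eq_X_add_C_of_natDegree_le_one (p := γ.Z) (hd ▸ γ.natDegree_Z_le)]
  simp
  field_simp
  ring

theorem integral_const_div_sq {a b : ℝ} (hab : a < b) (hI : γ.interval = Icc a b) {L : ℂ[X]}
    (h : γ.Avoids L) (hL : L.natDegree ≤ 1) (c : ℂ) {f : ℝ → ℂ} (hf : ∀ τ, f τ = c) :
    ∫ τ in γ.interval, f τ / L.eval (τ : ℂ) ^ 2 = c * (b - a) / (L.eval (a : ℂ) * L.eval (b : ℂ)) := by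
  have ha := h.1 a (by rw [hI]; exact left_mem_Icc.2 hab.le)
  have hb := h.1 b (by rw [hI]; exact right_mem_Icc.2 hab.le)
  -- For `L` of degree at most one, the numerator of the derivative of (τ - a)/L is the constant
  -- L(a), so this quotient is a primitive up to a constant factor.
  have hint := integral_quotient_derivative_of_some hab hI (N := X - C (a : ℂ)) h
  have hW : derivative (X - C (a : ℂ)) * L - (X - C (a : ℂ)) * derivative L =
      C (L.eval (a : ℂ)) := by
    rw [eq_X_add_C_of_natDegree_le_one hL]
    simp only [derivative_sub, derivative_X, derivative_C, derivative_mul,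
      eval_add, eval_mul, eval_C, eval_X, map_add, map_mul]
    ring
  rw [hW] at hint
  calc _ = c / L.eval (a : ℂ) * ∫ τ in γ.interval, (C (L.eval (a : ℂ))).eval (τ : ℂ) /
        L.eval (τ : ℂ) ^ 2 := by
        rw [← integral_const_mul]
        refine integral_congr_ae (Eventually.of_forall fun τ => ?_)
        simp only [eval_C, hf]
        field_simp
    _ = _ := by
      rw [hint]
      simp
      field_simp

variable (γ) in
/-- The product of the equations of the lines through the endpoints of the arc. -/
noncomputable def endPoly : MvPolynomial (Fin 2) ℂ :=
  match γ.ends with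
  | some e => γ.linePoly.eval (MvPolynomial.C (e.1 : ℂ)) * γ.linePoly.eval (MvPolynomial.C (e.2 : ℂ))
  | none => 1

theorem evalPair_eval (Q : (MvPolynomial (Fin 2) ℂ)[X]) (x : ℝ) (p : ℂ × ℂ) :
    evalPair p (Q.eval (MvPolynomial.C (x : ℂ))) = (Q.map (evalPair p)).eval (x : ℂ) := by
  rw [eval_map, ← eval₂_hom, MvPolynomial.eval_C]

theorem endPoly_of_some {a b : ℝ} (h : γ.ends = some (a, b)) :
    γ.endPoly = γ.linePoly.eval (MvPolynomial.C (a : ℂ)) * γ.linePoly.eval (MvPolynomial.C (b : ℂ)) := by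
  unfold endPoly; rw [h]

theorem endPoly_of_none (h : γ.ends = none) : γ.endPoly = 1 := by
  unfold endPoly; rw [h]

theorem exists_of_evalPair_endPoly_eq_zero {p : ℂ × ℂ} (h : evalPair p γ.endPoly = 0) :
    ∃ w ∈ γ.endpoints, 1 - p.1 * (w.1 : ℂ) - p.2 * (w.2 : ℂ) = 0 := by
  rcases γ.cases_ends with ⟨a, b, hab, hlt, hI, -, -, he, hz, -⟩ | ⟨hn, -⟩
  · rw [endPoly_of_some hab, map_mul, mul_eq_zero, evalPair_eval, evalPair_eval,
      RationalCurve.map_linePoly] at h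
    have key : ∀ x ∈ Icc a b, (γ.lineForm p).eval (x : ℂ) = 0 →
        1 - p.1 * ((γ.point x).1 : ℂ) - p.2 * ((γ.point x).2 : ℂ) = 0 := by
      intro x hx h0
      rw [RationalCurve.eval_lineForm_ofReal _ _ (hz x hx)] at h0
      exact (mul_eq_zero.1 h0).resolve_left (by exact_mod_cast hz x hx)
    rw [he]
    rcases h with h | h
    · exact ⟨_, by simp, key a (left_mem_Icc.2 hlt.le) h⟩
    · exact ⟨_, by simp, key b (right_mem_Icc.2 hlt.le) h⟩
  · rw [endPoly_of_none hn, map_one] at h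
    exact absurd h one_ne_zero

theorem natDegree_map_add_le {R : (MvPolynomial (Fin 2) ℂ)[X]} {m k : ℕ}
    (hR : R.natDegree + m ≤ k) (p : ℂ × ℂ) : (R.map (evalPair p)).natDegree + m ≤ k := by
  have := natDegree_map_le (f := evalPair p) (p := R)
  omega

/-- Hermite reduction of the integrals `∫ R / L²`. -/
theorem exists_lineIntegral_reduction (hd : 2 ≤ γ.degree) {R : (MvPolynomial (Fin 2) ℂ)[X]}
    (hR : R.natDegree + 2 ≤ 2 * γ.degree) :
    ∃ (N : MvPolynomial (Fin 2) ℂ) (G : Fin (γ.degree - 1) → MvPolynomial (Fin 2) ℂ),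
      ∀ p, γ.Avoids (γ.lineForm p) →
        evalPair p (γ.dualPoly * γ.endPoly) * γ.lineIntegral (R.map (evalPair p)) 2 p =
          evalPair p N + ∑ k, evalPair p (G k) * γ.lineIntegral (X ^ (k : ℕ)) 1 p := by
  obtain ⟨A, B, hA, hB, hAB⟩ := γ.exists_reduction hd hR
  set d := γ.degree with hdd
  -- With ΔR = AL' + B(dL - τL') and N₀ = A - τB one has ΔR/L² = -(N₀/L)' + (N₀' + dB)/L. The last
  -- numerator is Γ = A' + (d - 1)B - τB', in which Euler cancellation lowers the degree to d - 2,
  -- as required for convergence at ∞.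
  let Γ : (MvPolynomial (Fin 2) ℂ)[X] :=
    derivative A + (((d - 1 : ℕ) : (MvPolynomial (Fin 2) ℂ)[X]) * B - X * derivative B)
  have hΓ : Γ.natDegree + 2 ≤ d := by
    have h1 : (derivative A).natDegree ≤ d - 2 := (natDegree_derivative_le A).trans (by omega)
    have h2 := natDegree_euler_le hB
    have h3 : Γ.natDegree ≤ d - 2 := natDegree_add_le_of_degree_le h1 (h2.trans (by omega))
    omega
  let N₀ : (MvPolynomial (Fin 2) ℂ)[X] := A - X * B
  have hN₀ : N₀.natDegree ≤ d := by
    have h1 : (X * B).natDegree ≤ d := by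
      have := natDegree_X_le (R := MvPolynomial (Fin 2) ℂ)
      have := natDegree_mul_le (p := X) (q := B)
      omega
    exact (natDegree_sub_le_of_le hA h1).trans (by omega)
  have key : ∀ p, γ.Avoids (γ.lineForm p) →
      evalPair p γ.dualPoly * γ.lineIntegral (R.map (evalPair p)) 2 p =
      -(∫ τ in γ.interval, (derivative (N₀.map (evalPair p)) * γ.lineForm p -
        N₀.map (evalPair p) * derivative (γ.lineForm p)).eval (τ : ℂ) /
          (γ.lineForm p).eval (τ : ℂ) ^ 2) +
      ∑ k : Fin (d - 1), evalPair p (Γ.coeff k) * γ.lineIntegral (X ^ (k : ℕ)) 1 p := by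
    intro p hp
    have hL := γ.natDegree_lineForm_le p
    have hN₀p : (N₀.map (evalPair p)).natDegree ≤ d := natDegree_map_le.trans hN₀
    have i1 := hp.integrableOn hL (derivative (N₀.map (evalPair p)) * γ.lineForm p -
        N₀.map (evalPair p) * derivative (γ.lineForm p)) (n := 2) (by
      have := natDegree_wronskian_le hN₀p hL
      omega)
    have i2 := hp.integrableOn hL (Γ.map (evalPair p)) (n := 1)
      (by rw [one_mul]; exact natDegree_map_add_le hΓ p)
    have i3 : ∀ k : Fin (d - 1), IntegrableOn (fun τ : ℝ => (X ^ (k : ℕ) : ℂ[X]).eval (τ : ℂ) /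
        (γ.lineForm p).eval (τ : ℂ) ^ 1) γ.interval := fun k =>
      hp.integrableOn hL _ (n := 1) (by
        have := k.2
        rw [natDegree_X_pow]; omega)
    have hsum : ∑ k : Fin (d - 1), evalPair p (Γ.coeff k) * γ.lineIntegral (X ^ (k : ℕ)) 1 p =
        ∫ τ in γ.interval, (Γ.map (evalPair p)).eval (τ : ℂ) / (γ.lineForm p).eval (τ : ℂ) ^ 1 := by
      simp only [lineIntegral, ← integral_const_mul]
      rw [← integral_finsetSum _ fun k _ => (i3 k).const_mul _]
      refine integral_congr_ae (Eventually.of_forall fun τ => ?_)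
      simp only
      rw [eval_eq_sum_range' (p := Γ.map (evalPair p)) (n := d - 1) (by have := natDegree_map_add_le hΓ p; omega),
        Finset.sum_div, ← Fin.sum_univ_eq_sum_range (fun k => _ / _)]
      refine Finset.sum_congr rfl fun k _ => ?_
      rw [coeff_map, eval_pow, eval_X, mul_div_assoc]
    rw [hsum, ← integral_neg, ← integral_add (by exact i1.neg) i2, lineIntegral, ← integral_const_mul]
    refine setIntegral_congr_fun γ.measurableSet_interval fun τ hτ => ?_
    have hLτ := hp.1 τ hτ
    have hred := congrArg (fun Q => (Q.map (evalPair p)).eval (τ : ℂ)) hAB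
    simp only [Polynomial.map_mul, Polynomial.map_add, Polynomial.map_sub, map_C, map_X,
      RationalCurve.map_linePoly, Polynomial.map_natCast, eval_mul, eval_add, eval_sub,
      eval_C, eval_X, eval_natCast] at hred
    simp only [N₀, Γ, Polynomial.map_mul, Polynomial.map_add, Polynomial.map_sub, map_X,
      ← derivative_map, Polynomial.map_natCast, derivative_sub, derivative_mul,
      derivative_X, eval_mul, eval_add, eval_sub, eval_X, eval_natCast, Polynomial.map_one, eval_one, one_mul,
      Nat.cast_sub (show 1 ≤ d by omega), Nat.cast_one]
    rw [← derivative_map, RationalCurve.map_linePoly] at hred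
    field_simp
    linear_combination hred
  rcases γ.cases_ends with ⟨a, b, hab, hlt, hI, -⟩ | ⟨hn, -⟩
  -- The endpoint terms N₀/L have the denominators L(a) and L(b); multiplication by `endPoly` clears
  -- them.
  · refine ⟨-(N₀.eval (MvPolynomial.C (b : ℂ)) * γ.linePoly.eval (MvPolynomial.C (a : ℂ)) -
      N₀.eval (MvPolynomial.C (a : ℂ)) * γ.linePoly.eval (MvPolynomial.C (b : ℂ))),
      fun k => γ.endPoly * Γ.coeff k, fun p hp => ?_⟩
    have h := key p hp
    rw [integral_quotient_derivative_of_some hlt hI hp] at h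
    have ha := hp.1 a (by rw [hI]; exact left_mem_Icc.2 hlt.le)
    have hb := hp.1 b (by rw [hI]; exact right_mem_Icc.2 hlt.le)
    have he : evalPair p γ.endPoly = (γ.lineForm p).eval (a : ℂ) * (γ.lineForm p).eval (b : ℂ) := by
      rw [endPoly_of_some hab, map_mul, evalPair_eval, evalPair_eval, RationalCurve.map_linePoly]
    simp only [map_mul, map_neg, map_sub, evalPair_eval, RationalCurve.map_linePoly]
    rw [mul_right_comm, h, add_mul, Finset.sum_mul, he]
    congr 1
    · field_simp
    · exact Finset.sum_congr rfl fun k _ => by ring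
  · refine ⟨0, fun k => Γ.coeff k, fun p hp => ?_⟩
    rw [map_zero, zero_add, endPoly_of_none hn, mul_one, key p hp,
      integral_quotient_derivative_of_none hn hp (γ.natDegree_lineForm_le p)
      (natDegree_map_le.trans hN₀), neg_zero, zero_add]

end RationalArc

/-- A linear Pfaffian system `h ∂ᵤ eᵢ = ∑ aᵢⱼ eⱼ`, `h ∂ᵥ eᵢ = ∑ bᵢⱼ eⱼ` with polynomial
coefficients. -/
structure PfaffSystem (ι : Type) where
  h : MvPolynomial (Fin 2) ℂ
  a : ι → ι → MvPolynomial (Fin 2) ℂ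
  b : ι → ι → MvPolynomial (Fin 2) ℂ

/-- The germs `e` at `p` solve the system. -/
structure PfaffSystem.IsSolutionAt {ι : Type} [Fintype ι] (S : PfaffSystem ι)
    (e : ι → ℂ × ℂ → ℂ) (p : ℂ × ℂ) : Prop where
  analyticAt : ∀ i, AnalyticAt ℂ (e i) p
  eqU : ∀ i, ∀ᶠ q in 𝓝 p,
    evalPair q S.h * partialU (e i) q = ∑ j, evalPair q (S.a i j) * e j q
  eqV : ∀ i, ∀ᶠ q in 𝓝 p,
    evalPair q S.h * partialV (e i) q = ∑ j, evalPair q (S.b i j) * e j q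

theorem partialU_const (c : ℂ) (p : ℂ × ℂ) : partialU (fun _ => c) p = 0 := by
  simp [partialU]

theorem partialV_const (c : ℂ) (p : ℂ × ℂ) : partialV (fun _ => c) p = 0 := by
  simp [partialV]

/-- The periods of an arc are linear combinations of a solution of a Pfaffian system whose
singularities lie in the singular locus. -/
theorem RationalArc.exists_pfaffSystem (γ : RationalArc) :
    ∃ (ι : Type) (_ : Fintype ι) (S : PfaffSystem ι) (c : ι → MvPolynomial (Fin 2) ℂ)
      (e : ι → ℂ × ℂ → ℂ),
      (∀ p, evalPair p S.h = 0 →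
        (∃ w ∈ γ.endpoints, 1 - p.1 * (w.1 : ℂ) - p.2 * (w.2 : ℂ) = 0) ∨
          (¬γ.IsLinear ∧ γ.IsTangent p)) ∧
      ∀ p, (∀ᶠ q in 𝓝 p, γ.Avoids (γ.lineForm q)) → S.IsSolutionAt e p ∧
        ∀ᶠ q in 𝓝 p, evalPair q S.h * γ.lineIntegral γ.areaForm 2 q =
          ∑ i, evalPair q (c i) * e i q := by
  by_cases hlin : γ.IsLinear
  · have hd : γ.degree = 1 := hlin
    rcases γ.cases_ends with ⟨a, b, hab, hlt, hI, -⟩ | ⟨hn, -⟩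
    -- For a segment the period is a constant divided by L(a)L(b), so the trivial system for the
    -- constant function 1 suffices and no discriminant enters.
    · refine ⟨Unit, inferInstance, ⟨γ.endPoly, fun _ _ => 0, fun _ _ => 0⟩,
        fun _ => MvPolynomial.C ((b - a) * γ.areaForm.coeff 0), fun _ _ => 1,
        fun p hp => Or.inl (exists_of_evalPair_endPoly_eq_zero hp), fun p hp => ⟨⟨fun _ =>
          analyticAt_const, fun _ => ?_, fun _ => ?_⟩, ?_⟩⟩
      · exact Eventually.of_forall fun q => by simp [partialU_const]
      · exact Eventually.of_forall fun q => by simp [partialV_const]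
      filter_upwards [hp] with q hq
      have ha := hq.1 a (by rw [hI]; exact left_mem_Icc.2 hlt.le)
      have hb := hq.1 b (by rw [hI]; exact right_mem_Icc.2 hlt.le)
      have hR : γ.areaForm = C (γ.areaForm.coeff 0) := eq_C_of_natDegree_le_zero (by
        have := γ.natDegree_areaForm_le
        omega)
      have hval : γ.lineIntegral γ.areaForm 2 q = _ :=
        integral_const_div_sq hlt hI hq (hd ▸ γ.natDegree_lineForm_le q) (γ.areaForm.coeff 0)
          fun τ => by rw [hR]; simp
      rw [hval, endPoly_of_some hab, map_mul, evalPair_eval, evalPair_eval,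
        RationalCurve.map_linePoly]
      simp
      field_simp
    · exact (ends_ne_none_of_isLinear hlin hn).elim
  · have hd := γ.two_le_degree hlin
    let Φ : ℂ →+* MvPolynomial (Fin 2) ℂ := MvPolynomial.C
    have hΦ : ∀ (p : ℂ × ℂ) (Q : ℂ[X]), (Q.map Φ).map (evalPair p) = Q := by
      intro p Q
      rw [Polynomial.map_map, show (evalPair p).comp Φ = RingHom.id ℂ by ext x; simp [Φ],
        Polynomial.map_id]
    have hdeg : ∀ (Q : ℂ[X]) (m k : ℕ), Q.natDegree + m ≤ k → (Q.map Φ).natDegree + m ≤ k := by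
      intro Q m k h
      have := natDegree_map_le (f := Φ) (p := Q)
      omega
    have hmul : ∀ (Q : ℝ[X]), Q.natDegree ≤ γ.degree → ∀ k : Fin (γ.degree - 1),
        (((X : ℂ[X]) ^ (k : ℕ)) * Q.map (algebraMap ℝ ℂ)).natDegree + 2 ≤ 2 * γ.degree := by
      intro Q hQ k
      have h1 := natDegree_mul_le (p := (X : ℂ[X]) ^ (k : ℕ)) (q := Q.map (algebraMap ℝ ℂ))
      have h2 := natDegree_map_le (f := algebraMap ℝ ℂ) (p := Q)
      rw [natDegree_X_pow] at h1
      have := k.2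
      omega
    choose NX GX hX using fun k : Fin (γ.degree - 1) => exists_lineIntegral_reduction hd
      (hdeg _ _ _ (hmul γ.X γ.natDegree_X_le k))
    choose NY GY hY using fun k : Fin (γ.degree - 1) => exists_lineIntegral_reduction hd
      (hdeg _ _ _ (hmul γ.Y γ.natDegree_Y_le k))
    obtain ⟨NF, GF, hF⟩ := exists_lineIntegral_reduction hd (hdeg _ _ _ γ.natDegree_areaForm_le)
    simp only [hΦ] at hX hY hF
    -- The index `none` stands for the constant 1, which absorbs the endpoint terms, and `some k`
    -- for ∫ τᵏ/L. The derivatives of the latter in u and v are ∫ τᵏX/L² and ∫ τᵏY/L², and Hermite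
    -- reduction returns them to the same list.
    refine ⟨Option (Fin (γ.degree - 1)), inferInstance, ⟨γ.dualPoly * γ.endPoly,
      fun i j => i.elim 0 fun k => j.elim (NX k) (GX k),
      fun i j => i.elim 0 fun k => j.elim (NY k) (GY k)⟩,
      fun i => i.elim NF GF, fun i => i.elim (fun _ => 1) fun k => γ.lineIntegral (X ^ (k : ℕ)) 1,
      fun p hp => ?_, fun p hp => ⟨⟨?_, ?_, ?_⟩, ?_⟩⟩
    · rw [map_mul, mul_eq_zero] at hp
      rcases hp with hp | hp
      · exact Or.inr ⟨hlin, (γ.evalPair_dualPoly_eq_zero_iff hd p).1 hp⟩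
      · exact Or.inl (exists_of_evalPair_endPoly_eq_zero hp)
    · rintro (_ | k)
      · exact analyticAt_const
      · exact analyticAt_lineIntegral (by have := k.2; rw [natDegree_X_pow]; omega) hp.self_of_nhds
    · rintro (_ | k)
      · exact Eventually.of_forall fun q => by simp [partialU_const]
      · filter_upwards [hp] with q hq
        simp only [Option.elim_some, Fintype.sum_option, Option.elim_none, mul_one]
        rw [(partials_lineIntegral (by have := k.2; rw [natDegree_X_pow]; omega) hq).1,
          Nat.cast_one, one_mul]
        exact hX k q hq
    · rintro (_ | k)
      · exact Eventually.of_forall fun q => by simp [partialV_const]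
      · filter_upwards [hp] with q hq
        simp only [Option.elim_some, Fintype.sum_option, Option.elim_none, mul_one]
        rw [(partials_lineIntegral (by have := k.2; rw [natDegree_X_pow]; omega) hq).2,
          Nat.cast_one, one_mul]
        exact hY k q hq
    · filter_upwards [hp] with q hq
      simp only [Option.elim_some, Fintype.sum_option, Option.elim_none, mul_one]
      exact hF q hq

end Polypol

namespace Polypol

open MeasureTheory Filter Topology Set

/-! ### Holonomicity of solutions of Pfaffian systems -/

theorem totalDegree_pderiv_le (i : Fin 2) (q : MvPolynomial (Fin 2) ℂ) :
    (MvPolynomial.pderiv i q).totalDegree ≤ q.totalDegree := by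
  conv_lhs => rw [q.as_sum, map_sum]
  refine MvPolynomial.totalDegree_finsetSum_le fun s hs => ?_
  rw [MvPolynomial.pderiv_monomial]
  refine (MvPolynomial.totalDegree_monomial_le _ _).trans
    (le_trans ?_ (MvPolynomial.le_totalDegree hs))
  rw [Finsupp.sum_fintype _ _ fun _ => rfl, Finsupp.sum_fintype _ _ fun _ => rfl]
  exact Finset.sum_le_sum fun j _ => Nat.sub_le _ _

/-- The derivation of polynomials `δ` is the derivative in direction `v`. -/
def IsPartial (v : ℂ × ℂ) (δ : MvPolynomial (Fin 2) ℂ → MvPolynomial (Fin 2) ℂ) : Prop :=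
  (∀ q, (δ q).totalDegree ≤ q.totalDegree) ∧
    ∀ q z, fderiv ℂ (fun z => evalPair z q) z v = evalPair z (δ q)

theorem differentiableAt_evalPair (q : MvPolynomial (Fin 2) ℂ) (z : ℂ × ℂ) :
    DifferentiableAt ℂ (fun z => evalPair z q) z := (analyticAt_evalPair q z).differentiableAt

theorem fderiv_evalPair (q : MvPolynomial (Fin 2) ℂ) (z v : ℂ × ℂ) :
    fderiv ℂ (fun z => evalPair z q) z v =
      v.1 * evalPair z (MvPolynomial.pderiv 0 q) + v.2 * evalPair z (MvPolynomial.pderiv 1 q) := by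
  induction q using MvPolynomial.induction_on with
  | C a => simp
  | add f g hf hg =>
    simp only [map_add]
    rw [fderiv_fun_add (differentiableAt_evalPair f z) (differentiableAt_evalPair g z),
      add_apply, hf, hg]
    ring
  | mul_X f i hf =>
    have hX : fderiv ℂ (fun z : ℂ × ℂ => evalPair z (MvPolynomial.X i)) z v =
        v.1 * (Pi.single i 1 : Fin 2 → ℂ) 0 + v.2 * (Pi.single i 1 : Fin 2 → ℂ) 1 := by
      fin_cases i
      · simp [fderiv_fst]
      · simp [fderiv_snd]
    have hmul : fderiv ℂ (fun z => evalPair z (f * MvPolynomial.X i)) z =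
        evalPair z f • fderiv ℂ (fun z => evalPair z (MvPolynomial.X i)) z +
        evalPair z (MvPolynomial.X i) • fderiv ℂ (fun z => evalPair z f) z := by
      simp only [map_mul]
      exact fderiv_fun_mul (differentiableAt_evalPair f z) (differentiableAt_evalPair _ z)
    rw [hmul, add_apply, smul_apply,
      smul_apply, hX, hf]
    simp only [MvPolynomial.pderiv_mul, MvPolynomial.pderiv_X, map_add, map_mul, smul_eq_mul]
    fin_cases i <;> simp <;> ring

theorem isPartial_pderiv_zero : IsPartial (1, 0) (MvPolynomial.pderiv 0) :=
  ⟨totalDegree_pderiv_le 0, fun q z => by rw [fderiv_evalPair]; simp⟩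

theorem isPartial_pderiv_one : IsPartial (0, 1) (MvPolynomial.pderiv 1) :=
  ⟨totalDegree_pderiv_le 1, fun q z => by rw [fderiv_evalPair]; simp⟩

section

variable {ι : Type} [Fintype ι]

/-- `hˢ g` is a combination of the germs `e` at `p` with polynomial coefficients of degree at
most `m`. -/
structure Represents (h : MvPolynomial (Fin 2) ℂ) (e : ι → ℂ × ℂ → ℂ) (p : ℂ × ℂ) (s m : ℕ)
    (g : ℂ × ℂ → ℂ) : Prop where
  analyticAt : AnalyticAt ℂ g p
  exists_eq : ∃ q : ι → MvPolynomial (Fin 2) ℂ, (∀ i, (q i).totalDegree ≤ m) ∧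
    ∀ᶠ z in 𝓝 p, evalPair z h ^ s * g z = ∑ i, evalPair z (q i) * e i z

variable {h : MvPolynomial (Fin 2) ℂ} {e : ι → ℂ × ℂ → ℂ} {p : ℂ × ℂ} {s m : ℕ} {g : ℂ × ℂ → ℂ}

theorem analyticAt_fderiv_apply {f : ℂ × ℂ → ℂ} (hf : AnalyticAt ℂ f p) (v : ℂ × ℂ) :
    AnalyticAt ℂ (fun z => fderiv ℂ f z v) p :=
  ((ContinuousLinearMap.apply ℂ ℂ v).analyticAt _).comp hf.fderiv

/-- Differentiating hˢg = ∑ qᵢeᵢ and multiplying by h gives the new numerator h ∂qᵢ + ∑ qⱼaⱼᵢ - s ∂h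
qᵢ. One derivative thus costs one power of h and at most `N` in degree; this linear growth is the
core of holonomicity. -/
theorem Represents.fderiv_apply {v : ℂ × ℂ} {δ : MvPolynomial (Fin 2) ℂ → MvPolynomial (Fin 2) ℂ}
    (hv : IsPartial v δ) {a : ι → ι → MvPolynomial (Fin 2) ℂ} {N : ℕ} (hh : h.totalDegree ≤ N)
    (ha : ∀ i j, (a i j).totalDegree ≤ N) (he : ∀ i, AnalyticAt ℂ (e i) p)
    (heq : ∀ i, ∀ᶠ q in 𝓝 p, evalPair q h * fderiv ℂ (e i) q v = ∑ j, evalPair q (a i j) * e j q)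
    (hg : Represents h e p s m g) :
    Represents h e p (s + 1) (m + N) (fun z => fderiv ℂ g z v) := by
  obtain ⟨q, hq, hqe⟩ := hg.exists_eq
  refine ⟨analyticAt_fderiv_apply hg.analyticAt v, fun i => h * δ (q i) + ∑ j, q j * a j i -
    MvPolynomial.C (s : ℂ) * (δ h * q i), fun i => ?_, ?_⟩
  · have h1 : (h * δ (q i)).totalDegree ≤ m + N :=
      (MvPolynomial.totalDegree_mul _ _).trans (by have := (hv.1 (q i)).trans (hq i); omega)
    have h2 : (∑ j, q j * a j i).totalDegree ≤ m + N :=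
      MvPolynomial.totalDegree_finsetSum_le fun j _ =>
        (MvPolynomial.totalDegree_mul _ _).trans (add_le_add (hq j) (ha j i))
    have h3 : (MvPolynomial.C (s : ℂ) * (δ h * q i)).totalDegree ≤ m + N := by
      refine (MvPolynomial.totalDegree_mul _ _).trans ?_
      rw [MvPolynomial.totalDegree_C, zero_add]
      exact (MvPolynomial.totalDegree_mul _ _).trans (by
        have := (hv.1 h).trans hh; have := hq i; omega)
    refine (MvPolynomial.totalDegree_sub _ _).trans (max_le
      ((MvPolynomial.totalDegree_add _ _).trans (max_le h1 h2)) h3)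
  · have han : ∀ᶠ z in 𝓝 p, (∀ i, AnalyticAt ℂ (e i) z) ∧ AnalyticAt ℂ g z :=
      (eventually_all.2 fun i => (he i).eventually_analyticAt).and hg.analyticAt.eventually_analyticAt
    filter_upwards [hqe.eventually_nhds, han, eventually_all.2 heq, hqe] with z hz hza hzz hz0
    have d1 : HasFDerivAt (fun z => evalPair z h ^ s * g z) _ z :=
      ((differentiableAt_evalPair h z).hasFDerivAt.pow s).mul hza.2.differentiableAt.hasFDerivAt
    have d2 : HasFDerivAt (fun z => ∑ i, evalPair z (q i) * e i z) _ z :=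
      HasFDerivAt.fun_sum fun i _ =>
        (differentiableAt_evalPair (q i) z).hasFDerivAt.mul (hza.1 i).differentiableAt.hasFDerivAt
    have hd := congrArg (fun A : ℂ × ℂ →L[ℂ] ℂ => A v)
      (d1.unique (d2.congr_of_eventuallyEq hz))
    simp only [add_apply, smul_apply, smul_eq_mul,
      sum_apply, hv.2, nsmul_eq_mul] at hd
    have hs : (s : ℂ) * evalPair z h ^ (s - 1) * evalPair z h = s * evalPair z h ^ s := by
      rcases s with _ | s
      · simp
      · rw [Nat.add_sub_cancel, mul_assoc, ← pow_succ]
    have hsum : ∑ i, evalPair z h * (evalPair z (q i) * fderiv ℂ (e i) z v) =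
        ∑ i, evalPair z (∑ j, q j * a j i) * e i z := by
      simp only [map_sum, map_mul, Finset.sum_mul]
      rw [Finset.sum_comm]
      refine Finset.sum_congr rfl fun i _ => ?_
      rw [mul_left_comm, hzz i, Finset.mul_sum]
      exact Finset.sum_congr rfl fun j _ => by ring
    have hR : ∑ i, evalPair z (h * δ (q i) + ∑ j, q j * a j i -
        MvPolynomial.C (s : ℂ) * (δ h * q i)) * e i z =
        ∑ i, evalPair z h * (evalPair z (δ (q i)) * e i z) +
        ∑ i, evalPair z (∑ j, q j * a j i) * e i z -
        s * evalPair z (δ h) * ∑ i, evalPair z (q i) * e i z := by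
      rw [Finset.mul_sum, ← Finset.sum_add_distrib, ← Finset.sum_sub_distrib]
      refine Finset.sum_congr rfl fun i _ => ?_
      simp only [map_sub, map_add, map_mul, MvPolynomial.eval_C]
      ring
    rw [hR, ← hsum, ← hz0]
    have hd' := congrArg (fun x => evalPair z h * x) hd
    simp only [Finset.sum_add_distrib, mul_add, Finset.mul_sum] at hd'
    have e1 : ∑ i, evalPair z h * (evalPair z (δ (q i)) * e i z) =
        ∑ i, evalPair z h * (e i z * evalPair z (δ (q i))) :=
      Finset.sum_congr rfl fun i _ => by ring
    rw [e1, add_comm (∑ i, evalPair z h * (e i z * evalPair z (δ (q i)))), ← hd', pow_succ]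
    linear_combination (g z * evalPair z (δ h)) * (-hs)

theorem Represents.mul_poly (hg : Represents h e p s m g) (q : MvPolynomial (Fin 2) ℂ) :
    Represents h e p s (q.totalDegree + m) (fun z => evalPair z q * g z) := by
  obtain ⟨r, hr, hre⟩ := hg.exists_eq
  refine ⟨(analyticAt_evalPair q p).mul hg.analyticAt, fun i => q * r i, fun i =>
    (MvPolynomial.totalDegree_mul _ _).trans (add_le_add le_rfl (hr i)), ?_⟩
  filter_upwards [hre] with z hz
  rw [mul_left_comm, hz, Finset.mul_sum]
  exact Finset.sum_congr rfl fun i _ => by rw [map_mul, mul_assoc]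

theorem Represents.raise (hg : Represents h e p s m g) {N : ℕ} (hh : h.totalDegree ≤ N) (t : ℕ) :
    Represents h e p (s + t) (t * N + m) g := by
  obtain ⟨r, hr, hre⟩ := hg.exists_eq
  refine ⟨hg.analyticAt, fun i => h ^ t * r i, fun i =>
    (MvPolynomial.totalDegree_mul _ _).trans (add_le_add
      ((MvPolynomial.totalDegree_pow _ _).trans (by gcongr)) (hr i)), ?_⟩
  filter_upwards [hre] with z hz
  rw [pow_add, mul_right_comm, hz, Finset.sum_mul]
  exact Finset.sum_congr rfl fun i _ => by rw [map_mul, map_pow]; ring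

theorem Represents.mono (hg : Represents h e p s m g) {m' : ℕ} (hm : m ≤ m') :
    Represents h e p s m' g := by
  obtain ⟨r, hr, hre⟩ := hg.exists_eq
  exact ⟨hg.analyticAt, r, fun i => (hr i).trans hm, hre⟩

/-- The number of spanning germs is quadratic in `m`, since there are two variables. -/
theorem Represents.mem_span (hg : Represents h e p s m g) (hp : evalPair p h ≠ 0) :
    (g : Germ (𝓝 p) ℂ) ∈ Submodule.span ℂ (range fun x : (Fin (m + 1) × Fin (m + 1)) × ι =>
      ((fun z : ℂ × ℂ => z.1 ^ (x.1.1 : ℕ) * z.2 ^ (x.1.2 : ℕ) * e x.2 z / evalPair z h ^ s :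
        ℂ × ℂ → ℂ) : Germ (𝓝 p) ℂ)) := by
  obtain ⟨q, hq, hqe⟩ := hg.exists_eq
  let coeGerm : (ℂ × ℂ → ℂ) →ₗ[ℂ] Germ (𝓝 p) ℂ :=
    { toFun := fun f => (f : Germ (𝓝 p) ℂ), map_add' := fun _ _ => rfl, map_smul' := fun _ _ => rfl }
  have hgerm : (g : Germ (𝓝 p) ℂ) = coeGerm (∑ i, ∑ d ∈ (q i).support, (q i).coeff d •
      fun z : ℂ × ℂ => z.1 ^ d 0 * z.2 ^ d 1 * e i z / evalPair z h ^ s) := by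
    refine Germ.coe_eq.2 ?_
    filter_upwards [hqe, (continuous_evalPair h).continuousAt.eventually_ne hp] with z hz hne
    have hne' := pow_ne_zero s hne
    rw [eq_div_of_mul_eq hne' ((mul_comm _ _).trans hz), Finset.sum_apply, Finset.sum_div]
    refine Finset.sum_congr rfl fun i _ => ?_
    rw [Finset.sum_apply, MvPolynomial.eval_eq', Finset.sum_mul, Finset.sum_div]
    refine Finset.sum_congr rfl fun d _ => ?_
    simp only [Fin.prod_univ_two, Pi.smul_apply, smul_eq_mul, Matrix.cons_val_zero,
      Matrix.cons_val_one]
    ring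
  rw [hgerm, map_sum]
  refine Submodule.sum_mem _ fun i _ => ?_
  rw [map_sum]
  refine Submodule.sum_mem _ fun d hd => ?_
  rw [map_smul]
  have hdeg : d 0 + d 1 ≤ m := by
    have h1 := (MvPolynomial.le_totalDegree hd).trans (hq i)
    rwa [Finsupp.sum_fintype _ _ (fun _ => rfl), Fin.sum_univ_two] at h1
  exact Submodule.smul_mem _ _ (Submodule.subset_span
    ⟨((⟨d 0, by omega⟩, ⟨d 1, by omega⟩), i), rfl⟩)

end

/-- A combination of the solutions of a Pfaffian system is holonomic off the singularities of the
system. -/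
theorem PfaffSystem.IsSolutionAt.isHolonomicAt {ι : Type} [Fintype ι] {S : PfaffSystem ι}
    {e : ι → ℂ × ℂ → ℂ} {p : ℂ × ℂ} (he : S.IsSolutionAt e p) (hp : evalPair p S.h ≠ 0)
    {f : ℂ × ℂ → ℂ} (hf : AnalyticAt ℂ f p) {c : ι → MvPolynomial (Fin 2) ℂ}
    (hfe : ∀ᶠ q in 𝓝 p, evalPair q S.h * f q = ∑ i, evalPair q (c i) * e i q) :
    IsHolonomicAt f p := by
  refine ⟨hf, ?_⟩
  obtain ⟨N, hN⟩ : ∃ N, S.h.totalDegree ≤ N ∧ (∀ i j, (S.a i j).totalDegree ≤ N) ∧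
      (∀ i j, (S.b i j).totalDegree ≤ N) ∧ ∀ i, (c i).totalDegree ≤ N := by
    refine ⟨S.h.totalDegree + (∑ i, ∑ j, (S.a i j).totalDegree) + (∑ i, ∑ j, (S.b i j).totalDegree)
      + ∑ i, (c i).totalDegree, by omega, fun i j => ?_, fun i j => ?_, fun i => ?_⟩
    · have h1 := Finset.single_le_sum (f := fun j => (S.a i j).totalDegree)
        (fun _ _ => Nat.zero_le _) (Finset.mem_univ j)
      have h2 := Finset.single_le_sum (f := fun i => ∑ j, (S.a i j).totalDegree)
        (fun _ _ => Nat.zero_le _) (Finset.mem_univ i)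
      omega
    · have h1 := Finset.single_le_sum (f := fun j => (S.b i j).totalDegree)
        (fun _ _ => Nat.zero_le _) (Finset.mem_univ j)
      have h2 := Finset.single_le_sum (f := fun i => ∑ j, (S.b i j).totalDegree)
        (fun _ _ => Nat.zero_le _) (Finset.mem_univ i)
      omega
    · have h1 := Finset.single_le_sum (f := fun i => (c i).totalDegree)
        (fun _ _ => Nat.zero_le _) (Finset.mem_univ i)
      omega
  obtain ⟨hh, ha, hb, hc⟩ := hN
  have h0 : Represents S.h e p 1 N f :=
    ⟨hf, c, hc, hfe.mono fun q hq => by rw [pow_one]; exact hq⟩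
  have hV : ∀ d, Represents S.h e p (1 + d) (N + d * N) (partialV^[d] f) := by
    intro d
    induction d with
    | zero => simpa using h0
    | succ d ih =>
      rw [Function.iterate_succ_apply']
      refine (ih.fderiv_apply isPartial_pderiv_one hh hb he.analyticAt he.eqV).mono ?_
      rw [add_mul, one_mul, add_assoc]
  have hU : ∀ d c', Represents S.h e p (1 + d + c') (N + d * N + c' * N)
      (partialU^[c'] (partialV^[d] f)) := by
    intro d c'
    induction c' with
    | zero => simpa using hV d
    | succ c' ih =>
      rw [Function.iterate_succ_apply']
      refine (ih.fderiv_apply isPartial_pderiv_zero hh ha he.analyticAt he.eqU).mono ?_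
      rw [add_mul, one_mul, ← add_assoc]
  -- All germs of filtration degree at most `k` are brought to the common denominator h^(1 + k),
  -- with numerators of degree at most (N + 1)(k + 1). The number of exponents in each variable is
  -- then at most (N + 2)(k + 1).
  refine ⟨Fintype.card ι * (N + 2) ^ 2, fun k => ?_⟩
  have hle : bernsteinStep f p k ≤ Submodule.span ℂ (range fun x :
      (Fin ((N + 1) * (k + 1) + 1) × Fin ((N + 1) * (k + 1) + 1)) × ι =>
      ((fun z : ℂ × ℂ => z.1 ^ (x.1.1 : ℕ) * z.2 ^ (x.1.2 : ℕ) * e x.2 z / evalPair z S.h ^ (1 + k) :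
        ℂ × ℂ → ℂ) : Germ (𝓝 p) ℂ)) := by
    refine Submodule.span_le.2 ?_
    rintro φ ⟨a, b, c', d, hk, rfl⟩
    obtain ⟨t, ht⟩ := Nat.exists_eq_add_of_le (show c' + d ≤ k by omega)
    have h1 := (((hU d c').raise hh t).mul_poly
      (MvPolynomial.X 0 ^ a * MvPolynomial.X 1 ^ b)).mono (m' := (N + 1) * (k + 1)) (by
        have h2 : (MvPolynomial.X 0 ^ a * MvPolynomial.X 1 ^ b :
            MvPolynomial (Fin 2) ℂ).totalDegree ≤ a + b :=
          (MvPolynomial.totalDegree_mul _ _).trans (by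
            rw [MvPolynomial.totalDegree_X_pow, MvPolynomial.totalDegree_X_pow])
        have h3 : t * N + (N + d * N + c' * N) = N * (k + 1) := by rw [ht]; ring
        rw [h3, add_mul, one_mul]
        omega)
    rw [show 1 + d + c' + t = 1 + k by omega] at h1
    have h4 := h1.mem_span hp
    simp only [map_mul, map_pow, MvPolynomial.eval_X, Matrix.cons_val_zero, Matrix.cons_val_one] at h4
    exact h4
  have := FiniteDimensional.span_of_finite ℂ (finite_range fun x :
      (Fin ((N + 1) * (k + 1) + 1) × Fin ((N + 1) * (k + 1) + 1)) × ι =>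
      ((fun z : ℂ × ℂ => z.1 ^ (x.1.1 : ℕ) * z.2 ^ (x.1.2 : ℕ) * e x.2 z / evalPair z S.h ^ (1 + k) :
        ℂ × ℂ → ℂ) : Germ (𝓝 p) ℂ))
  refine (Submodule.finrank_mono hle).trans ((finrank_range_le_card _).trans ?_)
  simp only [Fintype.card_prod, Fintype.card_fin]
  calc ((N + 1) * (k + 1) + 1) * ((N + 1) * (k + 1) + 1) * Fintype.card ι
      ≤ ((N + 2) * (k + 1)) * ((N + 2) * (k + 1)) * Fintype.card ι := by
        have : (N + 1) * (k + 1) + 1 ≤ (N + 2) * (k + 1) := by nlinarith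
        gcongr
    _ = _ := by ring

/-! ### Sums of holonomic germs. -/

theorem eventuallyEq_fderiv_add {f g : ℂ × ℂ → ℂ} {p : ℂ × ℂ} (hf : AnalyticAt ℂ f p)
    (hg : AnalyticAt ℂ g p) (v : ℂ × ℂ) :
    (fun z => fderiv ℂ (f + g) z v) =ᶠ[𝓝 p]
      (fun z => fderiv ℂ f z v) + fun z => fderiv ℂ g z v := by
  filter_upwards [hf.eventually_analyticAt, hg.eventually_analyticAt] with z h1 h2
  rw [fderiv_add h1.differentiableAt h2.differentiableAt]; rfl

theorem iterate_partial_add {D : (ℂ × ℂ → ℂ) → ℂ × ℂ → ℂ} {v : ℂ × ℂ}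
    (hD : ∀ f z, D f z = fderiv ℂ f z v) {p : ℂ × ℂ} (n : ℕ) {f g : ℂ × ℂ → ℂ}
    (hf : AnalyticAt ℂ f p) (hg : AnalyticAt ℂ g p) :
    D^[n] (f + g) =ᶠ[𝓝 p] D^[n] f + D^[n] g ∧ AnalyticAt ℂ (D^[n] f) p ∧ AnalyticAt ℂ (D^[n] g) p := by
  have hD' : ∀ f, D f = fun z => fderiv ℂ f z v := fun f => funext (hD f)
  induction n with
  | zero => exact ⟨EventuallyEq.rfl, hf, hg⟩
  | succ n ih =>
    simp only [Function.iterate_succ_apply', hD']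
    refine ⟨?_, analyticAt_fderiv_apply ih.2.1 v, analyticAt_fderiv_apply ih.2.2 v⟩
    refine EventuallyEq.trans ?_ (eventuallyEq_fderiv_add ih.2.1 ih.2.2 v)
    filter_upwards [ih.1.fderiv (𝕜 := ℂ)] with z hz
    rw [hz]

/-- Needed because `finrank` is 0 on infinite-dimensional spaces: comparing dimensions along an
inclusion requires finiteness of the larger space. -/
instance (f : ℂ × ℂ → ℂ) (p : ℂ × ℂ) (k : ℕ) : FiniteDimensional ℂ (bernsteinStep f p k) := by
  refine FiniteDimensional.span_of_finite ℂ ((Set.finite_range fun x : (Fin (k + 1) × Fin (k + 1)) ×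
    (Fin (k + 1) × Fin (k + 1)) => ((fun z : ℂ × ℂ => z.1 ^ (x.1.1 : ℕ) * z.2 ^ (x.1.2 : ℕ) *
      (partialU^[(x.2.1 : ℕ)] (partialV^[(x.2.2 : ℕ)] f)) z : ℂ × ℂ → ℂ) : Germ (𝓝 p) ℂ)).subset ?_)
  rintro φ ⟨a, b, c, d, hk, rfl⟩
  exact ⟨((⟨a, by omega⟩, ⟨b, by omega⟩), (⟨c, by omega⟩, ⟨d, by omega⟩)), rfl⟩

theorem IsHolonomicAt.add {f g : ℂ × ℂ → ℂ} {p : ℂ × ℂ} (hf : IsHolonomicAt f p)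
    (hg : IsHolonomicAt g p) : IsHolonomicAt (f + g) p := by
  obtain ⟨hf1, c1, hc1⟩ := hf
  obtain ⟨hg1, c2, hc2⟩ := hg
  refine ⟨hf1.add hg1, c1 + c2, fun k => ?_⟩
  have hle : bernsteinStep (f + g) p k ≤ bernsteinStep f p k ⊔ bernsteinStep g p k := by
    refine Submodule.span_le.2 ?_
    rintro φ ⟨a, b, c, d, hk, rfl⟩
    have h1 := iterate_partial_add (D := partialV) (v := (0, 1)) (fun _ _ => rfl) d hf1 hg1
    have h2 := iterate_partial_add (D := partialU) (v := (1, 0)) (fun _ _ => rfl) c h1.2.1 h1.2.2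
    have h3 : partialU^[c] (partialV^[d] (f + g)) =ᶠ[𝓝 p]
        partialU^[c] (partialV^[d] f + partialV^[d] g) := by
      clear h2
      induction c with
      | zero => exact h1.1
      | succ c ih =>
        simp only [Function.iterate_succ_apply']
        filter_upwards [(ih (by omega)).fderiv (𝕜 := ℂ)] with z hz
        rw [partialU, partialU, hz]
    have h4 : ((fun z : ℂ × ℂ => z.1 ^ a * z.2 ^ b * (partialU^[c] (partialV^[d] (f + g))) z :
        ℂ × ℂ → ℂ) : Germ (𝓝 p) ℂ) =
        ((fun z : ℂ × ℂ => z.1 ^ a * z.2 ^ b * (partialU^[c] (partialV^[d] f)) z : ℂ × ℂ → ℂ) :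
          Germ (𝓝 p) ℂ) +
        ((fun z : ℂ × ℂ => z.1 ^ a * z.2 ^ b * (partialU^[c] (partialV^[d] g)) z : ℂ × ℂ → ℂ) :
          Germ (𝓝 p) ℂ) := by
      rw [← Germ.coe_add, Germ.coe_eq]
      filter_upwards [h3.trans h2.1] with z hz
      rw [hz, Pi.add_apply, mul_add]; rfl
    rw [h4]
    exact Submodule.add_mem_sup (Submodule.subset_span ⟨a, b, c, d, hk, rfl⟩)
      (Submodule.subset_span ⟨a, b, c, d, hk, rfl⟩)
  refine (Submodule.finrank_mono hle).trans
    ((Submodule.finrank_add_le_finrank_add_finrank _ _).trans ?_)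
  rw [add_mul]
  exact add_le_add (hc1 k) (hc2 k)

theorem isHolonomicAt_zero (p : ℂ × ℂ) : IsHolonomicAt 0 p :=
  PfaffSystem.IsSolutionAt.isHolonomicAt (ι := Empty) (S := ⟨1, fun _ _ => 0, fun _ _ => 0⟩)
    (e := fun _ _ => 0) (c := fun _ => 0) ⟨fun i => i.elim, fun i => i.elim, fun i => i.elim⟩
    (by simp) analyticAt_const (Eventually.of_forall fun q => by simp)

theorem IsHolonomicAt.sum {α : Type*} (s : Finset α) {f : α → ℂ × ℂ → ℂ} {p : ℂ × ℂ}
    (hf : ∀ i ∈ s, IsHolonomicAt (f i) p) : IsHolonomicAt (∑ i ∈ s, f i) p := by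
  classical
  induction s using Finset.induction_on with
  | empty => simpa using isHolonomicAt_zero p
  | insert i s his ih =>
    rw [Finset.sum_insert his]
    exact (hf i (Finset.mem_insert_self i s)).add
      (ih fun j hj => hf j (Finset.mem_insert_of_mem hj))

end Polypol

namespace Polypol

open MeasureTheory Filter Topology Set unitInterval

/-! ### Continuation of solutions of Pfaffian systems -/

theorem fderiv_apply_eq (f : ℂ × ℂ → ℂ) (z v : ℂ × ℂ) :
    fderiv ℂ f z v = v.1 * partialU f z + v.2 * partialV f z := by
  have : v = v.1 • ((1 : ℂ), (0 : ℂ)) + v.2 • ((0 : ℂ), (1 : ℂ)) := by ext <;> simp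
  conv_lhs => rw [this, map_add, map_smul, map_smul]
  simp [partialU, partialV]

/-- The solution of a linear equation depends analytically on the operator. -/
theorem analyticAt_resolvent {B A W : Type*} [NormedAddCommGroup B] [NormedSpace ℂ B]
    [NormedAddCommGroup A] [NormedSpace ℂ A]
    [NormedAddCommGroup W] [NormedSpace ℂ W] [CompleteSpace W] (L : A →L[ℂ] W →L[ℂ] W) {α : B → A}
    {p : B} (hα : AnalyticAt ℂ α p) (hu : ‖L (α p)‖ < 1) (c : W) (φ : W →L[ℂ] ℂ) :
    AnalyticAt ℂ (fun p => φ (Ring.inverse (1 - L (α p)) c)) p ∧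
      ∀ w, w - L (α p) w = c → φ (Ring.inverse (1 - L (α p)) c) = φ w := by
  have hunit := isUnit_one_sub_of_norm_lt_one (x := L (α p)) hu
  refine ⟨?_, fun w hw => ?_⟩
  · obtain ⟨U, hU⟩ := hunit
    have h1 : AnalyticAt ℂ (fun p => 1 - L (α p)) p :=
      analyticAt_const.sub ((L.analyticAt _).comp hα)
    have h2 : AnalyticAt ℂ (fun p => Ring.inverse (1 - L (α p))) p := by
      refine AnalyticAt.fun_comp (g := Ring.inverse) ?_ h1
      rw [← hU]; exact analyticAt_inverse U
    exact ((φ.comp (ContinuousLinearMap.apply ℂ W c)).analyticAt _).comp h2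
  · rw [← hw]
    exact congrArg φ (DFunLike.congr_fun (Ring.inverse_mul_cancel _ hunit) w)

/-- Integration from `0`, as an operator on the continuous functions on the unit interval. -/
noncomputable def volterra : C(I, ℂ) →L[ℂ] C(I, ℂ) :=
  LinearMap.mkContinuous
    { toFun := fun f => ⟨fun t => ∫ s in (0 : ℝ)..t, f (projIcc 0 1 zero_le_one s), by
        have hc : Continuous fun s => f (projIcc 0 1 zero_le_one s) := f.continuous.comp continuous_projIcc
        exact (intervalIntegral.continuous_primitive (fun a b => hc.intervalIntegrable a b) 0).comp
          continuous_subtype_val⟩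
      map_add' := fun f g => by
        ext t
        exact intervalIntegral.integral_add
          ((f.continuous.comp continuous_projIcc).intervalIntegrable _ _)
          ((g.continuous.comp continuous_projIcc).intervalIntegrable _ _)
      map_smul' := fun c f => by
        ext t
        exact intervalIntegral.integral_smul c _ }
    1 (fun f => by
      rw [one_mul]
      refine (ContinuousMap.norm_le _ (norm_nonneg f)).2 fun t => ?_
      refine (intervalIntegral.norm_integral_le_of_norm_le_const (C := ‖f‖)
        fun s _ => f.norm_coe_le_norm _).trans ?_
      rw [sub_zero, abs_of_nonneg t.2.1]
      exact mul_le_of_le_one_right (norm_nonneg _) t.2.2)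

theorem volterra_apply (f : C(I, ℂ)) (t : I) :
    volterra f t = ∫ s in (0 : ℝ)..t, f (projIcc 0 1 zero_le_one s) := rfl

theorem norm_volterra_le (f : C(I, ℂ)) : ‖volterra f‖ ≤ ‖f‖ := by
  have := LinearMap.mkContinuous_norm_le (f := volterra.toLinearMap) (C := 1) zero_le_one (fun f => by
    rw [one_mul]
    refine (ContinuousMap.norm_le _ (norm_nonneg f)).2 fun t => ?_
    refine (intervalIntegral.norm_integral_le_of_norm_le_const (C := ‖f‖)
      fun s _ => f.norm_coe_le_norm _).trans ?_
    rw [sub_zero, abs_of_nonneg t.2.1]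
    exact mul_le_of_le_one_right (norm_nonneg _) t.2.2)
  have h2 := volterra.le_of_opNorm_le this f
  rwa [one_mul] at h2

section

variable {ι : Type}

/-- The identity of the unit interval as a complex-valued function. -/
noncomputable def paramFun : C(I, ℂ) := ⟨fun t => ((t : ℝ) : ℂ), by fun_prop⟩

/-- The restriction of a polynomial to the segment from `p₁` to `p`. -/
noncomputable def onSegment (p₁ : ℂ × ℂ) (q : MvPolynomial (Fin 2) ℂ) (p : ℂ × ℂ) : C(I, ℂ) :=
  MvPolynomial.aeval ![p₁.1 • (1 : C(I, ℂ)) + (p.1 - p₁.1) • paramFun,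
    p₁.2 • (1 : C(I, ℂ)) + (p.2 - p₁.2) • paramFun] q

theorem onSegment_apply (p₁ : ℂ × ℂ) (q : MvPolynomial (Fin 2) ℂ) (p : ℂ × ℂ) (t : I) :
    onSegment p₁ q p t = evalPair (p₁ + ((t : ℝ) : ℂ) • (p - p₁)) q := by
  rw [onSegment, evalPair, ← MvPolynomial.coe_aeval_eq_eval]
  have h : (ContinuousMap.evalAlgHom ℂ ℂ t).comp
      (MvPolynomial.aeval ![p₁.1 • (1 : C(I, ℂ)) + (p.1 - p₁.1) • paramFun,
        p₁.2 • (1 : C(I, ℂ)) + (p.2 - p₁.2) • paramFun]) =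
      MvPolynomial.aeval ![(p₁ + ((t : ℝ) : ℂ) • (p - p₁)).1, (p₁ + ((t : ℝ) : ℂ) • (p - p₁)).2] := by
    refine MvPolynomial.algHom_ext fun i => ?_
    rw [AlgHom.comp_apply, MvPolynomial.aeval_X, MvPolynomial.aeval_X]
    fin_cases i
    · change (p₁.1 • (1 : C(I, ℂ)) + (p.1 - p₁.1) • paramFun) t = p₁.1 + ((t : ℝ) : ℂ) * (p.1 - p₁.1)
      simp [paramFun]; ring
    · change (p₁.2 • (1 : C(I, ℂ)) + (p.2 - p₁.2) • paramFun) t = p₁.2 + ((t : ℝ) : ℂ) * (p.2 - p₁.2)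
      simp [paramFun]; ring
  exact DFunLike.congr_fun h q

theorem analyticAt_onSegment (p₁ : ℂ × ℂ) (q : MvPolynomial (Fin 2) ℂ) (p : ℂ × ℂ) :
    AnalyticAt ℂ (onSegment p₁ q) p := by
  refine AnalyticAt.aeval_mvPolynomial (𝕜 := ℂ) (f := fun p : ℂ × ℂ =>
    ![p₁.1 • (1 : C(I, ℂ)) + (p.1 - p₁.1) • paramFun,
      p₁.2 • (1 : C(I, ℂ)) + (p.2 - p₁.2) • paramFun]) (z := p) (fun i => ?_) q
  fin_cases i
  · exact analyticAt_const.add ((analyticAt_fst.sub analyticAt_const).smul analyticAt_const)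
  · exact analyticAt_const.add ((analyticAt_snd.sub analyticAt_const).smul analyticAt_const)

namespace PfaffSystem

variable (S : PfaffSystem ι)

/-- The matrix of the system along the segment from `p₁` to `p`. -/
noncomputable def segmentMatrix (p₁ p : ℂ × ℂ) : ι → ι → C(I, ℂ) := fun i j =>
  Ring.inverse (onSegment p₁ S.h p) *
    ((p.1 - p₁.1) • onSegment p₁ (S.a i j) p + (p.2 - p₁.2) • onSegment p₁ (S.b i j) p)

variable {S} {p₀ p₁ p : ℂ × ℂ} {r : ℝ}

theorem segment_mem_ball (h1 : p₁ ∈ Metric.ball p₀ r) (h2 : p ∈ Metric.ball p₀ r) (t : I) :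
    p₁ + ((t : ℝ) : ℂ) • (p - p₁) ∈ Metric.ball p₀ r := by
  have := (convex_ball p₀ r).add_smul_sub_mem h1 h2 t.2
  simpa using this

theorem isUnit_onSegment (hh : ∀ q ∈ Metric.ball p₀ r, evalPair q S.h ≠ 0)
    (h1 : p₁ ∈ Metric.ball p₀ r) (h2 : p ∈ Metric.ball p₀ r) : IsUnit (onSegment p₁ S.h p) := by
  rw [ContinuousMap.isUnit_iff_forall_ne_zero]
  intro t
  rw [onSegment_apply]
  exact hh _ (segment_mem_ball h1 h2 t)

theorem segmentMatrix_apply (hh : ∀ q ∈ Metric.ball p₀ r, evalPair q S.h ≠ 0)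
    (h1 : p₁ ∈ Metric.ball p₀ r) (h2 : p ∈ Metric.ball p₀ r) (i j : ι) (t : I) :
    S.segmentMatrix p₁ p i j t =
      (evalPair (p₁ + ((t : ℝ) : ℂ) • (p - p₁)) S.h)⁻¹ *
      ((p.1 - p₁.1) * evalPair (p₁ + ((t : ℝ) : ℂ) • (p - p₁)) (S.a i j) +
        (p.2 - p₁.2) * evalPair (p₁ + ((t : ℝ) : ℂ) • (p - p₁)) (S.b i j)) := by
  have hu := Ring.mul_inverse_cancel _ (isUnit_onSegment hh h1 h2)
  have hut := DFunLike.congr_fun hu t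
  rw [ContinuousMap.mul_apply, ContinuousMap.one_apply, onSegment_apply] at hut
  rw [segmentMatrix, ContinuousMap.mul_apply, eq_inv_of_mul_eq_one_right hut]
  simp [onSegment_apply]

end PfaffSystem

variable [Fintype ι]

/-- The Volterra operator of the linear system of differential equations with matrix `α`. -/
noncomputable def systemOperator :
    (ι → ι → C(I, ℂ)) →L[ℂ] (ι → C(I, ℂ)) →L[ℂ] (ι → C(I, ℂ)) :=
  LinearMap.mkContinuous₂
    (LinearMap.mk₂ ℂ (fun (α : ι → ι → C(I, ℂ)) (w : ι → C(I, ℂ)) i => ∑ j, volterra (α i j * w j))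
      (fun α β w => by
        ext1 i; simp only [Pi.add_apply, add_mul, map_add, Finset.sum_add_distrib])
      (fun c α w => by
        ext1 i; simp only [Pi.smul_apply, smul_mul_assoc, map_smul, Finset.smul_sum])
      (fun α w w' => by
        ext1 i; simp only [Pi.add_apply, mul_add, map_add, Finset.sum_add_distrib])
      (fun c α w => by
        ext1 i; simp only [Pi.smul_apply, mul_smul_comm, map_smul, Finset.smul_sum]))
    (Fintype.card ι) (fun α w => by
      refine (pi_norm_le_iff_of_nonneg (by positivity)).2 fun i => ?_
      simp only [LinearMap.mk₂_apply]
      rw [mul_assoc, ← nsmul_eq_mul, ← Finset.card_univ]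
      refine (norm_sum_le _ _).trans (Finset.sum_le_card_nsmul _ _ _ fun j _ => ?_)
      refine (norm_volterra_le _).trans ((norm_mul_le _ _).trans ?_)
      exact mul_le_mul ((norm_le_pi_norm (α i) j).trans (norm_le_pi_norm α i)) (norm_le_pi_norm w j)
        (norm_nonneg _) (norm_nonneg _))

theorem systemOperator_apply (α : ι → ι → C(I, ℂ)) (w : ι → C(I, ℂ)) (i : ι) :
    systemOperator α w i = ∑ j, volterra (α i j * w j) := rfl

theorem norm_systemOperator_le (α : ι → ι → C(I, ℂ)) :
    ‖systemOperator α‖ ≤ Fintype.card ι * ‖α‖ := by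
  refine ContinuousLinearMap.opNorm_le_bound _ (by positivity) fun w => ?_
  refine (pi_norm_le_iff_of_nonneg (by positivity)).2 fun i => ?_
  rw [systemOperator_apply, mul_assoc, ← nsmul_eq_mul, ← Finset.card_univ]
  refine (norm_sum_le _ _).trans (Finset.sum_le_card_nsmul _ _ _ fun j _ => ?_)
  refine (norm_volterra_le _).trans ((norm_mul_le _ _).trans ?_)
  exact mul_le_mul ((norm_le_pi_norm (α i) j).trans (norm_le_pi_norm α i)) (norm_le_pi_norm w j)
    (norm_nonneg _) (norm_nonneg _)

namespace PfaffSystem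

variable {S : PfaffSystem ι} {p₀ p₁ p : ℂ × ℂ} {r : ℝ}

theorem analyticAt_segmentMatrix (hh : ∀ q ∈ Metric.ball p₀ r, evalPair q S.h ≠ 0)
    (h1 : p₁ ∈ Metric.ball p₀ r) (h2 : p ∈ Metric.ball p₀ r) :
    AnalyticAt ℂ (S.segmentMatrix p₁) p := by
  obtain ⟨U, hU⟩ := isUnit_onSegment hh h1 h2
  have hi : AnalyticAt ℂ (fun p => Ring.inverse (onSegment p₁ S.h p)) p := by
    refine AnalyticAt.fun_comp (g := Ring.inverse) ?_ (analyticAt_onSegment p₁ S.h p)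
    rw [← hU]; exact analyticAt_inverse U
  refine AnalyticAt.pi fun i => AnalyticAt.pi fun j => hi.mul (AnalyticAt.add ?_ ?_)
  · exact (analyticAt_fst.sub analyticAt_const).smul (analyticAt_onSegment _ _ _)
  · exact (analyticAt_snd.sub analyticAt_const).smul (analyticAt_onSegment _ _ _)

/-- Every solution germ extends to a ball of a radius which depends on the centre only. -/
theorem exists_extension (S : PfaffSystem ι) {p₀ : ℂ × ℂ} (hp₀ : evalPair p₀ S.h ≠ 0) :
    ∃ r > 0, ∀ p₁ ∈ Metric.ball p₀ r, ∀ e : ι → ℂ × ℂ → ℂ, S.IsSolutionAt e p₁ →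
      ∃ E : ι → ℂ × ℂ → ℂ, (∀ p ∈ Metric.ball p₀ r, S.IsSolutionAt E p) ∧
        ∀ i, E i =ᶠ[𝓝 p₁] e i := by
  have hcont : ∀ q : MvPolynomial (Fin 2) ℂ,
      ContinuousAt (fun z => (evalPair z S.h)⁻¹ * evalPair z q) p₀ := fun q =>
    ((continuous_evalPair S.h).continuousAt.inv₀ hp₀).mul (continuous_evalPair q).continuousAt
  obtain ⟨C, hC0, hC⟩ : ∃ C : ℝ, 0 ≤ C ∧ ∀ᶠ z in 𝓝 p₀, ∀ i j,
      ‖(evalPair z S.h)⁻¹ * evalPair z (S.a i j)‖ ≤ C ∧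
      ‖(evalPair z S.h)⁻¹ * evalPair z (S.b i j)‖ ≤ C := by
    refine ⟨∑ i, ∑ j, (‖(evalPair p₀ S.h)⁻¹ * evalPair p₀ (S.a i j)‖ +
      ‖(evalPair p₀ S.h)⁻¹ * evalPair p₀ (S.b i j)‖) + 1, by positivity,
      eventually_all.2 fun i => eventually_all.2 fun j => ?_⟩
    have hle : ‖(evalPair p₀ S.h)⁻¹ * evalPair p₀ (S.a i j)‖ +
        ‖(evalPair p₀ S.h)⁻¹ * evalPair p₀ (S.b i j)‖ ≤
        ∑ i, ∑ j, (‖(evalPair p₀ S.h)⁻¹ * evalPair p₀ (S.a i j)‖ +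
      ‖(evalPair p₀ S.h)⁻¹ * evalPair p₀ (S.b i j)‖) :=
      (Finset.single_le_sum (f := fun j => ‖(evalPair p₀ S.h)⁻¹ * evalPair p₀ (S.a i j)‖ +
        ‖(evalPair p₀ S.h)⁻¹ * evalPair p₀ (S.b i j)‖) (fun _ _ => by positivity)
        (Finset.mem_univ j)).trans
      (Finset.single_le_sum (f := fun i => ∑ j, (‖(evalPair p₀ S.h)⁻¹ * evalPair p₀ (S.a i j)‖ +
        ‖(evalPair p₀ S.h)⁻¹ * evalPair p₀ (S.b i j)‖)) (fun _ _ => by positivity)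
        (Finset.mem_univ i))
    have h0 := norm_nonneg ((evalPair p₀ S.h)⁻¹ * evalPair p₀ (S.a i j))
    have h0' := norm_nonneg ((evalPair p₀ S.h)⁻¹ * evalPair p₀ (S.b i j))
    filter_upwards [(hcont (S.a i j)).norm.tendsto.eventually_lt_const (lt_add_of_le_of_pos
      (le_trans (le_add_of_nonneg_right h0') hle) one_pos),
      (hcont (S.b i j)).norm.tendsto.eventually_lt_const (lt_add_of_le_of_pos
      (le_trans (le_add_of_nonneg_left h0) hle) one_pos)] with z h1 h2
    exact ⟨h1.le, h2.le⟩
  obtain ⟨r₀, hr₀, hball⟩ := Metric.eventually_nhds_iff_ball.1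
    (hC.and ((continuous_evalPair S.h).continuousAt.eventually_ne hp₀))
  set n : ℝ := (Fintype.card ι : ℝ) with hn
  have hn0 : 0 ≤ n := Nat.cast_nonneg _
  -- Two points of the ball have distance at most 2r, so both summands of the segment matrix are
  -- bounded by 2rC, and the Volterra operator has norm at most 4nCr. The choice of `r` makes this
  -- less than 1, uniformly in `p₁` and `p`.
  let r := min r₀ (1 / (4 * n * C + 1))
  have hr : 0 < r := lt_min hr₀ (by positivity)
  have hrle : 4 * n * C * r < 1 := by
    have h1 : r ≤ 1 / (4 * n * C + 1) := min_le_right _ _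
    have h2 : 0 ≤ 4 * n * C := by positivity
    have h3 : r * (4 * n * C + 1) ≤ 1 := by rwa [le_div_iff₀ (by positivity)] at h1
    nlinarith
  have hsub : Metric.ball p₀ r ⊆ Metric.ball p₀ r₀ := Metric.ball_subset_ball (min_le_left _ _)
  have hh : ∀ q ∈ Metric.ball p₀ r, evalPair q S.h ≠ 0 := fun q hq => (hball q (hsub hq)).2
  refine ⟨r, hr, fun p₁ hp₁ e he => ?_⟩
  have hnorm : ∀ p ∈ Metric.ball p₀ r, ‖systemOperator (S.segmentMatrix p₁ p)‖ < 1 := by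
    intro p hp
    have hd : ‖p - p₁‖ ≤ 2 * r := by
      have h1 := dist_triangle_right p p₁ p₀
      rw [Metric.mem_ball] at hp hp₁
      rw [← dist_eq_norm]; linarith
    have hα : ‖S.segmentMatrix p₁ p‖ ≤ 2 * r * C + 2 * r * C := by
      refine (pi_norm_le_iff_of_nonneg (by positivity)).2 fun i =>
        (pi_norm_le_iff_of_nonneg (by positivity)).2 fun j =>
        (ContinuousMap.norm_le _ (by positivity)).2 fun t => ?_
      rw [segmentMatrix_apply hh hp₁ hp, mul_add, mul_left_comm, mul_left_comm _ (p.2 - p₁.2)]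
      have hb := (hball _ (hsub (segment_mem_ball hp₁ hp t))).1 i j
      refine (norm_add_le _ _).trans (add_le_add ?_ ?_) <;> rw [norm_mul]
      · exact mul_le_mul ((norm_fst_le (p - p₁)).trans hd) hb.1 (norm_nonneg _) (by positivity)
      · exact mul_le_mul ((norm_snd_le (p - p₁)).trans hd) hb.2 (norm_nonneg _) (by positivity)
    refine (norm_systemOperator_le _).trans_lt ?_
    calc n * ‖S.segmentMatrix p₁ p‖ ≤ n * (2 * r * C + 2 * r * C) := by gcongr
      _ = 4 * n * C * r := by ring
      _ < 1 := hrle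
  let c₀ : ι → C(I, ℂ) := fun i => ContinuousMap.const _ (e i p₁)
  let φ : ι → (ι → C(I, ℂ)) →L[ℂ] ℂ := fun i =>
    (ContinuousMap.evalCLM ℂ (1 : I)).comp (ContinuousLinearMap.proj i)
  -- The equation is solved along the segment from `p₁` to `p` with initial value e(p₁), and its
  -- solution is evaluated at time 1. It depends analytically on `p` through the resolvent.
  let E : ι → ℂ × ℂ → ℂ := fun i p =>
    φ i (Ring.inverse (1 - systemOperator (S.segmentMatrix p₁ p)) c₀)
  have hres := fun (i : ι) (p : ℂ × ℂ) (hp : p ∈ Metric.ball p₀ r) =>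
    analyticAt_resolvent (A := ι → ι → C(I, ℂ)) (W := ι → C(I, ℂ)) systemOperator
      (analyticAt_segmentMatrix hh hp₁ hp) (hnorm p hp) c₀ (φ i)
  have hEa : ∀ i, AnalyticOnNhd ℂ (E i) (Metric.ball p₀ r) := fun i p hp => (hres i p hp).1
  have hEe : ∀ i, E i =ᶠ[𝓝 p₁] e i := by
    have hall : ∀ᶠ q in 𝓝 p₁, q ∈ Metric.ball p₀ r ∧ ∀ i, AnalyticAt ℂ (e i) q ∧
        (evalPair q S.h * partialU (e i) q = ∑ j, evalPair q (S.a i j) * e j q) ∧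
        evalPair q S.h * partialV (e i) q = ∑ j, evalPair q (S.b i j) * e j q :=
      (Metric.isOpen_ball.eventually_mem hp₁).and (eventually_all.2 fun i =>
        (he.analyticAt i).eventually_analyticAt.and ((he.eqU i).and (he.eqV i)))
    obtain ⟨ρ, hρ, hρb⟩ := Metric.eventually_nhds_iff_ball.1 hall
    intro i
    filter_upwards [Metric.ball_mem_nhds p₁ hρ] with p hp
    have hpB := (hρb p hp).1
    have hseg : ∀ t : I, p₁ + ((t : ℝ) : ℂ) • (p - p₁) ∈ Metric.ball p₁ ρ := fun t =>
      segment_mem_ball (Metric.mem_ball_self hρ) hp t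
    let w : ι → C(I, ℂ) := fun i => ⟨fun t => e i (p₁ + ((t : ℝ) : ℂ) • (p - p₁)), by
      refine continuous_iff_continuousAt.2 fun t => ?_
      refine ContinuousAt.comp (f := fun t : I => p₁ + ((t : ℝ) : ℂ) • (p - p₁)) (g := e i)
        ((hρb _ (hseg t)).2 i).1.continuousAt ?_
      fun_prop⟩
    -- The given solution, restricted to the segment, satisfies the integral equation by the
    -- fundamental theorem of calculus and the system; uniqueness for the operator then gives E = e
    -- near `p₁`.
    have hw : w - systemOperator (S.segmentMatrix p₁ p) w = c₀ := by
      ext1 i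
      change w i - systemOperator (S.segmentMatrix p₁ p) w i = c₀ i
      rw [sub_eq_iff_eq_add, systemOperator_apply]
      ext t
      rw [ContinuousMap.add_apply, ContinuousMap.sum_apply]
      simp only [volterra_apply]
      have hci : ∀ j, Continuous fun s : ℝ =>
          (S.segmentMatrix p₁ p i j * w j) (projIcc 0 1 zero_le_one s) := fun j =>
        (ContinuousMap.continuous _).comp continuous_projIcc
      rw [← intervalIntegral.integral_finsetSum fun j _ => (hci j).intervalIntegrable _ _]
      have hftc := intervalIntegral.integral_eq_sub_of_hasDerivAt (a := 0) (b := (t : ℝ))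
        (f := fun s : ℝ => e i (p₁ + (s : ℂ) • (p - p₁)))
        (f' := fun s => ∑ j, (S.segmentMatrix p₁ p i j * w j) (projIcc 0 1 zero_le_one s))
        (fun s hs => ?_)
        ((continuous_finsetSum _ fun j _ => hci j).intervalIntegrable _ _)
      · rw [hftc]
        simp [c₀, w]
      · rw [uIcc_of_le t.2.1] at hs
        have hsI : s ∈ Icc (0 : ℝ) 1 := ⟨hs.1, hs.2.trans t.2.2⟩
        rw [projIcc_of_mem zero_le_one hsI]
        obtain ⟨ha, hu, hv⟩ := (hρb _ (hseg ⟨s, hsI⟩)).2 i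
        have hhs := hh _ (hρb _ (hseg ⟨s, hsI⟩)).1
        have hline : HasDerivAt (fun s : ℝ => p₁ + (s : ℂ) • (p - p₁)) (p - p₁) s := by
          have h1 : HasDerivAt (fun s : ℝ => (s : ℂ)) 1 s := Complex.ofRealCLM.hasDerivAt
          have := (h1.smul_const (p - p₁)).const_add p₁
          rwa [one_smul] at this
        have hcomp := (ha.differentiableAt.hasFDerivAt.restrictScalars ℝ).comp_hasDerivAt s hline
        refine hcomp.congr_deriv ?_
        change (fderiv ℂ (e i) (p₁ + (s : ℂ) • (p - p₁))) (p - p₁) = _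
        rw [fderiv_apply_eq, Prod.fst_sub, Prod.snd_sub, ← mul_right_inj' hhs]
        simp only [ContinuousMap.mul_apply, segmentMatrix_apply hh hp₁ hpB]
        rw [mul_add, mul_left_comm, mul_left_comm _ (p.2 - p₁.2)]
        simp only at hu hv
        rw [hu, hv, Finset.mul_sum, Finset.mul_sum, Finset.mul_sum, ← Finset.sum_add_distrib]
        refine Finset.sum_congr rfl fun j _ => ?_
        simp only [w, ContinuousMap.coe_mk]
        field_simp
    refine ((hres i p hpB).2 w hw).trans ?_
    change w i 1 = e i p
    simp [w]
  -- The differential equations hold near `p₁`, where E = e, and spread over the ball by the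
  -- identity theorem. No integrability condition on the system is needed, because a solution germ
  -- is given.
  have hpart : ∀ (v : ℂ × ℂ) (m : ι → ι → MvPolynomial (Fin 2) ℂ) (i : ι),
      (∀ᶠ q in 𝓝 p₁, evalPair q S.h * fderiv ℂ (e i) q v = ∑ j, evalPair q (m i j) * e j q) →
      ∀ p ∈ Metric.ball p₀ r,
        evalPair p S.h * fderiv ℂ (E i) p v = ∑ j, evalPair p (m i j) * E j p := by
    intro v m i hev p hp
    have hA : AnalyticOnNhd ℂ (fun q => evalPair q S.h * fderiv ℂ (E i) q v -
        ∑ j, evalPair q (m i j) * E j q) (Metric.ball p₀ r) := fun q hq =>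
      ((analyticAt_evalPair _ q).mul (analyticAt_fderiv_apply (hEa i q hq) v)).sub
        (Finset.analyticAt_fun_sum _ fun j _ => (analyticAt_evalPair _ q).mul (hEa j q hq))
    have h0 := hA.eqOn_zero_of_preconnected_of_eventuallyEq_zero
      (convex_ball _ _).isPreconnected hp₁ (by
        filter_upwards [hev, (hEe i).eventuallyEq_nhds, eventually_all.2 hEe] with q h1 h2 h3
        rw [h2.fderiv_eq, h1]
        simp only [Pi.zero_apply, sub_eq_zero]
        exact Finset.sum_congr rfl fun j _ => by rw [h3 j]) hp
    exact sub_eq_zero.1 h0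
  refine ⟨E, fun p hp => ⟨fun i => hEa i p hp, fun i => ?_, fun i => ?_⟩, hEe⟩
  · filter_upwards [Metric.isOpen_ball.mem_nhds hp] with q hq
    exact hpart (1, 0) S.a i (he.eqU i) q hq
  · filter_upwards [Metric.isOpen_ball.mem_nhds hp] with q hq
    exact hpart (0, 1) S.b i (he.eqV i) q hq

end PfaffSystem

end

end Polypol

/-! ### Analytic continuation along paths. -/

namespace Polypol

open MeasureTheory Filter Topology Set unitInterval

/-- Solutions of a Pfaffian system continue along every path avoiding its singularities. -/
theorem PfaffSystem.exists_continuation {ι : Type} [Fintype ι] (S : PfaffSystem ι)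
    (γ : C(I, ℂ × ℂ)) (hγ : ∀ t, evalPair (γ t) S.h ≠ 0) {e₀ : ι → ℂ × ℂ → ℂ}
    (he₀ : S.IsSolutionAt e₀ (γ 0)) :
    ∃ g : I → ι → ℂ × ℂ → ℂ, g 0 = e₀ ∧ (∀ t, S.IsSolutionAt (g t) (γ t)) ∧
      ∀ t, ∀ᶠ s in 𝓝 t, ∀ i, g s i =ᶠ[𝓝 (γ s)] g t i := by
  -- Because the radius depends on the centre only and not on the germ, finitely many balls cover
  -- the path, and a Lebesgue subdivision continues the germ from one subinterval to the next.
  choose r hr hext using fun t : I => S.exists_extension (hγ t)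
  obtain ⟨t, ht0, htm, ⟨n, hn⟩, htc⟩ := exists_monotone_Icc_subset_open_cover_unitInterval
    (c := fun s : I => γ ⁻¹' Metric.ball (γ s) (r s))
    (fun s => Metric.isOpen_ball.preimage γ.continuous)
    (fun s _ => mem_iUnion.2 ⟨s, Metric.mem_ball_self (hr s)⟩)
  have key : ∀ m, ∃ g : I → ι → ℂ × ℂ → ℂ, g 0 = e₀ ∧
      (∀ s ≤ t m, S.IsSolutionAt (g s) (γ s)) ∧
      ∀ s ≤ t m, ∀ᶠ s' in 𝓝 s, s' ≤ t m → ∀ i, g s' i =ᶠ[𝓝 (γ s')] g s i := by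
    intro m
    induction m with
    | zero =>
      rw [ht0]
      refine ⟨fun _ => e₀, rfl, fun s hs => ?_, fun s _ => ?_⟩
      · rw [le_antisymm hs s.2.1]; exact he₀
      · exact Eventually.of_forall fun s' _ i => EventuallyEq.rfl
    | succ m ih =>
      obtain ⟨g, hg0, hg1, hg2⟩ := ih
      obtain ⟨c, hc⟩ := htc m
      have hmm : t m ≤ t (m + 1) := htm (Nat.le_succ m)
      obtain ⟨G, hG1, hG2⟩ := hext c (γ (t m)) (hc ⟨le_rfl, hmm⟩) (g (t m)) (hg1 _ le_rfl)
      classical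
      -- The new branch agrees near the division point with the old one as a germ, so switching
      -- there keeps the family locally constant.
      refine ⟨fun s => if s ≤ t m then g s else G, ?_, fun s hs => ?_, fun s hs => ?_⟩
      · simp only [if_pos (show (0 : I) ≤ t m from (t m).2.1), hg0]
      · by_cases h : s ≤ t m
        · simp only [if_pos h]; exact hg1 s h
        · simp only [if_neg h]; exact hG1 _ (hc ⟨(not_le.1 h).le, hs⟩)
      · rcases lt_trichotomy s (t m) with h | h | h
        · filter_upwards [hg2 s h.le, isOpen_Iio.mem_nhds h] with s' h1 h2 h3
          have h2' : s' ≤ t m := (show s' < t m from h2).le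
          simp only [if_pos h2', if_pos h.le]
          exact h1 h2'
        · have hev : ∀ᶠ s' in 𝓝 (t m), ∀ i, G i =ᶠ[𝓝 (γ s')] g (t m) i :=
            eventually_all.2 fun i => γ.continuous.continuousAt.eventually (hG2 i).eventuallyEq_nhds
          rw [h]
          filter_upwards [hg2 (t m) le_rfl, hev] with s' h1 h2 h3
          simp only [if_pos le_rfl]
          by_cases h4 : s' ≤ t m
          · simp only [if_pos h4]; exact h1 h4
          · simp only [if_neg h4]; exact h2
        · filter_upwards [isOpen_Ioi.mem_nhds h] with s' h1 _ i
          simp only [if_neg (not_le.2 h), if_neg (not_le.2 (show t m < s' from h1))]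
          exact EventuallyEq.rfl
  obtain ⟨g, hg0, hg1, hg2⟩ := key n
  rw [hn n le_rfl] at hg1 hg2
  exact ⟨g, hg0, fun s => hg1 s s.2.2, fun s => (hg2 s s.2.2).mono fun s' h => h s'.2.2⟩

/-- Analytic continuation of the transform, with holonomic branches. -/
theorem RationalPolypol.exists_continuation (P : RationalPolypol) (γ : C(I, ℂ × ℂ))
    (h0 : γ 0 ∈ fantappieDomain P.carrier) (hγ : ∀ t, γ t ∉ P.singularLocus) :
    ∃ g : I → ℂ × ℂ → ℂ, IsContinuationAlong (fantappie P.carrier) γ g ∧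
      ∀ t, IsHolonomicAt (g t) (γ t) := by
  obtain ⟨sgn, -, hsgn, -⟩ := P.exists_orientation
  choose ι hι S c e hS he using fun j => (P.arc j).exists_pfaffSystem
  have hdom : ∀ᶠ q in 𝓝 (γ 0), q ∈ fantappieDomain P.carrier :=
    (isOpen_fantappieDomain P.bounded).mem_nhds h0
  have hne : ∀ j t, evalPair (γ t) (S j).h ≠ 0 := by
    intro j t h
    refine hγ t ?_
    rcases hS j (γ t) h with ⟨w, hw, hw'⟩ | h
    · exact Or.inl ⟨w, mem_iUnion.2 ⟨j, hw⟩, hw'⟩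
    · exact Or.inr ⟨j, h⟩
  have hstart := fun j => he j (γ 0) (hdom.mono fun q hq => P.avoids hq j)
  choose g hg0 hg1 hg2 using fun j => (S j).exists_continuation γ (hne j) (hstart j).1
  -- Each arc has its own system. Its solutions are continued separately, and the contribution of
  -- the arc is reassembled by the same polynomial coefficients, which are single-valued.
  let f : Fin P.numArcs → I → ℂ × ℂ → ℂ := fun j t q =>
    (evalPair q (S j).h)⁻¹ * ∑ i, evalPair q (MvPolynomial.C (sgn j : ℂ) * c j i) * g j t i q
  have hfa : ∀ j t, AnalyticAt ℂ (f j t) (γ t) := fun j t =>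
    ((analyticAt_evalPair _ _).inv (hne j t)).mul (Finset.analyticAt_fun_sum _ fun i _ =>
      (analyticAt_evalPair _ _).mul ((hg1 j t).analyticAt i))
  have hfh : ∀ j t, IsHolonomicAt (f j t) (γ t) := by
    intro j t
    refine (hg1 j t).isHolonomicAt (hne j t) (hfa j t) 
      (c := fun i => MvPolynomial.C (sgn j : ℂ) * c j i) ?_
    filter_upwards [(continuous_evalPair (S j).h).continuousAt.eventually_ne (hne j t)] with q hq
    simp only [f]
    rw [mul_inv_cancel_left₀ hq]
  refine ⟨fun t => ∑ j, f j t, ⟨?_, fun t => ?_, fun t => ?_⟩, fun t => ?_⟩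
  · have h1 : ∀ᶠ q in 𝓝 (γ 0), ∀ j, evalPair q (S j).h ≠ 0 ∧
        evalPair q (S j).h * (P.arc j).lineIntegral (P.arc j).areaForm 2 q =
          ∑ i, evalPair q (c j i) * e j i q :=
      eventually_all.2 fun j => ((continuous_evalPair (S j).h).continuousAt.eventually_ne
        (hne j 0)).and (hstart j).2
    filter_upwards [hdom, h1] with q hq hq1
    rw [(hsgn q hq).2.2, Finset.sum_apply]
    refine Finset.sum_congr rfl fun j _ => ?_
    simp only [f, hg0, map_mul, MvPolynomial.eval_C, mul_assoc]
    rw [← Finset.mul_sum, ← (hq1 j).2, mul_left_comm, inv_mul_cancel_left₀ (hq1 j).1]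
  · exact Finset.analyticAt_sum _ fun j _ => hfa j t
  · filter_upwards [eventually_all.2 fun j => hg2 j t] with s hs
    have : ∀ᶠ q in 𝓝 (γ s), ∀ j i, g j s i q = g j t i q :=
      eventually_all.2 fun j => eventually_all.2 fun i => hs j i
    filter_upwards [this] with q hq
    simp only [Finset.sum_apply, f, hq]
  · exact IsHolonomicAt.sum _ fun j _ => hfh j t

end Polypol

namespace Polypol

open MeasureTheory Filter Topology Set

/-! ### Branched covers of the dual plane of the disk -/

/-- The Jacobian determinant of two functions of two complex variables. -/
noncomputable def jacobian (f g : ℂ × ℂ → ℂ) (x : ℂ × ℂ) : ℂ :=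
  fderiv ℂ f x (1, 0) * fderiv ℂ g x (0, 1) - fderiv ℂ f x (0, 1) * fderiv ℂ g x (1, 0)

/-- Where `f, g` are local coordinates, there is a curve on which `g` is constant and which is
parametrized by `f`. -/
theorem exists_coordinate_curve {f g : ℂ × ℂ → ℂ} {x : ℂ × ℂ} (hf : AnalyticAt ℂ f x)
    (hg : AnalyticAt ℂ g x) (h : jacobian f g x ≠ 0) :
    ∃ c : ℂ → ℂ × ℂ, AnalyticAt ℂ c 0 ∧ c 0 = x ∧
      ∀ᶠ s in 𝓝 0, f (c s) = f x + s ∧ g (c s) = g x := by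
  set Ψ : ℂ × ℂ → ℂ × ℂ := fun y => (f y, g y) with hΨ
  have han : AnalyticAt ℂ Ψ x := hf.prod hg
  have hfd : fderiv ℂ Ψ x = (fderiv ℂ f x).prod (fderiv ℂ g x) :=
    (hf.differentiableAt.hasFDerivAt.prodMk hg.differentiableAt.hasFDerivAt).fderiv
  have hdet : (fderiv ℂ Ψ x).det ≠ 0 := by
    rw [det_prod, hfd]
    intro h0
    apply h
    simp only [ContinuousLinearMap.prod_apply] at h0
    simp only [jacobian]; linear_combination h0
  set L := (fderiv ℂ Ψ x).toContinuousLinearEquivOfDetNeZero hdet with hL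
  have hLc : (L : ℂ × ℂ →L[ℂ] ℂ × ℂ) = fderiv ℂ Ψ x :=
    ContinuousLinearMap.coe_toContinuousLinearEquivOfDetNeZero _ _
  have hs : HasStrictFDerivAt Ψ (L : ℂ × ℂ →L[ℂ] ℂ × ℂ) x := hLc ▸ han.hasStrictFDerivAt
  set Φ := hs.toOpenPartialHomeomorph Ψ with hΦ
  have hΦc : (Φ : ℂ × ℂ → ℂ × ℂ) = Ψ := hs.toOpenPartialHomeomorph_coe
  have hx : x ∈ Φ.source := hs.mem_toOpenPartialHomeomorph_source
  have hsymm : AnalyticAt ℂ Φ.symm (Ψ x) := by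
    have := Φ.analyticAt_symm' hx (hΦc ▸ han) (i := L) (by rw [hΦc, hLc])
    rwa [hΦc] at this
  let ℓ : ℂ → ℂ × ℂ := fun s => (f x + s, g x)
  have hℓ : AnalyticAt ℂ ℓ 0 := (analyticAt_const.add analyticAt_id).prod analyticAt_const
  have hℓ0 : ℓ 0 = Ψ x := by simp [ℓ, hΨ]
  have hsx : Φ.symm (Ψ x) = x := by rw [← hΦc]; exact Φ.left_inv hx
  refine ⟨fun s => Φ.symm (ℓ s), AnalyticAt.fun_comp (hℓ0 ▸ hsymm) hℓ, by simp only [hℓ0, hsx], ?_⟩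
  have htgt : ∀ᶠ s in 𝓝 (0 : ℂ), ℓ s ∈ Φ.target := by
    refine hℓ.continuousAt.eventually (Φ.open_target.mem_nhds ?_)
    rw [hℓ0, ← hΦc]; exact Φ.map_source hx
  filter_upwards [htgt] with s hs'
  have := Φ.right_inv hs'
  rw [hΦc] at this
  exact ⟨congrArg Prod.fst this, congrArg Prod.snd this⟩

/-- The value of a linear map on the plane in terms of its values on the standard basis. -/
theorem clm_apply_eq {E : Type*} [NormedAddCommGroup E] [NormedSpace ℂ E] (A : ℂ × ℂ →L[ℂ] E)
    (v : ℂ × ℂ) : A v = v.1 • A (1, 0) + v.2 • A (0, 1) := by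
  rw [← map_smul, ← map_smul, ← map_add]; simp

/-- On a smooth curve which a map with finite fibres does not contract, one of the coordinates of
the map is generically a local coordinate. -/
theorem IsBranchedCoverPatch.exists_jacobian_ne_zero {U : Set (ℂ × ℂ)} {φ : ℂ × ℂ → ℂ × ℂ}
    {r : ℂ × ℂ → ℂ} (h : IsBranchedCoverPatch U φ r) :
    ∃ x ∈ U, r x = 0 ∧ ∃ w : ℂ × ℂ →L[ℂ] ℂ, jacobian r (fun y => w (φ y)) x ≠ 0 := by
  -- If all Jacobians vanish along r = 0, then φ has zero derivative along this smooth curve, so it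
  -- contracts a piece of it to one point, against finiteness of the fibres.
  by_contra! hcon
  obtain ⟨x, hxU, hx⟩ := h.nonempty
  have hlam : ∃ w : ℂ × ℂ →L[ℂ] ℂ, jacobian w r x ≠ 0 := by
    by_contra! h0
    apply h.smooth x hxU hx
    have h1 := h0 (ContinuousLinearMap.fst ℂ ℂ ℂ)
    have h2 := h0 (ContinuousLinearMap.snd ℂ ℂ ℂ)
    simp only [jacobian, ContinuousLinearMap.fderiv] at h1 h2
    simp at h1 h2
    ext <;> simp [h1, h2]
  obtain ⟨w, hw⟩ := hlam
  obtain ⟨c, hc, hc0, hcs⟩ := exists_coordinate_curve (w.analyticAt x) (h.analytic_eq x hxU) hw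
  rw [hx] at hcs
  have hU : ∀ᶠ s in 𝓝 (0 : ℂ), c s ∈ U :=
    hc.continuousAt.eventually (hc0 ▸ h.isOpen.mem_nhds hxU)
  have hder : ∀ᶠ s in 𝓝 (0 : ℂ), HasDerivAt (fun s => φ (c s)) 0 s := by
    filter_upwards [hc.eventually_analyticAt, hcs.eventually_nhds, hU] with s h1 h2 h3
    have hφ := (h.analytic _ h3).differentiableAt.hasFDerivAt
    have hr := (h.analytic_eq _ h3).differentiableAt.hasFDerivAt
    have hc' := h1.differentiableAt.hasDerivAt
    have hrc : fderiv ℂ r (c s) (deriv c s) = 0 :=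
      (hr.comp_hasDerivAt s hc').unique
        ((hasDerivAt_const s (0 : ℂ)).congr_of_eventuallyEq (h2.mono fun _ h => h.2))
    refine (hφ.comp_hasDerivAt s hc').congr_deriv ?_
    have hr0 : r (c s) = 0 := h2.self_of_nhds.2
    have hne := h.smooth _ h3 hr0
    -- A vanishing Jacobian makes the differential of w ∘ φ proportional to the nonzero differential
    -- of r, which annihilates the tangent vector of the curve.
    have hw0 : ∀ w : ℂ × ℂ →L[ℂ] ℂ, w (fderiv ℂ φ (c s) (deriv c s)) = 0 := by
      intro w
      have hj := hcon _ h3 hr0 w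
      have hfd : fderiv ℂ (fun y => w (φ y)) (c s) = w.comp (fderiv ℂ φ (c s)) :=
        (w.hasFDerivAt.comp (c s) hφ).fderiv
      simp only [jacobian, hfd, ContinuousLinearMap.comp_apply] at hj
      rw [clm_apply_eq] at hrc
      rw [clm_apply_eq (fderiv ℂ φ (c s)), map_add, map_smul, map_smul]
      simp only [smul_eq_mul] at hrc ⊢
      by_contra h0
      apply hne
      have e1 : fderiv ℂ r (c s) (1, 0) = 0 := by
        refine (mul_eq_zero.1 ?_).resolve_right h0
        linear_combination w (fderiv ℂ φ (c s) (1, 0)) * hrc + (deriv c s).2 * hj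
      have e2 : fderiv ℂ r (c s) (0, 1) = 0 := by
        refine (mul_eq_zero.1 ?_).resolve_right h0
        linear_combination w (fderiv ℂ φ (c s) (0, 1)) * hrc - (deriv c s).1 * hj
      ext <;> simp [e1, e2]
    exact Prod.ext (hw0 (ContinuousLinearMap.fst ℂ ℂ ℂ)) (hw0 (ContinuousLinearMap.snd ℂ ℂ ℂ))
  obtain ⟨ε, hε, hball⟩ := Metric.eventually_nhds_iff_ball.1 (hder.and (hU.and hcs))
  have hconst : ∀ s ∈ Metric.ball (0 : ℂ) ε, φ (c s) = φ x := by
    intro s hs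
    have := (convex_ball (0 : ℂ) ε).is_const_of_fderivWithin_eq_zero (𝕜 := ℂ)
      (f := fun s => φ (c s))
      (fun s hs => (hball s hs).1.differentiableAt.differentiableWithinAt)
      (fun s hs => by
        rw [fderivWithin_of_isOpen Metric.isOpen_ball hs, (hball s hs).1.hasFDerivAt.fderiv]
        ext; simp; simp)
      hs (Metric.mem_ball_self hε)
    simpa [hc0] using this
  have hinf : (Metric.ball (0 : ℂ) ε).Infinite :=
    infinite_of_mem_nhds 0 (Metric.ball_mem_nhds 0 hε)
  -- The curve is injective because a linear function takes the value `w x + s` at `c s`.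
  refine (hinf.image (f := c) ?_) ((h.finite_fibres (φ x)).subset ?_)
  · intro s hs s' hs' hss
    have h1 := (hball s hs).2.2.1
    have h2 := (hball s' hs').2.2.1
    rw [hss, h2] at h1
    exact (add_left_cancel h1).symm
  · rintro _ ⟨s, hs, rfl⟩
    exact ⟨(hball s hs).2.1, hconst s hs⟩

/-- A differential equation excluded by comparing orders of vanishing. -/
theorem false_of_sq_mul_cube_eq {Q N E : ℂ → ℂ} (hQ : AnalyticAt ℂ Q 0) (hN : ContinuousAt N 0)
    (hE : ContinuousAt E 0) (hE0 : E 0 ≠ 0) (hQ0 : Q 0 = 0) (hQne : ∀ᶠ s in 𝓝[≠] (0 : ℂ), Q s ≠ 0)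
    (h : ∀ᶠ s in 𝓝[≠] (0 : ℂ), N s ^ 2 * Q s ^ 3 = s ^ 2 * deriv Q s ^ 2 * E s ^ 2) : False := by
  -- Let Q vanish to order m ≥ 1. Then s Q' also has order m, so the right side has order exactly
  -- 2m, while the left side is divisible by s^(3m). Dividing by s^(2m) and letting s tend to 0
  -- yields a contradiction.
  obtain ⟨m, g, hg, hg0, hQg⟩ := (hQ.exists_eventuallyEq_pow_smul_nonzero_iff).2 fun h0 => by
    obtain ⟨s, h1, h2⟩ := (hQne.and (h0.filter_mono nhdsWithin_le_nhds)).exists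
    exact h1 h2
  have hm : m ≠ 0 := by
    rintro rfl
    have := hQg.self_of_nhds
    simp [hQ0] at this
    exact hg0 this.symm
  have hd : ∀ᶠ s in 𝓝 (0 : ℂ), s * deriv Q s = s ^ m * (m * g s + s * deriv g s) := by
    filter_upwards [hQg.eventually_nhds, hg.eventually_analyticAt] with s h1 h2
    have h3 : HasDerivAt Q (m * s ^ (m - 1) * g s + s ^ m * deriv g s) s := by
      refine HasDerivAt.congr_of_eventuallyEq ?_ (h1.mono fun _ h => h)
      simpa using (hasDerivAt_pow m s).fun_mul h2.differentiableAt.hasDerivAt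
    rw [h3.deriv]
    obtain ⟨k, rfl⟩ := Nat.exists_eq_succ_of_ne_zero hm
    simp only [Nat.succ_eq_add_one, Nat.add_sub_cancel]
    ring
  have hlim : ∀ᶠ s in 𝓝[≠] (0 : ℂ),
      N s ^ 2 * s ^ m * g s ^ 3 = (m * g s + s * deriv g s) ^ 2 * E s ^ 2 := by
    filter_upwards [h, hQg.filter_mono nhdsWithin_le_nhds, hd.filter_mono nhdsWithin_le_nhds,
      self_mem_nhdsWithin] with s h1 h2 h3 h4
    have h4' : s ^ (2 * m) ≠ 0 := pow_ne_zero _ h4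
    apply mul_left_cancel₀ h4'
    simp only [sub_zero, smul_eq_mul] at h2
    rw [← mul_pow, h3, h2] at h1
    linear_combination h1
  have hgd : ContinuousAt (deriv g) 0 := hg.deriv.continuousAt
  have hgc := hg.continuousAt
  have hL : Tendsto (fun s => N s ^ 2 * s ^ m * g s ^ 3) (𝓝[≠] 0) (𝓝 (N 0 ^ 2 * 0 ^ m * g 0 ^ 3)) :=
    (show ContinuousAt (fun s => N s ^ 2 * s ^ m * g s ^ 3) 0 by fun_prop).tendsto.mono_left
      nhdsWithin_le_nhds
  have hR : Tendsto (fun s => (m * g s + s * deriv g s) ^ 2 * E s ^ 2) (𝓝[≠] 0)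
      (𝓝 ((m * g 0 + 0 * deriv g 0) ^ 2 * E 0 ^ 2)) :=
    (show ContinuousAt (fun s => (m * g s + s * deriv g s) ^ 2 * E s ^ 2) 0 by
      fun_prop).tendsto.mono_left nhdsWithin_le_nhds
  have := tendsto_nhds_unique (hL.congr' hlim) hR
  rw [zero_pow hm] at this
  have h0 : (m : ℂ) * g 0 ≠ 0 := mul_ne_zero (Nat.cast_ne_zero.2 hm) hg0
  simp [hm, hg0, hE0] at this

/-- The pulled-back form `2π q^(-3/2) du ∧ dv` has no logarithmic branch on any branched cover. -/
theorem IsBranchedCoverPatch.not_pullbackIsLogarithmic {U : Set (ℂ × ℂ)} {φ : ℂ × ℂ → ℂ × ℂ}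
    {r : ℂ × ℂ → ℂ} (h : IsBranchedCoverPatch U φ r) : ¬PullbackIsLogarithmic U φ r := by
  rintro ⟨G, H, -, hG, hH, hHG⟩
  obtain ⟨x, hxU, hx, w, hw⟩ := h.exists_jacobian_ne_zero
  have hwφ : ∀ y ∈ U, AnalyticAt ℂ (fun y => w (φ y)) y := fun y hy =>
    (w.analyticAt _).fun_comp (h.analytic y hy)
  -- On this curve r is the parameter s and w ∘ φ is constant, so along it the pole condition
  -- becomes a one-variable statement about q ∘ φ.
  obtain ⟨c, hc, hc0, hcs⟩ := exists_coordinate_curve (h.analytic_eq x hxU) (hwφ x hxU) hw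
  simp only [hx, zero_add] at hcs
  have hU : ∀ᶠ s in 𝓝 (0 : ℂ), c s ∈ U :=
    hc.continuousAt.eventually (hc0 ▸ h.isOpen.mem_nhds hxU)
  have hφc : AnalyticAt ℂ (fun s => φ (c s)) 0 :=
    AnalyticAt.fun_comp (hc0.symm ▸ h.analytic x hxU) hc
  have hφ1 : AnalyticAt ℂ (fun s => (φ (c s)).1) 0 := analyticAt_fst.fun_comp hφc
  have hφ2 : AnalyticAt ℂ (fun s => (φ (c s)).2) 0 := analyticAt_snd.fun_comp hφc
  set Q : ℂ → ℂ := fun s => dualConic (φ (c s)) with hQdef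
  have hQ : AnalyticAt ℂ Q 0 := (analyticAt_const.sub (hφ1.pow 2)).sub (hφ2.pow 2)
  -- Up to sign this is the Jacobian of q and w at φ(c s). The chain rule for the Jacobian of q ∘ φ
  -- and w ∘ φ gives det(Dφ) D = -Q' J with J the Jacobian of r and w ∘ φ. Together with H = s G
  -- det(Dφ) and G²Q³ = 4π² this yields (HD)² Q³ = s² Q'² (2πJ)².
  let D : ℂ → ℂ := fun s => 2 * ((φ (c s)).1 * w (0, 1) - (φ (c s)).2 * w (1, 0))
  have hD : ContinuousAt D 0 := by
    have h1 := hφ1.continuousAt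
    have h2 := hφ2.continuousAt
    simp only [D]; fun_prop
  have hHc : ContinuousAt (fun s => H (c s)) 0 :=
    ContinuousAt.comp (f := c) (hc0.symm ▸ (hH x hxU).continuousAt) hc.continuousAt
  have hE : ContinuousAt (fun s => 2 * (Real.pi : ℂ) * jacobian r (fun y => w (φ y)) (c s)) 0 := by
    refine continuousAt_const.mul (ContinuousAt.comp (f := c) (g := jacobian r _) ?_ hc.continuousAt)
    rw [hc0]
    have h1 := analyticAt_fderiv_apply (h.analytic_eq x hxU)
    have h2 := analyticAt_fderiv_apply (hwφ x hxU)
    exact (((h1 _).mul (h2 _)).sub ((h1 _).mul (h2 _))).continuousAt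
  refine false_of_sq_mul_cube_eq (Q := Q) (N := fun s => H (c s) * D s) hQ (hHc.mul hD) hE ?_ ?_ ?_ ?_
  · simp only [hc0]
    exact mul_ne_zero (by simp [Real.pi_ne_zero]) hw
  · simp only [hQdef, hc0]; exact (h.zero_iff x hxU).1 hx
  · filter_upwards [hU.filter_mono nhdsWithin_le_nhds, hcs.filter_mono nhdsWithin_le_nhds,
      self_mem_nhdsWithin] with s h1 h2 h3 h4
    exact h3 (h2.1 ▸ (h.zero_iff _ h1).2 h4)
  · filter_upwards [hU.filter_mono nhdsWithin_le_nhds,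
      (hcs.eventually_nhds).filter_mono nhdsWithin_le_nhds,
      (hc.eventually_analyticAt).filter_mono nhdsWithin_le_nhds,
      self_mem_nhdsWithin] with s h1 h2 h3 h4
    have hrs : r (c s) = s := h2.self_of_nhds.1
    have hrne : r (c s) ≠ 0 := by rw [hrs]; exact h4
    have hA := (h.analytic _ h1).differentiableAt.hasFDerivAt
    have hr := (h.analytic_eq _ h1).differentiableAt.hasFDerivAt
    have hc' := h3.differentiableAt.hasDerivAt
    have hr1 : fderiv ℂ r (c s) (deriv c s) = 1 :=
      (hr.comp_hasDerivAt s hc').unique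
        ((hasDerivAt_id s).congr_of_eventuallyEq (h2.mono fun _ h => h.1))
    have hφ' := hA.comp_hasDerivAt s hc'
    have hK : w (fderiv ℂ φ (c s) (deriv c s)) = 0 :=
      (w.hasFDerivAt.comp_hasDerivAt s hφ').unique
        ((hasDerivAt_const s (w (φ x))).congr_of_eventuallyEq (h2.mono fun _ h => h.2))
    have hp1 : HasDerivAt (fun s => (φ (c s)).1) (fderiv ℂ φ (c s) (deriv c s)).1 s :=
      (ContinuousLinearMap.fst ℂ ℂ ℂ).hasFDerivAt.comp_hasDerivAt s hφ'
    have hp2 : HasDerivAt (fun s => (φ (c s)).2) (fderiv ℂ φ (c s) (deriv c s)).2 s :=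
      (ContinuousLinearMap.snd ℂ ℂ ℂ).hasFDerivAt.comp_hasDerivAt s hφ'
    have hQ' : deriv Q s = -2 * ((φ (c s)).1 * (fderiv ℂ φ (c s) (deriv c s)).1 +
        (φ (c s)).2 * (fderiv ℂ φ (c s) (deriv c s)).2) := by
      refine HasDerivAt.deriv ((((hasDerivAt_const s (1 : ℂ)).sub (hp1.pow 2)).sub
        (hp2.pow 2)).congr_deriv ?_)
      simp; ring
    have hfd : fderiv ℂ (fun y => w (φ y)) (c s) = w.comp (fderiv ℂ φ (c s)) :=
      (w.hasFDerivAt.comp (c s) hA).fderiv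
    have hdet : (fderiv ℂ φ (c s)).det * D s =
        -(deriv Q s * jacobian r (fun y => w (φ y)) (c s)) := by
      rw [hQ', det_prod]
      simp only [jacobian, hfd, ContinuousLinearMap.comp_apply, D]
      rw [clm_apply_eq] at hr1
      rw [clm_apply_eq w] at hK
      rw [clm_apply_eq w (fderiv ℂ φ (c s) (0, 1)), clm_apply_eq w (fderiv ℂ φ (c s) (1, 0))]
      rw [clm_apply_eq (fderiv ℂ φ (c s)) (deriv c s)] at hK ⊢
      simp only [smul_eq_mul, Prod.fst_add, Prod.snd_add, Prod.smul_fst, Prod.smul_snd] at hr1 hK ⊢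
      generalize (fderiv ℂ φ (c s) (1, 0)) = a at *
      generalize (fderiv ℂ φ (c s) (0, 1)) = b at *
      generalize (fderiv ℂ r (c s) (1, 0)) = r1 at *
      generalize (fderiv ℂ r (c s) (0, 1)) = r2 at *
      linear_combination (-(a.1 * b.2 - a.2 * b.1) *
        (2 * ((φ (c s)).1 * w (0, 1) - (φ (c s)).2 * w (1, 0)))) * hr1 +
        (-2 * (φ (c s)).2 * (r1 * b.2 - r2 * a.2) + 2 * (φ (c s)).1 * (-r1 * b.1 + r2 * a.1)) * hK
    have hG' := hG _ h1 hrne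
    have hH' := hHG _ h1 hrne
    rw [hrs] at hH'
    simp only [hQdef] at hdet ⊢
    rw [hH', mul_assoc, mul_assoc, hdet]
    linear_combination (s ^ 2 * (deriv (fun s => dualConic (φ (c s))) s *
      jacobian r (fun y => w (φ y)) (c s)) ^ 2) * hG'

end Polypol

namespace Polypol

open MeasureTheory Filter Topology Set

/-! ### The unit disk -/

/-- The rational parametrization of the unit circle. -/
noncomputable def circleCurve : RationalCurve where
  X := 1 - X ^ 2
  Y := C 2 * X
  Z := 1 + X ^ 2
  noCommonZero := by
    rintro τ ⟨h1, -, h3⟩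
    simp at h1 h3
    have : (2 : ℂ) = 0 := by linear_combination h1 + h3
    norm_num at this
  birational := by
    refine (Set.toFinite {Complex.I, -Complex.I}).subset ?_
    rintro τ ⟨σ, hne, h1, h2, h3⟩
    simp at h1 h2 h3
    have h4 : (σ - τ) * (σ + τ) = 0 := by linear_combination h2 / 2
    have h5 : σ = -τ := by
      rcases mul_eq_zero.1 h4 with h | h
      · exact absurd (sub_eq_zero.1 h) hne
      · exact eq_neg_of_add_eq_zero_left h
    subst h5
    have h6 : τ ≠ 0 := by rintro rfl; simp at hne
    have h7 : τ * (τ ^ 2 + 1) = 0 := by linear_combination h3 / 4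
    have h8 : (τ - Complex.I) * (τ + Complex.I) = 0 := by
      linear_combination (mul_eq_zero.1 h7).resolve_left h6 - Complex.I_sq
    rcases mul_eq_zero.1 h8 with h | h
    · exact Or.inl (sub_eq_zero.1 h)
    · exact Or.inr (eq_neg_of_add_eq_zero_left h)

theorem degree_circleCurve : circleCurve.degree = 2 := by
  have h1 : (1 - X ^ 2 : ℝ[X]).natDegree = 2 := by compute_degree!
  have h2 : (C 2 * X : ℝ[X]).natDegree = 1 := by compute_degree!
  have h3 : (1 + X ^ 2 : ℝ[X]).natDegree = 2 := by compute_degree!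
  simp only [RationalCurve.degree, circleCurve, h1, h2, h3]; rfl

theorem eval_circleCurve_X (τ : ℝ) : circleCurve.X.eval τ = 1 - τ ^ 2 := by simp [circleCurve]
theorem eval_circleCurve_Y (τ : ℝ) : circleCurve.Y.eval τ = 2 * τ := by simp [circleCurve]
theorem eval_circleCurve_Z (τ : ℝ) : circleCurve.Z.eval τ = 1 + τ ^ 2 := by simp [circleCurve]

theorem point_circleCurve (τ : ℝ) :
    circleCurve.point τ = ((1 - τ ^ 2) / (1 + τ ^ 2), 2 * τ / (1 + τ ^ 2)) := by
  simp only [RationalCurve.point, eval_circleCurve_X, eval_circleCurve_Y, eval_circleCurve_Z]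

theorem coeff_circleCurve_Z : circleCurve.Z.coeff 2 = 1 := by simp [circleCurve, coeff_one]

theorem pointAtInfinity_circleCurve : circleCurve.pointAtInfinity = (-1, 0) := by
  rw [RationalCurve.pointAtInfinity, degree_circleCurve, coeff_circleCurve_Z]
  simp [circleCurve, coeff_one]

/-- The unit circle as a closed rational arc. -/
noncomputable def circleArc : RationalArc where
  toRationalCurve := circleCurve
  ends := none
  ends_lt := by simp
  affine := ⟨fun τ => by rw [eval_circleCurve_Z]; positivity, by
    rw [degree_circleCurve, coeff_circleCurve_Z]; exact one_ne_zero⟩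
  simple := by
    refine ⟨fun τ σ h => ?_, fun τ h => ?_⟩
    · simp only [point_circleCurve, Prod.mk.injEq] at h
      obtain ⟨h1, h2⟩ := h
      have ht : (1 + τ ^ 2) ≠ 0 := by positivity
      have hs : (1 + σ ^ 2) ≠ 0 := by positivity
      rw [div_eq_div_iff ht hs] at h1 h2
      have h3 : τ ^ 2 = σ ^ 2 := by linarith
      rw [h3] at h2
      have := mul_right_cancel₀ hs h2
      linarith
    · rw [point_circleCurve, pointAtInfinity_circleCurve, Prod.mk.injEq] at h
      have ht : (1 + τ ^ 2) ≠ 0 := by positivity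
      have := h.1
      rw [div_eq_iff ht] at this
      linarith

theorem mem_support_circleArc (z : ℝ × ℝ) : z ∈ circleArc.support ↔ z.1 ^ 2 + z.2 ^ 2 = 1 := by
  have hsup : circleArc.support = range circleCurve.point ∪ {(-1, 0)} := by
    rw [← pointAtInfinity_circleCurve]; rfl
  rw [hsup]
  constructor
  · rintro (⟨τ, rfl⟩ | rfl)
    · rw [point_circleCurve]
      have ht : (1 + τ ^ 2) ≠ 0 := by positivity
      field_simp; ring
    · norm_num
  · intro h
    by_cases h1 : z.1 = -1
    · right
      have : z.2 = 0 := by rw [h1] at h; nlinarith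
      exact Prod.ext h1 this
    · left
      have h1' : 1 + z.1 ≠ 0 := fun h0 => h1 (by linarith)
      have h2 : 1 + (z.2 / (1 + z.1)) ^ 2 = 2 / (1 + z.1) := by
        field_simp; linear_combination h
      -- Stereographic projection from (-1, 0), which is the image of the parameter ∞.
      refine ⟨z.2 / (1 + z.1), ?_⟩
      rw [point_circleCurve, h2]
      refine Prod.ext ?_ ?_
      · simp only; field_simp; linear_combination -h
      · simp only; field_simp

theorem isClosed_unitDisk : IsClosed unitDisk :=
  isClosed_le (f := fun z : ℝ × ℝ => z.1 ^ 2 + z.2 ^ 2) (by fun_prop) continuous_const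

theorem convex_unitDisk : Convex ℝ unitDisk := by
  intro x hx y hy a b ha hb hab
  simp only [unitDisk, mem_ofPred_eq, Prod.fst_add, Prod.snd_add, Prod.smul_fst, Prod.smul_snd,
    smul_eq_mul] at hx hy ⊢
  have h2 : x.1 * y.1 + x.2 * y.2 ≤ 1 := by
    nlinarith [sq_nonneg (x.1 - y.1), sq_nonneg (x.2 - y.2)]
  have hb' : b = 1 - a := by linarith
  subst hb'
  nlinarith [mul_nonneg ha hb, mul_le_mul_of_nonneg_left hx (sq_nonneg a),
    mul_le_mul_of_nonneg_left hy (sq_nonneg (1 - a)),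
    mul_le_mul_of_nonneg_left h2 (mul_nonneg ha hb)]

theorem isBounded_unitDisk : Bornology.IsBounded unitDisk := by
  refine (Metric.isBounded_closedBall (x := (0 : ℝ × ℝ)) (r := 1)).subset fun z hz => ?_
  simp only [unitDisk, mem_ofPred_eq] at hz
  rw [mem_closedBall_zero_iff, Prod.norm_def, Real.norm_eq_abs, Real.norm_eq_abs]
  exact max_le ((sq_le_one_iff_abs_le_one _).1 (by nlinarith [sq_nonneg z.2]))
    ((sq_le_one_iff_abs_le_one _).1 (by nlinarith [sq_nonneg z.1]))

theorem zero_mem_interior_unitDisk : (0 : ℝ × ℝ) ∈ interior unitDisk := by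
  have ho : IsOpen {z : ℝ × ℝ | z.1 ^ 2 + z.2 ^ 2 < 1} :=
    isOpen_lt (by fun_prop) continuous_const
  exact interior_maximal (s := unitDisk)
    (fun z (hz : z.1 ^ 2 + z.2 ^ 2 < 1) => (hz.le : z.1 ^ 2 + z.2 ^ 2 ≤ 1)) ho
    (show (0 : ℝ) ^ 2 + 0 ^ 2 < 1 by norm_num)

theorem frontier_unitDisk : frontier unitDisk = circleArc.support := by
  ext z
  rw [mem_support_circleArc]
  constructor
  · intro h
    exact frontier_le_subset_eq (f := fun z : ℝ × ℝ => z.1 ^ 2 + z.2 ^ 2) (g := fun _ => 1)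
      (by fun_prop) continuous_const h
  · intro h
    refine ⟨subset_closure h.le, fun hi => ?_⟩
    have hc : Tendsto (fun s : ℝ => (1 + s) • z) (𝓝[>] 0) (𝓝 z) := by
      have : ContinuousAt (fun s : ℝ => (1 + s) • z) 0 := by fun_prop
      simpa using this.tendsto.mono_left nhdsWithin_le_nhds
    obtain ⟨s, hs1, hs2⟩ := ((hc.eventually (isOpen_interior.mem_nhds hi)).and
      self_mem_nhdsWithin).exists
    have h1 : ((1 + s) • z) ∈ unitDisk := interior_subset hs1
    have hs2' : 0 < s := hs2
    simp only [unitDisk, mem_ofPred_eq, Prod.smul_fst, Prod.smul_snd, smul_eq_mul] at h1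
    have h2 : (1 + s) ^ 2 * (z.1 ^ 2 + z.2 ^ 2) ≤ 1 := by linarith
    rw [h] at h2
    nlinarith

open Classical in
/-- The unit disk as a polypol. -/
noncomputable def diskPolypol : RationalPolypol where
  carrier := unitDisk
  semialgebraic := by
    let f : MvPolynomial (Fin 2) ℝ := 1 - MvPolynomial.X 0 ^ 2 - MvPolynomial.X 1 ^ 2
    refine ⟨{({f}, ∅), (∅, {f})}, ?_⟩
    ext z
    simp only [unitDisk, mem_ofPred_eq, f]
    simp [le_iff_lt_or_eq]
    constructor
    · rintro (h | h)
      · right; linarith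
      · left; linarith
    · rintro (h | h)
      · right; linarith
      · left; linarith
  bounded := isBounded_unitDisk
  pathConnected := convex_unitDisk.isPathConnected ⟨0, interior_subset zero_mem_interior_unitDisk⟩
  domain := by
    rw [convex_unitDisk.closure_interior_eq_closure_of_nonempty_interior
      ⟨0, zero_mem_interior_unitDisk⟩]
    exact subset_closure
  numArcs := 1
  arc := fun _ => circleArc
  boundary := by rw [frontier_unitDisk, iUnion_const]
  regular := fun i j h => absurd (Subsingleton.elim i j) h

theorem vertices_diskPolypol : diskPolypol.vertices = ∅ := by
  simp [RationalPolypol.vertices, diskPolypol, RationalArc.endpoints, circleArc]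

theorem lineForm_circleCurve (p : ℂ × ℂ) : circleCurve.lineForm p =
    C (1 + p.1) * X ^ 2 - C (2 * p.2) * X + C (1 - p.1) := by
  simp only [RationalCurve.lineForm, circleCurve, Polynomial.map_add, Polynomial.map_sub,
    Polynomial.map_mul, Polynomial.map_pow, Polynomial.map_one, Polynomial.map_X,
    Polynomial.map_C, C_add, C_sub, C_mul, C_1]
  rw [show (algebraMap ℝ ℂ 2) = 2 from map_ofNat _ 2]
  ring

/-- The form (1 + u)τ² - 2vτ + (1 - u) has discriminant -4q. When 1 + u = 0 its double zero is at
the parameter ∞, which is the second alternative in the definition of tangency. -/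
theorem singularLocus_diskPolypol : diskPolypol.singularLocus = {p | dualConic p = 0} := by
  ext p
  have h1 : p ∈ diskPolypol.singularLocus ↔ circleCurve.IsTangent p := by
    constructor
    · rintro (⟨w, hw, -⟩ | ⟨j, -, h⟩)
      · rw [vertices_diskPolypol] at hw; exact hw.elim
      · exact h
    · intro h
      refine Or.inr ⟨(0 : Fin 1), ?_, h⟩
      change circleCurve.degree ≠ 1
      rw [degree_circleCurve]; norm_num
  rw [h1, RationalCurve.IsTangent, degree_circleCurve, lineForm_circleCurve]
  simp only [mem_ofPred_eq, dualConic]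
  simp only [eval_add, eval_sub, eval_mul, eval_pow, eval_C, eval_X, derivative_add,
    derivative_sub, derivative_mul, derivative_C, derivative_X_pow, derivative_X, coeff_add,
    coeff_sub, coeff_C_mul, coeff_X_pow, coeff_X, coeff_C]
  simp
  constructor
  · rintro (⟨τ, h1, h2⟩ | ⟨h1, h2⟩)
    · linear_combination (1 + p.1) * h1 - (1 / 4) * ((1 + p.1) * 2 * τ - 2 * p.2) * h2
    · rw [h2, show p.1 = -1 by linear_combination h1]; norm_num
  · intro h
    by_cases h0 : 1 + p.1 = 0
    · right
      refine ⟨h0, pow_eq_zero_iff two_ne_zero |>.1 (?_ : p.2 ^ 2 = 0)⟩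
      linear_combination (1 - p.1) * h0 - h
    · left
      refine ⟨p.2 / (1 + p.1), ?_, ?_⟩
      · field_simp; linear_combination h
      · field_simp; ring

/-- Write (u, v) = a + ib with real vectors a, b. If q is real and not positive, then a and b are
orthogonal and |a|² ≥ 1 + |b|². The point a/|a|² then lies in the disk and on the complex line. -/
theorem dualConic_mem_slitPlane {p : ℂ × ℂ} (hp : p ∈ fantappieDomain unitDisk) :
    dualConic p ∈ Complex.slitPlane := by
  by_contra hc
  rw [Complex.mem_slitPlane_iff, not_or, not_lt, not_not] at hc
  obtain ⟨⟨a1, b1⟩, ⟨a2, b2⟩⟩ := p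
  simp only [dualConic, Complex.sub_re, Complex.sub_im, Complex.one_re, Complex.one_im, pow_two,
    Complex.mul_re, Complex.mul_im] at hc
  obtain ⟨h1, h2⟩ := hc
  have hN : 1 ≤ a1 ^ 2 + a2 ^ 2 := by nlinarith [sq_nonneg b1, sq_nonneg b2]
  have hN0 : a1 ^ 2 + a2 ^ 2 ≠ 0 := by linarith
  refine hp (a1 / (a1 ^ 2 + a2 ^ 2), a2 / (a1 ^ 2 + a2 ^ 2)) (subset_closure ?_) ?_
  · simp only [unitDisk, mem_ofPred_eq]
    rw [div_pow, div_pow, ← add_div, sq (a1 ^ 2 + a2 ^ 2), div_mul_eq_div_div, div_self hN0]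
    exact (div_le_one (by linarith)).2 hN
  · apply Complex.ext
    · simp only [Complex.sub_re, Complex.mul_re, Complex.one_re, Complex.ofReal_re,
        Complex.ofReal_im, Complex.zero_re]
      field_simp; ring
    · simp only [Complex.sub_im, Complex.mul_im, Complex.one_im, Complex.ofReal_re,
        Complex.ofReal_im, Complex.zero_im]
      field_simp; linarith

/-- The integral of `2 (1 + τ²) / ((1 + a) τ² - 2 b τ + (1 - a))²` over the line. -/
theorem integral_circle {a b : ℝ} (h : 0 < 1 - a ^ 2 - b ^ 2)
    (hint : Integrable fun τ : ℝ => 2 * (1 + τ ^ 2) / ((1 + a) * τ ^ 2 - 2 * b * τ + (1 - a)) ^ 2) :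
    ∫ τ : ℝ, 2 * (1 + τ ^ 2) / ((1 + a) * τ ^ 2 - 2 * b * τ + (1 - a)) ^ 2 =
      2 * Real.pi / (√(1 - a ^ 2 - b ^ 2) ^ 3) := by
  set q := 1 - a ^ 2 - b ^ 2 with hq
  set w := √q with hw
  have hw0 : 0 < w := Real.sqrt_pos.2 h
  have hww : w ^ 2 = q := Real.sq_sqrt h.le
  have hA : 0 < 1 + a := by nlinarith [sq_nonneg b]
  have hL : ∀ τ : ℝ, 0 < (1 + a) * τ ^ 2 - 2 * b * τ + (1 - a) := by
    intro τ
    have : (1 + a) * ((1 + a) * τ ^ 2 - 2 * b * τ + (1 - a)) = ((1 + a) * τ - b) ^ 2 + q := by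
      rw [hq]; ring
    have h2 : 0 < (1 + a) * ((1 + a) * τ ^ 2 - 2 * b * τ + (1 - a)) := by rw [this]; positivity
    exact pos_of_mul_pos_right h2 hA.le
  -- Hermite reduction gives a rational part, vanishing at ±∞, and a multiple of ∫ dτ/L. Since (1 +
  -- a)L = ((1 + a)τ - b)² + q, the latter is an arctangent; its total variation π produces 2π/(qw),
  -- where w² = q.
  let α := 2 / q - 2 / (1 + a)
  let β := -(b * (2 / q) / (1 + a))
  let Φ : ℝ → ℝ := fun τ => (α * τ + β) / ((1 + a) * τ ^ 2 - 2 * b * τ + (1 - a)) +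
    2 / (q * w) * Real.arctan (((1 + a) * τ - b) / w)
  have hder : ∀ τ, HasDerivAt Φ
      (2 * (1 + τ ^ 2) / ((1 + a) * τ ^ 2 - 2 * b * τ + (1 - a)) ^ 2) τ := by
    intro τ
    have hLτ := (hL τ).ne'
    have d1 : HasDerivAt (fun τ : ℝ => α * τ + β) α τ := by
      simpa using ((hasDerivAt_id τ).const_mul α).add_const β
    have d2 : HasDerivAt (fun τ : ℝ => (1 + a) * τ ^ 2 - 2 * b * τ + (1 - a))
        ((1 + a) * (2 * τ) - 2 * b) τ := by
      simpa using (((hasDerivAt_pow 2 τ).const_mul (1 + a)).sub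
        ((hasDerivAt_id τ).const_mul (2 * b))).add_const (1 - a)
    have d3 : HasDerivAt (fun τ : ℝ => ((1 + a) * τ - b) / w) ((1 + a) / w) τ := by
      simpa using (((hasDerivAt_id τ).const_mul (1 + a)).sub_const b).div_const w
    refine ((d1.div d2 hLτ).add (d3.arctan.const_mul (2 / (q * w)))).congr_deriv ?_
    have h1 : 1 + (((1 + a) * τ - b) / w) ^ 2 =
        (1 + a) * ((1 + a) * τ ^ 2 - 2 * b * τ + (1 - a)) / q := by
      rw [div_pow, hww]; field_simp; rw [hq]; ring
    rw [h1]
    have hq0 := h.ne'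
    have e1 : 2 / (q * w) * (1 / ((1 + a) * ((1 + a) * τ ^ 2 - 2 * b * τ + (1 - a)) / q) *
        ((1 + a) / w)) = 2 / (q * ((1 + a) * τ ^ 2 - 2 * b * τ + (1 - a))) := by
      have : q * w * w = q * q := by rw [mul_assoc, ← sq, hww]
      field_simp; rw [hww]
    rw [e1]
    have hα : α = 2 / q - 2 / (1 + a) := rfl
    have hβ : β = -(b * (2 / q) / (1 + a)) := rfl
    rw [hα, hβ]
    generalize hLL : (1 + a) * τ ^ 2 - 2 * b * τ + (1 - a) = L at *
    have hb : b ^ 2 = 1 - a ^ 2 - q := by rw [hq]; ring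
    field_simp
    rw [← hLL]
    linear_combination (-4 : ℝ) * hb
  have hlim1 : ∀ l : Filter ℝ, Tendsto (fun τ : ℝ => τ⁻¹) l (𝓝 0) → (∀ᶠ τ in l, τ ≠ 0) →
      Tendsto (fun τ => (α * τ + β) / ((1 + a) * τ ^ 2 - 2 * b * τ + (1 - a))) l (𝓝 0) := by
    intro l hl hne
    have : Tendsto (fun τ : ℝ => (α * τ⁻¹ + β * τ⁻¹ ^ 2) /
        ((1 + a) - 2 * b * τ⁻¹ + (1 - a) * τ⁻¹ ^ 2)) l
        (𝓝 ((α * 0 + β * 0 ^ 2) / ((1 + a) - 2 * b * 0 + (1 - a) * 0 ^ 2))) :=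
      ((hl.const_mul α).add ((hl.pow 2).const_mul β)).div
        ((tendsto_const_nhds.sub (hl.const_mul (2 * b))).add ((hl.pow 2).const_mul (1 - a)))
        (by simpa using hA.ne')
    refine (this.congr' ?_).trans (by simp)
    filter_upwards [hne] with τ hτ
    rw [← mul_div_mul_right _ _ (pow_ne_zero 2 hτ)]
    congr 1 <;> field_simp
  have hlin : ∀ τ : ℝ, ((1 + a) * τ - b) / w = (1 + a) / w * τ + -(b / w) := fun τ => by ring
  have htop : Tendsto Φ atTop (𝓝 (0 + 2 / (q * w) * (Real.pi / 2))) := by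
    refine (hlim1 _ tendsto_inv_atTop_zero (eventually_ne_atTop 0)).add (Tendsto.const_mul _ ?_)
    refine (Real.tendsto_arctan_atTop.mono_right nhdsWithin_le_nhds).comp ?_
    simp only [hlin]
    exact tendsto_atTop_add_const_right _ _ (tendsto_id.const_mul_atTop (by positivity))
  have hbot : Tendsto Φ atBot (𝓝 (0 + 2 / (q * w) * (-(Real.pi / 2)))) := by
    refine (hlim1 _ tendsto_inv_atBot_zero (eventually_ne_atBot 0)).add (Tendsto.const_mul _ ?_)
    refine (Real.tendsto_arctan_atBot.mono_right nhdsWithin_le_nhds).comp ?_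
    simp only [hlin]
    exact tendsto_atBot_add_const_right _ _ (tendsto_id.const_mul_atBot (by positivity))
  rw [integral_of_hasDerivAt_of_tendsto hder hint hbot htop, ← hww]
  field_simp; ring

theorem eval_areaForm_circleCurve (τ : ℂ) : circleCurve.areaForm.eval τ = 2 * (1 + τ ^ 2) := by
  simp [RationalCurve.areaForm, circleCurve]
  ring

/-- The sign of the single arc is read off at parameter 0: the point is (1, 0), the velocity points
upwards, and the disk lies on its left, in direction (-1, 0). -/
theorem exists_fantappie_unitDisk_eq : ∀ p ∈ fantappieDomain unitDisk,
    fantappie unitDisk p = ∫ τ : ℝ, circleCurve.areaForm.eval (τ : ℂ) /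
      (circleCurve.lineForm p).eval (τ : ℂ) ^ 2 := by
  obtain ⟨σ, -, h, hside⟩ := diskPolypol.exists_orientation
  intro p hp
  have hev := hside (0 : Fin 1) 0 (mem_univ (0 : ℝ)) (-1, 0) (by
    change 0 < cross (circleCurve.velocity 0) (-1, 0)
    simp [cross, RationalCurve.velocity, circleCurve])
  obtain ⟨s, hs1, hs2, hs3⟩ := (hev.and (Ioo_mem_nhdsGT (one_pos (α := ℝ)))).exists
  have hpt : (diskPolypol.arc (0 : Fin 1)).point 0 = (1, 0) := by
    change circleCurve.point 0 = _
    rw [point_circleCurve]; norm_num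
  have hσ : σ (0 : Fin 1) = 1 := by
    rw [hpt] at hs1
    apply hs1.1
    · change (1 + s * -1) ^ 2 + (0 + s * 0) ^ 2 ≤ 1
      nlinarith
    · change ¬((1 - s * -1) ^ 2 + (0 - s * 0) ^ 2 ≤ 1)
      nlinarith
  have h2 := (h p hp).2.2
  change fantappie unitDisk p = ∑ j : Fin 1, _ at h2
  rw [h2, Fin.sum_univ_one, hσ, Int.cast_one, one_mul]
  exact setIntegral_univ

theorem fantappie_unitDisk_real {a b : ℝ} (hq : 0 < 1 - a ^ 2 - b ^ 2)
    (hp : ((a : ℂ), (b : ℂ)) ∈ fantappieDomain unitDisk) :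
    fantappie unitDisk (a, b) = 2 * (Real.pi : ℂ) * dualConic (a, b) ^ (-(3 / 2) : ℂ) := by
  have heq : ∀ τ : ℝ, circleCurve.areaForm.eval (τ : ℂ) /
      (circleCurve.lineForm (a, b)).eval (τ : ℂ) ^ 2 =
        ((2 * (1 + τ ^ 2) / ((1 + a) * τ ^ 2 - 2 * b * τ + (1 - a)) ^ 2 : ℝ) : ℂ) := fun τ => by
    rw [eval_areaForm_circleCurve, lineForm_circleCurve]
    simp
  rw [exists_fantappie_unitDisk_eq _ hp]
  simp only [heq]
  have hint : Integrable fun τ : ℝ =>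
      2 * (1 + τ ^ 2) / ((1 + a) * τ ^ 2 - 2 * b * τ + (1 - a)) ^ 2 := by
    have h1 := RationalArc.Avoids.integrableOn (γ := circleArc)
      (diskPolypol.avoids hp (0 : Fin 1)) (RationalCurve.natDegree_lineForm_le _ _)
      circleCurve.areaForm (n := 2) (by
        have := circleCurve.natDegree_areaForm_le
        have h2 := degree_circleCurve
        change circleCurve.areaForm.natDegree + 2 ≤ 2 * circleCurve.degree
        omega)
    have h2 : Integrable fun τ : ℝ => circleCurve.areaForm.eval (τ : ℂ) /
      (circleCurve.lineForm (a, b)).eval (τ : ℂ) ^ 2 := integrableOn_univ.1 h1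
    simp only [heq] at h2
    exact h2.re
  rw [integral_complex_ofReal, integral_circle hq hint]
  have hd : dualConic ((a : ℂ), (b : ℂ)) = ((1 - a ^ 2 - b ^ 2 : ℝ) : ℂ) := by
    simp [dualConic]
  rw [hd, show (-(3 / 2) : ℂ) = ((-(3 / 2) : ℝ) : ℂ) by push_cast; rfl,
    ← Complex.ofReal_cpow hq.le, Real.rpow_neg hq.le, Real.sqrt_eq_rpow, ← Real.rpow_natCast,
    ← Real.rpow_mul hq.le]
  norm_num
  rw [div_eq_mul_inv]

/-- The transform of the disk. -/
theorem fantappie_unitDisk {p : ℂ × ℂ} (hp : p ∈ fantappieDomain unitDisk) :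
    fantappie unitDisk p = 2 * (Real.pi : ℂ) * dualConic p ^ (-(3 / 2) : ℂ) := by
  have hopen := isOpen_fantappieDomain isBounded_unitDisk
  have hF := analyticOnNhd_fantappie isClosed_unitDisk.measurableSet isBounded_unitDisk
  have hG : AnalyticOnNhd ℂ (fun p => 2 * (Real.pi : ℂ) * dualConic p ^ (-(3 / 2) : ℂ))
      (fantappieDomain unitDisk) := by
    intro p hp
    have hq : AnalyticAt ℂ dualConic p :=
      (analyticAt_const.sub (analyticAt_fst.pow 2)).sub (analyticAt_snd.pow 2)
    exact analyticAt_const.mul (hq.cpow analyticAt_const (dualConic_mem_slitPlane hp))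
  -- The domain is star-shaped about 0: the value of the line tp at z is that of the line p at tz,
  -- and the disk is stable under scaling by t in [0, 1].
  have hconn : IsPreconnected (fantappieDomain unitDisk) := by
    refine (StarConvex.isPathConnected (a := 0) (s := fantappieDomain unitDisk) ?_
      (zero_mem_fantappieDomain _)).isConnected.isPreconnected
    refine starConvex_zero_iff.2 fun p hp t ht0 ht1 z hz => ?_
    rw [isClosed_unitDisk.closure_eq] at hz
    have := hp (t • z) (subset_closure (by
      simp only [unitDisk, mem_ofPred_eq, Prod.smul_fst, Prod.smul_snd, smul_eq_mul] at hz ⊢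
      nlinarith [sq_nonneg z.1, sq_nonneg z.2, mul_nonneg ht0 (sub_nonneg.2 ht1)]))
    convert! this using 1
    simp
    ring
  have hmem : ∀ᶠ p : ℂ × ℂ in 𝓝 0, p ∈ fantappieDomain unitDisk ∧ ‖p‖ < 1 / 2 :=
    (hopen.eventually_mem (zero_mem_fantappieDomain _)).and
      (continuous_norm.continuousAt.eventually_lt_const (by simp))
  obtain ⟨ε, hε, hball⟩ := Metric.eventually_nhds_iff_ball.1 hmem
  have hzero := eqOn_zero_of_real (f := fun p => fantappie unitDisk p -
      2 * (Real.pi : ℂ) * dualConic p ^ (-(3 / 2) : ℂ)) (ε := ε)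
    (fun p hp => (hF p (hball p hp).1).sub (hG p (hball p hp).1)) (fun a b hab => by
      obtain ⟨h1, h2⟩ := hball _ hab
      refine sub_eq_zero.2 (fantappie_unitDisk_real ?_ h1)
      rw [Prod.norm_def, max_lt_iff, Complex.norm_real, Complex.norm_real, Real.norm_eq_abs,
        Real.norm_eq_abs, abs_lt, abs_lt] at h2
      nlinarith [h2.1.1, h2.1.2, h2.2.1, h2.2.2])
  exact hF.eqOn_of_preconnected_of_eventuallyEq hG hconn (zero_mem_fantappieDomain _)
    (by filter_upwards [Metric.ball_mem_nhds 0 hε] with p hp using sub_eq_zero.1 (hzero p hp)) hp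

/-- The transform of the disk is not rational. -/
theorem not_rational_fantappie_unitDisk : ¬∃ a b : MvPolynomial (Fin 2) ℂ, b ≠ 0 ∧
    ∀ p ∈ fantappieDomain unitDisk, evalPair p b * fantappie unitDisk p = evalPair p a := by
  rintro ⟨a, b, hb, h⟩
  have hopen := isOpen_fantappieDomain isBounded_unitDisk
  let q : MvPolynomial (Fin 2) ℂ := 1 - MvPolynomial.X 0 ^ 2 - MvPolynomial.X 1 ^ 2
  have hq : ∀ p, evalPair p q = dualConic p := fun p => by simp [q, dualConic, evalPair]
  -- Squaring removes the choice of branch and makes the relation polynomial.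
  have hpoly : (MvPolynomial.C (2 * (Real.pi : ℂ)) * b) ^ 2 = a ^ 2 * q ^ 3 := by
    refine eq_of_evalPair_eq_on hopen ⟨0, zero_mem_fantappieDomain _⟩ fun p hp => ?_
    have hne := Complex.slitPlane_ne_zero (dualConic_mem_slitPlane hp)
    have hpow : (dualConic p ^ (-(3 / 2) : ℂ)) ^ 2 * dualConic p ^ 3 = 1 := by
      rw [← Complex.cpow_nat_mul, ← Complex.cpow_natCast, ← Complex.cpow_add _ _ hne]
      norm_num
    rw [map_pow, map_mul, map_mul (evalPair p) (a ^ 2), map_pow, map_pow, hq, ← h p hp,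
      fantappie_unitDisk hp]
    simp only [evalPair, MvPolynomial.eval_C]
    linear_combination (-(2 * (Real.pi : ℂ)) ^ 2 * (MvPolynomial.eval ![p.1, p.2] b) ^ 2) * hpow
  -- A line on which v is constant with v² ≠ 1, and on which b does not vanish identically. There q
  -- splits into two distinct linear factors with roots c and -c, so c is a simple root.
  obtain ⟨p, hp, hpb⟩ := exists_evalPair_ne_zero hb
    (U := {p : ℂ × ℂ | p.2 ^ 2 ≠ 1})
    (isOpen_ne_fun (by fun_prop) continuous_const) ⟨0, by simp⟩
  obtain ⟨c, hc⟩ := IsAlgClosed.exists_pow_nat_eq (1 - p.2 ^ 2) (n := 2) two_pos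
  have hc0 : c ≠ 0 := by
    rintro rfl
    exact hp (by linear_combination hc)
  let ρ := MvPolynomial.aeval (R := ℂ) ![(X : ℂ[X]), C p.2]
  have hev : ∀ f, (ρ f).eval p.1 = evalPair p f := fun f => by
    have h2 : ((Polynomial.aeval p.1).comp ρ) = MvPolynomial.aeval ![p.1, p.2] := by
      ext i; fin_cases i <;> simp [ρ]
    have h3 := congrArg (fun φ => φ f) h2
    simpa [MvPolynomial.aeval_eq_eval, Polynomial.aeval_def, evalPair] using h3
  have hρb : ρ b ≠ 0 := fun h0 => hpb (by rw [← hev, h0, eval_zero])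
  have hρq : ρ q = -((X - C c) * (X + C c)) := by
    have h1 : (C c : ℂ[X]) ^ 2 = 1 - C p.2 ^ 2 := by rw [← C_pow, hc]; simp
    simp [q, ρ]
    linear_combination -h1
  have hmain := congrArg ρ hpoly
  rw [map_pow, map_mul ρ (a ^ 2), map_pow, map_pow, hρq] at hmain
  have hB : ρ (MvPolynomial.C (2 * (Real.pi : ℂ)) * b) ≠ 0 := by
    rw [map_mul]
    refine mul_ne_zero ?_ hρb
    rw [MvPolynomial.algHom_C]
    exact (map_ne_zero_iff _ (algebraMap ℂ ℂ[X]).injective).2 (by simp [Real.pi_ne_zero])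
  generalize ρ (MvPolynomial.C (2 * (Real.pi : ℂ)) * b) = B at hmain hB
  generalize ρ a = A at hmain
  have hN : rootMultiplicity c (-((X - C c) * (X + C c))) = 1 := by
    have h0 : (X - C c) * -(X + C c) ≠ (0 : ℂ[X]) :=
      mul_ne_zero (X_sub_C_ne_zero c) (neg_ne_zero.2 (X_add_C_ne_zero c))
    rw [← mul_neg, rootMultiplicity_mul h0, rootMultiplicity_X_sub_C_self,
      rootMultiplicity_eq_zero]
    simpa [IsRoot, ← two_mul] using hc0
  generalize -((X - C c) * (X + C c)) = N at hmain hN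
  have hne : A * A * (N * N * N) ≠ 0 := by
    have := pow_ne_zero 2 hB
    rw [hmain] at this
    convert this using 1; ring
  -- Parity: the multiplicity of c on the left is even, and on the right it is an even number plus
  -- 3.
  have hcount := congrArg (rootMultiplicity c)
    (show B * B = A * A * (N * N * N) by linear_combination hmain)
  have hNNN := right_ne_zero_of_mul hne
  rw [rootMultiplicity_mul (mul_ne_zero hB hB), rootMultiplicity_mul hne,
    rootMultiplicity_mul (left_ne_zero_of_mul hne), rootMultiplicity_mul hNNN,
    rootMultiplicity_mul (left_ne_zero_of_mul hNNN), hN] at hcount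
  omega

end Polypol

namespace Polypol

open Filter Topology Set

/-! ### Restriction of rational functions -/

section Restriction

variable {R K L : Type*} [CommRing R] [Field K] [Algebra R K] [IsFractionRing R K]
  [Field L]

/-- The rational function `f` is defined on the generic point of the subvariety given by the
homomorphism `ψ`, and restricts to `g` there. -/
def HasRestriction (ψ : R →+* L) (f : K) (g : L) : Prop :=
  ∃ a b, ψ b ≠ 0 ∧ f = algebraMap R K a / algebraMap R K b ∧ g = ψ a / ψ b

theorem algebraMap_ne_zero_of_map {ψ : R →+* L} {b : R} (h : ψ b ≠ 0) : algebraMap R K b ≠ 0 :=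
  (map_ne_zero_iff _ (IsFractionRing.injective R K)).2 fun h0 => h (by rw [h0, map_zero])

namespace HasRestriction

variable {ψ : R →+* L} {f f' : K} {g g' : L}

theorem add (h : HasRestriction ψ f g) (h' : HasRestriction ψ f' g') :
    HasRestriction ψ (f + f') (g + g') := by
  obtain ⟨a, b, hb, rfl, rfl⟩ := h
  obtain ⟨a', b', hb', rfl, rfl⟩ := h'
  refine ⟨a * b' + b * a', b * b', by rw [map_mul]; exact mul_ne_zero hb hb', ?_, ?_⟩
  · rw [div_add_div _ _ (algebraMap_ne_zero_of_map hb) (algebraMap_ne_zero_of_map hb')]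
    simp only [map_add, map_mul]
  · rw [div_add_div _ _ hb hb']
    simp only [map_add, map_mul]

theorem mul (h : HasRestriction ψ f g) (h' : HasRestriction ψ f' g') :
    HasRestriction ψ (f * f') (g * g') := by
  obtain ⟨a, b, hb, rfl, rfl⟩ := h
  obtain ⟨a', b', hb', rfl, rfl⟩ := h'
  refine ⟨a * a', b * b', by rw [map_mul]; exact mul_ne_zero hb hb', ?_, ?_⟩
  · rw [div_mul_div_comm]; simp only [map_mul]
  · rw [div_mul_div_comm]; simp only [map_mul]

theorem of_algebraMap (ψ : R →+* L) (a : R) : HasRestriction ψ (algebraMap R K a) (ψ a) :=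
  ⟨a, 1, by simp, by simp, by simp⟩

theorem inv_algebraMap {b : R} (h : ψ b ≠ 0) : HasRestriction ψ (algebraMap R K b)⁻¹ (ψ b)⁻¹ :=
  ⟨1, b, h, by simp, by simp⟩

theorem neg (h : HasRestriction ψ f g) : HasRestriction ψ (-f) (-g) := by
  simpa using (of_algebraMap (K := K) ψ (-1)).mul h

theorem sub (h : HasRestriction ψ f g) (h' : HasRestriction ψ f' g') :
    HasRestriction ψ (f - f') (g - g') := by
  simpa only [sub_eq_add_neg] using h.add h'.neg

theorem exists_sum {ι : Type*} (s : Finset ι) {F : ι → K}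
    (h : ∀ i ∈ s, ∃ g, HasRestriction ψ (F i) g) : ∃ g, HasRestriction ψ (∑ i ∈ s, F i) g := by
  classical
  induction s using Finset.induction_on with
  | empty => exact ⟨_, by simpa using of_algebraMap (K := K) ψ 0⟩
  | insert i s hi ih =>
    obtain ⟨g, hg⟩ := h i (Finset.mem_insert_self i s)
    obtain ⟨k, hk⟩ := ih fun j hj => h j (Finset.mem_insert_of_mem hj)
    rw [Finset.sum_insert hi]
    exact ⟨_, hg.add hk⟩

/-- A simple pole with vanishing residue is no pole. -/
theorem exists_of_mul {q : R} (hq : q ≠ 0) (hker : ∀ a, ψ a = 0 → q ∣ a)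
    (h : HasRestriction ψ (algebraMap R K q * f) 0) : ∃ g, HasRestriction ψ f g := by
  obtain ⟨a, b, hb, hf, hg⟩ := h
  have ha : ψ a = 0 := by
    rcases div_eq_zero_iff.1 hg.symm with h | h
    · exact h
    · exact absurd h hb
  obtain ⟨a', rfl⟩ := hker a ha
  refine ⟨_, a', b, hb, ?_, rfl⟩
  have hq' : algebraMap R K q ≠ 0 := (map_ne_zero_iff _ (IsFractionRing.injective R K)).2 hq
  apply mul_left_cancel₀ hq'
  rw [hf, map_mul, mul_div_assoc]

end HasRestriction

/-- A rational function without poles is a polynomial. -/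
theorem exists_eq_algebraMap [IsDomain R] [UniqueFactorizationMonoid R] {f : K}
    (h : ∀ q : R, Irreducible q → ∃ a b, ¬q ∣ b ∧ f = algebraMap R K a / algebraMap R K b) :
    ∃ a, f = algebraMap R K a := by
  obtain ⟨a, b, hab, rfl⟩ := IsFractionRing.exists_reduced_fraction R f
  have hb0 : (b : R) ≠ 0 := nonZeroDivisors.ne_zero b.2
  have hbu : IsUnit (b : R) := by
    by_contra hb
    obtain ⟨q, hq, hqb⟩ := WfDvdMonoid.exists_irreducible_factor hb hb0
    obtain ⟨a', b', hb', he⟩ := h q hq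
    have hqp := hq.prime
    have hb'0 : b' ≠ 0 := by rintro rfl; exact hb' (dvd_zero q)
    have e : a * b' = a' * b := by
      apply IsFractionRing.injective R K
      rw [IsFractionRing.mk'_eq_div, div_eq_div_iff
        ((map_ne_zero_iff _ (IsFractionRing.injective R K)).2 hb0)
        ((map_ne_zero_iff _ (IsFractionRing.injective R K)).2 hb'0)] at he
      simpa only [map_mul] using he
    have hqa : q ∣ a := (hqp.dvd_or_dvd (e ▸ hqb.mul_left a')).resolve_right hb'
    exact hq.not_isUnit (hab hqa hqb)
  obtain ⟨u, hu⟩ := hbu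
  refine ⟨a * ↑u⁻¹, ?_⟩
  rw [IsFractionRing.mk'_eq_div, div_eq_iff
    ((map_ne_zero_iff _ (IsFractionRing.injective R K)).2 hb0), ← map_mul, ← hu, mul_assoc,
    Units.inv_mul, mul_one]

end Restriction

/-! ### The canonical form of an interval -/

/-- The canonical form of the interval `[0, 1]` is unique. -/
theorem IsIntervalCanonicalForm.unique {g g' : RatFunc ℂ} (h : IsIntervalCanonicalForm g)
    (h' : IsIntervalCanonicalForm g') : g = g' := by
  obtain ⟨h1, h2, h3, h4⟩ := h
  obtain ⟨h1', h2', h3', h4'⟩ := h'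
  -- The residues at 0 and at 1 are prescribed, so the difference has no finite pole and is a
  -- polynomial; its degree is at most -2, so it is zero.
  have key : ∀ c : ℂ, ∃ v, HasRestriction (evalRingHom c) (g - g') v := by
    intro c
    have hpole : ∀ (g₀ g₁ : RatFunc ℂ) (v : ℂ),
        HasRestriction (evalRingHom c) (algebraMap ℂ[X] (RatFunc ℂ) (X - C c) * g₀) v →
        HasRestriction (evalRingHom c) (algebraMap ℂ[X] (RatFunc ℂ) (X - C c) * g₁) v →
        ∃ w, HasRestriction (evalRingHom c) (g₀ - g₁) w := by
      intro g₀ g₁ v h0 h1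
      refine HasRestriction.exists_of_mul (X_sub_C_ne_zero c)
        (fun a ha => dvd_iff_isRoot.2 ha) ?_
      rw [mul_sub, ← sub_self v]
      exact h0.sub h1
    by_cases hc0 : c = 0
    · subst hc0
      obtain ⟨a, b, hb, hv, he⟩ := h2
      obtain ⟨a', b', hb', hv', he'⟩ := h2'
      refine hpole g g' 1 ⟨a, b, hb, ?_, hv.symm⟩ ⟨a', b', hb', ?_, hv'.symm⟩
      · rw [C_0, sub_zero]; exact he
      · rw [C_0, sub_zero]; exact he'
    by_cases hc1 : c = 1
    · subst hc1
      obtain ⟨a, b, hb, hv, he⟩ := h3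
      obtain ⟨a', b', hb', hv', he'⟩ := h3'
      refine hpole g g' (-1) ⟨a, b, hb, ?_, hv.symm⟩ ⟨a', b', hb', ?_, hv'.symm⟩
      · rw [C_1]; exact he
      · rw [C_1]; exact he'
    · obtain ⟨a, b, hb, he⟩ := h1 c hc0 hc1
      obtain ⟨a', b', hb', he'⟩ := h1' c hc0 hc1
      have r1 : HasRestriction (evalRingHom c) g _ := ⟨a, b, hb, he, rfl⟩
      have r2 : HasRestriction (evalRingHom c) g' _ := ⟨a', b', hb', he', rfl⟩
      exact ⟨_, r1.sub r2⟩
  obtain ⟨a, ha⟩ := exists_eq_algebraMap (R := ℂ[X]) (f := g - g') fun q hq => by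
    obtain ⟨c, hc⟩ := IsAlgClosed.exists_root q (degree_pos_of_irreducible hq).ne'
    obtain ⟨-, a, b, hb, he, -⟩ := key c
    exact ⟨a, b, fun hd => hb (hc.dvd hd), he⟩
  by_contra hne
  have hne' : g + -g' ≠ 0 := by rw [← sub_eq_add_neg]; exact sub_ne_zero.2 hne
  have hg'0 : -g' ≠ 0 := by
    intro h0
    rw [neg_eq_zero.1 h0, RatFunc.intDegree_zero] at h4'
    norm_num at h4'
  have hdeg := RatFunc.intDegree_add_le hg'0 hne'
  rw [RatFunc.intDegree_neg, ← sub_eq_add_neg, ha, RatFunc.intDegree_polynomial] at hdeg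
  have : max g.intDegree g'.intDegree ≤ -2 := max_le h4 h4'
  omega

/-- The canonical form of the interval `[0, 1]`. -/
theorem isIntervalCanonicalForm_inv_add_inv : IsIntervalCanonicalForm
    ((algebraMap ℂ[X] (RatFunc ℂ) X)⁻¹ + (algebraMap ℂ[X] (RatFunc ℂ) (1 - X))⁻¹) := by
  have hX : algebraMap ℂ[X] (RatFunc ℂ) X ≠ 0 := RatFunc.algebraMap_ne_zero X_ne_zero
  have h1X' : (1 - X : ℂ[X]) ≠ 0 := by
    rw [← neg_sub, neg_ne_zero]; exact X_sub_C_ne_zero 1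
  have h1X : algebraMap ℂ[X] (RatFunc ℂ) (1 - X) ≠ 0 := RatFunc.algebraMap_ne_zero h1X'
  have hsum : (algebraMap ℂ[X] (RatFunc ℂ) X)⁻¹ + (algebraMap ℂ[X] (RatFunc ℂ) (1 - X))⁻¹ =
      algebraMap ℂ[X] (RatFunc ℂ) 1 / algebraMap ℂ[X] (RatFunc ℂ) (X * (1 - X)) := by
    rw [map_mul, map_one]
    field_simp
    rw [map_sub, map_one]; ring
  rw [hsum]
  refine ⟨fun c h0 h1 => ⟨1, X * (1 - X), ?_, rfl⟩, ⟨1, 1 - X, by simp, by simp, ?_⟩,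
    ⟨-1, X, by simp, by simp, ?_⟩, ?_⟩
  · simp [h0, sub_eq_zero, Ne.symm h1]
  · rw [map_mul]; field_simp
  · rw [map_mul, map_neg, show (X - 1 : ℂ[X]) = -(1 - X) by ring, map_neg]; field_simp
  · rw [RatFunc.intDegree_div (RatFunc.algebraMap_ne_zero one_ne_zero)
      (RatFunc.algebraMap_ne_zero (mul_ne_zero X_ne_zero h1X')), RatFunc.intDegree_polynomial,
      RatFunc.intDegree_polynomial, natDegree_mul X_ne_zero h1X', natDegree_one, natDegree_X,
      ← neg_sub X, natDegree_neg, ← C_1, natDegree_X_sub_C]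
    norm_num

/-! ### Restriction to lines -/

/-- The scalar product on the plane. -/
def dot (a b : ℝ × ℝ) : ℝ := a.1 * b.1 + a.2 * b.2

/-- Restriction to the line through two points, as a homomorphism. -/
noncomputable def lineHom (A B : ℝ × ℝ) : MvPolynomial (Fin 2) ℂ →+* RatFunc ℂ :=
  (algebraMap ℂ[X] (RatFunc ℂ)).comp
    (MvPolynomial.aeval ![C (A.1 : ℂ) + C ((B.1 - A.1 : ℝ) : ℂ) * X,
      C (A.2 : ℂ) + C ((B.2 - A.2 : ℝ) : ℂ) * X]).toRingHom

theorem lineHom_apply (A B : ℝ × ℝ) (a : MvPolynomial (Fin 2) ℂ) :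
    lineHom A B a = algebraMap ℂ[X] (RatFunc ℂ) (restrictToLine A B a) := rfl

theorem restrictToLine_edgePoly (A B : ℝ × ℝ) (c : ℝ) (n : ℝ × ℝ) :
    restrictToLine A B (edgePoly c n) =
      C ((c + dot n A : ℝ) : ℂ) + C ((dot n (B - A) : ℝ) : ℂ) * X := by
  simp [restrictToLine, edgePoly, dot]
  ring

/-- The coordinate t on the line extends to an affine function `T` on the plane. Modulo the linear
form both plane coordinates are affine functions of `T`, so restriction to the line followed by
substitution of `T` is the identity modulo the form. Hence the kernel of restriction is the
principal ideal of the form. -/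
theorem edgePoly_dvd {c : ℝ} {n A B : ℝ × ℝ} (hn : n ≠ 0) (hAB : A ≠ B) (hA : c + dot n A = 0)
    (hB : c + dot n B = 0) {a : MvPolynomial (Fin 2) ℂ} (ha : restrictToLine A B a = 0) :
    edgePoly c n ∣ a := by
  have hM : n.1 ^ 2 + n.2 ^ 2 ≠ 0 := by
    intro h
    have h1 : n.1 = 0 := by nlinarith [sq_nonneg n.1, sq_nonneg n.2]
    have h2 : n.2 = 0 := by nlinarith [sq_nonneg n.1, sq_nonneg n.2]
    exact hn (Prod.ext h1 h2)
  set M := n.1 ^ 2 + n.2 ^ 2 with hMdef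
  set k := (n.1 * (B.2 - A.2) - n.2 * (B.1 - A.1)) / M with hk
  have hnd : n.1 * (B.1 - A.1) + n.2 * (B.2 - A.2) = 0 := by
    simp only [dot] at hA hB ⊢
    linarith
  have hk1 : B.1 - A.1 = -(k * n.2) := by
    rw [hk]; field_simp; rw [hMdef]; linear_combination n.1 * hnd
  have hk2 : B.2 - A.2 = k * n.1 := by
    rw [hk]; field_simp; rw [hMdef]; linear_combination n.2 * hnd
  have hk0 : k ≠ 0 := by
    intro h
    rw [h] at hk1 hk2
    exact hAB (Prod.ext (by linarith) (by linarith))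
  let c' : ℝ → MvPolynomial (Fin 2) ℂ := fun r => MvPolynomial.C (r : ℂ)
  have hmul : ∀ x y : ℝ, c' x * c' y = c' (x * y) := fun x y => by
    simp only [c', ← MvPolynomial.C_mul]; push_cast; rfl
  have hm : c' (1 / M) * (c' n.1 ^ 2 + c' n.2 ^ 2) = 1 := by
    simp only [c', ← MvPolynomial.C_mul, ← MvPolynomial.C_pow, ← MvPolynomial.C_add,
      ← MvPolynomial.C_1]
    congr 1
    rw [← Complex.ofReal_pow, ← Complex.ofReal_pow, ← Complex.ofReal_add, ← Complex.ofReal_mul,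
      ← hMdef, one_div_mul_cancel hM, Complex.ofReal_one]
  have hc : c' c = -(c' n.1 * c' A.1 + c' n.2 * c' A.2) := by
    rw [show c = -(n.1 * A.1 + n.2 * A.2) by rw [dot] at hA; linarith]
    simp [c']
  have hd1 : c' (B.1 - A.1) * c' (1 / (k * M)) = -(c' n.2 * c' (1 / M)) := by
    rw [hmul, hmul, hk1,
      show -(k * n.2) * (1 / (k * M)) = -(n.2 * (1 / M)) by field_simp]
    simp [c']
  have hd2 : c' (B.2 - A.2) * c' (1 / (k * M)) = c' n.1 * c' (1 / M) := by
    rw [hmul, hmul, hk2]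
    congr 1; field_simp
  let T : MvPolynomial (Fin 2) ℂ := c' (1 / (k * M)) *
    (-(c' n.2 * (MvPolynomial.X 0 - c' A.1)) + c' n.1 * (MvPolynomial.X 1 - c' A.2))
  let I := Ideal.span {edgePoly c n}
  let s : ℂ[X] →ₐ[ℂ] MvPolynomial (Fin 2) ℂ := Polynomial.aeval T
  let ρ : MvPolynomial (Fin 2) ℂ →ₐ[ℂ] ℂ[X] :=
    MvPolynomial.aeval ![C (A.1 : ℂ) + C ((B.1 - A.1 : ℝ) : ℂ) * X,
      C (A.2 : ℂ) + C ((B.2 - A.2 : ℝ) : ℂ) * X]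
  have hedge : edgePoly c n = c' c + c' n.1 * MvPolynomial.X 0 + c' n.2 * MvPolynomial.X 1 := rfl
  have hs : ∀ x y : ℝ, s (C (x : ℂ) + C (y : ℂ) * X) = c' x + c' y * T := fun x y => by
    simp only [s, map_add, map_mul, aeval_C, aeval_X]; rfl
  have hker : (Ideal.Quotient.mkₐ ℂ I).comp (s.comp ρ) = Ideal.Quotient.mkₐ ℂ I := by
    ext i
    simp only [AlgHom.comp_apply, Ideal.Quotient.mkₐ_eq_mk]
    rw [Ideal.Quotient.mk_eq_mk_iff_sub_mem, Ideal.mem_span_singleton]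
    fin_cases i
    · refine ⟨-(c' n.1 * c' (1 / M)), ?_⟩
      simp only [ρ, Fin.zero_eta, MvPolynomial.aeval_X, Matrix.cons_val_zero, hs, hedge, T, hc]
      linear_combination (-(c' n.2 * (MvPolynomial.X 0 - c' A.1)) +
        c' n.1 * (MvPolynomial.X 1 - c' A.2)) * hd1 + (MvPolynomial.X 0 - c' A.1) * hm
    · refine ⟨-(c' n.2 * c' (1 / M)), ?_⟩
      simp only [ρ, Fin.mk_one, MvPolynomial.aeval_X, Matrix.cons_val_one, Matrix.cons_val_fin_one,
        hs, hedge, T, hc]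
      linear_combination (-(c' n.2 * (MvPolynomial.X 0 - c' A.1)) +
        c' n.1 * (MvPolynomial.X 1 - c' A.2)) * hd2 + (MvPolynomial.X 1 - c' A.2) * hm
  have := congrArg (fun φ => φ a) hker
  simp only [AlgHom.comp_apply, Ideal.Quotient.mkₐ_eq_mk] at this
  rw [show ρ a = 0 from ha, map_zero, map_zero] at this
  exact Ideal.mem_span_singleton.1 (Ideal.Quotient.eq_zero_iff_mem.1 this.symm)

theorem exists_points_on_line {c : ℝ} {n : ℝ × ℝ} (hn : n ≠ 0) :
    ∃ A B : ℝ × ℝ, A ≠ B ∧ c + dot n A = 0 ∧ c + dot n B = 0 := by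
  have hM : n.1 ^ 2 + n.2 ^ 2 ≠ 0 := by
    intro h
    have h1 : n.1 = 0 := by nlinarith [sq_nonneg n.1, sq_nonneg n.2]
    have h2 : n.2 = 0 := by nlinarith [sq_nonneg n.1, sq_nonneg n.2]
    exact hn (Prod.ext h1 h2)
  set t := -c / (n.1 ^ 2 + n.2 ^ 2) with ht
  have htM : t * (n.1 ^ 2 + n.2 ^ 2) = -c := div_mul_cancel₀ _ hM
  refine ⟨(t * n.1, t * n.2), (t * n.1 - n.2, t * n.2 + n.1), fun h => hn ?_, ?_, ?_⟩
  · simp only [Prod.mk.injEq] at h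
    exact Prod.ext (show n.1 = 0 by linarith [h.2]) (show n.2 = 0 by linarith [h.1])
  · simp only [dot]; linear_combination htM
  · simp only [dot]; linear_combination htM

theorem restrictToLine_edgePoly_eq_zero {c : ℝ} {n A B : ℝ × ℝ} (hA : c + dot n A = 0)
    (hB : c + dot n B = 0) : restrictToLine A B (edgePoly c n) = 0 := by
  rw [restrictToLine_edgePoly, hA, show dot n (B - A) = 0 by
    simp only [dot, Prod.fst_sub, Prod.snd_sub] at hA hB ⊢; linarith]
  simp

/-- Divisibility by the form is vanishing of the restriction to its line, which takes values in a
domain. -/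
theorem prime_edgePoly {c : ℝ} {n : ℝ × ℝ} (hn : n ≠ 0) : Prime (edgePoly c n) := by
  obtain ⟨A, B, hAB, hA, hB⟩ := exists_points_on_line (c := c) hn
  have h0 := restrictToLine_edgePoly_eq_zero hA hB
  refine ⟨fun h => ?_, fun h => ?_, fun x y hxy => ?_⟩
  · have e1 : ∀ p, evalPair p (edgePoly c n) = 0 := fun p => by rw [h, map_zero]
    simp only [RationalPolypol.evalPair_edgePoly] at e1
    have a0 := e1 (0, 0)
    have a1 := e1 (1, 0)
    have a2 := e1 (0, 1)
    simp at a0 a1 a2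
    simp [a0] at a1 a2
    exact hn (Prod.ext a1 a2)
  · have := h.map (MvPolynomial.aeval ![C (A.1 : ℂ) + C ((B.1 - A.1 : ℝ) : ℂ) * X,
      C (A.2 : ℂ) + C ((B.2 - A.2 : ℝ) : ℂ) * X])
    exact not_isUnit_zero (h0 ▸ this : IsUnit (0 : ℂ[X]))
  · obtain ⟨z, hz⟩ := hxy
    have : restrictToLine A B x * restrictToLine A B y = 0 := by
      have e : restrictToLine A B (x * y) = restrictToLine A B x * restrictToLine A B y :=
        map_mul _ _ _
      rw [← e, hz]
      have e : restrictToLine A B (edgePoly c n * z) =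
        restrictToLine A B (edgePoly c n) * restrictToLine A B z := map_mul _ _ _
      rw [e, h0, zero_mul]
    exact (mul_eq_zero.1 this).imp (edgePoly_dvd hn hAB hA hB) (edgePoly_dvd hn hAB hA hB)

theorem lineHom_eq_zero_iff {c : ℝ} {n A B : ℝ × ℝ} (hn : n ≠ 0) (hAB : A ≠ B)
    (hA : c + dot n A = 0) (hB : c + dot n B = 0) {a : MvPolynomial (Fin 2) ℂ} :
    lineHom A B a = 0 ↔ edgePoly c n ∣ a := by
  constructor
  · intro h
    refine edgePoly_dvd hn hAB hA hB ?_
    rw [lineHom_apply] at h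
    exact (map_eq_zero_iff _ (RatFunc.algebraMap_injective ℂ)).1 h
  · rintro ⟨z, rfl⟩
    rw [map_mul, lineHom_apply, restrictToLine_edgePoly_eq_zero hA hB, map_zero, zero_mul]

/-- The linear form `1 - ⟨V, z⟩`. -/
noncomputable def vertexPoly (V : ℝ × ℝ) : MvPolynomial (Fin 2) ℂ := edgePoly 1 (-V)

theorem restrictToLine_vertexPoly (A B V : ℝ × ℝ) : restrictToLine A B (vertexPoly V) =
    C ((1 - dot V A : ℝ) : ℂ) - C ((dot V (B - A) : ℝ) : ℂ) * X := by
  rw [vertexPoly, restrictToLine_edgePoly]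
  simp [dot]
  ring

/-- Comparison on the line of `V`: if 1 - ⟨W, z⟩ vanishes at two distinct points of it, then W and V
solve the same nonsingular linear system. The determinant is nonzero because the line does not pass
through the origin. -/
theorem vertexPoly_dvd_iff {V W : ℝ × ℝ} (hV : V ≠ 0) : vertexPoly V ∣ vertexPoly W ↔ W = V := by
  refine ⟨fun h => ?_, fun h => h ▸ dvd_rfl⟩
  obtain ⟨A, B, hAB, hA, hB⟩ := exists_points_on_line (c := 1) (n := -V) (neg_ne_zero.2 hV)
  have h0 := (lineHom_eq_zero_iff (neg_ne_zero.2 hV) hAB hA hB).2 h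
  rw [lineHom_apply, map_eq_zero_iff _ (RatFunc.algebraMap_injective ℂ),
    restrictToLine_vertexPoly] at h0
  have c0 := congrArg (fun p => p.coeff 0) h0
  have c1 := congrArg (fun p => p.coeff (0 + 1)) h0
  simp only [coeff_sub, coeff_C_zero, coeff_C_mul, coeff_X_zero, mul_zero, sub_zero, coeff_zero,
    Complex.ofReal_eq_zero] at c0
  simp only [coeff_sub, coeff_C_succ, coeff_C_mul, zero_add, coeff_X_one, mul_one, zero_sub,
    coeff_zero, neg_eq_zero, Complex.ofReal_eq_zero] at c1
  simp only [dot, Prod.fst_neg, Prod.snd_neg, Prod.fst_sub, Prod.snd_sub] at hA hB c0 c1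
  have hdet : A.1 * B.2 - A.2 * B.1 ≠ 0 := by
    intro hd
    apply hAB
    have e1 : A.1 - B.1 = 0 := by linear_combination A.1 * hB - B.1 * hA + V.2 * hd
    have e2 : A.2 - B.2 = 0 := by linear_combination A.2 * hB - B.2 * hA - V.1 * hd
    exact Prod.ext (sub_eq_zero.1 e1) (sub_eq_zero.1 e2)
  have f1 : (A.1 * B.2 - A.2 * B.1) * (W.1 - V.1) = 0 := by
    linear_combination (B.2 - A.2) * (hA - c0) - A.2 * (c1 + hB - hA)
  have f2 : (A.1 * B.2 - A.2 * B.1) * (W.2 - V.2) = 0 := by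
    linear_combination A.1 * (c1 + hB - hA) - (B.1 - A.1) * (hA - c0)
  exact Prod.ext (sub_eq_zero.1 ((mul_eq_zero.1 f1).resolve_left hdet))
    (sub_eq_zero.1 ((mul_eq_zero.1 f2).resolve_left hdet))

end Polypol

namespace Polypol

open Filter Topology Set

/-! ### Uniqueness of canonical forms -/

section Edge

variable {Q : Set (ℝ × ℝ)} {c : ℝ} {n A B : ℝ × ℝ}

theorem IsOrientedEdge.line (h : IsOrientedEdge Q c n A B) :
    n ≠ 0 ∧ A ≠ B ∧ c + dot n A = 0 ∧ c + dot n B = 0 := by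
  obtain ⟨-, h2, h3⟩ := h
  have hA : A ∈ {z ∈ Q | c + n.1 * z.1 + n.2 * z.2 = 0} := h2 ▸ left_mem_segment ℝ A B
  have hB : B ∈ {z ∈ Q | c + n.1 * z.1 + n.2 * z.2 = 0} := h2 ▸ right_mem_segment ℝ A B
  refine ⟨?_, ?_, by rw [dot]; linarith [hA.2], by rw [dot]; linarith [hB.2]⟩
  · rintro rfl; simp at h3
  · rintro rfl; simp at h3

theorem HasEdgeResidue.exists_hasRestriction {f : RationalFunction} {g : RatFunc ℂ}
    (he : IsOrientedEdge Q c n A B) (h : HasEdgeResidue f c n A B g) :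
    ∃ r, HasRestriction (lineHom A B) (algebraMap _ RationalFunction (edgePoly c n) * f) r ∧
      g = RatFunc.C (((((B.1 - A.1) * n.2 - (B.2 - A.2) * n.1) / (n.1 ^ 2 + n.2 ^ 2) : ℝ) : ℂ)) *
        r := by
  obtain ⟨a, b, hb, hf, hg⟩ := h
  obtain ⟨hn, hAB, hA, hB⟩ := he.line
  exact ⟨_, ⟨a, b, fun h0 => hb ((lineHom_eq_zero_iff hn hAB hA hB).1 h0), hf, rfl⟩, hg⟩

theorem norm_sq_pos_of_ne_zero {n : ℝ × ℝ} (hn : n ≠ 0) : 0 < n.1 ^ 2 + n.2 ^ 2 := by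
  rcases eq_or_ne n.1 0 with h | h
  · have : n.2 ≠ 0 := fun h2 => hn (Prod.ext h h2)
    positivity
  · positivity

end Edge

/-- Along each edge both residues are the unique canonical form of an interval, so the pole cancels
in the difference; elsewhere neither form has one. The difference is therefore a polynomial, and the
order condition along the line at infinity makes its degree negative unless it is zero. -/
theorem IsCanonicalForm.unique {Q : Set (ℝ × ℝ)} {f f' : RationalFunction}
    (h : IsCanonicalForm Q f) (h' : IsCanonicalForm Q f') : f = f' := by
  obtain ⟨p, hp⟩ := exists_eq_algebraMap (R := MvPolynomial (Fin 2) ℂ) (f := f - f')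
    fun q hq => by
    by_cases hedge : ∃ c n A B, IsOrientedEdge Q c n A B ∧ Associated q (edgePoly c n)
    · obtain ⟨c, n, A, B, he, hass⟩ := hedge
      obtain ⟨g, hg, hgc⟩ := h.residue c n A B he
      obtain ⟨g', hg', hgc'⟩ := h'.residue c n A B he
      obtain ⟨hn, hAB, hA, hB⟩ := he.line
      obtain ⟨r, hr, e⟩ := hg.exists_hasRestriction he
      obtain ⟨r', hr', e'⟩ := hg'.exists_hasRestriction he
      have hκ : RatFunc.C (((((B.1 - A.1) * n.2 - (B.2 - A.2) * n.1) /
          (n.1 ^ 2 + n.2 ^ 2) : ℝ) : ℂ)) ≠ 0 := by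
        rw [Ne, map_eq_zero, Complex.ofReal_eq_zero]
        exact (div_pos he.2.2 (norm_sq_pos_of_ne_zero hn)).ne'
      have hrr : r = r' := mul_left_cancel₀ hκ (e ▸ e' ▸ hgc.unique hgc')
      have h0 := hr.sub hr'
      rw [hrr, sub_self, ← mul_sub] at h0
      obtain ⟨-, a, b, hb, hab, -⟩ := HasRestriction.exists_of_mul (prime_edgePoly hn).ne_zero
        (fun a ha => (lineHom_eq_zero_iff hn hAB hA hB).1 ha) h0
      exact ⟨a, b, fun hd => hb ((lineHom_eq_zero_iff hn hAB hA hB).2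
        ((hass.dvd_iff_dvd_left).1 hd)), hab⟩
    · push Not at hedge
      obtain ⟨a, b, hb, e⟩ := h.regular q hq hedge
      obtain ⟨a', b', hb', e'⟩ := h'.regular q hq hedge
      refine ⟨a * b' - b * a', b * b', fun hd => (hq.prime.dvd_or_dvd hd).elim hb hb', ?_⟩
      rw [e, e', quot, quot, div_sub_div]
      · simp only [map_sub, map_mul]
      all_goals
        refine (map_ne_zero_iff _ (IsFractionRing.injective _ _)).2 ?_
        rintro rfl
      exacts [hb (dvd_zero q), hb' (dvd_zero q)]
  obtain ⟨a, b, hb, e, hdeg⟩ := h.regular_infinity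
  obtain ⟨a', b', hb', e', hdeg'⟩ := h'.regular_infinity
  have hinj := IsFractionRing.injective (MvPolynomial (Fin 2) ℂ) RationalFunction
  have hpoly : p * (b * b') = a * b' - b * a' := by
    apply hinj
    have h1 := (map_ne_zero_iff _ hinj).2 hb
    have h2 := (map_ne_zero_iff _ hinj).2 hb'
    rw [map_mul, ← hp, e, e', quot, quot, div_sub_div _ _ h1 h2, map_mul,
      div_mul_cancel₀ _ (mul_ne_zero h1 h2)]
    simp only [map_sub, map_mul]
  by_contra hne
  have hp0 : p ≠ 0 := by
    rintro rfl
    exact hne (sub_eq_zero.1 (by rw [hp, map_zero]))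
  have d1 := congrArg MvPolynomial.totalDegree hpoly
  rw [MvPolynomial.totalDegree_mul_of_isDomain hp0 (mul_ne_zero hb hb'),
    MvPolynomial.totalDegree_mul_of_isDomain hb hb'] at d1
  have d2 := MvPolynomial.totalDegree_sub (a * b') (b * a')
  have d3 := MvPolynomial.totalDegree_mul a b'
  have d4 := MvPolynomial.totalDegree_mul b a'
  have d5 : max (a * b').totalDegree (b * a').totalDegree + 3 ≤ b.totalDegree + b'.totalDegree := by
    rw [← Nat.add_max_add_right]; exact max_le (by omega) (by omega)
  omega

/-! ### The canonical form of the polar of a convex polygon -/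

/-- The edges `[A j, B j]` form the counterclockwise boundary of a convex polygon around the
origin. -/
structure ConvexCycle {n : ℕ} (A B : Fin n → ℝ × ℝ) : Prop where
  pos : ∀ j, 0 < cross (A j) (B j)
  injective_fst : Function.Injective A
  injective_snd : Function.Injective B
  range_eq : range A = range B
  dual : ∀ j, ∃ D, dot D (A j) = 1 ∧ dot D (B j) = 1 ∧ ∀ k, dot D (A k) ≤ 1

/-- A real number as a constant rational function. -/
noncomputable def constFun (r : ℝ) : RationalFunction :=
  algebraMap (MvPolynomial (Fin 2) ℂ) RationalFunction (MvPolynomial.C (r : ℂ))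

/-- The linear form `1 - ⟨V, z⟩` as a rational function. -/
noncomputable def vertexFun (V : ℝ × ℝ) : RationalFunction :=
  algebraMap _ RationalFunction (vertexPoly V)

theorem vertexPoly_ne_zero (V : ℝ × ℝ) : vertexPoly V ≠ 0 := RationalPolypol.vertexPoly_ne_zero V

theorem vertexFun_ne_zero (V : ℝ × ℝ) : vertexFun V ≠ 0 :=
  (map_ne_zero_iff _ (IsFractionRing.injective _ _)).2 (vertexPoly_ne_zero V)

/-- The contribution of an edge to the canonical form. -/
noncomputable def edgeTerm (V W : ℝ × ℝ) : RationalFunction :=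
  constFun (cross V W) * ((vertexFun V)⁻¹ * (vertexFun W)⁻¹)

theorem mem_polar_range {n : ℕ} {A : Fin n → ℝ × ℝ} {w : ℝ × ℝ} :
    w ∈ polar (range A) ↔ ∀ j, dot (A j) w ≤ 1 := by
  simp only [polar, mem_ofPred_eq, forall_mem_range, dot, sub_nonneg]

theorem dot_comm (a b : ℝ × ℝ) : dot a b = dot b a := by simp only [dot]; ring

/-- The supporting lines of the edges of the polar are the vertex lines. -/
theorem exists_eq_of_isOrientedEdge {m : ℕ} {V : Fin m → ℝ × ℝ} {c : ℝ} {n D₁ D₂ : ℝ × ℝ}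
    (he : IsOrientedEdge (polar (range V)) c n D₁ D₂) : 0 < c ∧ ∃ j, n = -(c • V j) := by
  obtain ⟨hn, hD, h1, h2⟩ := he.line
  have hN := norm_sq_pos_of_ne_zero hn
  -- A point satisfying all vertex inequalities strictly can be moved by a small multiple of -n
  -- without leaving the polar, so it cannot lie on a supporting line.
  have hstrict : ∀ w, (∀ j, dot (V j) w < 1) → 0 < c + dot n w := by
    intro w hw
    have hev : ∀ᶠ ε : ℝ in 𝓝[>] 0, ∀ j, dot (V j) (w - ε • n) < 1 := by
      refine eventually_all.2 fun j => nhdsWithin_le_nhds ?_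
      have hc : ContinuousAt (fun ε : ℝ => dot (V j) (w - ε • n)) 0 := by
        simp only [dot, Prod.fst_sub, Prod.snd_sub, Prod.smul_fst, Prod.smul_snd]; fun_prop
      exact hc.eventually_lt_const (by simpa using hw j)
    obtain ⟨ε, hε, hε0⟩ := (hev.and self_mem_nhdsWithin).exists
    have hε0' : 0 < ε := hε0
    have := he.1 _ (mem_polar_range.2 fun j => (hε j).le)
    simp only [dot, Prod.fst_sub, Prod.snd_sub, Prod.smul_fst, Prod.smul_snd, smul_eq_mul] at this ⊢
    nlinarith [mul_pos hε0' hN]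
  have hc : 0 < c := by simpa [dot] using hstrict 0 (fun j => by simp [dot])
  refine ⟨hc, ?_⟩
  have hmem : ∀ z ∈ segment ℝ D₁ D₂, z ∈ polar (range V) := fun z hz => by
    have h := he.2.1
    rw [← h] at hz
    exact hz.1
  have hq1 := mem_polar_range.1 (hmem D₁ (left_mem_segment ℝ _ _))
  have hq2 := mem_polar_range.1 (hmem D₂ (right_mem_segment ℝ _ _))
  -- Some vertex inequality is sharp at the midpoint of the edge, hence at both ends. So two
  -- distinct points lie on both lines, and n is a multiple of the vertex.
  obtain ⟨j, hj⟩ : ∃ j, ¬dot (V j) ((1 / 2 : ℝ) • (D₁ + D₂)) < 1 := by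
    by_contra! hall
    have := hstrict _ hall
    simp only [dot, Prod.smul_fst, Prod.smul_snd, Prod.fst_add, Prod.snd_add, smul_eq_mul]
      at this h1 h2
    linarith
  refine ⟨j, ?_⟩
  have e1 : dot (V j) D₁ = 1 := by
    have a1 := hq1 j
    have a2 := hq2 j
    simp only [dot, Prod.smul_fst, Prod.smul_snd, Prod.fst_add, Prod.snd_add, smul_eq_mul, not_lt]
      at hj a1 a2 ⊢
    linarith
  have e2 : dot (V j) D₂ = 1 := by
    have a1 := hq1 j
    have a2 := hq2 j
    simp only [dot, Prod.smul_fst, Prod.smul_snd, Prod.fst_add, Prod.snd_add, smul_eq_mul, not_lt]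
      at hj a1 a2 ⊢
    linarith
  simp only [dot] at e1 e2 h1 h2
  have hdet : D₁.1 * D₂.2 - D₁.2 * D₂.1 ≠ 0 := by
    intro hd
    apply hD
    have f1 : D₁.1 - D₂.1 = 0 := by linear_combination (-D₁.1) * e2 + D₂.1 * e1 + (V j).2 * hd
    have f2 : D₁.2 - D₂.2 = 0 := by linear_combination (-D₁.2) * e2 + D₂.2 * e1 - (V j).1 * hd
    exact Prod.ext (sub_eq_zero.1 f1) (sub_eq_zero.1 f2)
  have g1 : (D₁.1 * D₂.2 - D₁.2 * D₂.1) * (n.1 + c * (V j).1) = 0 := by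
    linear_combination D₂.2 * (h1 + c * e1) - D₁.2 * (h2 + c * e2)
  have g2 : (D₁.1 * D₂.2 - D₁.2 * D₂.1) * (n.2 + c * (V j).2) = 0 := by
    linear_combination D₁.1 * (h2 + c * e2) - D₂.1 * (h1 + c * e1)
  refine Prod.ext ?_ ?_
  · simpa using eq_neg_of_add_eq_zero_left ((mul_eq_zero.1 g1).resolve_left hdet)
  · simpa using eq_neg_of_add_eq_zero_left ((mul_eq_zero.1 g2).resolve_left hdet)

theorem edgePoly_eq_mul_vertexPoly (c : ℝ) (V : ℝ × ℝ) :
    edgePoly c (-(c • V)) = MvPolynomial.C (c : ℂ) * vertexPoly V := by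
  simp [edgePoly, vertexPoly]; ring

/-- A vector orthogonal to `V` is a multiple of `V` turned by a right angle. This turns scalar
products along an edge of the polar into determinants of vertices, whose signs are known. -/
theorem dot_eq_mul_cross {V d : ℝ × ℝ} (hV : V ≠ 0) (hd : dot V d = 0) (W : ℝ × ℝ) :
    dot W d = cross V d / (V.1 ^ 2 + V.2 ^ 2) * cross V W := by
  rw [div_mul_eq_mul_div, eq_div_iff (norm_sq_pos_of_ne_zero hV).ne']
  simp only [dot, cross] at hd ⊢
  linear_combination (V.1 * W.1 + V.2 * W.2) * hd

namespace ConvexCycle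

variable {m : ℕ} {A B : Fin m → ℝ × ℝ}

/-- The canonical form of the polar. -/
noncomputable def form (A B : Fin m → ℝ × ℝ) : RationalFunction := ∑ j, edgeTerm (A j) (B j)

theorem ne_zero (h : ConvexCycle A B) (j : Fin m) : A j ≠ 0 := fun h0 => by
  have := h.pos j
  rw [h0] at this; simp [cross] at this

theorem exists_prev (h : ConvexCycle A B) (o : Fin m) : ∃ i, B i = A o := by
  have : A o ∈ range B := h.range_eq ▸ mem_range_self o
  exact this

theorem ne (h : ConvexCycle A B) (j : Fin m) : A j ≠ B j := fun h0 => by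
  have := h.pos j
  rw [h0, cross] at this; linarith

/-- The two terms of the form with a pole along the line of a given vertex. -/
theorem exists_form_eq (h : ConvexCycle A B) {L : Type*} [Field L]
    (ψ : MvPolynomial (Fin 2) ℂ →+* L) {i o : Fin m} (hio : B i = A o) (hψ : ∀ W, W ≠ A o → ψ (vertexPoly W) ≠ 0) :
    ∃ R g, HasRestriction ψ R g ∧
      form A B = edgeTerm (A i) (A o) + edgeTerm (A o) (B o) + R := by
  have hne : i ≠ o := fun h0 => h.ne o (by rw [← hio, h0])
  obtain ⟨g, hg⟩ := HasRestriction.exists_sum (ψ := ψ) ((Finset.univ.erase i).erase o)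
    (F := fun j => edgeTerm (A j) (B j)) fun j hj => by
      have hjo := (Finset.mem_erase.1 hj).1
      have hji := (Finset.mem_erase.1 (Finset.mem_erase.1 hj).2).1
      exact ⟨_, (HasRestriction.of_algebraMap ψ _).mul
        ((HasRestriction.inv_algebraMap (hψ _ fun h0 => hjo (h.injective_fst h0))).mul
          (HasRestriction.inv_algebraMap (hψ _ fun h0 => hji
            (h.injective_snd (h0.trans hio.symm)))))⟩
  refine ⟨_, g, hg, ?_⟩
  rw [form, ← Finset.add_sum_erase _ _ (Finset.mem_univ i), ← Finset.add_sum_erase _ _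
    (Finset.mem_erase.2 ⟨hne.symm, Finset.mem_univ o⟩), hio, add_assoc]

/-- Only the two polygon edges meeting at the vertex V dual to the polar edge contribute a pole
along its line. Their forms 1 - ⟨A i, z⟩ and 1 - ⟨B o, z⟩ restrict to multiples of t and 1 - t, and
the determinants cancel to leave 1/t + 1/(1 - t). -/
theorem residue (h : ConvexCycle A B) {c : ℝ} {n D₁ D₂ : ℝ × ℝ}
    (he : IsOrientedEdge (polar (range A)) c n D₁ D₂) :
    ∃ g : RatFunc ℂ, HasEdgeResidue (form A B) c n D₁ D₂ g ∧ IsIntervalCanonicalForm g := by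
  obtain ⟨hc, o, hn⟩ := exists_eq_of_isOrientedEdge he
  obtain ⟨i, hio⟩ := h.exists_prev o
  obtain ⟨hn0, hD, h1, h2⟩ := he.line
  set V := A o with hV
  have hV0 : V ≠ 0 := h.ne_zero o
  have hVpos := norm_sq_pos_of_ne_zero hV0
  set d := D₂ - D₁ with hd
  have v1 : dot V D₁ = 1 := by
    rw [hn] at h1
    simp only [dot, Prod.fst_neg, Prod.snd_neg, Prod.smul_fst, Prod.smul_snd, smul_eq_mul] at h1 ⊢
    apply mul_left_cancel₀ hc.ne'; linarith
  have v2 : dot V D₂ = 1 := by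
    rw [hn] at h2
    simp only [dot, Prod.fst_neg, Prod.snd_neg, Prod.smul_fst, Prod.smul_snd, smul_eq_mul] at h2 ⊢
    apply mul_left_cancel₀ hc.ne'; linarith
  have vd : dot V d = 0 := by
    simp only [dot, hd, Prod.fst_sub, Prod.snd_sub] at v1 v2 ⊢; linarith
  set μ := cross V d / (V.1 ^ 2 + V.2 ^ 2) with hμ
  have hμ0 : 0 < μ := by
    have := he.2.2
    rw [hn] at this
    simp only [Prod.fst_neg, Prod.snd_neg, Prod.smul_fst, Prod.smul_snd, smul_eq_mul] at this
    refine div_pos ((mul_pos_iff_of_pos_left hc).1 ?_) hVpos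
    simp only [cross, hd, Prod.fst_sub, Prod.snd_sub]; linarith
  have hdot := dot_eq_mul_cross hV0 vd
  have hseg : ∀ D, dot D V = 1 → (∀ k, dot D (A k) ≤ 1) →
      ∃ t ∈ Icc (0 : ℝ) 1, ∀ W, dot W D = dot W D₁ + t * dot W d := by
    intro D hDV hDk
    have hmem : D ∈ {z ∈ polar (range A) | c + n.1 * z.1 + n.2 * z.2 = 0} := by
      refine ⟨mem_polar_range.2 fun k => dot_comm D (A k) ▸ hDk k, ?_⟩
      rw [hn]
      simp only [dot, Prod.fst_neg, Prod.snd_neg, Prod.smul_fst, Prod.smul_snd, smul_eq_mul] at hDV ⊢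
      linear_combination (-c) * hDV
    rw [he.2.1, segment_eq_image'] at hmem
    obtain ⟨t, ht, rfl⟩ := hmem
    refine ⟨t, ht, fun W => ?_⟩
    simp only [dot, Prod.fst_add, Prod.snd_add, Prod.smul_fst, Prod.smul_snd, smul_eq_mul, hd]
    ring
  have hmemD : ∀ z ∈ segment ℝ D₁ D₂, ∀ k, dot (A k) z ≤ 1 := fun z hz => by
    have := he.2.1
    rw [← this] at hz
    exact mem_polar_range.1 hz.1
  have hpos_o : 0 < cross V (B o) := h.pos o
  have hpos_i := h.pos i
  rw [hio] at hpos_i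
  -- ⟨B o, ·⟩ increases along the polar edge, is at most 1 at `D₂` and equals 1 at the dual point of
  -- edge `o`, which lies on the polar edge. Hence it equals 1 at `D₂`.
  have b1 : 1 - dot (B o) D₁ = μ * cross V (B o) := by
    obtain ⟨D, hD1, hD2, hD3⟩ := h.dual o
    obtain ⟨t, ht, hW⟩ := hseg D hD1 hD3
    have e := hW (B o)
    rw [dot_comm, hD2, hdot] at e
    obtain ⟨k, hk⟩ : B o ∈ range A := h.range_eq ▸ mem_range_self o
    have e2 := hmemD D₂ (right_mem_segment ℝ _ _) k
    rw [hk] at e2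
    have e3 : dot (B o) D₂ = dot (B o) D₁ + μ * cross V (B o) := by
      rw [← hdot]; simp only [dot, hd, Prod.fst_sub, Prod.snd_sub]; ring
    have := mul_pos hμ0 hpos_o
    nlinarith [ht.2]
  -- The same argument at the other end: ⟨A i, ·⟩ decreases along the edge and attains the bound 1
  -- at the dual point of edge `i`.
  have a1 : 1 - dot (A i) D₁ = 0 := by
    obtain ⟨D, hD1, hD2, hD3⟩ := h.dual i
    obtain ⟨t, ht, hW⟩ := hseg D (hio ▸ hD2) hD3
    have e := hW (A i)
    rw [dot_comm, hD1, hdot] at e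
    have e2 := hmemD D₁ (left_mem_segment ℝ _ _) i
    have e3 : cross V (A i) = -cross (A i) V := by simp only [cross]; ring
    rw [e3] at e
    have := mul_nonneg ht.1 (mul_pos hμ0 hpos_i).le
    linarith
  have hker : ∀ a, lineHom D₁ D₂ a = 0 ↔ edgePoly c n ∣ a := fun a =>
    lineHom_eq_zero_iff hn0 hD h1 h2
  have hedge : edgePoly c n = MvPolynomial.C (c : ℂ) * vertexPoly V := by
    rw [hn, edgePoly_eq_mul_vertexPoly]
  have hψ : ∀ W, W ≠ V → lineHom D₁ D₂ (vertexPoly W) ≠ 0 := by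
    intro W hW h0
    rw [hker, hedge] at h0
    exact hW ((vertexPoly_dvd_iff hV0).1 (dvd_of_mul_left_dvd h0))
  obtain ⟨R, gR, hR, hform⟩ := h.exists_form_eq (lineHom D₁ D₂) hio hψ
  have hAi : A i ≠ V := fun h0 => h.ne i (h0.trans hio.symm)
  have hBo : B o ≠ V := (h.ne o).symm
  have hC : ∀ r : ℝ, lineHom D₁ D₂ (MvPolynomial.C (r : ℂ)) = RatFunc.C (r : ℂ) := fun r => by
    rw [lineHom_apply, restrictToLine, MvPolynomial.algHom_C]; rfl
  have hfe : algebraMap _ RationalFunction (edgePoly c n) * form A B =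
      constFun c * (constFun (cross (A i) V) * (vertexFun (A i))⁻¹ +
        constFun (cross V (B o)) * (vertexFun (B o))⁻¹) +
      algebraMap _ RationalFunction (edgePoly c n) * R := by
    have hcv : algebraMap _ RationalFunction (edgePoly c n) = constFun c * vertexFun V := by
      rw [hedge, map_mul]; rfl
    rw [hform, hcv, edgeTerm, edgeTerm, ← hV]
    have := vertexFun_ne_zero V
    have h3 := vertexFun_ne_zero (A i)
    have h4 := vertexFun_ne_zero (B o)
    field_simp
  have hrest := ((HasRestriction.of_algebraMap (K := RationalFunction) (lineHom D₁ D₂)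
    (MvPolynomial.C (c : ℂ))).mul
      (((HasRestriction.of_algebraMap (K := RationalFunction) (lineHom D₁ D₂)
        (MvPolynomial.C ((cross (A i) V : ℝ) : ℂ))).mul
          (HasRestriction.inv_algebraMap (hψ _ hAi))).add
      ((HasRestriction.of_algebraMap (K := RationalFunction) (lineHom D₁ D₂)
        (MvPolynomial.C ((cross V (B o) : ℝ) : ℂ))).mul
          (HasRestriction.inv_algebraMap (hψ _ hBo))))).add
      ((HasRestriction.of_algebraMap (K := RationalFunction) (lineHom D₁ D₂)
        (edgePoly c n)).mul hR)
  rw [(hker _).2 dvd_rfl, zero_mul, add_zero] at hrest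
  obtain ⟨a, b, hb, hab, hg⟩ := hrest
  refine ⟨_, ⟨a, b, fun h0 => hb ((hker _).2 h0), hfe.trans hab, rfl⟩, ?_⟩
  have hg' : algebraMap _ (RatFunc ℂ) (restrictToLine D₁ D₂ a) /
      algebraMap _ (RatFunc ℂ) (restrictToLine D₁ D₂ b) = _ := hg.symm
  rw [hg', hC, hC, hC, lineHom_apply, lineHom_apply, restrictToLine_vertexPoly,
    restrictToLine_vertexPoly, a1, b1, ← hd, hdot, hdot]
  have hκ : ((D₂.1 - D₁.1) * n.2 - (D₂.2 - D₁.2) * n.1) / (n.1 ^ 2 + n.2 ^ 2) = μ / c := by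
    rw [hn, hμ]
    simp only [Prod.fst_neg, Prod.snd_neg, Prod.smul_fst, Prod.smul_snd, smul_eq_mul, cross, hd,
      Prod.fst_sub, Prod.snd_sub]
    have : V.1 ^ 2 + V.2 ^ 2 ≠ 0 := hVpos.ne'
    field_simp
    ring
  rw [hκ]
  convert! isIntervalCanonicalForm_inv_add_inv using 1
  have q1 : (C (((0 : ℝ)) : ℂ) - C ((μ * cross V (A i) : ℝ) : ℂ) * X : ℂ[X]) =
      C ((μ * cross (A i) V : ℝ) : ℂ) * X := by
    rw [show μ * cross V (A i) = -(μ * cross (A i) V) by simp only [cross]; ring]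
    simp
  have q2 : (C ((μ * cross V (B o) : ℝ) : ℂ) - C ((μ * cross V (B o) : ℝ) : ℂ) * X : ℂ[X]) =
      C ((μ * cross V (B o) : ℝ) : ℂ) * (1 - X) := by ring
  rw [q1, q2, map_mul, map_mul, RatFunc.algebraMap_C, RatFunc.algebraMap_C]
  have hne : ∀ r : ℝ, r ≠ 0 → RatFunc.C (r : ℂ) ≠ 0 := fun r hr => by
    rw [Ne, map_eq_zero, Complex.ofReal_eq_zero]; exact hr
  have n1 := hne _ hμ0.ne'
  have n2 := hne _ hc.ne'
  have n3 := hne _ hpos_i.ne'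
  have n4 := hne _ hpos_o.ne'
  have hX : algebraMap ℂ[X] (RatFunc ℂ) X ≠ 0 := RatFunc.algebraMap_ne_zero X_ne_zero
  have h1X : algebraMap ℂ[X] (RatFunc ℂ) (1 - X) ≠ 0 := RatFunc.algebraMap_ne_zero (by
    rw [← neg_sub, neg_ne_zero]; exact X_sub_C_ne_zero 1)
  push_cast
  simp only [map_mul, map_div₀]
  generalize (algebraMap ℂ[X] (RatFunc ℂ)) (1 - X) = y at *
  field_simp

/-- The edge of the polar which is dual to a vertex. -/
theorem isOrientedEdge (h : ConvexCycle A B) {i o : Fin m} (hio : B i = A o) {D₁ D₂ : ℝ × ℝ}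
    (h₁ : dot D₁ (A i) = 1 ∧ dot D₁ (A o) = 1 ∧ ∀ k, dot D₁ (A k) ≤ 1)
    (h₂ : dot D₂ (A o) = 1 ∧ dot D₂ (B o) = 1 ∧ ∀ k, dot D₂ (A k) ≤ 1) (hne : D₁ ≠ D₂) :
    IsOrientedEdge (polar (range A)) 1 (-A o) D₁ D₂ := by
  simp only [dot_comm D₁, dot_comm D₂] at h₁ h₂
  have hV := h.ne_zero o
  have hVpos := norm_sq_pos_of_ne_zero hV
  have hpi := h.pos i
  have hpo := h.pos o
  rw [hio] at hpi
  have hsub : ∀ W z : ℝ × ℝ, dot W (z - D₁) = dot W z - dot W D₁ := fun W z => by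
    simp only [dot, Prod.fst_sub, Prod.snd_sub]; ring
  have hcr : cross (A o) (A i) = -cross (A i) (A o) := by simp only [cross]; ring
  have hext : ∀ z w : ℝ × ℝ, (∀ W, dot W z = dot W w) → z = w := fun z w hzw =>
    Prod.ext (by simpa [dot] using hzw (1, 0)) (by simpa [dot] using hzw (0, 1))
  -- On the line dual to `A o` a point is determined by its displacement ν from `D₁`. The inequality
  -- of the preceding vertex gives ν ≥ 0, and that of the following vertex will bound ν by its value
  -- at `D₂`.
  have key : ∀ z, dot (A o) z = 1 → dot (A i) z ≤ 1 →
      ∃ ν, 0 ≤ ν ∧ ν * ((A o).1 ^ 2 + (A o).2 ^ 2) = cross (A o) (z - D₁) ∧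
        ∀ W, dot W z = dot W D₁ + ν * cross (A o) W := by
    intro z hz hzi
    have h0 : dot (A o) (z - D₁) = 0 := by rw [hsub, hz, h₁.2.1, sub_self]
    have h1 := dot_eq_mul_cross hV h0
    refine ⟨_, ?_, div_mul_cancel₀ _ hVpos.ne', fun W => by rw [← h1, hsub]; ring⟩
    have h2 := h1 (A i)
    rw [hsub, h₁.1, hcr] at h2
    by_contra! hneg
    nlinarith
  obtain ⟨μ, hμ, hμV, hμW⟩ := key D₂ h₂.1 (h₂.2.2 i)
  have hμ0 : 0 < μ := by
    refine lt_of_le_of_ne hμ fun h0 => hne (hext _ _ fun W => ?_)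
    rw [hμW W, ← h0]; ring
  have hlin : ∀ z : ℝ × ℝ, 1 + (-A o).1 * z.1 + (-A o).2 * z.2 = 1 - dot (A o) z := fun z => by
    simp only [dot, Prod.fst_neg, Prod.snd_neg]; ring
  refine ⟨fun z hz => ?_, ?_, ?_⟩
  · rw [hlin]; linarith [mem_polar_range.1 hz o]
  · ext z
    rw [segment_eq_image']
    constructor
    · rintro ⟨hz, hz0⟩
      rw [hlin] at hz0
      rw [mem_polar_range] at hz
      obtain ⟨ν, hν, -, hνW⟩ := key z (by linarith) (hz i)
      obtain ⟨k, hk⟩ : B o ∈ range A := h.range_eq ▸ mem_range_self o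
      have hνμ : ν ≤ μ := by
        have e1 := hz k
        rw [hk, hνW] at e1
        have e2 := h₂.2.1
        rw [hμW] at e2
        exact le_of_mul_le_mul_right (by linarith) hpo
      refine ⟨ν / μ, ⟨div_nonneg hν hμ, (div_le_one hμ0).2 hνμ⟩, hext _ _ fun W => ?_⟩
      have e : dot W (D₁ + (ν / μ) • (D₂ - D₁)) = dot W D₁ + ν / μ * (dot W D₂ - dot W D₁) := by
        simp only [dot, Prod.fst_add, Prod.snd_add, Prod.smul_fst, Prod.smul_snd, Prod.fst_sub,
          Prod.snd_sub, smul_eq_mul]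
        ring
      simp only [e, hμW W, hνW W]
      field_simp
      ring
    · rintro ⟨t, ht, rfl⟩
      have e : ∀ W, dot W (D₁ + t • (D₂ - D₁)) = (1 - t) * dot W D₁ + t * dot W D₂ := fun W => by
        simp only [dot, Prod.fst_add, Prod.snd_add, Prod.smul_fst, Prod.smul_snd, Prod.fst_sub,
          Prod.snd_sub, smul_eq_mul]
        ring
      refine ⟨mem_polar_range.2 fun k => ?_, ?_⟩
      · rw [e]
        nlinarith [mul_le_mul_of_nonneg_left (h₁.2.2 k) (sub_nonneg.2 ht.2),
          mul_le_mul_of_nonneg_left (h₂.2.2 k) ht.1]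
      · rw [hlin, e, h₁.2.1, h₂.1]; ring
  · have := mul_pos hμ0 hVpos
    rw [hμV] at this
    simp only [cross, Prod.fst_sub, Prod.snd_sub, Prod.fst_neg, Prod.snd_neg] at this ⊢
    linarith

/-- Two collinear edges combine to one edge. -/
theorem edgeTerm_add_edgeTerm {U V W D : ℝ × ℝ} (hU : dot D U = 1) (hV : dot D V = 1)
    (hW : dot D W = 1) : edgeTerm U V + edgeTerm V W = edgeTerm U W := by
  -- The linear relation among three vectors of the plane, in coordinates. Pairing it with D shows
  -- that the determinants add up for collinear points, and then the two partial fractions combine.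
  have hx : cross U V * W.1 + cross V W * U.1 = cross U W * V.1 := by simp only [cross]; ring
  have hy : cross U V * W.2 + cross V W * U.2 = cross U W * V.2 := by simp only [cross]; ring
  have h1 : cross U V + cross V W = cross U W := by
    simp only [dot] at hU hV hW
    linear_combination D.1 * hx + D.2 * hy - cross U V * hW - cross V W * hU + cross U W * hV
  have hp : MvPolynomial.C ((cross U V : ℝ) : ℂ) * vertexPoly W +
      MvPolynomial.C ((cross V W : ℝ) : ℂ) * vertexPoly U =
      MvPolynomial.C ((cross U W : ℝ) : ℂ) * vertexPoly V := by
    have c1 := congrArg (fun r : ℝ => (MvPolynomial.C (σ := Fin 2) (r : ℂ))) h1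
    have cx := congrArg (fun r : ℝ => (MvPolynomial.C (σ := Fin 2) (r : ℂ))) hx
    have cy := congrArg (fun r : ℝ => (MvPolynomial.C (σ := Fin 2) (r : ℂ))) hy
    simp only [Complex.ofReal_add, Complex.ofReal_mul, map_add, map_mul] at c1 cx cy
    simp only [vertexPoly, edgePoly, Prod.fst_neg, Prod.snd_neg, Complex.ofReal_neg, map_neg,
      Complex.ofReal_one, map_one]
    linear_combination c1 - MvPolynomial.X 0 * cx - MvPolynomial.X 1 * cy
  have hf : constFun (cross U V) * vertexFun W + constFun (cross V W) * vertexFun U =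
      constFun (cross U W) * vertexFun V := by
    simp only [constFun, vertexFun, ← map_mul, ← map_add, hp]
  have h2 := vertexFun_ne_zero U
  have h3 := vertexFun_ne_zero V
  have h4 := vertexFun_ne_zero W
  simp only [edgeTerm]
  field_simp
  linear_combination hf

/-- The target is the function field of the curve q = 0, so the restriction calculus applies to
arbitrary irreducible curves. -/
theorem exists_residueHom {q : MvPolynomial (Fin 2) ℂ} (hq : Irreducible q) :
    ∃ (L : Type) (_ : Field L) (ψ : MvPolynomial (Fin 2) ℂ →+* L), ∀ b, ψ b = 0 ↔ q ∣ b := by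
  have : (Ideal.span {q}).IsPrime := (Ideal.span_singleton_prime hq.ne_zero).2 hq.prime
  refine ⟨FractionRing (MvPolynomial (Fin 2) ℂ ⧸ Ideal.span {q}), inferInstance,
    (algebraMap (MvPolynomial (Fin 2) ℂ ⧸ Ideal.span {q}) _).comp (Ideal.Quotient.mk _), fun b => ?_⟩
  rw [RingHom.comp_apply, map_eq_zero_iff _ (IsFractionRing.injective _ _),
    Ideal.Quotient.eq_zero_iff_mem, Ideal.mem_span_singleton]

/-- If q is the form of a vertex but not of an edge of the polar, the dual points of the two polygon
edges at this vertex coincide. These edges are then collinear, and their terms merge into one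
without a pole along q. For any other q every term is regular. -/
theorem regular (h : ConvexCycle A B) {q : MvPolynomial (Fin 2) ℂ} (hq : Irreducible q)
    (hedge : ∀ c n D₁ D₂, IsOrientedEdge (polar (range A)) c n D₁ D₂ →
      ¬Associated q (edgePoly c n)) :
    ∃ a b : MvPolynomial (Fin 2) ℂ, ¬q ∣ b ∧ form A B = quot a b := by
  obtain ⟨L, _, ψ, hψ⟩ := exists_residueHom hq
  suffices hs : ∃ g, HasRestriction ψ (form A B) g by
    obtain ⟨-, a, b, hb, hab, -⟩ := hs
    exact ⟨a, b, fun hd => hb ((hψ b).2 hd), hab⟩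
  have hterm : ∀ V W, ψ (vertexPoly V) ≠ 0 → ψ (vertexPoly W) ≠ 0 →
      ∃ g, HasRestriction ψ (edgeTerm V W) g := fun V W hV hW =>
    ⟨_, (HasRestriction.of_algebraMap ψ _).mul
      ((HasRestriction.inv_algebraMap hV).mul (HasRestriction.inv_algebraMap hW))⟩
  have hass : ∀ V, V ≠ 0 → q ∣ vertexPoly V → Associated q (vertexPoly V) := fun V hV hd =>
    (hq.dvd_irreducible_iff_associated (prime_edgePoly (neg_ne_zero.2 hV)).irreducible).1 hd
  by_cases ho : ∃ o, Associated q (vertexPoly (A o))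
  · obtain ⟨o, ho⟩ := ho
    obtain ⟨i, hio⟩ := h.exists_prev o
    obtain ⟨D₁, a1, a2, a3⟩ := h.dual i
    obtain ⟨D₂, b1, b2, b3⟩ := h.dual o
    rw [hio] at a2
    have hD : D₁ = D₂ := by
      by_contra hne
      exact hedge _ _ _ _ (h.isOrientedEdge hio ⟨a1, a2, a3⟩ ⟨b1, b2, b3⟩ hne) ho
    have hW : ∀ W, W ≠ A o → ψ (vertexPoly W) ≠ 0 := fun W hW h0 => hW
      ((vertexPoly_dvd_iff (h.ne_zero o)).1 ((ho.dvd_iff_dvd_left).1 ((hψ _).1 h0)))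
    obtain ⟨R, gR, hR, hform⟩ := h.exists_form_eq ψ hio hW
    obtain ⟨g, hg⟩ := hterm (A i) (B o) (hW _ fun h0 => h.ne i (h0.trans hio.symm))
      (hW _ (h.ne o).symm)
    rw [hform, edgeTerm_add_edgeTerm a1 a2 (hD ▸ b2)]
    exact ⟨_, hg.add hR⟩
  · push Not at ho
    have hA : ∀ j, ψ (vertexPoly (A j)) ≠ 0 := fun j h0 =>
      ho j (hass _ (h.ne_zero j) ((hψ _).1 h0))
    refine HasRestriction.exists_sum _ fun j _ => hterm _ _ (hA j) ?_
    obtain ⟨k, hk⟩ : B j ∈ range A := h.range_eq ▸ mem_range_self j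
    rw [← hk]; exact hA k

/-- The common denominator of the edge terms. -/
noncomputable def denom (A B : Fin m → ℝ × ℝ) : MvPolynomial (Fin 2) ℂ :=
  ∏ j, (vertexPoly (A j) * vertexPoly (B j))

/-- The numerator of a sum of edge terms with constant coefficients. -/
noncomputable def numer (A B : Fin m → ℝ × ℝ) (κ : Fin m → ℝ) : MvPolynomial (Fin 2) ℂ :=
  ∑ j, MvPolynomial.C (κ j : ℂ) *
    ∏ k ∈ Finset.univ.erase j, (vertexPoly (A k) * vertexPoly (B k))

theorem map_numer_div_map_denom {L : Type*} [Field L] (ψ : MvPolynomial (Fin 2) ℂ →+* L)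
    (hA : ∀ j, ψ (vertexPoly (A j)) ≠ 0) (hB : ∀ j, ψ (vertexPoly (B j)) ≠ 0) (κ : Fin m → ℝ) :
    ψ (numer A B κ) / ψ (denom A B) = ∑ j, ψ (MvPolynomial.C (κ j : ℂ)) *
      ((ψ (vertexPoly (A j)))⁻¹ * (ψ (vertexPoly (B j)))⁻¹) := by
  have h0 : ∀ j, ψ (vertexPoly (A j) * vertexPoly (B j)) ≠ 0 := fun j => by
    rw [map_mul]; exact mul_ne_zero (hA j) (hB j)
  have hd : ψ (denom A B) ≠ 0 := by
    rw [denom, map_prod]; exact Finset.prod_ne_zero_iff.2 fun j _ => h0 j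
  rw [div_eq_iff hd, numer, map_sum, Finset.sum_mul]
  refine Finset.sum_congr rfl fun j _ => ?_
  rw [denom, ← Finset.mul_prod_erase _ _ (Finset.mem_univ j), map_mul, map_mul, map_mul]
  have := hA j
  have := hB j
  field_simp

theorem sum_eq_sum (h : ConvexCycle A B) {L : Type*} [AddCommMonoid L] (φ : ℝ × ℝ → L) :
    ∑ j, φ (A j) = ∑ j, φ (B j) := by
  classical
  rw [← Finset.sum_image (s := Finset.univ) (g := A) h.injective_fst.injOn,
    ← Finset.sum_image (s := Finset.univ) (g := B) h.injective_snd.injOn]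
  congr 1
  ext V
  have := h.range_eq
  simp only [Finset.mem_image, Finset.mem_univ, true_and]
  exact iff_of_eq (congrArg (V ∈ ·) this)

theorem denom_ne_zero : denom A B ≠ 0 := Finset.prod_ne_zero_iff.2 fun _ _ =>
  mul_ne_zero (vertexPoly_ne_zero _) (vertexPoly_ne_zero _)

theorem form_eq : form A B = quot (numer A B fun j => cross (A j) (B j)) (denom A B) :=
  (map_numer_div_map_denom (algebraMap _ RationalFunction) (fun _ => vertexFun_ne_zero _)
    (fun _ => vertexFun_ne_zero _) _).symm

/-- Counting degrees in the sum gives order two at infinity, but three is needed. The identity u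
det(A, B) - (B₂ - A₂) = A₂ℓ_B - B₂ℓ_A makes the difference of the two sides telescope around the
cycle, so u times the numerator still obeys the naive bound. -/
theorem X_mul_numer (h : ConvexCycle A B) :
    MvPolynomial.X 0 * numer A B (fun j => cross (A j) (B j)) =
      numer A B fun j => (B j).2 - (A j).2 := by
  have hinj := IsFractionRing.injective (MvPolynomial (Fin 2) ℂ) RationalFunction
  have hd : algebraMap _ RationalFunction (denom A B) ≠ 0 :=
    (map_ne_zero_iff _ hinj).2 denom_ne_zero
  apply hinj
  have e := fun κ => map_numer_div_map_denom (A := A) (B := B) (algebraMap _ RationalFunction)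
    (fun _ => vertexFun_ne_zero _) (fun _ => vertexFun_ne_zero _) κ
  rw [map_mul, ← div_left_inj' hd, mul_div_assoc, e, e, Finset.mul_sum, ← sub_eq_zero,
    ← Finset.sum_sub_distrib]
  have hterm : ∀ j, algebraMap (MvPolynomial (Fin 2) ℂ) RationalFunction (MvPolynomial.X 0) *
      (algebraMap (MvPolynomial (Fin 2) ℂ) RationalFunction (MvPolynomial.C ((cross (A j) (B j) : ℝ) : ℂ)) *
        ((algebraMap (MvPolynomial (Fin 2) ℂ) RationalFunction (vertexPoly (A j)))⁻¹ *
          (algebraMap (MvPolynomial (Fin 2) ℂ) RationalFunction (vertexPoly (B j)))⁻¹)) -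
      algebraMap (MvPolynomial (Fin 2) ℂ) RationalFunction (MvPolynomial.C (((B j).2 - (A j).2 : ℝ) : ℂ)) *
        ((algebraMap (MvPolynomial (Fin 2) ℂ) RationalFunction (vertexPoly (A j)))⁻¹ *
          (algebraMap (MvPolynomial (Fin 2) ℂ) RationalFunction (vertexPoly (B j)))⁻¹) =
      constFun (A j).2 * (vertexFun (A j))⁻¹ - constFun (B j).2 * (vertexFun (B j))⁻¹ := by
    intro j
    have hp : MvPolynomial.X 0 * MvPolynomial.C ((cross (A j) (B j) : ℝ) : ℂ) -
        MvPolynomial.C (((B j).2 - (A j).2 : ℝ) : ℂ) =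
        MvPolynomial.C ((A j).2 : ℂ) * vertexPoly (B j) -
          MvPolynomial.C ((B j).2 : ℂ) * vertexPoly (A j) := by
      simp [cross, vertexPoly, edgePoly]; ring
    have hf := congrArg (algebraMap (MvPolynomial (Fin 2) ℂ) RationalFunction) hp
    simp only [map_sub, map_mul] at hf
    have h1 := vertexFun_ne_zero (A j)
    have h2 := vertexFun_ne_zero (B j)
    simp only [vertexFun, constFun] at h1 h2 ⊢
    simp only [Complex.ofReal_sub, map_sub] at hf ⊢
    field_simp
    linear_combination hf
  rw [Finset.sum_congr rfl fun j _ => hterm j, Finset.sum_sub_distrib,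
    h.sum_eq_sum (fun V => constFun V.2 * (vertexFun V)⁻¹), sub_self]

theorem totalDegree_vertexPoly_le (V : ℝ × ℝ) : (vertexPoly V).totalDegree ≤ 1 := by
  have h1 : ∀ (r : ℂ) (i : Fin 2), (MvPolynomial.C r * MvPolynomial.X i).totalDegree ≤ 1 :=
    fun r i => (MvPolynomial.totalDegree_mul _ _).trans (by simp)
  refine (MvPolynomial.totalDegree_add _ _).trans (max_le ((MvPolynomial.totalDegree_add _ _).trans
    (max_le (by simp) (h1 _ _))) (h1 _ _))

theorem totalDegree_vertexPoly {V : ℝ × ℝ} (hV : V ≠ 0) : (vertexPoly V).totalDegree = 1 := by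
  refine le_antisymm (totalDegree_vertexPoly_le V) (Nat.one_le_iff_ne_zero.2 fun h0 => ?_)
  rw [MvPolynomial.totalDegree_eq_zero_iff_eq_C] at h0
  have hunit : IsUnit (vertexPoly V) := by
    rw [h0]
    refine (isUnit_iff_ne_zero.2 fun hc => ?_).map MvPolynomial.C
    rw [hc, map_zero] at h0
    exact vertexPoly_ne_zero V h0
  exact (prime_edgePoly (neg_ne_zero.2 hV)).not_isUnit hunit

theorem totalDegree_denom (h : ConvexCycle A B) : (denom A B).totalDegree = 2 * m := by
  have hB : ∀ j, B j ≠ 0 := fun j h0 => by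
    have := h.pos j
    rw [h0] at this; simp [cross] at this
  have key : ∀ s : Finset (Fin m),
      (∏ j ∈ s, (vertexPoly (A j) * vertexPoly (B j))).totalDegree = 2 * s.card := by
    intro s
    induction s using Finset.induction_on with
    | empty => simp
    | insert j s hj ih =>
      rw [Finset.prod_insert hj, Finset.card_insert_of_notMem hj,
        MvPolynomial.totalDegree_mul_of_isDomain
          (mul_ne_zero (vertexPoly_ne_zero _) (vertexPoly_ne_zero _))
          (Finset.prod_ne_zero_iff.2 fun j _ =>
            mul_ne_zero (vertexPoly_ne_zero _) (vertexPoly_ne_zero _)), ih,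
        MvPolynomial.totalDegree_mul_of_isDomain (vertexPoly_ne_zero _) (vertexPoly_ne_zero _),
        totalDegree_vertexPoly (h.ne_zero j), totalDegree_vertexPoly (hB j)]
      ring
  rw [denom, key, Finset.card_univ, Fintype.card_fin]

theorem totalDegree_numer_le (κ : Fin m → ℝ) : (numer A B κ).totalDegree ≤ 2 * (m - 1) := by
  refine MvPolynomial.totalDegree_finsetSum_le fun j _ => ?_
  refine (MvPolynomial.totalDegree_mul _ _).trans ?_
  rw [MvPolynomial.totalDegree_C, zero_add]
  refine (MvPolynomial.totalDegree_finsetProd _ _).trans ?_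
  refine (Finset.sum_le_card_nsmul _ _ 2 fun k _ => (MvPolynomial.totalDegree_mul _ _).trans
    (Nat.add_le_add (totalDegree_vertexPoly_le _) (totalDegree_vertexPoly_le _))).trans ?_
  rw [Finset.card_erase_of_mem (Finset.mem_univ j), Finset.card_univ, Fintype.card_fin]
  simp [mul_comm]

theorem numer_ne_zero (h : ConvexCycle A B) (hm : 0 < m) :
    numer A B (fun j => cross (A j) (B j)) ≠ 0 := by
  intro h0
  have h1 : ∀ V : ℝ × ℝ, evalPair 0 (vertexPoly V) = 1 := fun V => by
    rw [vertexPoly, RationalPolypol.evalPair_vertexPoly]; simp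
  have h2 := congrArg (evalPair 0) h0
  simp only [numer, map_sum, map_mul, map_prod, h1, mul_one, Finset.prod_const_one, map_zero] at h2
  simp only [evalPair, MvPolynomial.eval_C] at h2
  rw [← Complex.ofReal_sum, Complex.ofReal_eq_zero] at h2
  have : Nonempty (Fin m) := ⟨⟨0, hm⟩⟩
  exact (Finset.sum_pos (fun j _ => h.pos j) Finset.univ_nonempty).ne' h2

/-- The canonical form of the polar of a convex polygon. -/
theorem isCanonicalForm (h : ConvexCycle A B) (hm : 0 < m) :
    IsCanonicalForm (polar (range A)) (form A B) where
  ne_zero := by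
    rw [form_eq, quot]
    have hinj := IsFractionRing.injective (MvPolynomial (Fin 2) ℂ) RationalFunction
    exact div_ne_zero ((map_ne_zero_iff _ hinj).2 (h.numer_ne_zero hm))
      ((map_ne_zero_iff _ hinj).2 denom_ne_zero)
  residue := fun _ _ _ _ he => h.residue he
  regular := fun _ hq hedge => h.regular hq hedge
  regular_infinity := by
    refine ⟨_, _, denom_ne_zero, form_eq, ?_⟩
    have h1 := congrArg MvPolynomial.totalDegree h.X_mul_numer
    rw [MvPolynomial.totalDegree_mul_of_isDomain (MvPolynomial.X_ne_zero 0) (h.numer_ne_zero hm),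
      MvPolynomial.totalDegree_X] at h1
    have h2 := totalDegree_numer_le (A := A) (B := B) fun j => (B j).2 - (A j).2
    rw [h.totalDegree_denom]
    omega

end ConvexCycle

end Polypol

namespace Polypol
open MeasureTheory Filter Topology Set

/-! ### Polygons -/

theorem sub_mul_eval_of_natDegree_le_one {Q : ℝ[X]} (hQ : Q.natDegree ≤ 1) (a b τ : ℝ) :
    (b - a) * Q.eval τ = (b - τ) * Q.eval a + (τ - a) * Q.eval b := by
  rw [eq_X_add_C_of_natDegree_le_one hQ]
  simp
  ring

theorem sub_mul_wronskian_of_natDegree_le_one {Q R : ℝ[X]} (hQ : Q.natDegree ≤ 1)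
    (hR : R.natDegree ≤ 1) (a b τ : ℝ) : (b - a) * (derivative Q * R - Q * derivative R).eval τ =
      Q.eval b * R.eval a - Q.eval a * R.eval b := by
  rw [eq_X_add_C_of_natDegree_le_one hQ, eq_X_add_C_of_natDegree_le_one hR]
  simp
  ring

theorem evalPair_vertexPoly (p : ℂ × ℂ) (V : ℝ × ℝ) :
    evalPair p (vertexPoly V) = 1 - p.1 * (V.1 : ℂ) - p.2 * (V.2 : ℂ) :=
  RationalPolypol.evalPair_vertexPoly V p

/-- An arc of degree one is a segment, and its periods are rational functions. -/
theorem RationalArc.exists_segment (γ : RationalArc) (h : γ.IsLinear) :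
    ∃ A B : ℝ × ℝ, A ≠ B ∧ γ.support = segment ℝ A B ∧ γ.endpoints = {A, B} ∧
      (∃ τ ∈ γ.openInterval, ∃ c > 0, cross (γ.velocity τ) (γ.point τ) = -(c * cross A B)) ∧
      ∀ p, γ.Avoids (γ.lineForm p) →
        γ.lineIntegral γ.areaForm 2 p =
          cross A B * ((evalPair p (vertexPoly A))⁻¹ * (evalPair p (vertexPoly B))⁻¹) ∧
        γ.periodX p = ((B.1 - A.1 : ℝ) : ℂ) *
          ((evalPair p (vertexPoly A))⁻¹ * (evalPair p (vertexPoly B))⁻¹) ∧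
        γ.periodY p = ((B.2 - A.2 : ℝ) : ℂ) *
          ((evalPair p (vertexPoly A))⁻¹ * (evalPair p (vertexPoly B))⁻¹) := by
  have hd : γ.degree = 1 := h
  have hX := hd ▸ γ.natDegree_X_le
  have hY := hd ▸ γ.natDegree_Y_le
  have hZ := hd ▸ γ.natDegree_Z_le
  obtain ⟨a, b, hab, hlt, hI, hO, hs, he, hz, hi, -⟩ | ⟨hn, -⟩ := γ.cases_ends
  swap
  · exact (ends_ne_none_of_isLinear h hn).elim
  have hba : 0 < b - a := sub_pos.2 hlt
  have ha : a ∈ Icc a b := left_mem_Icc.2 hlt.le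
  have hb : b ∈ Icc a b := right_mem_Icc.2 hlt.le
  have hza := hz a ha
  have hzb := hz b hb
  -- Z has no zero on the interval, so by the intermediate value theorem it has constant sign there.
  have hsign : ∀ x ∈ Icc a b, 0 < γ.Z.eval a * γ.Z.eval x := by
    intro x hx
    by_contra! hneg
    have hc : ContinuousOn (fun t => γ.Z.eval a * γ.Z.eval t) (Icc a x) :=
      (continuous_const.mul γ.Z.continuous).continuousOn
    obtain ⟨t, ht, h0⟩ := intermediate_value_Icc' hx.1 hc ⟨hneg, (mul_self_pos.2 hza).le⟩
    rcases mul_eq_zero.1 h0 with h0 | h0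
    · exact hza h0
    · exact hz t ⟨ht.1, ht.2.trans hx.2⟩ h0
  -- A projective parametrization of a line is a barycentric combination of the endpoints with
  -- weights proportional to (b - x)Z(a) and (x - a)Z(b).
  have hpoint : ∀ x ∈ Icc a b, γ.point x =
      ((b - x) * γ.Z.eval a / ((b - a) * γ.Z.eval x)) • γ.point a +
        ((x - a) * γ.Z.eval b / ((b - a) * γ.Z.eval x)) • γ.point b := by
    intro x hx
    have hzx := hz x hx
    have h1 := sub_mul_eval_of_natDegree_le_one hX a b x
    have h2 := sub_mul_eval_of_natDegree_le_one hY a b x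
    ext
    · simp only [RationalCurve.point, Prod.fst_add, Prod.smul_fst, smul_eq_mul]
      field_simp
      linear_combination h1
    · simp only [RationalCurve.point, Prod.snd_add, Prod.smul_snd, smul_eq_mul]
      field_simp
      linear_combination h2
  have hsum : ∀ x ∈ Icc a b, (b - x) * γ.Z.eval a / ((b - a) * γ.Z.eval x) +
      (x - a) * γ.Z.eval b / ((b - a) * γ.Z.eval x) = 1 := by
    intro x hx
    have hzx := hz x hx
    rw [← add_div, ← sub_mul_eval_of_natDegree_le_one hZ, div_self (mul_ne_zero hba.ne' hzx)]
  have hsupp : γ.support = segment ℝ (γ.point a) (γ.point b) := by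
    rw [hs]
    apply Subset.antisymm
    · rintro _ ⟨x, hx, rfl⟩
      have hzx := hz x hx
      have hxb : 0 < γ.Z.eval x * γ.Z.eval b := by
        have := mul_pos (hsign x hx) (hsign b hb)
        have h2 := mul_self_pos.2 hza
        refine (mul_pos_iff_of_pos_left h2).1 ?_
        nlinarith
      refine ⟨_, _, ?_, ?_, hsum x hx, (hpoint x hx).symm⟩
      · rw [show (b - x) * γ.Z.eval a / ((b - a) * γ.Z.eval x) =
          (b - x) * (γ.Z.eval a * γ.Z.eval x) / ((b - a) * γ.Z.eval x ^ 2) by field_simp]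
        exact div_nonneg (mul_nonneg (sub_nonneg.2 hx.2) (hsign x hx).le) (by positivity)
      · rw [show (x - a) * γ.Z.eval b / ((b - a) * γ.Z.eval x) =
          (x - a) * (γ.Z.eval x * γ.Z.eval b) / ((b - a) * γ.Z.eval x ^ 2) by field_simp]
        exact div_nonneg (mul_nonneg (sub_nonneg.2 hx.1) hxb.le) (by positivity)
    · rintro _ ⟨s, t, hs0, ht0, hst, rfl⟩
      have hpos : 0 < γ.Z.eval a * (s * γ.Z.eval b + t * γ.Z.eval a) := by
        have h1 := hsign b hb
        have h2 := mul_self_pos.2 hza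
        rcases hs0.eq_or_lt with h0 | h0
        · rw [← h0] at hst ⊢
          rw [show t = 1 by linarith]
          linarith
        · have h3 := mul_pos h0 h1
          have h4 := mul_nonneg ht0 h2.le
          linarith
      have hD : s * γ.Z.eval b + t * γ.Z.eval a ≠ 0 := right_ne_zero_of_mul hpos.ne'
      have hq : ∀ w : ℝ, 0 ≤ w → ∀ y ∈ Icc a b, 0 ≤ w * γ.Z.eval y /
          (s * γ.Z.eval b + t * γ.Z.eval a) := by
        intro w hw y hy
        rw [show w * γ.Z.eval y / (s * γ.Z.eval b + t * γ.Z.eval a) =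
          w * (γ.Z.eval a * γ.Z.eval y) / (γ.Z.eval a * (s * γ.Z.eval b + t * γ.Z.eval a)) by
            field_simp]
        exact div_nonneg (mul_nonneg hw (hsign y hy).le) hpos.le
      -- The parameter at which the barycentric weights are `s` and `t`.
      set x := (s * a * γ.Z.eval b + t * b * γ.Z.eval a) / (s * γ.Z.eval b + t * γ.Z.eval a) with hx
      have h1 : x - a = (b - a) * t * γ.Z.eval a / (s * γ.Z.eval b + t * γ.Z.eval a) := by
        rw [hx]; field_simp; ring
      have h2 : b - x = (b - a) * s * γ.Z.eval b / (s * γ.Z.eval b + t * γ.Z.eval a) := by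
        rw [hx]; field_simp; ring
      have hxI : x ∈ Icc a b := ⟨sub_nonneg.1 (h1 ▸ hq _ (mul_nonneg hba.le ht0) a ha),
        sub_nonneg.1 (h2 ▸ hq _ (mul_nonneg hba.le hs0) b hb)⟩
      refine ⟨x, hxI, ?_⟩
      have hzx : γ.Z.eval x = γ.Z.eval a * γ.Z.eval b / (s * γ.Z.eval b + t * γ.Z.eval a) := by
        have h3 := sub_mul_eval_of_natDegree_le_one hZ a b x
        rw [h1, h2] at h3
        refine mul_left_cancel₀ hba.ne' (h3.trans ?_)
        field_simp
        linear_combination hst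
      rw [hpoint x hxI, h1, h2, hzx]
      congr 2 <;> field_simp
  have hne : γ.point a ≠ γ.point b := by
    intro h0
    rw [← h0, segment_same, hs] at hsupp
    obtain ⟨c, hc⟩ := exists_between hlt
    have h1 : γ.point c ∈ γ.point '' Icc a b := ⟨c, ⟨hc.1.le, hc.2.le⟩, rfl⟩
    rw [hsupp] at h1
    exact hc.1.ne' (hi ⟨hc.1.le, hc.2⟩ ⟨le_rfl, hlt⟩ h1)
  refine ⟨γ.point a, γ.point b, hne, hsupp, he, ?_, fun p hp => ?_⟩
  · obtain ⟨x, hx⟩ := exists_between hlt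
    have hxI : x ∈ Icc a b := ⟨hx.1.le, hx.2.le⟩
    have hzx := hz x hxI
    refine ⟨x, hO ▸ hx, γ.Z.eval a * γ.Z.eval b / ((b - a) * γ.Z.eval x ^ 2),
      div_pos (hsign b hb) (by positivity), ?_⟩
    have hv : γ.velocity x = (γ.Z.eval a * γ.Z.eval b / ((b - a) * γ.Z.eval x ^ 2)) •
        (γ.point b - γ.point a) := by
      have h1 := sub_mul_wronskian_of_natDegree_le_one hX hZ a b x
      have h2 := sub_mul_wronskian_of_natDegree_le_one hY hZ a b x
      ext
      · simp only [RationalCurve.velocity, RationalCurve.point, Prod.smul_fst, Prod.fst_sub,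
          smul_eq_mul]
        field_simp
        linear_combination h1
      · simp only [RationalCurve.velocity, RationalCurve.point, Prod.smul_snd, Prod.snd_sub,
          smul_eq_mul]
        field_simp
        linear_combination h2
    have h3 := hsum x hxI
    rw [hv, hpoint x hxI]
    generalize (b - x) * γ.Z.eval a / ((b - a) * γ.Z.eval x) = s at h3
    generalize (x - a) * γ.Z.eval b / ((b - a) * γ.Z.eval x) = t at h3
    rw [show s = 1 - t by linarith]
    simp [cross]
    ring
  · have hLa := γ.eval_lineForm_ofReal p hza
    have hLb := γ.eval_lineForm_ofReal p hzb
    rw [← evalPair_vertexPoly] at hLa hLb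
    have key : ∀ (k : ℝ) (f : ℝ → ℂ), (∀ x, f x = ((γ.Z.eval a * γ.Z.eval b * k / (b - a) : ℝ) : ℂ)) →
        ∫ x in γ.interval, f x / (γ.lineForm p).eval (x : ℂ) ^ 2 = (k : ℂ) *
          ((evalPair p (vertexPoly (γ.point a)))⁻¹ * (evalPair p (vertexPoly (γ.point b)))⁻¹) := by
      intro k f hf
      rw [integral_const_div_sq hlt hI hp (hd ▸ γ.natDegree_lineForm_le p) _ hf, hLa, hLb]
      have h1 : ((γ.Z.eval a : ℝ) : ℂ) ≠ 0 := by exact_mod_cast hza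
      have h2 : ((γ.Z.eval b : ℝ) : ℂ) ≠ 0 := by exact_mod_cast hzb
      have h3 : (b : ℂ) - a ≠ 0 := by exact_mod_cast hba.ne'
      push_cast
      field_simp
    refine ⟨key _ _ fun x => ?_, key _ _ fun x => ?_, key _ _ fun x => ?_⟩
    · rw [RationalCurve.areaForm, RationalCurve.eval_map_ofReal]
      congr 1
      rw [eq_div_iff hba.ne', mul_comm, sub_mul_wronskian_of_natDegree_le_one hY hX]
      simp only [cross, RationalCurve.point]
      field_simp
    · congr 1
      rw [eq_div_iff hba.ne', mul_comm, sub_mul_wronskian_of_natDegree_le_one hX hZ]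
      simp only [RationalCurve.point]
      field_simp
    · congr 1
      rw [eq_div_iff hba.ne', mul_comm, sub_mul_wronskian_of_natDegree_le_one hY hZ]
      simp only [RationalCurve.point]
      field_simp

end Polypol

/-! ### Convex polygons around the origin and the cycle of their edges. -/

namespace Polypol
open MeasureTheory Filter Topology Set

section Convex

variable {K : Set (ℝ × ℝ)}

theorem smul_mem_interior_of_lt_one (hK : Convex ℝ K) (h0 : (0 : ℝ × ℝ) ∈ interior K)
    {z : ℝ × ℝ} (hz : z ∈ closure K) {s : ℝ} (hs : 0 ≤ s) (hs1 : s < 1) : s • z ∈ interior K := by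
  simpa using hK.combo_interior_closure_mem_interior h0 hz (sub_pos.2 hs1) hs (sub_add_cancel 1 s)

theorem smul_notMem_closure_of_one_lt (hK : Convex ℝ K) (h0 : (0 : ℝ × ℝ) ∈ interior K)
    {z : ℝ × ℝ} (hz : z ∈ frontier K) {s : ℝ} (hs : 1 < s) : s • z ∉ closure K := fun h => by
  have h1 := smul_mem_interior_of_lt_one hK h0 h (inv_nonneg.2 (zero_lt_one.trans hs).le)
    (inv_lt_one_of_one_lt₀ hs)
  rw [inv_smul_smul₀ (zero_lt_one.trans hs).ne'] at h1
  exact hz.2 h1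

theorem eq_one_of_smul_mem_frontier (hK : Convex ℝ K) (h0 : (0 : ℝ × ℝ) ∈ interior K)
    {z : ℝ × ℝ} (hz : z ∈ frontier K) {s : ℝ} (hs : 0 ≤ s) (hsz : s • z ∈ frontier K) : s = 1 := by
  rcases lt_trichotomy s 1 with h | h | h
  · exact (hsz.2 (smul_mem_interior_of_lt_one hK h0 hz.1 hs h)).elim
  · exact h
  · exact (smul_notMem_closure_of_one_lt hK h0 hz h hsz.1).elim

theorem cross_self (a : ℝ × ℝ) : cross a a = 0 := by simp only [cross]; ring

theorem cross_swap (a b : ℝ × ℝ) : cross b a = -cross a b := by simp only [cross]; ring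

/-- If A and B were collinear with the origin, either they would lie on one ray, which meets the
frontier only once, or the segment would pass through the origin, an interior point. -/
theorem cross_ne_zero_of_segment_subset_frontier (hK : Convex ℝ K) (h0 : (0 : ℝ × ℝ) ∈ interior K)
    {A B : ℝ × ℝ} (hAB : A ≠ B) (hs : segment ℝ A B ⊆ frontier K) : cross A B ≠ 0 := by
  intro hc
  have hA := hs (left_mem_segment ℝ A B)
  have hA0 : A ≠ 0 := fun h => hA.2 (h ▸ h0)
  have hn := norm_sq_pos_of_ne_zero hA0
  simp only [cross] at hc
  obtain ⟨t, ht⟩ : ∃ t : ℝ, B = t • A := by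
    refine ⟨(A.1 * B.1 + A.2 * B.2) / (A.1 ^ 2 + A.2 ^ 2), ?_⟩
    ext
    · simp only [Prod.smul_fst, smul_eq_mul]
      rw [div_mul_eq_mul_div, eq_div_iff hn.ne']
      linear_combination -A.2 * hc
    · simp only [Prod.smul_snd, smul_eq_mul]
      rw [div_mul_eq_mul_div, eq_div_iff hn.ne']
      linear_combination A.1 * hc
  subst ht
  rcases le_or_gt 0 t with h | h
  · have := eq_one_of_smul_mem_frontier hK h0 hA h (hs (right_mem_segment ℝ _ _))
    exact hAB (by rw [this, one_smul])
  · have h1 : 0 < 1 - t := by linarith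
    refine (hs (a := 0) ⟨-t / (1 - t), 1 / (1 - t), div_nonneg (by linarith) h1.le, by positivity,
      by field_simp; ring, ?_⟩).2 h0
    rw [smul_smul, ← add_smul, show -t / (1 - t) + 1 / (1 - t) * t = 0 by field_simp; ring, zero_smul]

/-- A boundary point seen from the origin under the angle of a boundary segment lies on the
segment. -/
theorem mem_segment_of_mem_frontier (hK : Convex ℝ K) (h0 : (0 : ℝ × ℝ) ∈ interior K)
    {V B B' : ℝ × ℝ} (hs : segment ℝ V B' ⊆ frontier K) (hB : B ∈ frontier K)
    (h1 : 0 < cross V B) (h2 : 0 < cross V B') (h3 : 0 ≤ cross B B') : B ∈ segment ℝ V B' := by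
  set α := cross B B' / cross V B' with hα
  set β := cross V B / cross V B' with hβ
  have hα0 : 0 ≤ α := div_nonneg h3 h2.le
  have hβ0 : 0 < β := div_pos h1 h2
  have hc : α • V + β • B' = B := by
    ext
    · simp only [hα, hβ, Prod.fst_add, Prod.smul_fst, smul_eq_mul]
      field_simp
      simp only [cross]
      ring
    · simp only [hα, hβ, Prod.snd_add, Prod.smul_snd, smul_eq_mul]
      field_simp
      simp only [cross]
      ring
  have hpos : 0 < α + β := by linarith
  have hm : (α + β)⁻¹ • B ∈ segment ℝ V B' := by
    refine ⟨α / (α + β), β / (α + β), by positivity, by positivity, by field_simp, ?_⟩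
    rw [← hc, smul_add, smul_smul, smul_smul, div_eq_inv_mul, div_eq_inv_mul]
  rwa [eq_one_of_smul_mem_frontier hK h0 hB (inv_nonneg.2 hpos.le) (hs hm), one_smul] at hm

/-- A supporting line of a convex set along a boundary segment. -/
theorem exists_dot_eq_one (hK : Convex ℝ K) (h0 : (0 : ℝ × ℝ) ∈ interior K)
    (hd : K ⊆ closure (interior K)) {A B : ℝ × ℝ} (hs : segment ℝ A B ⊆ frontier K) :
    ∃ D, dot D A = 1 ∧ dot D B = 1 ∧ ∀ z ∈ closure K, dot D z ≤ 1 := by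
  -- A functional which attains its maximum over the closure at the midpoint is equal at both ends.
  -- It is positive there because 0 is interior, so it can be normalized to 1.
  obtain ⟨f, hf⟩ := geometric_hahn_banach_open_point hK.interior isOpen_interior
    (hs (midpoint_mem_segment A B)).2
  have hle : ∀ z ∈ closure K, f z ≤ f (midpoint ℝ A B) := fun z hz =>
    closure_minimal (fun w hw => (hf w hw).le) (isClosed_le f.continuous continuous_const)
      (closure_minimal hd isClosed_closure hz)
  have hm : 0 < f (midpoint ℝ A B) := by simpa using hf 0 h0
  have hA := hle A (hs (left_mem_segment ℝ A B)).1
  have hB := hle B (hs (right_mem_segment ℝ A B)).1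
  have hM : f (midpoint ℝ A B) = (f A + f B) / 2 := by
    rw [midpoint_eq_smul_add, map_smul, map_add, smul_eq_mul, invOf_eq_inv]; ring
  have hdot : ∀ z, dot (f (1, 0) / f (midpoint ℝ A B), f (0, 1) / f (midpoint ℝ A B)) z =
      f z / f (midpoint ℝ A B) := by
    intro z
    have : f z = z.1 * f (1, 0) + z.2 * f (0, 1) := by
      rw [← smul_eq_mul, ← smul_eq_mul, ← map_smul, ← map_smul, ← map_add]; simp
    rw [this, dot]; ring
  refine ⟨(f (1, 0) / f (midpoint ℝ A B), f (0, 1) / f (midpoint ℝ A B)), ?_, ?_, fun z hz => ?_⟩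
  · rw [hdot, div_eq_one_iff_eq hm.ne']; linarith
  · rw [hdot, div_eq_one_iff_eq hm.ne']; linarith
  · rw [hdot, div_le_one hm]; exact hle z hz

end Convex

/-- The functions `1 / (1 - ⟨V, z⟩)` are linearly independent. -/
theorem eq_zero_of_sum_inv_vertexPoly {S : Finset (ℝ × ℝ)} {k : ℝ × ℝ → ℂ} {U : Set (ℂ × ℂ)}
    (hU : IsOpen U) (hne : U.Nonempty) (hS : ∀ p ∈ U, ∀ V ∈ S, evalPair p (vertexPoly V) ≠ 0)
    (h : ∀ p ∈ U, ∑ V ∈ S, k V * (evalPair p (vertexPoly V))⁻¹ = 0) {V : ℝ × ℝ} (hV : V ∈ S)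
    (hV0 : V ≠ 0) : k V = 0 := by
  have hN : ∑ W ∈ S, MvPolynomial.C (k W) * ∏ W' ∈ S.erase W, vertexPoly W' = 0 := by
    refine eq_of_evalPair_eq_on hU hne fun p hp => ?_
    have h1 := congrArg (· * ∏ W ∈ S, evalPair p (vertexPoly W)) (h p hp)
    simp only [Finset.sum_mul, zero_mul] at h1
    rw [map_zero, map_sum, ← h1]
    refine Finset.sum_congr rfl fun W hW => ?_
    rw [← Finset.mul_prod_erase S _ hW, map_mul, map_prod, evalPair, MvPolynomial.eval_C]
    have := hS p hp W hW
    rw [evalPair] at this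
    field_simp
  rw [← Finset.add_sum_erase S _ hV] at hN
  have hp : Prime (vertexPoly V) := prime_edgePoly (neg_ne_zero.2 hV0)
  have hdvd : vertexPoly V ∣ MvPolynomial.C (k V) * ∏ W ∈ S.erase V, vertexPoly W := by
    rw [eq_neg_of_add_eq_zero_left hN, dvd_neg]
    exact Finset.dvd_sum fun W hW => (Finset.dvd_prod_of_mem _
      (Finset.mem_erase.2 ⟨(Finset.ne_of_mem_erase hW).symm, hV⟩)).mul_left _
  rcases hp.dvd_or_dvd hdvd with ⟨c, hc⟩ | hd
  · have hn : ((V.1 : ℂ) ^ 2 + (V.2 : ℂ) ^ 2) ≠ 0 := by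
      exact_mod_cast (norm_sq_pos_of_ne_zero hV0).ne'
    have h1 := congrArg (evalPair ((V.1 : ℂ) / ((V.1 : ℂ) ^ 2 + (V.2 : ℂ) ^ 2),
      (V.2 : ℂ) / ((V.1 : ℂ) ^ 2 + (V.2 : ℂ) ^ 2))) hc
    rw [map_mul, evalPair_vertexPoly, evalPair, MvPolynomial.eval_C] at h1
    rw [h1]
    refine mul_eq_zero_of_left ?_ _
    field_simp
    ring
  · obtain ⟨W, hW, hd⟩ := (hp.dvd_finsetProd_iff _).1 hd
    exact (Finset.ne_of_mem_erase hW ((vertexPoly_dvd_iff hV0).1 hd)).elim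

/-- By linear independence of the 1/ℓ_V, the vector identity ∑ B/ℓ_B = ∑ A/ℓ_A says that V times the
excess of ends over starts at V is zero; V ≠ 0 in at least one coordinate. This replaces following
the boundary around the polygon. -/
theorem card_fiber_eq_of_sum_eq {n : ℕ} {A B : Fin n → ℝ × ℝ} (hA0 : ∀ j, A j ≠ 0)
    (hB0 : ∀ j, B j ≠ 0) {U : Set (ℂ × ℂ)} (hU : IsOpen U) (hne : U.Nonempty)
    (hA : ∀ p ∈ U, ∀ j, evalPair p (vertexPoly (A j)) ≠ 0)
    (hB : ∀ p ∈ U, ∀ j, evalPair p (vertexPoly (B j)) ≠ 0)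
    (h1 : ∀ p ∈ U, ∑ j, (((B j).1 : ℂ) * (evalPair p (vertexPoly (B j)))⁻¹ -
      ((A j).1 : ℂ) * (evalPair p (vertexPoly (A j)))⁻¹) = 0)
    (h2 : ∀ p ∈ U, ∑ j, (((B j).2 : ℂ) * (evalPair p (vertexPoly (B j)))⁻¹ -
      ((A j).2 : ℂ) * (evalPair p (vertexPoly (A j)))⁻¹) = 0) (V : ℝ × ℝ) :
    (Finset.univ.filter (A · = V)).card = (Finset.univ.filter (B · = V)).card := by
  classical
  let S := Finset.univ.image A ∪ Finset.univ.image B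
  have hAS : ∀ j ∈ Finset.univ, A j ∈ S := fun j _ => Finset.mem_union_left _ (by simp)
  have hBS : ∀ j ∈ Finset.univ, B j ∈ S := fun j _ => Finset.mem_union_right _ (by simp)
  have hfib : ∀ (E : Fin n → ℝ × ℝ), (∀ j ∈ Finset.univ, E j ∈ S) → ∀ φ : ℝ × ℝ → ℂ,
      ∑ j, φ (E j) = ∑ W ∈ S, ((Finset.univ.filter (E · = W)).card : ℂ) * φ W := by
    intro E hE φ
    rw [← Finset.sum_fiberwise_of_maps_to hE]
    refine Finset.sum_congr rfl fun W _ => ?_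
    rw [Finset.sum_congr rfl (g := fun _ => φ W) fun j hj => by rw [(Finset.mem_filter.1 hj).2],
      Finset.sum_const, nsmul_eq_mul]
  by_cases hV : V ∈ S
  swap
  · rw [Finset.filter_false_of_mem fun j hj (h : A j = V) => hV (h ▸ hAS j hj),
      Finset.filter_false_of_mem fun j hj (h : B j = V) => hV (h ▸ hBS j hj)]
  have hS : ∀ W ∈ S, (∃ j, A j = W) ∨ ∃ j, B j = W := fun W hW => by simpa [S] using hW
  have hV0 : V ≠ 0 := by rcases hS V hV with ⟨j, rfl⟩ | ⟨j, rfl⟩ <;> simp [hA0, hB0]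
  have key : ∀ c : ℝ × ℝ → ℝ, (∀ p ∈ U, ∑ j, ((c (B j) : ℂ) * (evalPair p (vertexPoly (B j)))⁻¹ -
      (c (A j) : ℂ) * (evalPair p (vertexPoly (A j)))⁻¹) = 0) →
      (((Finset.univ.filter (B · = V)).card : ℂ) - (Finset.univ.filter (A · = V)).card) * c V = 0 := by
    intro c hc
    refine eq_zero_of_sum_inv_vertexPoly (S := S) (k := fun V => (((Finset.univ.filter (B · = V)).card : ℂ) -
      (Finset.univ.filter (A · = V)).card) * c V) hU hne (fun p hp W hW => ?_) (fun p hp => ?_) hV hV0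
    · rcases hS W hW with ⟨j, rfl⟩ | ⟨j, rfl⟩
      exacts [hA p hp j, hB p hp j]
    · have h := hc p hp
      rw [Finset.sum_sub_distrib, hfib B hBS fun W => (c W : ℂ) * (evalPair p (vertexPoly W))⁻¹,
        hfib A hAS fun W => (c W : ℂ) * (evalPair p (vertexPoly W))⁻¹, ← Finset.sum_sub_distrib] at h
      rw [← h]
      exact Finset.sum_congr rfl fun W _ => by ring
  have k1 := key Prod.fst h1
  have k2 := key Prod.snd h2
  have : ((Finset.univ.filter (B · = V)).card : ℂ) - (Finset.univ.filter (A · = V)).card = 0 := by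
    by_contra hc
    refine hV0 (Prod.ext ?_ ?_)
    · exact_mod_cast (mul_eq_zero.1 k1).resolve_left hc
    · exact_mod_cast (mul_eq_zero.1 k2).resolve_left hc
  exact_mod_cast (sub_eq_zero.1 this).symm

namespace RationalPolypol

variable {P : RationalPolypol}

theorem IsPolygon.singularLocus_eq (h : P.IsPolygon) : P.singularLocus = P.vertexLines :=
  union_eq_left.2 fun _ ⟨j, hj, _⟩ => (hj (h j)).elim

theorem support_subset_frontier (j : Fin P.numArcs) : (P.arc j).support ⊆ frontier P.carrier :=
  P.boundary ▸ Set.subset_iUnion (fun j => (P.arc j).support) j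

theorem numArcs_pos : 0 < P.numArcs := by
  have : (frontier P.carrier).Nonempty := by
    rw [nonempty_iff_ne_empty, Ne, ← isClopen_iff_frontier_eq_empty, isClopen_iff]
    rintro (h | h)
    · exact P.pathConnected.nonempty.ne_empty h
    · exact NormedSpace.unbounded_univ ℝ (ℝ × ℝ) (h ▸ P.bounded)
  obtain ⟨z, hz⟩ := this
  rw [P.boundary, mem_iUnion] at hz
  exact Fin.pos hz.choose

/-- The boundary of a convex polygon around the origin, oriented counterclockwise. -/
theorem IsPolygon.exists_oriented (h : P.IsPolygon) (hK : Convex ℝ P.carrier)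
    (h0 : (0 : ℝ × ℝ) ∈ interior P.carrier) :
    ∃ A B : Fin P.numArcs → ℝ × ℝ, (∀ j, 0 < cross (A j) (B j)) ∧
      (∀ j, (P.arc j).support = segment ℝ (A j) (B j)) ∧
      (∀ j, (P.arc j).endpoints = {A j, B j}) ∧ ∀ p ∈ fantappieDomain P.carrier,
        fantappie P.carrier p = ∑ j, (cross (A j) (B j) : ℂ) *
          ((evalPair p (vertexPoly (A j)))⁻¹ * (evalPair p (vertexPoly (B j)))⁻¹) ∧
        p.1 * fantappie P.carrier p = ∑ j, (((B j).2 - (A j).2 : ℝ) : ℂ) *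
          ((evalPair p (vertexPoly (A j)))⁻¹ * (evalPair p (vertexPoly (B j)))⁻¹) ∧
        p.2 * fantappie P.carrier p = -∑ j, (((B j).1 - (A j).1 : ℝ) : ℂ) *
          ((evalPair p (vertexPoly (A j)))⁻¹ * (evalPair p (vertexPoly (B j)))⁻¹) := by
  obtain ⟨σ, -, hF, hσ⟩ := P.exists_orientation
  have key : ∀ j, ∃ A B : ℝ × ℝ, 0 < cross A B ∧ (P.arc j).support = segment ℝ A B ∧
      (P.arc j).endpoints = {A, B} ∧ ∀ p ∈ fantappieDomain P.carrier,
        (σ j : ℂ) * (P.arc j).lineIntegral (P.arc j).areaForm 2 p =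
          cross A B * ((evalPair p (vertexPoly A))⁻¹ * (evalPair p (vertexPoly B))⁻¹) ∧
        (σ j : ℂ) * (P.arc j).periodX p = ((B.1 - A.1 : ℝ) : ℂ) *
          ((evalPair p (vertexPoly A))⁻¹ * (evalPair p (vertexPoly B))⁻¹) ∧
        (σ j : ℂ) * (P.arc j).periodY p = ((B.2 - A.2 : ℝ) : ℂ) *
          ((evalPair p (vertexPoly A))⁻¹ * (evalPair p (vertexPoly B))⁻¹) := by
    intro j
    obtain ⟨A, B, hne, hs, he, ⟨τ, hτ, c, hc, hcr⟩, hp⟩ := (P.arc j).exists_segment (h j)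
    have hfr := P.support_subset_frontier j
    have hz := hfr ((P.arc j).point_mem_support ((P.arc j).openInterval_subset hτ))
    -- The position vector serves as transversal: moving towards the origin enters the interior,
    -- moving outwards leaves the closure.
    have hev : ∀ᶠ s : ℝ in 𝓝[>] 0,
        (P.arc j).point τ - s • (P.arc j).point τ ∈ P.carrier ∧
          (P.arc j).point τ + s • (P.arc j).point τ ∉ P.carrier := by
      filter_upwards [Ioo_mem_nhdsGT (zero_lt_one' ℝ)] with s hs
      constructor
      · have := smul_mem_interior_of_lt_one hK h0 hz.1 (sub_nonneg.2 hs.2.le)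
          (sub_lt_self 1 hs.1)
        rw [sub_smul, one_smul] at this
        exact interior_subset this
      · have := smul_notMem_closure_of_one_lt hK h0 hz (lt_add_of_pos_right 1 hs.1)
        rw [add_smul, one_smul] at this
        exact fun h => this (subset_closure h)
    -- An arc parametrized clockwise has σ = -1; exchanging its ends absorbs the sign and makes the
    -- determinant positive.
    rcases (cross_ne_zero_of_segment_subset_frontier hK h0 hne (hs ▸ hfr)).lt_or_gt with hlt | hgt
    · have h1 : σ j = -1 := by
        obtain ⟨s, hs1, hs2⟩ := ((hσ j τ hτ ((P.arc j).point τ)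
          (by rw [hcr]; nlinarith)).and hev).exists
        exact hs1.2 hs2.2 hs2.1
      refine ⟨B, A, by rw [cross_swap]; linarith, by rw [hs, segment_symm], by rw [he, pair_comm],
        fun p hpd => ?_⟩
      obtain ⟨h2, h3, h4⟩ := hp p (P.avoids hpd j)
      rw [h1, h2, h3, h4, cross_swap]
      refine ⟨?_, ?_, ?_⟩ <;> push_cast <;> ring
    · have h1 : σ j = 1 := by
        obtain ⟨s, hs1, hs2⟩ := ((hσ j τ hτ (-(P.arc j).point τ) (by
          have : cross ((P.arc j).velocity τ) (-(P.arc j).point τ) =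
            -cross ((P.arc j).velocity τ) ((P.arc j).point τ) := by simp [cross]; ring
          rw [this, hcr, neg_neg]
          exact mul_pos hc hgt)).and hev).exists
        rw [smul_neg, ← sub_eq_add_neg, sub_neg_eq_add] at hs1
        exact hs1.1 hs2.1 hs2.2
      refine ⟨A, B, hgt, hs, he, fun p hpd => ?_⟩
      rw [h1, Int.cast_one, one_mul, one_mul, one_mul]
      exact hp p (P.avoids hpd j)
  choose A B h1 h2 h3 h4 using key
  refine ⟨A, B, h1, h2, h3, fun p hp => ?_⟩
  obtain ⟨f1, f2, f3⟩ := hF p hp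
  refine ⟨f3.trans ?_, f1.trans ?_, f2.trans ?_⟩
  · exact Finset.sum_congr rfl fun j _ => (h4 j p hp).1
  · exact Finset.sum_congr rfl fun j _ => (h4 j p hp).2.2
  · exact congrArg _ (Finset.sum_congr rfl fun j _ => (h4 j p hp).2.1)

/-- The transform of a convex polygon around the origin is the canonical form of its polar. -/
theorem IsPolygon.exists_canonicalForm (h : P.IsPolygon) (hK : Convex ℝ P.carrier)
    (h0 : (0 : ℝ × ℝ) ∈ interior P.carrier) :
    ∃ f : RationalFunction, IsCanonicalForm (polar P.vertices) f ∧
      (∀ f', IsCanonicalForm (polar P.vertices) f' → f' = f) ∧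
      ∃ a b : MvPolynomial (Fin 2) ℂ, f = quot a b ∧ ∀ p ∈ fantappieDomain P.carrier,
        evalPair p b ≠ 0 ∧ fantappie P.carrier p = evalPair p a / evalPair p b := by
  obtain ⟨A, B, hpos, hs, he, hF⟩ := h.exists_oriented hK h0
  have hfr : ∀ j, segment ℝ (A j) (B j) ⊆ frontier P.carrier := fun j =>
    hs j ▸ P.support_subset_frontier j
  have hAf : ∀ j, A j ∈ frontier P.carrier := fun j => hfr j (left_mem_segment ℝ _ _)
  have hBf : ∀ j, B j ∈ frontier P.carrier := fun j => hfr j (right_mem_segment ℝ _ _)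
  have hne : ∀ {z}, z ∈ frontier P.carrier → z ≠ 0 := fun hz h => hz.2 (h ▸ h0)
  have hev : ∀ p ∈ fantappieDomain P.carrier, ∀ z ∈ frontier P.carrier,
      evalPair p (vertexPoly z) ≠ 0 := fun p hp z hz => by
    rw [Polypol.evalPair_vertexPoly]; exact hp z hz.1
  have hAB : ∀ i j, A i = A j → B i ≠ A j := fun i j hij hB => by
    have := hpos i
    rw [hij, hB, cross_self] at this
    exact this.false
  -- Of two edges starting at the same vertex, the one spanning the smaller angle at the origin has
  -- its end on the other edge. Regularity makes this end a common endpoint, so the edges coincide,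
  -- and their common midpoint contradicts regularity once more.
  have hinj : ∀ i j, A i = A j → 0 ≤ cross (B i) (B j) → i = j := by
    intro i j hij hc
    by_contra hn
    have hreg := P.regular i j hn
    have h1 : B i ∈ segment ℝ (A j) (B j) := mem_segment_of_mem_frontier hK h0 (hfr j) (hBf i)
      (hij ▸ hpos i) (hpos j) hc
    have h2 := (hreg ⟨by rw [hs]; exact right_mem_segment ℝ _ _, by rwa [hs]⟩).2
    rw [he] at h2
    have h3 : B i = B j := h2.resolve_left (hAB i j hij)
    have h4 := (hreg ⟨by rw [hs]; exact midpoint_mem_segment _ _,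
      by rw [hs, ← hij, ← h3]; exact midpoint_mem_segment _ _⟩).1
    rw [he, mem_insert_iff, mem_singleton_iff, midpoint_eq_left_iff, midpoint_eq_right_iff] at h4
    exact hAB i i rfl (h4.elim Eq.symm Eq.symm)
  have hA : Function.Injective A := fun i j hij => by
    rcases le_total 0 (cross (B i) (B j)) with hc | hc
    · exact hinj i j hij hc
    · exact (hinj j i hij.symm (by rw [cross_swap]; linarith)).symm
  -- The formulas for F, uF and vF are not independent. Substituting the first into the other two
  -- gives ∑ (B/ℓ_B - A/ℓ_A) = 0 coordinatewise, by v det(A, B) + (B₁ - A₁) = B₁ℓ_A - A₁ℓ_B and its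
  -- analogue for u.
  have hcard := card_fiber_eq_of_sum_eq (fun j => hne (hAf j)) (fun j => hne (hBf j))
    (isOpen_fantappieDomain P.bounded) ⟨0, zero_mem_fantappieDomain _⟩
    (fun p hp j => hev p hp _ (hAf j)) (fun p hp j => hev p hp _ (hBf j))
    (fun p hp => by
      obtain ⟨f1, -, f3⟩ := hF p hp
      have h5 : ∑ j, (p.2 * ((cross (A j) (B j) : ℂ) * ((evalPair p (vertexPoly (A j)))⁻¹ *
          (evalPair p (vertexPoly (B j)))⁻¹)) + (((B j).1 - (A j).1 : ℝ) : ℂ) *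
          ((evalPair p (vertexPoly (A j)))⁻¹ * (evalPair p (vertexPoly (B j)))⁻¹)) = 0 := by
        rw [Finset.sum_add_distrib, ← Finset.mul_sum, ← f1, f3, neg_add_cancel]
      rw [← h5]
      refine Finset.sum_congr rfl fun j _ => ?_
      have ha := hev p hp _ (hAf j)
      have hb := hev p hp _ (hBf j)
      field_simp
      rw [Polypol.evalPair_vertexPoly, Polypol.evalPair_vertexPoly]
      simp only [cross]
      push_cast
      ring)
    (fun p hp => by
      obtain ⟨f1, f2, -⟩ := hF p hp
      have h5 : ∑ j, ((((B j).2 - (A j).2 : ℝ) : ℂ) *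
          ((evalPair p (vertexPoly (A j)))⁻¹ * (evalPair p (vertexPoly (B j)))⁻¹) -
          p.1 * ((cross (A j) (B j) : ℂ) * ((evalPair p (vertexPoly (A j)))⁻¹ *
          (evalPair p (vertexPoly (B j)))⁻¹))) = 0 := by
        rw [Finset.sum_sub_distrib, ← Finset.mul_sum, ← f1, f2, sub_self]
      rw [← h5]
      refine Finset.sum_congr rfl fun j _ => ?_
      have ha := hev p hp _ (hAf j)
      have hb := hev p hp _ (hBf j)
      field_simp
      rw [Polypol.evalPair_vertexPoly, Polypol.evalPair_vertexPoly]
      simp only [cross]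
      push_cast
      ring)
  -- Each point is the start of at most one edge, hence by equality of the counts the end of at most
  -- one.
  have hB : Function.Injective B := fun i j hij => by
    have h1 : (Finset.univ.filter (B · = B j)).card ≤ 1 := by
      rw [← hcard, Finset.card_le_one]
      intro a ha b hb
      exact hA ((Finset.mem_filter.1 ha).2.trans (Finset.mem_filter.1 hb).2.symm)
    exact Finset.card_le_one.1 h1 i (by simp [hij]) j (by simp)
  have hrange : range A = range B := by
    ext V
    have hmem : ∀ E : Fin P.numArcs → ℝ × ℝ,
        V ∈ range E ↔ 0 < (Finset.univ.filter (E · = V)).card := fun E => by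
      simp [Finset.card_pos, Finset.filter_nonempty_iff]
    rw [hmem, hmem, hcard]
  have hcycle : ConvexCycle A B := ⟨hpos, hA, hB, hrange, fun j => by
    obtain ⟨D, h1, h2, h3⟩ := exists_dot_eq_one hK h0 P.domain (hfr j)
    exact ⟨D, h1, h2, fun k => h3 _ (hAf k).1⟩⟩
  have hvert : P.vertices = range A := by
    ext V
    simp only [vertices, he, mem_iUnion, mem_insert_iff, mem_singleton_iff]
    constructor
    · rintro ⟨j, rfl | rfl⟩
      exacts [⟨j, rfl⟩, hrange ▸ ⟨j, rfl⟩]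
    · rintro ⟨j, rfl⟩
      exact ⟨j, Or.inl rfl⟩
  have hcan := hcycle.isCanonicalForm P.numArcs_pos
  rw [hvert]
  refine ⟨_, hcan, fun f' hf' => hf'.unique hcan, _, _, ConvexCycle.form_eq, fun p hp => ⟨?_, ?_⟩⟩
  · rw [ConvexCycle.denom, map_prod]
    refine Finset.prod_ne_zero_iff.2 fun j _ => ?_
    rw [map_mul]
    exact mul_ne_zero (hev p hp _ (hAf j)) (hev p hp _ (hBf j))
  · rw [ConvexCycle.map_numer_div_map_denom _ (fun j => hev p hp _ (hAf j))
      (fun j => hev p hp _ (hBf j)), (hF p hp).1]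
    exact Finset.sum_congr rfl fun j _ => by rw [evalPair, MvPolynomial.eval_C]

end RationalPolypol

end Polypol

theorem mainTheorem2 :
    (∀ P : Polypol.RationalPolypol,
      -- the transform is analytic where the integrand has no singularity on the closure of `P`
      AnalyticOnNhd ℂ (Polypol.fantappie P.carrier) (Polypol.fantappieDomain P.carrier) ∧
      -- the singular locus is an algebraic curve
      (∃ h : MvPolynomial (Fin 2) ℂ, h ≠ 0 ∧
        P.singularLocus = {p | MvPolynomial.eval ![p.1, p.2] h = 0}) ∧
      -- analytic continuation along all paths in its complement, all branches being holonomic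
      (∀ γ : C(unitInterval, ℂ × ℂ), γ 0 ∈ Polypol.fantappieDomain P.carrier →
        (∀ t, γ t ∉ P.singularLocus) →
        ∃ g : unitInterval → ℂ × ℂ → ℂ,
          Polypol.IsContinuationAlong (Polypol.fantappie P.carrier) γ g ∧
          ∀ t, Polypol.IsHolonomicAt (g t) (γ t)) ∧
      -- the transform is a period of the moving-line family along the oriented boundary
      (∃ σ : Fin P.numArcs → ℤ, (∀ j, σ j = -1 ∨ σ j = 0 ∨ σ j = 1) ∧
        ∀ p ∈ Polypol.fantappieDomain P.carrier,
          p.1 * Polypol.fantappie P.carrier p = ∑ j, (σ j : ℂ) * (P.arc j).periodY p ∧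
          p.2 * Polypol.fantappie P.carrier p = -∑ j, (σ j : ℂ) * (P.arc j).periodX p) ∧
      -- polygons
      (P.IsPolygon → P.singularLocus = P.vertexLines ∧
        (Convex ℝ P.carrier → (0 : ℝ × ℝ) ∈ interior P.carrier →
          ∃ f : Polypol.RationalFunction,
            Polypol.IsCanonicalForm (Polypol.polar P.vertices) f ∧
            (∀ f', Polypol.IsCanonicalForm (Polypol.polar P.vertices) f' → f' = f) ∧
            ∃ a b : MvPolynomial (Fin 2) ℂ, f = Polypol.quot a b ∧
              ∀ p ∈ Polypol.fantappieDomain P.carrier,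
                MvPolynomial.eval ![p.1, p.2] b ≠ 0 ∧
                Polypol.fantappie P.carrier p =
                  MvPolynomial.eval ![p.1, p.2] a / MvPolynomial.eval ![p.1, p.2] b))) ∧
    -- the disk: a polypol with curved boundary whose transform is not a logarithmic canonical form
    (∃ D : Polypol.RationalPolypol, D.carrier = Polypol.unitDisk ∧ D.vertices = ∅ ∧
      D.singularLocus = {p | Polypol.dualConic p = 0} ∧
      (∀ p ∈ Polypol.fantappieDomain D.carrier,
        Polypol.dualConic p ∈ Complex.slitPlane ∧
        Polypol.fantappie D.carrier p =
          2 * (Real.pi : ℂ) * Polypol.dualConic p ^ (-(3 / 2) : ℂ)) ∧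
      (¬∃ a b : MvPolynomial (Fin 2) ℂ, b ≠ 0 ∧
        ∀ p ∈ Polypol.fantappieDomain D.carrier,
          MvPolynomial.eval ![p.1, p.2] b * Polypol.fantappie D.carrier p =
            MvPolynomial.eval ![p.1, p.2] a) ∧
      ∀ (U : Set (ℂ × ℂ)) (φ : ℂ × ℂ → ℂ × ℂ) (r : ℂ × ℂ → ℂ),
        Polypol.IsBranchedCoverPatch U φ r → ¬Polypol.PullbackIsLogarithmic U φ r) := by
  refine ⟨fun P => ⟨Polypol.analyticOnNhd_fantappie P.semialgebraic.measurableSet P.bounded,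
    P.exists_singularLocus_eq, P.exists_continuation, ?_,
    fun h => ⟨h.singularLocus_eq, h.exists_canonicalForm⟩⟩,
    Polypol.diskPolypol, rfl, Polypol.vertices_diskPolypol, Polypol.singularLocus_diskPolypol,
    fun p hp => ⟨Polypol.dualConic_mem_slitPlane hp, Polypol.fantappie_unitDisk hp⟩,
    Polypol.not_rational_fantappie_unitDisk, fun U φ r h => h.not_pullbackIsLogarithmic⟩
  obtain ⟨σ, h1, h2, -⟩ := P.exists_orientation
  exact ⟨σ, h1, fun p hp => ⟨(h2 p hp).1, (h2 p hp).2.1⟩⟩
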